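/- Let $k$ be an algebraically closed field and let $S=(\operatorname{Spec} k, M_S)$ be $\operatorname{Spec} k$ with an integral logarithmic structure. Log structures are on the small étale site; write $\overline M=M/\mathcal O^*$. A \emph{logarithmic curve} $X\to S$ is a logarithmic scheme $X$ over $S$ with connected underlying scheme $\underline X$, whose markings (case (ii) below) are locally finite, and such that at each geometric point $x$ of $X$ one of the following holds: (i) $\underline X$ is a smooth curve at $x$ and $\overline M_S\to\overline M_{X,x}$ is an isomorphism; (ii) $x$ is a \emph{marking}: $\underline X$ is a smooth curve at $x$ and $\overline M_{X,x}\simeq\overline M_S\oplus\mathbf N\gamma$, with $\gamma$ represented by a section mapping to a local parameter of $\underline X$ at $x$; (iii) $x$ is a \emph{node}: some étale neighbourhood of $x$ has an étale map to $\operatorname{Spec}k[u,v]/(uv)$ taking $x$ to the origin, and $\overline M_{X,x}\simeq\overline M_S\oplus\mathbf N\alpha\oplus\mathbf N\beta/(\alpha+\beta=\delta)$ for some $\delta\in\overline M_S$, with $\alpha,\beta$ represented by sections mapping to $u,v$. A \emph{2-marked semistable rational curve} over $S$ is a logarithmic curve $Q\to S$ which is proper, has $H^1(Q,\mathcal O_Q)=0$,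 has exactly two markings $p_0\ne p_1$, and each of whose irreducible components contains at least two points which are markings or nodes (so $Q$ is a chain of rational curves). For such $Q$, let $D=p_0+p_1$. Let $T_Q$ be the logarithmic tangent sheaf of $Q/S$: its sections are the pairs $(\partial,\partial^{\log})$ of a derivation $\partial:\mathcal O_Q\to\mathcal O_Q$ over $\mathcal O_S$ and a monoid homomorphism $\partial^{\log}:M_Q\to(\mathcal O_Q,+)$ which vanishes on $M_S$ and satisfies $\partial(\varepsilon(m))=\varepsilon(m)\,\partial^{\log}(m)$, where $\varepsilon:M_Q\to\mathcal O_Q$ is the structure map. Let $T_{\underline Q}(\log D)$ be the sheaf of $k$-derivations of $\mathcal O_{\underline Q}$ which preserve the ideals of $p_0$ and $p_1$. For a morphism $f:C\to Q$ of logarithmic schemes, let $f^\dagger T_Q$ be the quotient of $f^*T_{\underline Q}(\log D)$ by its torsion subsheaf. \textbf{Proposition.} Let $C\to S$ be a logarithmic curve, $Q\to S$ a 2-marked semistable rational curve, and $f:C\to Q$ a morphism of logarithmic schemes over $S$ which carries no irreducible component of $C$ to a node of $Q$. Then $(\partial,\partial^{\log})\mapsto\partial$ defines a homomorphism $T_Q\to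 T_{\underline Q}(\log D)$, and, with the induced homomorphism $f^*T_Q\to f^\dagger T_Q$ as first map, there is an exact sequence of $\mathcal O_C$-modules $$0\to f^*T_Q\to f^\dagger T_Q\to\prod_{e}\mathcal O_e\to0,$$ where the product is over the nodes $e$ of $C$ such that $f(e)$ is a node of $Q$, and $\mathcal O_e$ is the skyscraper sheaf at $e$ with value the residue field of $e$. -/

import Mathlib

open CategoryTheory AlgebraicGeometry TopologicalSpace Opposite

universe u

noncomputable section

/-- The structure morphism of an object of the small étale site. -/
abbrev etHom {X : Scheme.{u}} (U : X.Etale) : U.left ⟶ X := U.hom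

/-- `X` as an object of its own small étale site. -/
abbrev etTop (X : Scheme.{u}) : X.Etale := Scheme.Etale.mk (𝟙 X)

/-- An integral logarithmic structure on a scheme: an étale sheaf of (multiplicative, cancellative)
commutative monoids `M` with a homomorphism `ε : M ⟶ 𝒪` which restricts to a bijection
`ε⁻¹(𝒪ˣ) ≃ 𝒪ˣ`. -/
structure LogStructure (X : Scheme.{u}) where
  M : Sheaf X.smallEtaleTopology CommMonCat.{u}
  ε : ∀ U : X.Etale, M.obj.obj (op U) →* Γ(U.left, ⊤)
  ε_map : ∀ {U V : X.Etale} (h : U ⟶ V) (m : M.obj.obj (op V)),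
    ε U (M.obj.map h.op m) = h.left.appTop (ε V m)
  sharp : ∀ (U : X.Etale) (a : Γ(U.left, ⊤)), IsUnit a → ∃! m, ε U m = a
  integral : ∀ (U : X.Etale) (a b c : M.obj.obj (op U)), a * b = a * c → b = c

/-- A logarithmic scheme. -/
structure LogScheme where
  toScheme : Scheme.{u}
  log : LogStructure toScheme

namespace LogScheme

variable (X : LogScheme.{u})

/-- Sections of the sheaf of monoids over an étale `U ⟶ X`. -/
abbrev Sec (U : X.toScheme.Etale) : Type u := X.log.M.obj.obj (op U)

/-- Restriction of sections of the sheaf of monoids. -/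
abbrev res {U V : X.toScheme.Etale} (h : U ⟶ V) : X.Sec V →* X.Sec U :=
  (X.log.M.obj.map h.op).hom

/-- The map from the sheaf of monoids to the structure sheaf. -/
abbrev eps (U : X.toScheme.Etale) : X.Sec U →* Γ(U.left, ⊤) := X.log.ε U

variable {X} in
/-- A morphism of logarithmic schemes: a morphism `f` of schemes with a homomorphism
`f⁻¹ M_Y ⟶ M_X` compatible with the maps to the structure sheaves.  The homomorphism is given by
compatible maps `M_Y(V) → M_X(U)` for all commutative squares `U ⟶ V` over `X ⟶ Y` with `U`, `V`
étale over `X`, `Y`. -/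
structure Hom (X Y : LogScheme.{u}) where
  base : X.toScheme ⟶ Y.toScheme
  pull : ∀ (U : X.toScheme.Etale) (V : Y.toScheme.Etale) (g : U.left ⟶ V.left),
    g ≫ etHom V = etHom U ≫ base → (Y.Sec V →* X.Sec U)
  eps_pull : ∀ U V g h (m : Y.Sec V), X.eps U (pull U V g h m) = g.appTop (Y.eps V m)
  pull_res : ∀ (U U' : X.toScheme.Etale) (V V' : Y.toScheme.Etale) (a : U' ⟶ U) (b : V ⟶ V')
    (g : U.left ⟶ V.left) h (g' : U'.left ⟶ V'.left) h' (m : Y.Sec V'),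
    a.left ≫ g ≫ b.left = g' → X.res a (pull U V g h (Y.res b m)) = pull U' V' g' h' m

/-- `f ≫ q = p` as morphisms of logarithmic schemes. -/
structure IsOver {X Y S : LogScheme.{u}} (f : Hom X Y) (q : Hom Y S) (p : Hom X S) : Prop where
  base_comp : f.base ≫ q.base = p.base
  pull_comp : ∀ (U : X.toScheme.Etale) (V : Y.toScheme.Etale) (W : S.toScheme.Etale)
    (g : U.left ⟶ V.left) (h : V.left ⟶ W.left) (hg : g ≫ etHom V = etHom U ≫ f.base)
    (hh : h ≫ etHom W = etHom V ≫ q.base) (hgh : (g ≫ h) ≫ etHom W = etHom U ≫ p.base)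
    (m : S.Sec W), f.pull U V g hg (q.pull V W h hh m) = p.pull U W (g ≫ h) hgh m

section Stalk

variable {Ω : Type u} [Field Ω] [IsAlgClosed Ω] (x : Spec (.of Ω) ⟶ X.toScheme)

/-- The type of lifts of a geometric point of `X` to an étale `U ⟶ X`. -/
abbrev Lift (U : X.toScheme.Etale) : Type u := (Scheme.pointSmallEtale x).fiber.obj U

variable {x} in
/-- The point of `U` underlying a lift of a geometric point. -/
abbrev Lift.pt {X : LogScheme.{u}} {x : Spec (.of Ω) ⟶ X.toScheme} {U : X.toScheme.Etale}
  (y : X.Lift x U) : U.left := y.left (default : Spec (.of Ω))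

/-- The stalk of the sheaf of monoids at a geometric point. -/
abbrev Stalk : Type u :=
  ((Scheme.pointSmallEtale x).presheafFiber.obj
    (X.log.M.obj ⋙ forget₂ CommMonCat.{u} MonCat.{u}) : MonCat.{u})

/-- The germ of a section at a geometric point. -/
abbrev germ (U : X.toScheme.Etale) (y : X.Lift x U) : X.Sec U →* X.Stalk x :=
  ((Scheme.pointSmallEtale x).toPresheafFiber U y (X.log.M.obj ⋙ forget₂ CommMonCat MonCat)).hom

instance : CommMonoid (X.Stalk x) where
  mul_comm a b := by
    obtain ⟨U, y, s, t, rfl, rfl⟩ := GrothendieckTopology.Point.toPresheafFiber_jointly_surjective₂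
      (Φ := Scheme.pointSmallEtale x) (P := X.log.M.obj ⋙ forget₂ CommMonCat MonCat) a b
    change X.germ x U y (s : X.Sec U) * X.germ x U y (t : X.Sec U) =
      X.germ x U y (t : X.Sec U) * X.germ x U y (s : X.Sec U)
    rw [← map_mul, ← map_mul, mul_comm]

/-- The stalk of the characteristic monoid `M / ε⁻¹(𝒪ˣ)` at a geometric point; note that
`ε⁻¹(𝒪ˣ)` consists of the units of `M`. -/
abbrev CharStalk : Type u := Associates (X.Stalk x)

end Stalk

end LogScheme

section Node

variable (k : Type u) [Field k]

/-- The ring `k[x, y] / (x y)`. -/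
abbrev NodeRing : Type u :=
  MvPolynomial (Fin 2) k ⧸ Ideal.span {(MvPolynomial.X 0 * MvPolynomial.X 1 : MvPolynomial (Fin 2) k)}

variable {k} {X : Scheme.{u}} (p : X ⟶ Spec (.of k))

/-- A chart of a nodal curve at a point `y` of an étale `U ⟶ X`: an étale `k`-morphism from `U` to
`Spec k[x, y] / (x y)` which maps `y` to the origin. -/
structure NodeChart (U : X.Etale) (y : U.left) where
  map : U.left ⟶ Spec (.of (NodeRing k))
  isEtale : Etale map
  comm : map ≫ Spec.map (CommRingCat.ofHom (algebraMap k (NodeRing k))) = etHom U ≫ p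
  origin : ∀ i : Fin 2, y ∉ U.left.basicOpen (map.appTop ((Scheme.ΓSpecIso (.of (NodeRing k))).inv
    (Ideal.Quotient.mk _ (MvPolynomial.X i))))

/-- The two coordinate functions of a chart, the parameters along the two branches. -/
def NodeChart.coord {p : X ⟶ Spec (.of k)} {U : X.Etale} {y : U.left} (c : NodeChart p U y)
    (i : Fin 2) : Γ(U.left, ⊤) :=
  c.map.appTop ((Scheme.ΓSpecIso (.of (NodeRing k))).inv
    (Ideal.Quotient.mk _ (MvPolynomial.X i)))

/-- `x` is a node of the `k`-scheme `X`: étale locally `X` is the union of the coordinate axes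
in the plane, with `x` at the origin. -/
def IsNode (x : X) : Prop :=
  ∃ (U : X.Etale) (y : U.left), etHom U y = x ∧ Nonempty (NodeChart p U y)

/-- The `k`-scheme `X` is a smooth curve at `x`. -/
def IsSmoothPoint (x : X) : Prop :=
  ∃ W : X.Opens, x ∈ W ∧ SmoothOfRelativeDimension 1 (W.ι ≫ p)

/-- `t` is a local parameter of the curve `X` at the (smooth, closed) point `x`. -/
def IsLocalParameter (x : X) (t : Γ(X, ⊤)) : Prop :=
  X.presheaf.germ ⊤ x trivial t ≠ 0 ∧
    Ideal.span {X.presheaf.germ ⊤ x trivial t} = IsLocalRing.maximalIdeal (X.presheaf.stalk x)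

end Node

section LogCurve

variable {k : Type u} [Field k] [IsAlgClosed k] {N : LogStructure (Spec (.of k))}
  {X : LogScheme.{u}} (p : X.Hom ⟨Spec (.of k), N⟩)
  {Ω : Type u} [Field Ω] [IsAlgClosed Ω] (x : Spec (.of Ω) ⟶ X.toScheme)

/-- The global sections of a logarithmic structure on `Spec k`, for `k` algebraically closed; this
is also the stalk at the geometric point. -/
abbrev BaseMonoid (N : LogStructure (Spec (.of k))) : Type u :=
  N.M.obj.obj (op (etTop (Spec (.of k))))

/-- The homomorphism from the monoid of the base to the stalk of `M_X` at a geometric point. -/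
def baseToStalk : BaseMonoid N →* X.Stalk x :=
  (X.germ x (etTop X.toScheme) (Over.homMk x)).comp
    (p.pull (etTop X.toScheme) (etTop (Spec (.of k))) p.base
      ((Category.comp_id _).trans (Category.id_comp _).symm))

/-- The homomorphism of characteristic monoids `M̄_S ⟶ M̄_{X, x}`. -/
def baseToChar : Associates (BaseMonoid N) →* X.CharStalk x where
  toFun := Quotient.map' (baseToStalk p x) fun _ _ h => h.map (baseToStalk p x)
  map_one' := congrArg Associates.mk (map_one (baseToStalk p x))
  map_mul' := by
    rintro ⟨a⟩ ⟨b⟩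
    exact congrArg Associates.mk (map_mul (baseToStalk p x) a b)

/-- The image of a section in the stalk of the characteristic monoid. -/
def charGerm (U : X.toScheme.Etale) (y : X.Lift x U) (m : X.Sec U) : X.CharStalk x :=
  Associates.mk (X.germ x U y m)

/-- The geometric point `x` is a smooth point of the curve and `M̄_S ≃ M̄_{X, x}`. -/
def IsUnmarkedAt : Prop :=
  IsSmoothPoint p.base (x default) ∧ Function.Bijective (baseToChar p x)

/-- The geometric point `x` is a marking: a smooth point of the curve
such that `M̄_{X, x} ≃ M̄_S + ℕ γ` with `γ` corresponding to a local parameter. -/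
def IsMarkedAt : Prop :=
  IsSmoothPoint p.base (x default) ∧
  ∃ (U : X.toScheme.Etale) (y : X.Lift x U) (γ : X.Sec U),
    IsLocalParameter (y.pt) (X.eps U γ) ∧
    Function.Bijective fun a : Associates (BaseMonoid N) × ℕ =>
      baseToChar p x a.1 * charGerm x U y γ ^ a.2

/-- The geometric point `x` is a node of the curve and
`M̄_{X, x} ≃ M̄_S + ℕ α + ℕ β / (α + β = δ)` for some `δ ∈ M̄_S`, with `α` and `β` corresponding to
parameters along the two branches. -/
def IsNodalAt : Prop :=
  ∃ (U : X.toScheme.Etale) (y : X.Lift x U) (c : NodeChart p.base U y.pt) (α β : X.Sec U)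
    (δ : Associates (BaseMonoid N)),
    X.eps U α = c.coord 0 ∧ X.eps U β = c.coord 1 ∧
    let φ : Associates (BaseMonoid N) × Multiplicative ℕ × Multiplicative ℕ →* X.CharStalk x :=
      (baseToChar p x).coprod ((powersHom _ (charGerm x U y α)).coprod
        (powersHom _ (charGerm x U y β)))
    Function.Surjective φ ∧
    Con.ker φ = conGen fun a b =>
      a = (1, Multiplicative.ofAdd 1, Multiplicative.ofAdd 1) ∧ b = (δ, 1, 1)

/-- The point `z` of the curve is a marking. -/
def IsMarking (z : X.toScheme) : Prop :=
  ∀ (Ω : Type u) [Field Ω] [IsAlgClosed Ω] (x : Spec (.of Ω) ⟶ X.toScheme),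
    x default = z → IsMarkedAt p x

/-- A logarithmic curve over the logarithmic scheme `(Spec k, N)`, `k` algebraically closed: a
connected scheme with the usual local description of log smooth curves at every geometric point, and
locally finitely many markings.  (Then the logarithmic structure is étale locally pulled back from
`Spec k`, `𝔸¹` or the standard log smooth degeneration `α β = δ`.) -/
structure IsLogCurve : Prop where
  connected : ConnectedSpace X.toScheme
  description : ∀ (Ω : Type u) [Field Ω] [IsAlgClosed Ω] (x : Spec (.of Ω) ⟶ X.toScheme),
    IsUnmarkedAt p x ∨ IsMarkedAt p x ∨ IsNodalAt p x
  locallyFinite : ∀ z : X.toScheme, ∃ W : X.toScheme.Opens, z ∈ W ∧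
    ∀ w ∈ W, IsMarking p w → w = z

/-- A `2`-marked semistable rational curve, with markings `p₀` and `p₁`: a proper logarithmic curve of
arithmetic genus `0` whose markings are the two distinct points `p₀` and `p₁`, such that each
irreducible component has at least two special points (markings or nodes). -/
structure IsTwoMarkedSemistableRational (p₀ p₁ : X.toScheme) : Prop where
  isLogCurve : IsLogCurve p
  proper : IsProper p.base
  genus_zero : Subsingleton (((SheafOfModules.toSheaf _).obj
    (SheafOfModules.unit X.toScheme.ringCatSheaf)).H 1)
  ne : p₀ ≠ p₁
  marking_iff : ∀ z : X.toScheme, IsMarking p z ↔ z = p₀ ∨ z = p₁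
  semistable : ∀ Z ∈ irreducibleComponents X.toScheme,
    2 ≤ {z ∈ Z | z = p₀ ∨ z = p₁ ∨ IsNode p.base z}.encard

end LogCurve

section Tangent

variable {X S : Scheme.{u}}

/-- Restriction of functions. -/
abbrev rs {V W : X.Opens} (h : V ≤ W) : Γ(X, W) →+* Γ(X, V) := (X.presheaf.map (homOfLE h).op).hom

lemma rs_rs {V W T : X.Opens} (h : V ≤ W) (h' : W ≤ T) (a : Γ(X, T)) :
    rs h (rs h' a) = rs (h.trans h') a := by
  simp only [rs, ← ConcreteCategory.comp_apply, ← Functor.map_comp]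
  rfl

lemma rs_self {V : X.Opens} (h : V ≤ V) (a : Γ(X, V)) : rs h a = a := by
  simp [rs]

lemma fun_ext_local {ι : Type u} (U : ι → X.Opens) (V : X.Opens) (h : V ≤ iSup U) (a b : Γ(X, V))
    (H : ∀ i, rs (inf_le_left : V ⊓ U i ≤ V) a = rs (inf_le_left : V ⊓ U i ≤ V) b) : a = b := by
  refine X.sheaf.eq_of_locally_eq' (fun i => V ⊓ U i) V (fun i => homOfLE inf_le_left) ?_ a b H
  rw [← inf_iSup_eq]
  exact le_inf le_rfl h

lemma fun_glue {ι : Type u} (U : ι → X.Opens) (V : X.Opens) (h : V ≤ iSup U)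
    (t : ∀ i, Γ(X, V ⊓ U i))
    (H : ∀ i j, rs (le_inf (inf_le_left.trans inf_le_left) (inf_le_left.trans inf_le_right) :
        V ⊓ U i ⊓ U j ≤ V ⊓ U i) (t i) =
      rs (le_inf (inf_le_left.trans inf_le_left) inf_le_right : V ⊓ U i ⊓ U j ≤ V ⊓ U j) (t j)) :
    ∃ a : Γ(X, V), ∀ i, rs (inf_le_left : V ⊓ U i ≤ V) a = t i := by
  refine (X.sheaf.existsUnique_gluing' (fun i => V ⊓ U i) V (fun i => homOfLE inf_le_left) ?_ t
    ?_).exists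
  · rw [← inf_iSup_eq]
    exact le_inf le_rfl h
  · intro i j
    have e : V ⊓ U i ⊓ (V ⊓ U j) ≤ V ⊓ U i ⊓ U j := le_inf inf_le_left (inf_le_right.trans inf_le_right)
    have := congrArg (rs e) (H i j)
    rw [rs_rs, rs_rs] at this
    exact this

/-- Functions on an open subset `V` of `W` as a module over functions on `W`. -/
abbrev restrModule {W : X.Opens} (V : {V : X.Opens // V ≤ W}) : Module Γ(X, W) Γ(X, V.1) :=
  Module.compHom _ (rs V.2)

attribute [local instance] restrModule

lemma restr_smul_def {W : X.Opens} (V : {V : X.Opens // V ≤ W}) (a : Γ(X, W)) (b : Γ(X, V.1)) :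
    a • b = rs V.2 a * b := rfl

/-- A family of maps `𝒪(V) → 𝒪(V)`, for the open subsets `V` of `W`, is a derivation of `𝒪_W` over
`S` which preserves, for every point `z` of `Z`, the ideal of functions vanishing at `z`. -/
structure IsTangentField (p : X ⟶ S) (Z : Set X) (W : X.Opens)
    (D : ∀ V : {V : X.Opens // V ≤ W}, Γ(X, V.1) → Γ(X, V.1)) : Prop where
  res : ∀ (V V' : {V : X.Opens // V ≤ W}) (h : V'.1 ≤ V.1) (a : Γ(X, V.1)),
    rs h (D V a) = D V' (rs h a)
  add : ∀ V a b, D V (a + b) = D V a + D V b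
  leibniz : ∀ V a b, D V (a * b) = a * D V b + b * D V a
  base : ∀ (V : {V : X.Opens // V ≤ W}) (T : S.Opens) (h : V.1 ≤ p ⁻¹ᵁ T) (s : Γ(S, T)),
    D V (p.appLE T V.1 h s) = 0
  tangent : ∀ (V : {V : X.Opens // V ≤ W}) (a : Γ(X, V.1)), ∀ z ∈ Z, z ∈ V.1 →
    z ∉ X.basicOpen a → z ∉ X.basicOpen (D V a)

/-- The module of vector fields on `W` relative to `S` which are tangent to `Z`. -/
def tangentFields (p : X ⟶ S) (Z : Set X) (W : X.Opens) :
    Submodule Γ(X, W) (∀ V : {V : X.Opens // V ≤ W}, Γ(X, V.1) → Γ(X, V.1)) where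
  carrier := {D | IsTangentField p Z W D}
  zero_mem' :=
    { res := by intros; simp
      add := by intros; simp
      leibniz := by intros; simp
      base := by intros; simp
      tangent := by
        intro V a z _ _ _
        simp }
  add_mem' {D E} hD hE :=
    { res := by intro V V' h a; simp only [Pi.add_apply, map_add, hD.res V V' h, hE.res V V' h]
      add := by intros; simp only [Pi.add_apply, hD.add, hE.add]; ring
      leibniz := by intros; simp only [Pi.add_apply, hD.leibniz, hE.leibniz]; ring
      base := by intro V T h s; simp only [Pi.add_apply, hD.base V T h, hE.base V T h, add_zero]
      tangent := by
        intro V a z hz hzV ha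
        have h1 := hD.tangent V a z hz hzV ha
        have h2 := hE.tangent V a z hz hzV ha
        simp only [Pi.add_apply, Scheme.mem_basicOpen _ _ _ hzV, map_add] at h1 h2 ⊢
        intro h
        exact (IsLocalRing.isUnit_or_isUnit_of_isUnit_add h).elim h1 h2 }
  smul_mem' c {D} hD :=
    { res := by
        intro V V' h a
        simp only [Pi.smul_apply, restr_smul_def, map_mul, hD.res V V' h, rs_rs]
      add := by intros; simp only [Pi.smul_apply, restr_smul_def, hD.add]; ring
      leibniz := by intros; simp only [Pi.smul_apply, restr_smul_def, hD.leibniz]; ring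
      base := by intro V T h s; simp only [Pi.smul_apply, hD.base V T h, smul_zero]
      tangent := by
        intro V a z hz hzV ha
        have h1 := hD.tangent V a z hz hzV ha
        simp only [Pi.smul_apply, restr_smul_def, Scheme.mem_basicOpen _ _ _ hzV, map_mul] at h1 ⊢
        exact fun h => h1 (isUnit_of_mul_isUnit_right h) }

lemma mem_tangentFields {p : X ⟶ S} {Z : Set X} {W : X.Opens}
    {D : ∀ V : {V : X.Opens // V ≤ W}, Γ(X, V.1) → Γ(X, V.1)} :
    D ∈ tangentFields p Z W ↔ IsTangentField p Z W D := Iff.rfl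

/-- Restriction of vector fields. -/
def tangentRes (p : X ⟶ S) (Z : Set X) {W' W : X.Opens} (h : W' ≤ W) :
    tangentFields p Z W →+ tangentFields p Z W' where
  toFun D := ⟨fun V => D.1 ⟨V.1, V.2.trans h⟩,
    { res := fun V V' h' a => D.2.res ⟨V.1, V.2.trans h⟩ ⟨V'.1, V'.2.trans h⟩ h' a
      add := fun V a b => D.2.add ⟨V.1, V.2.trans h⟩ a b
      leibniz := fun V a b => D.2.leibniz ⟨V.1, V.2.trans h⟩ a b
      base := fun V T h' s => D.2.base ⟨V.1, V.2.trans h⟩ T h' s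
      tangent := fun V a z hz hzV => D.2.tangent ⟨V.1, V.2.trans h⟩ a z hz hzV }⟩
  map_zero' := rfl
  map_add' _ _ := rfl

/-- The presheaf of vector fields. -/
def tangentPresheaf (p : X ⟶ S) (Z : Set X) : TopCat.Presheaf AddCommGrpCat.{u} X where
  obj W := AddCommGrpCat.of (tangentFields p Z W.unop)
  map f := AddCommGrpCat.ofHom (tangentRes p Z f.unop.le)
  map_id _ := by ext; rfl
  map_comp _ _ := by ext; rfl

instance (p : X ⟶ S) (Z : Set X) (W : (Opens X)ᵒᵖ) :
    Module (X.ringCatSheaf.obj.obj W) ((tangentPresheaf p Z).obj W) :=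
  inferInstanceAs (Module Γ(X, W.unop) (tangentFields p Z W.unop))

lemma tangentPresheaf_isSheaf (p : X ⟶ S) (Z : Set X) : (tangentPresheaf p Z).IsSheaf := by
  rw [TopCat.Presheaf.isSheaf_iff_isSheaf_comp (forget AddCommGrpCat.{u})]
  apply TopCat.Presheaf.isSheaf_of_isSheafUniqueGluing_types
  intro ι U sf hsf
  let s : ∀ i, tangentFields p Z (U i) := sf
  have hs : ∀ i j (V : X.Opens) (hi : V ≤ U i) (hj : V ≤ U j),
      (s i).1 ⟨V, hi⟩ = (s j).1 ⟨V, hj⟩ := by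
    intro i j V hi hj
    have h1 : tangentRes p Z inf_le_left (s i) = tangentRes p Z inf_le_right (s j) := hsf i j
    exact congrFun (congrArg Subtype.val h1) ⟨V, le_inf hi hj⟩
  have hs' : ∀ i j (V : X.Opens) (hi : V ≤ U i) (hj : V ≤ U j) a,
      (s i).1 ⟨V, hi⟩ a = (s j).1 ⟨V, hj⟩ a := fun i j V hi hj a => congrFun (hs i j V hi hj) a
  have key : ∀ (V : {V : X.Opens // V ≤ iSup U}) (a : Γ(X, V.1)), ∃ b : Γ(X, V.1), ∀ i,
      rs (inf_le_left : V.1 ⊓ U i ≤ V.1) b = (s i).1 ⟨V.1 ⊓ U i, inf_le_right⟩ (rs inf_le_left a) := by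
    intro V a
    refine fun_glue U V.1 V.2 _ fun i j => ?_
    rw [(s i).2.res ⟨V.1 ⊓ U i, inf_le_right⟩ ⟨V.1 ⊓ U i ⊓ U j, inf_le_left.trans inf_le_right⟩ inf_le_left,
      (s j).2.res ⟨V.1 ⊓ U j, inf_le_right⟩ ⟨V.1 ⊓ U i ⊓ U j, inf_le_right⟩
        (le_inf (inf_le_left.trans inf_le_left) inf_le_right), rs_rs, rs_rs]
    exact hs' i j _ _ _ _
  choose D hD using key
  have hD' : ∀ (V : {V : X.Opens // V ≤ iSup U}) (i : ι) (T : X.Opens) (hT : T ≤ V.1) (hi : T ≤ U i)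
      (a : Γ(X, V.1)), rs hT (D V a) = (s i).1 ⟨T, hi⟩ (rs hT a) := by
    intro V i T hT hi a
    have h1 : T ≤ V.1 ⊓ U i := le_inf hT hi
    rw [← rs_rs h1 inf_le_left, hD, (s i).2.res ⟨V.1 ⊓ U i, inf_le_right⟩ ⟨T, hi⟩ h1, rs_rs]
  have hmem : IsTangentField p Z (iSup U) D := by
    refine ⟨?_, ?_, ?_, ?_, ?_⟩
    · intro V V' h a
      refine fun_ext_local U V'.1 V'.2 _ _ fun i => ?_
      rw [rs_rs, hD' V i _ _ inf_le_right, hD' V' i _ _ inf_le_right, rs_rs]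
    · intro V a b
      refine fun_ext_local U V.1 V.2 _ _ fun i => ?_
      simp only [map_add, hD' V i _ _ inf_le_right, (s i).2.add]
    · intro V a b
      refine fun_ext_local U V.1 V.2 _ _ fun i => ?_
      simp only [map_add, map_mul, hD' V i _ _ inf_le_right, (s i).2.leibniz]
    · intro V T h t
      refine fun_ext_local U V.1 V.2 _ _ fun i => ?_
      rw [hD' V i _ _ inf_le_right, map_zero]
      have : rs (inf_le_left : V.1 ⊓ U i ≤ V.1) (p.appLE T V.1 h t) =
          p.appLE T (V.1 ⊓ U i) (inf_le_left.trans h) t := by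
        simp only [rs, ← ConcreteCategory.comp_apply, Scheme.Hom.appLE_map]
      rw [this]
      exact (s i).2.base ⟨V.1 ⊓ U i, inf_le_right⟩ T _ t
    · intro V a z hz hzV ha
      obtain ⟨i, hi⟩ := Opens.mem_iSup.mp (V.2 hzV)
      have hm : z ∈ V.1 ⊓ U i := ⟨hzV, hi⟩
      have h0 := (s i).2.tangent ⟨V.1 ⊓ U i, inf_le_right⟩ (rs inf_le_left a) z hz hm (by
        rw [Scheme.basicOpen_res]
        exact fun h => ha h.2)
      rw [← hD, Scheme.basicOpen_res] at h0
      exact fun h => h0 ⟨hm, h⟩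
  refine ⟨(⟨D, hmem⟩ : tangentFields p Z (iSup U)), ?_, ?_⟩
  · intro i
    change tangentRes p Z (le_iSup U i) ⟨D, hmem⟩ = s i
    ext V a
    have := hD' ⟨V.1, V.2.trans (le_iSup U i)⟩ i V.1 le_rfl V.2 a
    rw [rs_self, rs_self] at this
    exact this
  · intro E hE
    let E' : tangentFields p Z (iSup U) := E
    change E' = ⟨D, hmem⟩
    ext V a
    refine fun_ext_local U V.1 V.2 _ _ fun i => ?_
    have h1 : tangentRes p Z (le_iSup U i) E' = s i := hE i
    rw [hD' V i _ _ inf_le_right, E'.2.res V ⟨V.1 ⊓ U i, inf_le_left.trans V.2⟩ inf_le_left, ← h1]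
    rfl

/-- The tangent sheaf `T_{X/S}(- log Z)`: the sheaf of derivations of `𝒪_X` over `S` which preserve, for
every `z` in `Z`, the ideal of functions vanishing at `z`. -/
def tangentSheaf (p : X ⟶ S) (Z : Set X) : X.Modules where
  val := PresheafOfModules.ofPresheaf (tangentPresheaf p Z) (by
    intro W W' f r m
    refine Subtype.ext (funext fun V => funext fun a => ?_)
    exact congrArg (· * m.1 ⟨V.1, V.2.trans f.unop.le⟩ a) (rs_rs V.2 f.unop.le r).symm)
  isSheaf := tangentPresheaf_isSheaf p Z

end Tangent

section EtaleLocal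

lemma top_ext {V : Scheme.{u}} {ι : Type u} (A : ι → V.Opens) (h : ⊤ ≤ iSup A) (a b : Γ(V, ⊤))
    (H : ∀ i, (A i).ι.appTop a = (A i).ι.appTop b) : a = b := by
  refine V.sheaf.eq_of_locally_eq' (fun i => (A i).ι ''ᵁ ⊤) ⊤ (fun i => homOfLE le_top) ?_ a b H
  simpa only [Scheme.Opens.ι_image_top] using h

lemma top_glue {V : Scheme.{u}} {ι : Type u} (A : ι → V.Opens) (h : ⊤ ≤ iSup A)
    (t : ∀ i, Γ((A i).toScheme, ⊤))
    (H : ∀ i j, (V.homOfLE (inf_le_left : A i ⊓ A j ≤ A i)).appTop (t i) =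
      (V.homOfLE (inf_le_right : A i ⊓ A j ≤ A j)).appTop (t j)) :
    ∃ a : Γ(V, ⊤), ∀ i, (A i).ι.appTop a = t i := by
  obtain ⟨a, ha, -⟩ := V.sheaf.existsUnique_gluing' (fun i => (A i).ι ''ᵁ ⊤) ⊤
    (fun i => homOfLE le_top) (by simpa only [Scheme.Opens.ι_image_top] using h) t
    (fun i j => by
      have e1 : (A i).ι ''ᵁ ⊤ ⊓ (A j).ι ''ᵁ ⊤ ≤ (A i ⊓ A j).ι ''ᵁ ⊤ := by
        simp only [Scheme.Opens.ι_image_top]; exact le_rfl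
      have e := H i j
      rw [Scheme.homOfLE_appTop, Scheme.homOfLE_appTop] at e
      have e2 := congrArg (rs e1) e
      erw [rs_rs, rs_rs] at e2
      exact e2)
  exact ⟨a, ha⟩

variable {X : Scheme.{u}}

/-- An open subscheme of an étale `U ⟶ X`, as an object of the étale site. -/
abbrev etOpen (U : X.Etale) (A : U.left.Opens) : X.Etale := Scheme.Etale.mk (A.ι ≫ etHom U)

/-- The inclusion of an open subscheme. -/
abbrev etOpenι (U : X.Etale) (A : U.left.Opens) : etOpen U A ⟶ U :=
  MorphismProperty.Over.homMk A.ι rfl trivial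

lemma et_w {T U : X.Etale} (h : T ⟶ U) : h.left ≫ etHom U = etHom T :=
  Over.w h.hom

lemma exists_lift_opens {T U : Scheme.{u}} (h : T ⟶ U) (A : U.Opens) (hT : ∀ y : T, h y ∈ A) :
    ∃ h' : T ⟶ A.toScheme, h' ≫ A.ι = h := by
  refine ⟨IsOpenImmersion.lift A.ι h ?_, IsOpenImmersion.lift_fac _ _ _⟩
  rintro _ ⟨y, rfl⟩
  rw [Scheme.Opens.range_ι]
  exact hT y

lemma etOpen_lift {T U : X.Etale} (h : T ⟶ U) (A : U.left.Opens) (hT : ∀ y : T.left, h.left y ∈ A) :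
    ∃ h' : T ⟶ etOpen U A, h' ≫ etOpenι U A = h := by
  obtain ⟨l, hl⟩ := exists_lift_opens h.left A hT
  refine ⟨MorphismProperty.Over.homMk l ?_ trivial, ?_⟩
  · change l ≫ A.ι ≫ etHom U = _
    rw [← Category.assoc, hl]
    exact et_w h
  · apply MorphismProperty.Over.Hom.ext
    exact hl

/-- The étale schemes over `X` with image in the open subset `W`. -/
abbrev EtIn (W : X.Opens) : Type (u + 1) := {U : X.Etale // ∀ y : U.left, etHom U y ∈ W}

/-- Pull back of functions on `W` to an étale scheme over `W`. -/
abbrev etPull {W : X.Opens} (U : EtIn W) : Γ(X, W) →+* Γ(U.1.left, ⊤) :=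
  ((etHom U.1).appLE W ⊤ (fun y _ => U.2 y)).hom

lemma etPull_res {W : X.Opens} {U V : EtIn W} (h : U.1 ⟶ V.1) (a : Γ(X, W)) :
    h.left.appTop (etPull V a) = etPull U a := by
  have e := et_w h
  have : ∀ (g : U.1.left ⟶ X) (hg : g = h.left ≫ etHom V.1) (hW : ⊤ ≤ g ⁻¹ᵁ W),
      h.left.appTop (etPull V a) = g.appLE W ⊤ hW a := by
    rintro g rfl hW
    rw [← Scheme.Hom.appLE_comp_appLE h.left (etHom V.1) W ⊤ ⊤ (fun y _ => V.2 y) le_top,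
      ConcreteCategory.comp_apply, Scheme.Hom.appTop, Scheme.Hom.app_eq_appLE]
    rfl
  exact this _ e.symm _

lemma etPull_mono {W' W : X.Opens} (hW : W' ≤ W) (U : EtIn W') (a : Γ(X, W)) :
    etPull U (rs hW a) = etPull (⟨U.1, fun y => hW (U.2 y)⟩ : EtIn W) a := by
  exact ConcreteCategory.congr_hom (Scheme.Hom.map_appLE (etHom U.1) (fun y _ => U.2 y)
    (homOfLE hW).op) a

/-- Functions on an étale scheme over `W` as a module over functions on `W`. -/
abbrev etModule {W : X.Opens} (U : EtIn W) : Module Γ(X, W) Γ(U.1.left, ⊤) :=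
  Module.compHom _ (etPull U)

end EtaleLocal

section LogTangent

attribute [local instance] etModule

lemma et_smul_def {X : Scheme.{u}} {W : X.Opens} (U : EtIn W) (a : Γ(X, W)) (b : Γ(U.1.left, ⊤)) :
    a • b = etPull U a * b := rfl

variable {X S : LogScheme.{u}} (p : X.Hom S)

/-- Families of pairs of maps `𝒪(U) → 𝒪(U)` and `M(U) → 𝒪(U)`, for `U` étale over `X` with image
in `W`. -/
abbrev LogFamily (X : LogScheme.{u}) (W : X.toScheme.Opens) : Type (u + 1) :=
  ∀ U : EtIn W, (Γ(U.1.left, ⊤) → Γ(U.1.left, ⊤)) × (X.Sec U.1 → Γ(U.1.left, ⊤))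

/-- A family `(D, ∂)` is a logarithmic derivation over `S` on the open subset `W`: `D` is a derivation
of the structure sheaf over `𝒪_S` and `∂` is a homomorphism from the sheaf of monoids to the
additive group of the structure sheaf, such that `D (ε m) = ε m * ∂ m` for all `m` and `∂` vanishes on
the monoid of `S`. -/
structure IsLogDerivation (W : X.toScheme.Opens) (δ : LogFamily X W) : Prop where
  res : ∀ (U V : EtIn W) (h : U.1 ⟶ V.1) (a : Γ(V.1.left, ⊤)),
    h.left.appTop ((δ V).1 a) = (δ U).1 (h.left.appTop a)
  add : ∀ U a b, (δ U).1 (a + b) = (δ U).1 a + (δ U).1 b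
  leibniz : ∀ U a b, (δ U).1 (a * b) = a * (δ U).1 b + b * (δ U).1 a
  base : ∀ (U : EtIn W) (T : S.toScheme.Etale) (g : U.1.left ⟶ T.left),
    g ≫ etHom T = etHom U.1 ≫ p.base → ∀ s : Γ(T.left, ⊤), (δ U).1 (g.appTop s) = 0
  dlog_res : ∀ (U V : EtIn W) (h : U.1 ⟶ V.1) (m : X.Sec V.1),
    h.left.appTop ((δ V).2 m) = (δ U).2 (X.res h m)
  dlog_mul : ∀ U m n, (δ U).2 (m * n) = (δ U).2 m + (δ U).2 n
  dlog_eps : ∀ U m, (δ U).1 (X.eps U.1 m) = X.eps U.1 m * (δ U).2 m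
  dlog_base : ∀ (U : EtIn W) (T : S.toScheme.Etale) (g : U.1.left ⟶ T.left)
    (hg : g ≫ etHom T = etHom U.1 ≫ p.base) (m : S.Sec T), (δ U).2 (p.pull U.1 T g hg m) = 0

/-- The module of logarithmic derivations on `W`. -/
def logDerivations (W : X.toScheme.Opens) : Submodule Γ(X.toScheme, W) (LogFamily X W) where
  carrier := {δ | IsLogDerivation p W δ}
  zero_mem' := by constructor <;> intros <;> simp
  add_mem' {D E} hD hE :=
    { res := by
        intro U V h a
        simp only [Pi.add_apply, Prod.fst_add, map_add, hD.res U V h, hE.res U V h]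
      add := by intros; simp only [Pi.add_apply, Prod.fst_add, hD.add, hE.add]; ring
      leibniz := by intros; simp only [Pi.add_apply, Prod.fst_add, hD.leibniz, hE.leibniz]; ring
      base := by
        intro U T g hg s
        simp only [Pi.add_apply, Prod.fst_add, hD.base U T g hg, hE.base U T g hg, add_zero]
      dlog_res := by
        intro U V h a
        simp only [Pi.add_apply, Prod.snd_add, map_add, hD.dlog_res U V h, hE.dlog_res U V h]
      dlog_mul := by intros; simp only [Pi.add_apply, Prod.snd_add, hD.dlog_mul, hE.dlog_mul]; ring
      dlog_eps := by
        intros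
        simp only [Pi.add_apply, Prod.snd_add, Prod.fst_add, hD.dlog_eps, hE.dlog_eps]; ring
      dlog_base := by
        intro U T g hg m
        simp only [Pi.add_apply, Prod.snd_add, hD.dlog_base U T g hg, hE.dlog_base U T g hg,
          add_zero] }
  smul_mem' c {D} hD :=
    { res := by
        intro U V h a
        simp only [Pi.smul_apply, Prod.smul_fst, et_smul_def, map_mul, hD.res U V h, etPull_res h]
      add := by intros; simp only [Pi.smul_apply, Prod.smul_fst, et_smul_def, hD.add]; ring
      leibniz := by intros; simp only [Pi.smul_apply, Prod.smul_fst, et_smul_def, hD.leibniz]; ring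
      base := by
        intro U T g hg s
        simp only [Pi.smul_apply, Prod.smul_fst, hD.base U T g hg, smul_zero]
      dlog_res := by
        intro U V h a
        simp only [Pi.smul_apply, Prod.smul_snd, et_smul_def, map_mul, hD.dlog_res U V h,
          etPull_res h]
      dlog_mul := by intros; simp only [Pi.smul_apply, Prod.smul_snd, et_smul_def, hD.dlog_mul]; ring
      dlog_eps := by
        intros
        simp only [Pi.smul_apply, Prod.smul_snd, Prod.smul_fst, et_smul_def, hD.dlog_eps]; ring
      dlog_base := by
        intro U T g hg m
        simp only [Pi.smul_apply, Prod.smul_snd, hD.dlog_base U T g hg, smul_zero] }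

/-- Restriction of logarithmic derivations. -/
def logRes {W' W : X.toScheme.Opens} (h : W' ≤ W) : logDerivations p W →+ logDerivations p W' where
  toFun D := ⟨fun U => D.1 ⟨U.1, fun y => h (U.2 y)⟩,
    { res := fun U V => D.2.res ⟨U.1, fun y => h (U.2 y)⟩ ⟨V.1, fun y => h (V.2 y)⟩
      add := fun U => D.2.add ⟨U.1, fun y => h (U.2 y)⟩
      leibniz := fun U => D.2.leibniz ⟨U.1, fun y => h (U.2 y)⟩
      base := fun U => D.2.base ⟨U.1, fun y => h (U.2 y)⟩
      dlog_res := fun U V => D.2.dlog_res ⟨U.1, fun y => h (U.2 y)⟩ ⟨V.1, fun y => h (V.2 y)⟩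
      dlog_mul := fun U => D.2.dlog_mul ⟨U.1, fun y => h (U.2 y)⟩
      dlog_eps := fun U => D.2.dlog_eps ⟨U.1, fun y => h (U.2 y)⟩
      dlog_base := fun U => D.2.dlog_base ⟨U.1, fun y => h (U.2 y)⟩ }⟩
  map_zero' := rfl
  map_add' _ _ := rfl

lemma top_ext_of_openImmersion {V : Scheme.{u}} (a b : Γ(V, ⊤))
    (H : ∀ x : V, ∃ (T : Scheme.{u}) (j : T ⟶ V), IsOpenImmersion j ∧ x ∈ Set.range j ∧
      j.appTop a = j.appTop b) : a = b := by
  choose T j hj hx hab using H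
  refine top_ext (fun x => (j x).opensRange) ?_ a b fun x => ?_
  · intro x _
    exact Opens.mem_iSup.mpr ⟨x, hx x⟩
  · have hr : Set.range (j x).opensRange.ι ⊆ Set.range (j x) := by
      rw [Scheme.Opens.range_ι]; exact le_rfl
    rw [← IsOpenImmersion.lift_fac (j x) (j x).opensRange.ι hr, Scheme.Hom.comp_appTop,
      ConcreteCategory.comp_apply, ConcreteCategory.comp_apply, hab x]

/-- A small set of representatives of the affine étale schemes over `X`. -/
abbrev smallEt (X : Scheme.{u}) (A : SmallModel.{u} X.AffineEtale) : X.Etale :=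
  (Scheme.AffineEtale.Spec X).obj ((equivSmallModel X.AffineEtale).inverse.obj A)

lemma isOpenImmersion_iso_comp {A B C : Scheme.{u}} (l : A ≅ B) (j : B ⟶ C) [IsOpenImmersion j] :
    IsOpenImmersion (l.hom ≫ j) := inferInstance

lemma exists_smallEt {X : Scheme.{u}} (U : X.Etale) (x : U.left) :
    ∃ (A : SmallModel.{u} X.AffineEtale) (h : smallEt X A ⟶ U),
      IsOpenImmersion h.left ∧ x ∈ Set.range h.left := by
  obtain ⟨R, j, hj, hx, -⟩ :=
    Scheme.exists_affine_mem_range_and_range_subset (x := x) (U := ⊤) trivial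
  let B : X.AffineEtale := Scheme.AffineEtale.mk (j ≫ etHom U)
  let i : (equivSmallModel X.AffineEtale).inverse.obj ((equivSmallModel X.AffineEtale).functor.obj B) ≅ B :=
    (equivSmallModel X.AffineEtale).unitIso.symm.app B
  let e := (Scheme.AffineEtale.Spec X).mapIso i
  let g : (Scheme.AffineEtale.Spec X).obj B ⟶ U := MorphismProperty.Over.homMk j rfl trivial
  let l : (smallEt X ((equivSmallModel X.AffineEtale).functor.obj B)).left ≅ Spec R :=
    { hom := e.hom.left
      inv := e.inv.left
      hom_inv_id := congrArg (fun f => f.left) e.hom_inv_id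
      inv_hom_id := congrArg (fun f => f.left) e.inv_hom_id }
  have h1 : IsOpenImmersion (l.hom ≫ j) := isOpenImmersion_iso_comp l j
  refine ⟨_, e.hom ≫ g, h1, ?_⟩
  obtain ⟨z, rfl⟩ := hx
  refine ⟨l.inv z, ?_⟩
  change (l.hom ≫ j) (l.inv z) = j z
  rw [← Scheme.Hom.comp_apply, Iso.inv_hom_id_assoc]

instance (W : X.toScheme.Opens) : Small.{u} (logDerivations p W) := by
  classical
  let Φ : logDerivations p W → ∀ A : SmallModel.{u} X.toScheme.AffineEtale,
      (Γ((smallEt X.toScheme A).left, ⊤) → Γ((smallEt X.toScheme A).left, ⊤)) ×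
        (X.Sec (smallEt X.toScheme A) → Γ((smallEt X.toScheme A).left, ⊤)) :=
    fun δ A => if h : ∀ y, etHom (smallEt X.toScheme A) y ∈ W then δ.1 ⟨_, h⟩ else 0
  refine small_of_injective (f := Φ) fun δ δ' hδ => ?_
  refine Subtype.ext (funext fun U => ?_)
  have key : ∀ A (h : ∀ y, etHom (smallEt X.toScheme A) y ∈ W), δ.1 ⟨_, h⟩ = δ'.1 ⟨_, h⟩ := by
    intro A h
    have := congrFun hδ A
    simpa only [Φ, dif_pos h] using this
  have hin : ∀ {A} (h : smallEt X.toScheme A ⟶ U.1) (y), etHom (smallEt X.toScheme A) y ∈ W := by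
    intro A h y
    rw [← et_w h]
    exact U.2 _
  refine Prod.ext (funext fun a => top_ext_of_openImmersion _ _ fun x => ?_)
    (funext fun m => top_ext_of_openImmersion _ _ fun x => ?_)
  · obtain ⟨A, h, h1, h2⟩ := exists_smallEt U.1 x
    refine ⟨_, h.left, h1, h2, ?_⟩
    have h3 := δ.2.res ⟨_, hin h⟩ U h a
    have h4 := δ'.2.res ⟨_, hin h⟩ U h a
    have h5 := congrFun (congrArg Prod.fst (key A (hin h))) (h.left.appTop a)
    exact h3.trans (h5.trans h4.symm)
  · obtain ⟨A, h, h1, h2⟩ := exists_smallEt U.1 x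
    refine ⟨_, h.left, h1, h2, ?_⟩
    have h3 := δ.2.dlog_res ⟨_, hin h⟩ U h m
    have h4 := δ'.2.dlog_res ⟨_, hin h⟩ U h m
    have h5 := congrFun (congrArg Prod.snd (key A (hin h))) (X.res h m)
    exact h3.trans (h5.trans h4.symm)

/-- The comparison of logarithmic derivations with their small model. -/
def unshrink (W : X.toScheme.Opens) : Shrink.{u} (logDerivations p W) ≃ₗ[Γ(X.toScheme, W)]
    logDerivations p W := Shrink.linearEquiv _ _

/-- The presheaf of logarithmic derivations, with sections shrunk to the correct universe. -/
def logTangentPresheaf : TopCat.Presheaf AddCommGrpCat.{u} X.toScheme where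
  obj W := AddCommGrpCat.of (Shrink.{u} (logDerivations p W.unop))
  map {W W'} f := AddCommGrpCat.ofHom (((unshrink p W'.unop).symm.toAddMonoidHom.comp
    (logRes p f.unop.le)).comp (unshrink p W.unop).toAddMonoidHom)
  map_id W := by
    refine ConcreteCategory.hom_ext _ _ fun s => ?_
    exact (unshrink p W.unop).symm_apply_apply s
  map_comp {W W' W''} f g := by
    refine ConcreteCategory.hom_ext _ _ fun s => ?_
    exact congrArg (fun t => (unshrink p W''.unop).symm (logRes p g.unop.le t))
      ((unshrink p W'.unop).apply_symm_apply (logRes p f.unop.le (unshrink p W.unop s))).symm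

instance (W : (Opens X.toScheme)ᵒᵖ) :
    Module (X.toScheme.ringCatSheaf.obj.obj W) ((logTangentPresheaf p).obj W) :=
  inferInstanceAs (Module Γ(X.toScheme, W.unop) (Shrink.{u} (logDerivations p W.unop)))

lemma etOpen_in {X : Scheme.{u}} {ι : Type u} {W : ι → X.Opens} (U : EtIn (iSup W)) (i : ι)
    (A : U.1.left.Opens) (hA : A ≤ etHom U.1 ⁻¹ᵁ W i) :
    ∀ y, etHom (etOpen U.1 A) y ∈ W i := fun y => hA y.2

lemma et_cover {X : Scheme.{u}} {ι : Type u} {W : ι → X.Opens} (U : EtIn (iSup W)) :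
    ⊤ ≤ iSup fun i => (etHom U.1 ⁻¹ᵁ W i : U.1.left.Opens) := by
  intro y _
  obtain ⟨i, hi⟩ := Opens.mem_iSup.mp (U.2 y)
  exact Opens.mem_iSup.mpr ⟨i, hi⟩

lemma et_ext_local {X : Scheme.{u}} {ι : Type u} {W : ι → X.Opens} (U : EtIn (iSup W))
    (a b : Γ(U.1.left, ⊤))
    (H : ∀ (i : ι) (T : X.Etale) (h : T ⟶ U.1), (∀ y, etHom T y ∈ W i) →
      h.left.appTop a = h.left.appTop b) : a = b :=
  top_ext _ (et_cover U) a b fun i =>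
    H i (etOpen U.1 (etHom U.1 ⁻¹ᵁ W i)) (etOpenι U.1 _) (etOpen_in U i _ le_rfl)

lemma et_glue {X : Scheme.{u}} {ι : Type u} {W : ι → X.Opens} (U : EtIn (iSup W))
    (t : ∀ (i : ι) (T : X.Etale) (_ : T ⟶ U.1) (_ : ∀ y, etHom T y ∈ W i), Γ(T.left, ⊤))
    (ht : ∀ i T T' (h : T ⟶ U.1) (h' : T' ⟶ T) hT hT',
      h'.left.appTop (t i T h hT) = t i T' (h' ≫ h) hT')
    (ht' : ∀ i j T h hi hj, t i T h hi = t j T h hj) :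
    ∃ a : Γ(U.1.left, ⊤), ∀ i T h hT, h.left.appTop a = t i T h hT := by
  obtain ⟨a, ha⟩ := top_glue (fun i => (etHom U.1 ⁻¹ᵁ W i : U.1.left.Opens)) (et_cover U)
    (fun i => t i (etOpen U.1 (etHom U.1 ⁻¹ᵁ W i)) (etOpenι U.1 _) (etOpen_in U i _ le_rfl))
    (fun i j => by
      let A := fun i => (etHom U.1 ⁻¹ᵁ W i : U.1.left.Opens)
      let B : X.Etale := etOpen U.1 (A i ⊓ A j)
      let q : ∀ l (_ : A i ⊓ A j ≤ A l), B ⟶ etOpen U.1 (A l) := fun l hl =>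
        MorphismProperty.Over.homMk (Scheme.homOfLE _ hl) (by
          change Scheme.homOfLE _ hl ≫ (A l).ι ≫ etHom U.1 = (A i ⊓ A j).ι ≫ etHom U.1
          rw [← Category.assoc, Scheme.homOfLE_ι]) trivial
      have hq : ∀ l hl, q l hl ≫ etOpenι U.1 (A l) = etOpenι U.1 (A i ⊓ A j) := fun l hl =>
        MorphismProperty.Over.Hom.ext (Scheme.homOfLE_ι _ hl)
      have e : ∀ l (hl : A i ⊓ A j ≤ A l), (q l hl).left.appTop
          (t l (etOpen U.1 (A l)) (etOpenι U.1 _) (etOpen_in U l _ le_rfl)) =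
          t l B (etOpenι U.1 _) (etOpen_in U l _ hl) := by
        intro l hl
        rw [ht l _ _ _ (q l hl) _ (etOpen_in U l _ hl)]
        simp only [hq]
      exact (e i inf_le_left).trans ((ht' i j _ _ _ _).trans (e j inf_le_right).symm))
  refine ⟨a, fun i T h hT => ?_⟩
  obtain ⟨h', rfl⟩ := etOpen_lift h (etHom U.1 ⁻¹ᵁ W i) (fun y => by
    have := hT y
    rw [← et_w h] at this
    exact this)
  rw [← ht i _ _ (etOpenι U.1 (etHom U.1 ⁻¹ᵁ W i)) h' (etOpen_in U i _ le_rfl)]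
  exact congrArg h'.left.appTop (ha i)

lemma id_appTop {X : Scheme.{u}} (U : X.Etale) (b : Γ(U.left, ⊤)) :
    (𝟙 U : U ⟶ U).left.appTop b = b :=
  ConcreteCategory.congr_hom (Scheme.Hom.id_appTop (X := U.left)) b

set_option maxHeartbeats 1000000 in
lemma logTangentPresheaf_isSheaf : (logTangentPresheaf p).IsSheaf := by
  rw [TopCat.Presheaf.isSheaf_iff_isSheaf_comp (forget AddCommGrpCat.{u})]
  apply TopCat.Presheaf.isSheaf_of_isSheafUniqueGluing_types
  intro ι W sf hsf
  let s : ∀ i, logDerivations p (W i) := fun i => unshrink p (W i) (sf i)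
  have hs : ∀ i j (U : X.toScheme.Etale) (hi : ∀ y, etHom U y ∈ W i) (hj : ∀ y, etHom U y ∈ W j),
      (s i).1 ⟨U, hi⟩ = (s j).1 ⟨U, hj⟩ := by
    intro i j U hi hj
    have h1 : logRes p inf_le_left (s i) = logRes p inf_le_right (s j) :=
      (unshrink p (W i ⊓ W j)).symm.injective (hsf i j)
    exact congrFun (congrArg Subtype.val h1) ⟨U, fun y => ⟨hi y, hj y⟩⟩
  have keyD : ∀ (U : EtIn (iSup W)) (a : Γ(U.1.left, ⊤)), ∃ b : Γ(U.1.left, ⊤),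
      ∀ i T (h : T ⟶ U.1) (hT : ∀ y, etHom T y ∈ W i),
        h.left.appTop b = ((s i).1 ⟨T, hT⟩).1 (h.left.appTop a) := fun U a =>
    et_glue U (fun i T h hT => ((s i).1 ⟨T, hT⟩).1 (h.left.appTop a))
      (fun i T T' h h' hT hT' => (s i).2.res ⟨T', hT'⟩ ⟨T, hT⟩ h' _)
      (fun i j T h hi hj => congrFun (congrArg Prod.fst (hs i j T hi hj)) _)
  have keyL : ∀ (U : EtIn (iSup W)) (m : X.Sec U.1), ∃ b : Γ(U.1.left, ⊤),
      ∀ i T (h : T ⟶ U.1) (hT : ∀ y, etHom T y ∈ W i),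
        h.left.appTop b = ((s i).1 ⟨T, hT⟩).2 (X.res h m) := fun U m =>
    et_glue U (fun i T h hT => ((s i).1 ⟨T, hT⟩).2 (X.res h m))
      (fun i T T' h h' hT hT' => by
        rw [(s i).2.dlog_res ⟨T', hT'⟩ ⟨T, hT⟩ h' _]
        simp only [LogScheme.res, op_comp, Functor.map_comp]
        rfl)
      (fun i j T h hi hj => congrFun (congrArg Prod.snd (hs i j T hi hj)) _)
  choose D hD using keyD
  choose L hL using keyL
  have hmem : IsLogDerivation p (iSup W) fun U => (D U, L U) := by
    refine ⟨?_, ?_, ?_, ?_, ?_, ?_, ?_, ?_⟩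
    · intro U V h a
      refine et_ext_local U _ _ fun i T g hT => ?_
      have h1 := hD V a i T (g ≫ h) hT
      have h2 := hD U (h.left.appTop a) i T g hT
      exact h1.trans h2.symm
    · intro U a b
      refine et_ext_local U _ _ fun i T g hT => ?_
      simp only [map_add, hD U _ i T g hT, (s i).2.add]
    · intro U a b
      refine et_ext_local U _ _ fun i T g hT => ?_
      simp only [map_add, map_mul, hD U _ i T g hT, (s i).2.leibniz]
    · intro U T' g' hg' t
      refine et_ext_local U _ _ fun i T g hT => ?_
      rw [map_zero]
      refine (hD U _ i T g hT).trans ?_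
      refine (s i).2.base ⟨T, hT⟩ T' (g.left ≫ g') ?_ t
      rw [Category.assoc, hg', ← Category.assoc, et_w]
    · intro U V h m
      refine et_ext_local U _ _ fun i T g hT => ?_
      have h1 := hL V m i T (g ≫ h) hT
      have h2 := hL U (X.res h m) i T g hT
      refine h1.trans (Eq.trans ?_ h2.symm)
      simp only [LogScheme.res, op_comp, Functor.map_comp]
      rfl
    · intro U m n
      refine et_ext_local U _ _ fun i T g hT => ?_
      simp only [map_add, map_mul, hL U _ i T g hT, (s i).2.dlog_mul]
    · intro U m
      refine et_ext_local U _ _ fun i T g hT => ?_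
      have h1 : g.left.appTop (X.eps U.1 m) = X.eps T (X.res g m) := (X.log.ε_map g m).symm
      simp only [map_mul, hL U _ i T g hT, hD U _ i T g hT, h1]
      exact (s i).2.dlog_eps ⟨T, hT⟩ _
    · intro U T' g' hg' m
      refine et_ext_local U _ _ fun i T g hT => ?_
      rw [map_zero]
      refine (hL U _ i T g hT).trans ?_
      have hg2 : (g.left ≫ g') ≫ etHom T' = etHom T ≫ p.base := by
        rw [Category.assoc, hg', ← Category.assoc, et_w]
      have h1 := p.pull_res U.1 T T' T' g (𝟙 T') g' hg' (g.left ≫ g') hg2 m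
        (congrArg (g.left ≫ ·) (Category.comp_id g'))
      have h2 : S.res (𝟙 T') m = m := by
        simp [LogScheme.res]
      rw [h2] at h1
      rw [h1]
      exact (s i).2.dlog_base ⟨T, hT⟩ T' (g.left ≫ g') hg2 m
  let G : logDerivations p (iSup W) := ⟨_, hmem⟩
  refine ⟨(unshrink p (iSup W)).symm G, ?_, ?_⟩
  · intro i
    have h1 : logRes p (le_iSup W i) G = s i := by
      refine Subtype.ext (funext fun U => Prod.ext (funext fun a => ?_) (funext fun m => ?_))
      · have h2 := hD ⟨U.1, fun y => le_iSup W i (U.2 y)⟩ a i U.1 (𝟙 U.1) U.2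
        rw [id_appTop, id_appTop] at h2
        exact h2
      · have h2 := hL ⟨U.1, fun y => le_iSup W i (U.2 y)⟩ m i U.1 (𝟙 U.1) U.2
        have h4 : X.res (𝟙 U.1) m = m := by simp [LogScheme.res]
        rw [id_appTop, h4] at h2
        exact h2
    have h5 : (unshrink p (W i)).symm (logRes p (le_iSup W i) (unshrink p (iSup W)
        ((unshrink p (iSup W)).symm G))) = sf i :=
      (congrArg (fun t => (unshrink p (W i)).symm (logRes p (le_iSup W i) t))
        ((unshrink p (iSup W)).apply_symm_apply G)).trans
        ((congrArg (unshrink p (W i)).symm h1).trans ((unshrink p (W i)).symm_apply_apply (sf i)))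
    exact h5
  · intro E hE
    let E' : logDerivations p (iSup W) := unshrink p (iSup W) E
    have hE' : ∀ i, logRes p (le_iSup W i) E' = s i := fun i => by
      have h1 : (unshrink p (W i)).symm (logRes p (le_iSup W i) E') = sf i := hE i
      exact (unshrink p (W i)).symm_apply_eq.mp h1
    have h6 : E' = G := by
      refine Subtype.ext (funext fun U => Prod.ext (funext fun a => ?_) (funext fun m => ?_))
      · refine et_ext_local U _ _ fun i T h hT => ?_
        have h1 := E'.2.res ⟨T, fun y => le_iSup W i (hT y)⟩ U h a
        have h2 : ((s i).1 ⟨T, hT⟩).1 (h.left.appTop a) =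
            (E'.1 ⟨T, fun y => le_iSup W i (hT y)⟩).1 (h.left.appTop a) := by
          rw [← hE' i]; rfl
        exact h1.trans (h2.symm.trans (hD U a i T h hT).symm)
      · refine et_ext_local U _ _ fun i T h hT => ?_
        have h1 := E'.2.dlog_res ⟨T, fun y => le_iSup W i (hT y)⟩ U h m
        have h2 : ((s i).1 ⟨T, hT⟩).2 (X.res h m) =
            (E'.1 ⟨T, fun y => le_iSup W i (hT y)⟩).2 (X.res h m) := by
          rw [← hE' i]; rfl
        exact h1.trans (h2.symm.trans (hL U m i T h hT).symm)
    exact ((unshrink p (iSup W)).symm_apply_apply E).symm.trans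
      (congrArg (unshrink p (iSup W)).symm h6)

lemma logRes_smul {W' W : X.toScheme.Opens} (h : W' ≤ W) (a : Γ(X.toScheme, W))
    (δ : logDerivations p W) : logRes p h (a • δ) = rs h a • logRes p h δ := by
  refine Subtype.ext (funext fun U => Prod.ext (funext fun b => ?_) (funext fun m => ?_))
  · exact congrArg (· * ((logRes p h δ).1 U).1 b) (etPull_mono h U a).symm
  · exact congrArg (· * ((logRes p h δ).1 U).2 m) (etPull_mono h U a).symm

/-- The logarithmic tangent sheaf `T_{X/S}`. -/
def logTangentSheaf : X.toScheme.Modules where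
  val := PresheafOfModules.ofPresheaf (logTangentPresheaf p) (by
    intro W W' f r m
    let m' : Shrink.{u} (logDerivations p W.unop) := m
    let r' : Γ(X.toScheme, W.unop) := r
    have h1 : logRes p f.unop.le (unshrink p W.unop (r' • m')) =
        rs f.unop.le r' • logRes p f.unop.le (unshrink p W.unop m') :=
      (congrArg (logRes p f.unop.le) ((unshrink p W.unop).map_smul r' m')).trans
        (logRes_smul p _ _ _)
    have h3 : (unshrink p W'.unop).symm (logRes p f.unop.le (unshrink p W.unop (r' • m'))) =
        rs f.unop.le r' • (unshrink p W'.unop).symm (logRes p f.unop.le (unshrink p W.unop m')) :=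
      (congrArg (unshrink p W'.unop).symm h1).trans ((unshrink p W'.unop).symm.map_smul _ _)
    exact h3)
  isSheaf := logTangentPresheaf_isSheaf p

end LogTangent

section Torsion

variable {X : Scheme.{u}}

/-- Restriction of sections of a module. -/
abbrev mrs (F : X.Modules) {V W : X.Opens} (h : V ≤ W) : Γ(F, W) →+ Γ(F, V) :=
  (F.presheaf.map (homOfLE h).op).hom

lemma mrs_mrs (F : X.Modules) {V W T : X.Opens} (h : V ≤ W) (h' : W ≤ T) (a : Γ(F, T)) :
    mrs F h (mrs F h' a) = mrs F (h.trans h') a := by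
  simp only [mrs, ← ConcreteCategory.comp_apply, ← Functor.map_comp]
  rfl

lemma mrs_smul (F : X.Modules) {V W : X.Opens} (h : V ≤ W) (a : Γ(X, W)) (s : Γ(F, W)) :
    mrs F h (a • s) = rs h a • mrs F h s :=
  Scheme.Modules.map_smul F (homOfLE h) a s

/-- A section of a module is torsion if at each point it is killed by a function which is not a
zero divisor at that point. -/
def IsTorsionSection (F : X.Modules) (U : X.Opens) (s : Γ(F, U)) : Prop :=
  ∀ x ∈ U, ∃ (V : X.Opens) (h : V ≤ U) (hx : x ∈ V) (a : Γ(X, V)),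
    X.presheaf.germ V x hx a ∈ nonZeroDivisors (X.presheaf.stalk x) ∧ a • mrs F h s = 0

lemma germ_rs {V W : X.Opens} (h : V ≤ W) (x : X) (hx : x ∈ V) (a : Γ(X, W)) :
    X.presheaf.germ V x hx (rs h a) = X.presheaf.germ W x (h hx) a :=
  TopCat.Presheaf.germ_res_apply X.presheaf (homOfLE h) x hx a

lemma IsTorsionSection.res {F : X.Modules} {U W : X.Opens} (h : W ≤ U) {s : Γ(F, U)}
    (hs : IsTorsionSection F U s) : IsTorsionSection F W (mrs F h s) := by
  intro x hx
  obtain ⟨V, hV, hxV, a, ha, has⟩ := hs x (h hx)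
  refine ⟨V ⊓ W, inf_le_right, ⟨hxV, hx⟩, rs inf_le_left a, ?_, ?_⟩
  · exact (germ_rs (inf_le_left : V ⊓ W ≤ V) x ⟨hxV, hx⟩ a).symm ▸ ha
  · rw [mrs_mrs, ← mrs_mrs F (inf_le_left : V ⊓ W ≤ V) hV, ← mrs_smul, has, map_zero]

/-- The torsion sections of a module. -/
def torsionSections (F : X.Modules) (U : X.Opens) : Submodule Γ(X, U) Γ(F, U) where
  carrier := {s | IsTorsionSection F U s}
  zero_mem' := fun x hx => ⟨U, le_rfl, hx, 1, by rw [map_one]; exact one_mem _, by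
    rw [map_zero, smul_zero]⟩
  add_mem' {s t} hs ht := by
    intro x hx
    obtain ⟨V, hV, hxV, a, ha, has⟩ := hs x hx
    obtain ⟨W, hW, hxW, b, hb, hbt⟩ := ht x hx
    refine ⟨V ⊓ W, inf_le_left.trans hV, ⟨hxV, hxW⟩, rs inf_le_left a * rs inf_le_right b, ?_, ?_⟩
    · have h1 := germ_rs (inf_le_left : V ⊓ W ≤ V) x ⟨hxV, hxW⟩ a
      have h2 := germ_rs (inf_le_right : V ⊓ W ≤ W) x ⟨hxV, hxW⟩ b
      rw [map_mul, h1, h2]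
      exact mul_mem ha hb
    · have h1 : rs (inf_le_left : V ⊓ W ≤ V) a • mrs F ((inf_le_left : V ⊓ W ≤ V).trans hV) s = 0 := by
        rw [← mrs_mrs F (inf_le_left : V ⊓ W ≤ V) hV, ← mrs_smul, has, map_zero]
      have h2 : rs (inf_le_right : V ⊓ W ≤ W) b • mrs F ((inf_le_left : V ⊓ W ≤ V).trans hV) t = 0 := by
        have h3 : mrs F ((inf_le_left : V ⊓ W ≤ V).trans hV) t =
            mrs F ((inf_le_right : V ⊓ W ≤ W).trans hW) t := rfl
        rw [h3, ← mrs_mrs F (inf_le_right : V ⊓ W ≤ W) hW, ← mrs_smul, hbt, map_zero]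
      rw [map_add, smul_add, mul_smul, mul_smul, h2, smul_zero, add_zero,
        smul_comm, h1, smul_zero]
  smul_mem' c {s} hs := by
    intro x hx
    obtain ⟨V, hV, hxV, a, ha, has⟩ := hs x hx
    refine ⟨V, hV, hxV, a, ha, ?_⟩
    rw [mrs_smul, smul_comm, has, smul_zero]

/-- The torsion sections of a module as a presheaf. -/
def torsionSubmodule (F : X.Modules) : PresheafOfModules.Submodule F.val where
  obj U := torsionSections F U.unop
  map f := fun _ hs => IsTorsionSection.res f.unop.le hs

/-- The torsion subsheaf of a module. -/
def torsion (F : X.Modules) : X.Modules where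
  val := (torsionSubmodule F).toPresheafOfModules
  isSheaf := by
    change TopCat.Presheaf.IsSheaf (X := X) (torsionSubmodule F).toPresheafOfModules.presheaf
    rw [TopCat.Presheaf.isSheaf_iff_isSheaf_comp (forget AddCommGrpCat.{u})]
    apply TopCat.Presheaf.isSheaf_of_isSheafUniqueGluing_types
    intro ι U sf hsf
    let s : ∀ i, torsionSections F (U i) := sf
    obtain ⟨t, ht, ht'⟩ := F.isSheaf.isSheafUniqueGluing U
      (fun i => (s i).1) (fun i j => congrArg Subtype.val (hsf i j))
    have hmem : IsTorsionSection F (iSup U) t := by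
      intro x hx
      obtain ⟨i, hi⟩ := Opens.mem_iSup.mp hx
      obtain ⟨V, hV, hxV, a, ha, has⟩ := (s i).2 x hi
      refine ⟨V, hV.trans (le_iSup U i), hxV, a, ha, ?_⟩
      have h1 : mrs F (le_iSup U i) t = (s i).1 := ht i
      rw [← mrs_mrs F hV (le_iSup U i), h1, has]
    refine ⟨(⟨t, hmem⟩ : torsionSections F (iSup U)), fun i => Subtype.ext (ht i), ?_⟩
    intro E hE
    exact Subtype.ext (ht' (E : torsionSections F (iSup U)).1 fun i => congrArg Subtype.val (hE i))

/-- The inclusion of the torsion subsheaf. -/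
def torsionι (F : X.Modules) : torsion F ⟶ F := ⟨(torsionSubmodule F).ι⟩

/-- The quotient of a module by its torsion. -/
abbrev modTorsion (F : X.Modules) : X.Modules := Limits.cokernel (torsionι F)

/-- The projection to the quotient by the torsion. -/
abbrev modTorsionπ (F : X.Modules) : F ⟶ modTorsion F := Limits.cokernel.π (torsionι F)

/-- The structure sheaf `𝒪_e` of the point `e`: the push forward of the structure sheaf of the spectrum
of the residue field. -/
abbrev pointSheaf (e : X) : X.Modules :=
  (Scheme.Modules.pushforward (X.fromSpecResidueField e)).obj (SheafOfModules.unit _)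

end Torsion

section Anchor

variable {X S : LogScheme.{u}} (p : X.Hom S)

/-- An open subset of `W`, as an étale scheme over `X` with image in `W`. -/
abbrev openEt {W : X.toScheme.Opens} (V : {V : X.toScheme.Opens // V ≤ W}) : EtIn W :=
  ⟨Scheme.Etale.mk V.1.ι, fun y => V.2 y.2⟩

/-- A homomorphism from the logarithmic tangent sheaf to the sheaf of vector fields on the underlying
scheme tangent to `Z` is the natural one if it maps a logarithmic derivation `(D, ∂)` to the
derivation `D` of the structure sheaf. -/
def IsUnderlyingDerivation {Z : Set X.toScheme}
    (a : logTangentSheaf p ⟶ tangentSheaf p.base Z) : Prop :=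
  ∀ (W : X.toScheme.Opens) (δ : Shrink.{u} (logDerivations p W))
    (V : {V : X.toScheme.Opens // V ≤ W}) (b : Γ(X.toScheme, V.1)),
    V.1.topIso.hom (((unshrink p W δ).1 (openEt V)).1 (V.1.topIso.inv b)) =
      (Scheme.Modules.Hom.app a W δ : tangentFields p.base Z W).1 V b

end Anchor

section Pullback

variable {C Q S : LogScheme.{u}} (q : Q.Hom S) (f : C.Hom Q) (Z : Set Q.toScheme)

/-- The torsion-free pull back `f†T_Q` along `f : C ⟶ Q` of the logarithmic tangent sheaf of a curve `Q`
with set of markings `Z`: the pull back, modulo torsion, of the sheaf of vector fields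
on the underlying curve which vanish along the markings. -/
abbrev torsionFreePullback : C.toScheme.Modules :=
  modTorsion ((Scheme.Modules.pullback f.base).obj (tangentSheaf q.base Z))

/-- The map `f^* T_Q ⟶ f†T_Q` induced by a map from the logarithmic tangent sheaf to the sheaf of
vector fields. -/
abbrev toTorsionFreePullback (a : logTangentSheaf q ⟶ tangentSheaf q.base Z) :
    (Scheme.Modules.pullback f.base).obj (logTangentSheaf q) ⟶ torsionFreePullback q f Z :=
  (Scheme.Modules.pullback f.base).map a ≫ modTorsionπ _

end Pullback

end

open CategoryTheory.Limits

/-! Both tangent sheaves of Q consist of derivations, and everything is read off on stalks. A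
logarithmic derivation is determined by the underlying derivation. Where the characteristic monoid
is that of the base, every section of `M_Q` is étale locally a base section times a unit, so its
logarithmic derivative is forced; functions that agree at these points are equal
(`IsLogCurve.fun_ext`).

Conversely a derivation lifts as soon as logarithmic derivatives exist étale locally
(`exists_logDerivation`). At a marking this means that the ideal of the point is preserved. At a
node with parameters `u, v` along the branches every derivation has the form `u ↦ a u`, `v ↦ b v`,
with `a` defined modulo `v` and `b` modulo `u`. The relation `α + β = δ` with `δ` from the base
forces the trace `a + b` to vanish at the node, and this suffices. Hence T_Q is a subsheaf of the
vector fields tangent to D: everything off the nodes, and the traceless derivations at a node.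

At a node q of Q the traceless derivations are free on one generator `σ`, similar to `u ∂u - v ∂v`.
All derivations are generated by `σ` and one `τ`, similar to `u ∂u`
(`IsNodeExtension.exists_generators`). Each `b` in the maximal ideal satisfies `b τ = c σ` for some
`c`, and `c / b` is then `p / g` on the branch `v = 0` and `-q / g` on `u = 0`, where `g` and `p +
q` are units.

Now pull back to C. No component is contracted to q, so some `b` in the maximal ideal at q pulls
back to a non-zero-divisor, and modulo torsion `τ` becomes `(c / b) σ`. At a smooth point of C over
q, `c / b` satisfies a monic quadratic equation over a normal ring, so it lies in the local ring and
the cokernel is zero (`IsCurveRing.dvd_of_sq`). At a node e of C over q, `u` and `v` are values of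
sections of `M_Q`, so their pull backs are values of sections of `M_C` and each vanishes on a branch
at e. The two branches are different because `b ∈ (u, v)` is a non-zero-divisor. So `c / b` takes on
the two branches values with unit difference: it is not in the local ring, but its products with the
maximal ideal are, and the cokernel is the residue field (`IsNodeRing.not_dvd_and_dvd`,
`IsNodalPullback.exists_residue`). Over the other points of Q the sheaves agree and are torsion free
over a discrete valuation ring or a field, so no torsion appears.

Charts exist only étale locally. The two kinds of local ring are therefore described by properties
stable under étale extension, divisibility and non-zero-divisors descend by faithful flatness, and
derivations extend uniquely along étale maps. Finally `shortExact_of_stalks` turns the statements on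
stalks into the exact sequence. -/

open IsLocalRing nonZeroDivisors TensorProduct
set_option linter.unusedSectionVars false

/-! ### Local rings of smooth points and of nodes -/

/-- A local ring whose maximal ideal is generated by a nonzerodivisor is a domain. -/
lemma isDomain_of_maximalIdeal_eq_span {R : Type*} [CommRing R] [IsLocalRing R]
    [IsNoetherianRing R] (t : R) (ht : maximalIdeal R = Ideal.span {t})
    (hn : ∀ r, t * r = 0 → r = 0) : IsDomain R := by
  -- Krull's intersection theorem puts `r ≠ 0` outside some power of `(t)`; after division by the
  -- largest possible power of `t` the cofactor lies outside the maximal ideal.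
  have key : ∀ r : R, r ≠ 0 → ∃ (n : ℕ) (w : R), IsUnit w ∧ r = t ^ n * w := by
    intro r hr
    have h1 : ∃ n, r ∉ Ideal.span {t} ^ n := by
      by_contra! h
      apply hr
      have := Ideal.iInf_pow_eq_bot_of_isLocalRing (Ideal.span {t} : Ideal R)
        (by rw [← ht]; exact (maximalIdeal.isMaximal R).ne_top)
      rw [← Ideal.mem_bot, ← this]
      exact (Ideal.mem_iInf).2 h
    classical
    obtain ⟨n, hn1, hn2⟩ : ∃ n, r ∈ Ideal.span {t} ^ n ∧ r ∉ Ideal.span {t} ^ (n + 1) := by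
      have h2 := Nat.find_spec h1
      rcases h3 : Nat.find h1 with _ | n
      · rw [h3] at h2; simp at h2
      · refine ⟨n, ?_, h3 ▸ h2⟩
        by_contra h4
        exact Nat.find_min h1 (m := n) (by omega) h4
    rw [Ideal.span_singleton_pow, Ideal.mem_span_singleton] at hn1
    obtain ⟨w, rfl⟩ := hn1
    refine ⟨n, w, ?_, rfl⟩
    by_contra hw
    have : w ∈ maximalIdeal R := hw
    rw [ht, Ideal.mem_span_singleton] at this
    obtain ⟨z, rfl⟩ := this
    apply hn2
    rw [Ideal.span_singleton_pow, Ideal.mem_span_singleton]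
    exact ⟨z, by ring⟩
  have hpow : ∀ n r, t ^ n * r = 0 → r = 0 := by
    intro n
    induction n with
    | zero => intro r hr; simpa using hr
    | succ n ih => intro r hr; exact hn _ (ih _ (by rw [← hr]; ring))
  have : NoZeroDivisors R := ⟨by
    intro a b hab
    by_contra! h
    obtain ⟨n, w, hw, rfl⟩ := key a h.1
    obtain ⟨m, z, hz, rfl⟩ := key b h.2
    have h1 : t ^ (n + m) * (w * z) = 0 := by rw [← hab]; ring
    exact (hw.mul hz).ne_zero (hpow _ _ h1)⟩
  exact NoZeroDivisors.to_isDomain R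

/-- The local rings of smooth curves: fields and discrete valuation rings. -/
structure IsCurveRing (R : Type*) [CommRing R] : Prop where
  isLocalRing : IsLocalRing R
  isNoetherianRing : IsNoetherianRing R
  isDomain : IsDomain R
  principal : ∃ t : R, ∀ r, ¬ IsUnit r ↔ t ∣ r

/-- The local rings of nodes, with the parameters along the branches. -/
structure IsNodeRing {R : Type*} [CommRing R] (u v : R) : Prop where
  isLocalRing : IsLocalRing R
  isNoetherianRing : IsNoetherianRing R
  mul : u * v = 0
  ann_left : ∀ r, u ^ 2 * r = 0 → v ∣ r
  ann_right : ∀ r, v ^ 2 * r = 0 → u ∣ r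
  nonunit : ∀ r, ¬ IsUnit r ↔ ∃ a b, r = a * u + b * v

namespace IsNodeRing

variable {R : Type*} [CommRing R] {u v : R} (h : IsNodeRing u v)
include h

lemma symm : IsNodeRing v u where
  isLocalRing := h.isLocalRing
  isNoetherianRing := h.isNoetherianRing
  mul := by rw [mul_comm, h.mul]
  ann_left := h.ann_right
  ann_right := h.ann_left
  nonunit r := (h.nonunit r).trans ⟨fun ⟨a, b, e⟩ => ⟨b, a, by rw [e, add_comm]⟩,
    fun ⟨a, b, e⟩ => ⟨b, a, by rw [e, add_comm]⟩⟩

lemma not_isUnit_left : ¬ IsUnit u := (h.nonunit u).2 ⟨1, 0, by ring⟩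

lemma not_isUnit_right : ¬ IsUnit v := h.symm.not_isUnit_left

lemma dvd_of_mul_left {r : R} (hr : u * r = 0) : v ∣ r :=
  h.ann_left r (by rw [pow_two, mul_assoc, hr, mul_zero])

lemma dvd_of_mul_right {r : R} (hr : v * r = 0) : u ∣ r := h.symm.dvd_of_mul_left hr

lemma left_ne_zero : u ≠ 0 := fun h0 =>
  h.not_isUnit_right (isUnit_of_dvd_one (h.ann_left 1 (by rw [h0]; ring)))

lemma right_ne_zero : v ≠ 0 := h.symm.left_ne_zero

lemma not_dvd : ¬ u ∣ v := by
  rintro ⟨r, hr⟩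
  refine h.not_isUnit_left (isUnit_of_dvd_one (h.ann_right 1 ?_))
  have := h.mul
  calc v ^ 2 * 1 = u * v * r := by rw [pow_two]; nth_rewrite 2 [hr]; ring
    _ = 0 := by rw [this, zero_mul]

/-- The square in `ann_left` is used here: `x = u a = v b` gives `u ^ 2 a = u v b = 0`, hence `v ∣
a` and `x ∈ (u v) = 0`. -/
lemma eq_zero_of_dvd {x : R} (h1 : u ∣ x) (h2 : v ∣ x) : x = 0 := by
  obtain ⟨a, rfl⟩ := h1
  obtain ⟨b, hb⟩ := h2
  obtain ⟨c, rfl⟩ := h.ann_left a (by rw [pow_two, mul_assoc, hb, ← mul_assoc, h.mul, zero_mul])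
  rw [← mul_assoc, h.mul, zero_mul]

/-- Modulo `u` the maximal ideal is generated by `v`, and `v` is a non-zero-divisor there: `v r ∈
(u)` gives `v ^ 2 r = 0`, so `u ∣ r`. Hence the quotient by `u` is a domain. -/
lemma left_prime {a b : R} (hab : u ∣ a * b) : u ∣ a ∨ u ∣ b := by
  have := h.isLocalRing
  have := h.isNoetherianRing
  let I : Ideal R := Ideal.span {u}
  have hI : I ≠ ⊤ := by
    rw [Ne, Ideal.span_singleton_eq_top]
    exact h.not_isUnit_left
  have : Nontrivial (R ⧸ I) := Ideal.Quotient.nontrivial_iff.2 hI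
  have : IsLocalRing (R ⧸ I) := IsLocalRing.of_surjective' _ (Ideal.Quotient.mk_surjective (I := I))
  have hloc : IsLocalHom (Ideal.Quotient.mk I) :=
    IsLocalHom.of_surjective _ Ideal.Quotient.mk_surjective
  have : IsDomain (R ⧸ I) := by
    refine isDomain_of_maximalIdeal_eq_span (Ideal.Quotient.mk I v) ?_ ?_
    · ext x
      obtain ⟨r, rfl⟩ := Ideal.Quotient.mk_surjective x
      rw [Ideal.mem_span_singleton, mem_maximalIdeal, mem_nonunits_iff]
      constructor
      · intro hr
        obtain ⟨a, b, rfl⟩ := (h.nonunit r).1 fun h' => hr (h'.map _)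
        refine ⟨Ideal.Quotient.mk I a * 0 + Ideal.Quotient.mk I b, ?_⟩
        have : Ideal.Quotient.mk I u = 0 :=
          Ideal.Quotient.eq_zero_iff_mem.2 (Ideal.mem_span_singleton_self u)
        rw [map_add, map_mul, map_mul, this]; ring
      · rintro ⟨y, hy⟩ hu
        rw [hy] at hu
        exact h.not_isUnit_right (isUnit_of_map_unit (Ideal.Quotient.mk I) _
          (isUnit_of_mul_isUnit_left hu))
    · intro x hx
      obtain ⟨r, rfl⟩ := Ideal.Quotient.mk_surjective x
      rw [← map_mul, Ideal.Quotient.eq_zero_iff_mem, Ideal.mem_span_singleton] at hx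
      rw [Ideal.Quotient.eq_zero_iff_mem, Ideal.mem_span_singleton]
      obtain ⟨s, hs⟩ := hx
      refine h.ann_right r ?_
      rw [pow_two, mul_assoc, hs, ← mul_assoc, mul_comm v u, h.mul, zero_mul]
  have h0 : Ideal.Quotient.mk I a * Ideal.Quotient.mk I b = 0 := by
    rw [← map_mul, Ideal.Quotient.eq_zero_iff_mem, Ideal.mem_span_singleton]; exact hab
  simpa only [mul_eq_zero, Ideal.Quotient.eq_zero_iff_mem, I, Ideal.mem_span_singleton] using h0

/-- `(u)` and `(v)` are primes with zero intersection, so the zero divisors are the elements that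
vanish on a branch. -/
lemma mem_nonZeroDivisors {r : R} (h1 : ¬ u ∣ r) (h2 : ¬ v ∣ r) : r ∈ R⁰ := by
  rw [mem_nonZeroDivisors_iff_right]
  intro x hx
  refine h.eq_zero_of_dvd ?_ ?_
  · exact (h.left_prime (hx ▸ dvd_zero u)).resolve_right h1
  · exact (h.symm.left_prime (hx ▸ dvd_zero v)).resolve_right h2

lemma not_dvd_left_of_mem {r : R} (hr : r ∈ R⁰) : ¬ u ∣ r := by
  rintro ⟨s, rfl⟩
  refine h.right_ne_zero ((mem_nonZeroDivisors_iff_right.1 hr) v ?_)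
  rw [← mul_assoc, mul_comm v, h.mul, zero_mul]

lemma not_dvd_right_of_mem {r : R} (hr : r ∈ R⁰) : ¬ v ∣ r := h.symm.not_dvd_left_of_mem hr

/-- Avoidance of the two branch ideals: if `f a` survives on one branch only and `f b` only on the
other, then `f (a + b)` survives on both. An additive `f` is enough, so the lemma serves for the
values of a derivation as well as for pull backs of elements of a maximal ideal. -/
lemma exists_mem_nonZeroDivisors {B : Type*} [AddCommGroup B] (f : B →+ R) (I : AddSubgroup B)
    (h1 : ∃ a ∈ I, ¬ u ∣ f a) (h2 : ∃ a ∈ I, ¬ v ∣ f a) : ∃ a ∈ I, f a ∈ R⁰ := by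
  obtain ⟨a, ha, hua⟩ := h1
  obtain ⟨b, hb, hvb⟩ := h2
  by_cases hva : v ∣ f a
  · by_cases hub : u ∣ f b
    · refine ⟨a + b, I.add_mem ha hb, h.mem_nonZeroDivisors ?_ ?_⟩
      · rw [map_add]; exact fun h' => hua ((dvd_add_left hub).1 h')
      · rw [map_add]; exact fun h' => hvb ((dvd_add_right hva).1 h')
    · exact ⟨b, hb, h.mem_nonZeroDivisors hub hvb⟩
  · exact ⟨a, ha, h.mem_nonZeroDivisors hua hva⟩

lemma add_mem_nonZeroDivisors : u + v ∈ R⁰ :=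
  h.mem_nonZeroDivisors (fun h' => h.not_dvd ((dvd_add_right dvd_rfl).1 h'))
    (fun h' => h.symm.not_dvd ((dvd_add_left dvd_rfl).1 h'))

/-- In `a u` the factor `a` matters only modulo `v`, and in `b v` the factor `b` only modulo `u`.
The sum `a + b` can therefore be moved by any element of the maximal ideal; only its value at the
node is intrinsic. -/
lemma exists_sum_eq {a b w x y : R} (hw : ¬ IsUnit (a + b - w)) (hx : x = a * u) (hy : y = b * v) :
    ∃ a' b', x = a' * u ∧ y = b' * v ∧ a' + b' = w := by
  obtain ⟨c, d, hcd⟩ := (h.nonunit _).1 hw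
  refine ⟨a - d * v, b - c * u, ?_, ?_, ?_⟩
  · rw [hx, sub_mul, mul_assoc, mul_comm v u, h.mul, mul_zero, sub_zero]
  · rw [hy, sub_mul, mul_assoc, h.mul, mul_zero, sub_zero]
  · linear_combination hcd

end IsNodeRing

/-! ### Derivations along homomorphisms and their extension -/

/-- `D` is a derivation along the ring homomorphism `f`. -/
structure IsDerAlong {B C : Type*} [CommRing B] [CommRing C] (f : B →+* C) (D : B → C) : Prop where
  add : ∀ a b, D (a + b) = D a + D b
  leibniz : ∀ a b, D (a * b) = f a * D b + f b * D a

namespace IsDerAlong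

variable {A B C E : Type*} [CommRing A] [CommRing B] [CommRing C] [CommRing E]

lemma zero {f : B →+* C} {D : B → C} (h : IsDerAlong f D) : D 0 = 0 := by
  have := h.add 0 0
  rw [add_zero] at this
  simpa using this

lemma one {f : B →+* C} {D : B → C} (h : IsDerAlong f D) : D 1 = 0 := by
  have := h.leibniz 1 1
  rw [mul_one, map_one, one_mul] at this
  simpa using this

lemma neg {f : B →+* C} {D : B → C} (h : IsDerAlong f D) (a : B) : D (-a) = - D a := by
  have := h.add a (-a)
  rw [add_neg_cancel, h.zero] at this
  exact (neg_eq_of_add_eq_zero_right this.symm).symm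

lemma sub {f : B →+* C} {D : B → C} (h : IsDerAlong f D) (a b : B) : D (a - b) = D a - D b := by
  rw [sub_eq_add_neg, h.add, h.neg, sub_eq_add_neg]

lemma comp_left {f : B →+* C} {D : B → C} (h : IsDerAlong f D) (g : C →+* E) :
    IsDerAlong (g.comp f) (fun b => g (D b)) where
  add a b := by rw [h.add, map_add]
  leibniz a b := by simp only [h.leibniz, map_add, map_mul, RingHom.comp_apply]

lemma comp_right {f : B →+* C} {D : B → C} (h : IsDerAlong f D) (g : A →+* B) :
    IsDerAlong (f.comp g) (fun b => D (g b)) where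
  add a b := by rw [map_add, h.add]
  leibniz a b := by simp only [h.leibniz, map_mul, RingHom.comp_apply]

lemma of_zero (f : B →+* C) : IsDerAlong f (fun _ => 0) where
  add _ _ := by simp
  leibniz _ _ := by simp

lemma add' {f : B →+* C} {D E : B → C} (hD : IsDerAlong f D) (hE : IsDerAlong f E) :
    IsDerAlong f (fun b => D b + E b) where
  add a b := by rw [hD.add, hE.add]; ring
  leibniz a b := by rw [hD.leibniz, hE.leibniz]; ring

lemma smul {f : B →+* C} {D : B → C} (hD : IsDerAlong f D) (c : C) :
    IsDerAlong f (fun b => c * D b) where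
  add a b := by rw [hD.add]; ring
  leibniz a b := by rw [hD.leibniz]; ring

lemma sum {f : B →+* C} {ι : Type*} (s : Finset ι) {D : ι → B → C}
    (hD : ∀ i, IsDerAlong f (D i)) : IsDerAlong f (fun b => ∑ i ∈ s, D i b) where
  add a b := by simp only [(hD _).add, Finset.sum_add_distrib]
  leibniz a b := by simp only [(hD _).leibniz, Finset.sum_add_distrib, Finset.mul_sum]

/-- The bundled derivation. -/
noncomputable def toDerivation [Algebra B C] {D : B → C} (h : IsDerAlong (algebraMap B C) D) :
    Derivation ℤ B C :=
  Derivation.mk' (AddMonoidHom.toIntLinearMap ⟨⟨D, h.zero⟩, h.add⟩) fun a b => by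
    change D (a * b) = _
    rw [h.leibniz, Algebra.smul_def, Algebra.smul_def]; rfl

lemma of_derivation {R : Type*} [CommRing R] [Algebra R B] [Algebra R C] [Algebra B C]
    [IsScalarTower R B C] (d : Derivation R B C) : IsDerAlong (algebraMap B C) d where
  add := map_add d
  leibniz a b := by rw [d.leibniz, Algebra.smul_def, Algebra.smul_def]

/-- The difference of the two derivations is `A`-linear, so it factors through `Ω[B⁄A] = 0`.
Derivations on étale extensions and on localizations are always compared in this way below. -/
lemma ext_of_formallyUnramified {f : A →+* B} (hf : f.FormallyUnramified) {g : B →+* C}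
    {D E : B → C} (hD : IsDerAlong g D) (hE : IsDerAlong g E) (h : ∀ a, D (f a) = E (f a)) :
    D = E := by
  algebraize [f, g]
  have : Algebra.FormallyUnramified A B := hf
  let H : B → C := fun b => D b + (-1) * E b
  have hH : IsDerAlong (algebraMap B C) H := hD.add' (hE.smul (-1))
  have h0 : ∀ a, H (f a) = 0 := fun a => by simp only [H, h]; ring
  let : Algebra A C := (g.comp f).toAlgebra
  have : IsScalarTower A B C := .of_algebraMap_eq' rfl
  let d : Derivation A B C := Derivation.mk'
    { toFun := H
      map_add' := hH.add
      map_smul' := fun a b => by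
        rw [Algebra.smul_def, hH.leibniz, RingHom.algebraMap_toAlgebra f, h0, mul_zero, add_zero,
          RingHom.id_apply, Algebra.smul_def]; rfl } fun a b => by
        change H (a * b) = _
        rw [hH.leibniz, Algebra.smul_def, Algebra.smul_def]; rfl
  have hd : d = 0 := by
    ext b
    rw [← d.liftKaehlerDifferential_comp_D b, Subsingleton.elim (KaehlerDifferential.D A B b) 0,
      map_zero]
    rfl
  funext b
  have : H b = 0 := congrArg (fun e => e b) hd
  simp only [H] at this
  linear_combination this

/-- For `B` formally étale over `A`, `Ω[B⁄ℤ]` is the base change of `Ω[A⁄ℤ]`, so the linear map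
attached to `D` extends. -/
lemma exists_extension {f : A →+* B} (hf : f.FormallyEtale) (g : B →+* C) {D : A → C}
    (hD : IsDerAlong (g.comp f) D) : ∃ E : B → C, IsDerAlong g E ∧ ∀ a, E (f a) = D a := by
  algebraize [f, g, g.comp f]
  have : Algebra.FormallyEtale A B := hf
  let d : Derivation ℤ A C := hD.toDerivation
  let e := KaehlerDifferential.tensorKaehlerEquivOfFormallyEtale ℤ A B
  let l : Ω[B⁄ℤ] →ₗ[B] C := (d.liftKaehlerDifferential.liftBaseChange B).comp e.symm.toLinearMap
  refine ⟨fun b => l (KaehlerDifferential.D ℤ B b), ⟨fun a b => by simp, fun a b => ?_⟩, fun a => ?_⟩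
  · rw [Derivation.leibniz, map_add, map_smul, map_smul, Algebra.smul_def, Algebra.smul_def]; rfl
  · have := KaehlerDifferential.tensorKaehlerEquivOfFormallyEtale_symm_D_algebraMap ℤ A B a
    change (d.liftKaehlerDifferential.liftBaseChange B) (e.symm (KaehlerDifferential.D ℤ B
      (algebraMap A B a))) = _
    rw [this, LinearMap.liftBaseChange_tmul, Derivation.liftKaehlerDifferential_comp_D, one_smul]
    rfl

end IsDerAlong

/-! ### Flat and étale local homomorphisms -/

/-- By hypothesis `A → A → A`, multiplication by `b` followed by multiplication by `a`, is exact in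
the middle; tensoring with the flat algebra `B` keeps it exact. -/
lemma flat_dvd_of_mul_eq_zero {A B : Type*} [CommRing A] [CommRing B] (f : A →+* B) (hf : f.Flat)
    {a b : A} (h : ∀ r, a * r = 0 → b ∣ r) (hab : a * b = 0) {s : B} (hs : f a * s = 0) :
    f b ∣ s := by
  algebraize [f]
  have hex : Function.Exact (LinearMap.lsmul A A b) (LinearMap.lsmul A A a) := by
    intro r
    constructor
    · intro hr
      obtain ⟨c, rfl⟩ := h r hr
      exact ⟨c, rfl⟩
    · rintro ⟨c, rfl⟩
      change a * (b * c) = 0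
      rw [← mul_assoc, hab, zero_mul]
  have h2 := Module.Flat.lTensor_exact B hex
  have h3 := (h2 (s ⊗ₜ 1)).1 (by
    rw [LinearMap.lTensor_tmul]
    change s ⊗ₜ[A] (a * 1) = 0
    rw [mul_one, ← mul_one a, ← smul_eq_mul, ← TensorProduct.smul_tmul, Algebra.smul_def,
      RingHom.algebraMap_toAlgebra, hs, TensorProduct.zero_tmul])
  obtain ⟨z, hz⟩ := h3
  let e := TensorProduct.rid A B
  have h4 : ∀ z : B ⊗[A] A, e ((LinearMap.lsmul A A b).lTensor B z) = f b * e z := by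
    intro z
    induction z with
    | zero => simp
    | add x y hx hy => rw [map_add, map_add, hx, hy, map_add, mul_add]
    | tmul x y =>
      rw [LinearMap.lTensor_tmul]
      change e (x ⊗ₜ (b * y)) = f b * e (x ⊗ₜ y)
      rw [TensorProduct.rid_tmul, TensorProduct.rid_tmul, mul_smul, Algebra.smul_def]; rfl
  refine ⟨e z, ?_⟩
  rw [← h4, hz]
  change s = e (s ⊗ₜ 1)
  rw [TensorProduct.rid_tmul, one_smul]

/-- The properties of the homomorphisms of local rings of an étale morphism. -/
structure IsEtaleLocal {A B : Type*} [CommRing A] [CommRing B] (f : A →+* B) : Prop where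
  flat : f.Flat
  formallyEtale : f.FormallyEtale
  isLocalHom : IsLocalHom f
  essFiniteType : f.EssFiniteType

section Descent

variable {A B : Type*} [CommRing A] [CommRing B] {f : A →+* B}

lemma RingHom.Flat.map_mem_nonZeroDivisors (hf : f.Flat) {a : A} (ha : a ∈ A⁰) : f a ∈ B⁰ := by
  rw [mem_nonZeroDivisors_iff_right]
  intro s hs
  -- The case `b = 0`: the annihilator of `a` is zero.
  have := flat_dvd_of_mul_eq_zero f hf (a := a) (b := 0)
    (fun r hr => by rw [(mem_nonZeroDivisors_iff_right.1 ha) r (by rw [mul_comm, hr])])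
    (mul_zero a) (s := s) (by rw [mul_comm, hs])
  rwa [map_zero, zero_dvd_iff] at this

variable [IsLocalRing A] [IsLocalRing B] (hf : f.Flat) (hl : IsLocalHom f)
include hf hl

/-- A flat local homomorphism is faithfully flat, so an ideal is the contraction of its extension.
Thus membership, divisibility and vanishing can be tested after an étale extension. -/
lemma mem_of_map_mem_of_flat {I : Ideal A} {a : A} (h : f a ∈ I.map f) : a ∈ I := by
  algebraize [f]
  have : IsLocalHom (algebraMap A B) := hl
  have : Module.FaithfullyFlat A B := Module.FaithfullyFlat.of_flat_of_isLocalHom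
  rw [← Ideal.comap_map_eq_self_of_faithfullyFlat (B := B) I]
  exact h

lemma dvd_of_map_dvd_of_flat {a b : A} (h : f a ∣ f b) : a ∣ b := by
  rw [← Ideal.mem_span_singleton]
  refine mem_of_map_mem_of_flat hf hl ?_
  rw [Ideal.map_span, Set.image_singleton, Ideal.mem_span_singleton]
  exact h

lemma injective_of_flat_of_isLocalHom : Function.Injective f := by
  rw [injective_iff_map_eq_zero]
  intro a ha
  have : a ∈ (⊥ : Ideal A) := mem_of_map_mem_of_flat hf hl (by rw [ha]; exact zero_mem _)
  exact this

lemma mem_nonZeroDivisors_of_map_mem {a : A} (h : f a ∈ B⁰) : a ∈ A⁰ := by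
  rw [mem_nonZeroDivisors_iff_right]
  intro r hr
  refine injective_of_flat_of_isLocalHom hf hl ?_
  rw [map_zero]
  exact (mem_nonZeroDivisors_iff_right.1 h) _ (by rw [← map_mul, hr, map_zero])

end Descent

namespace IsEtaleLocal

variable {A B C : Type*} [CommRing A] [CommRing B] [CommRing C] {f : A →+* B}

lemma formallyUnramified (h : IsEtaleLocal f) : f.FormallyUnramified := by
  algebraize [f]
  have : Algebra.FormallyEtale A B := h.formallyEtale
  exact (inferInstance : Algebra.FormallyUnramified A B)

variable [IsLocalRing A] [IsLocalRing B] (h : IsEtaleLocal f)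
include h

lemma map_maximalIdeal : (maximalIdeal A).map f = maximalIdeal B := by
  algebraize [f]
  have : IsLocalHom (algebraMap A B) := h.isLocalHom
  have : Algebra.FormallyUnramified A B := h.formallyUnramified
  have : Algebra.EssFiniteType A B := h.essFiniteType
  exact Algebra.FormallyUnramified.map_maximalIdeal

lemma isNoetherianRing [IsNoetherianRing A] : IsNoetherianRing B := by
  algebraize [f]
  have : Algebra.EssFiniteType A B := h.essFiniteType
  exact Algebra.EssFiniteType.isNoetherianRing A B

/-- The maximal ideal of `B` is generated by `f t`. If `t = 0` this makes `B` a field; otherwise `f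
t` is a non-zero-divisor by flatness and `isDomain_of_maximalIdeal_eq_span` applies. -/
lemma isCurveRing (hA : IsCurveRing A) : IsCurveRing B := by
  have := hA.isNoetherianRing
  have := hA.isDomain
  have hn := h.isNoetherianRing
  obtain ⟨t, ht⟩ := hA.principal
  have h1 : maximalIdeal A = Ideal.span {t} := by
    ext r; rw [Ideal.mem_span_singleton, ← ht]; rfl
  have h2 : maximalIdeal B = Ideal.span {f t} := by
    rw [← h.map_maximalIdeal, h1, Ideal.map_span, Set.image_singleton]
  refine ⟨inferInstance, hn, ?_, f t, fun r => ?_⟩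
  · by_cases h0 : t = 0
    · rw [h0, map_zero, Ideal.span_singleton_eq_bot.2 rfl, ← IsLocalRing.isField_iff_maximalIdeal_eq]
        at h2
      exact h2.isDomain
    · refine isDomain_of_maximalIdeal_eq_span (f t) h2 fun r hr => ?_
      exact (mem_nonZeroDivisors_iff_right.1 (h.flat.map_mem_nonZeroDivisors
        (mem_nonZeroDivisors_of_ne_zero h0))) r (by rw [mul_comm, hr])
  · rw [← Ideal.mem_span_singleton, ← h2]; rfl

/-- A node ring is characterized by annihilators, which flatness controls, and by generators of the
maximal ideal, which extend because the homomorphism is unramified. -/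
lemma isNodeRing {u v : A} (hA : IsNodeRing u v) : IsNodeRing (f u) (f v) := by
  have := hA.isNoetherianRing
  have hn := h.isNoetherianRing
  have h1 : maximalIdeal A = Ideal.span {u, v} := by
    ext r
    rw [Ideal.mem_span_pair, mem_maximalIdeal, mem_nonunits_iff, hA.nonunit]
    simp only [eq_comm]
  have h2 : maximalIdeal B = Ideal.span {f u, f v} := by
    rw [← h.map_maximalIdeal, h1, Ideal.map_span, Set.image_pair]
  have huv : v * u = 0 := by rw [mul_comm, hA.mul]
  refine ⟨inferInstance, hn, by rw [← map_mul, hA.mul, map_zero], fun r hr => ?_, fun r hr => ?_,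
    fun r => ?_⟩
  · rw [← map_pow] at hr
    exact flat_dvd_of_mul_eq_zero f h.flat hA.ann_left (by rw [pow_two, mul_assoc, hA.mul, mul_zero]) hr
  · rw [← map_pow] at hr
    exact flat_dvd_of_mul_eq_zero f h.flat hA.ann_right (by rw [pow_two, mul_assoc, huv, mul_zero]) hr
  · change r ∈ maximalIdeal B ↔ _
    rw [h2, Ideal.mem_span_pair]
    simp only [eq_comm]

end IsEtaleLocal

lemma IsNodeRing.not_isCurveRing {R : Type*} [CommRing R] {u v : R} (h : IsNodeRing u v) :
    ¬ IsCurveRing R := fun hR => by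
  have := hR.isDomain
  exact (mul_eq_zero.1 h.mul).elim h.left_ne_zero h.right_ne_zero

/-- The localization of a principal ideal domain at a prime is a field or a discrete valuation
ring. -/
lemma isCurveRing_of_isLocalization {A : Type*} [CommRing A] [IsDomain A] [IsPrincipalIdealRing A]
    (P : Ideal A) [P.IsPrime] (L : Type*) [CommRing L] [Algebra A L] [IsLocalization.AtPrime L P] :
    IsCurveRing L := by
  have hl : IsLocalRing L := IsLocalization.AtPrime.isLocalRing L P
  obtain ⟨g, hg⟩ := (IsPrincipalIdealRing.principal P).principal
  have h1 : maximalIdeal L = Ideal.span {algebraMap A L g} := by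
    rw [← IsLocalization.AtPrime.map_eq_maximalIdeal P L, hg, Ideal.submodule_span_eq, Ideal.map_span,
      Set.image_singleton]
  refine ⟨hl, IsLocalization.isNoetherianRing P.primeCompl L inferInstance,
    IsLocalization.isDomain_of_le_nonZeroDivisors (M := P.primeCompl) L P.primeCompl_le_nonZeroDivisors,
    algebraMap A L g, fun r => ?_⟩
  rw [← Ideal.mem_span_singleton, ← h1]; rfl

/-! ### The coordinate ring of two crossing lines -/

namespace NodeRing

variable (k : Type u) [Field k]

/-- The coordinates. -/
noncomputable abbrev x (i : Fin 2) : NodeRing k := Ideal.Quotient.mk _ (MvPolynomial.X i)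

lemma X_mul_X {i j : Fin 2} (hij : i ≠ j) :
    (MvPolynomial.X 0 * MvPolynomial.X 1 : MvPolynomial (Fin 2) k) =
      MvPolynomial.X i * MvPolynomial.X j := by
  fin_cases i <;> fin_cases j <;> first | exact absurd rfl hij | rfl | exact mul_comm _ _

lemma x_mul_x {i j : Fin 2} (hij : i ≠ j) : x k i * x k j = 0 := by
  rw [← map_mul, ← X_mul_X k hij]
  exact Ideal.Quotient.eq_zero_iff_mem.2 (Ideal.mem_span_singleton_self _)

lemma dvd_of_sq_mul {i j : Fin 2} (hij : i ≠ j) (r : NodeRing k) (hr : x k i ^ 2 * r = 0) :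
    x k j ∣ r := by
  obtain ⟨r, rfl⟩ := Ideal.Quotient.mk_surjective r
  rw [← map_pow, ← map_mul, Ideal.Quotient.eq_zero_iff_mem, Ideal.mem_span_singleton,
    X_mul_X k hij] at hr
  obtain ⟨s, hs⟩ := hr
  have h1 : MvPolynomial.X i * r = MvPolynomial.X j * s := by
    refine mul_left_cancel₀ (MvPolynomial.X_ne_zero (R := k) i) ?_
    rw [← mul_assoc, ← mul_assoc, ← hs, pow_two]
  have h2 : (MvPolynomial.X j : MvPolynomial (Fin 2) k) ∣ MvPolynomial.X i * r := ⟨s, h1⟩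
  rcases MvPolynomial.X_dvd_mul_iff.1 h2 with h3 | h3
  · exact absurd (MvPolynomial.X_dvd_X.1 h3) (Ne.symm hij)
  · exact map_dvd _ h3

lemma x_isUnit_or {P : Ideal (NodeRing k)} [P.IsPrime] {i j : Fin 2} (hij : i ≠ j) :
    x k i ∈ P ∨ x k j ∈ P :=
  Ideal.IsPrime.mem_or_mem ‹_› (by rw [x_mul_x k hij]; exact zero_mem _)

/-- The projection to the ring of functions on a branch. -/
noncomputable def toBranch (i : Fin 2) : NodeRing k →ₐ[k] Polynomial k :=
  Ideal.Quotient.liftₐ _ (MvPolynomial.aeval fun l => if l = i then Polynomial.X else 0) (by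
    intro a ha
    obtain ⟨b, rfl⟩ := Ideal.mem_span_singleton.1 ha
    fin_cases i <;> simp)

/-- The section of the projection to a branch. -/
noncomputable def ofBranch (i : Fin 2) : Polynomial k →ₐ[k] NodeRing k := Polynomial.aeval (x k i)

lemma toBranch_x (i l : Fin 2) : toBranch k i (x k l) = if l = i then Polynomial.X else 0 := by
  change MvPolynomial.aeval _ (MvPolynomial.X l) = _
  rw [MvPolynomial.aeval_X]

lemma toBranch_ofBranch (i : Fin 2) (p : Polynomial k) : toBranch k i (ofBranch k i p) = p := by
  have : (toBranch k i).comp (ofBranch k i) = AlgHom.id k _ := by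
    ext
    simp [ofBranch, toBranch_x]
  exact congrArg (fun g => g p) this

/-- Modulo `x j` the ring is generated by `x i`, so it is enough to compare two algebra
homomorphisms on the coordinates. -/
lemma dvd_sub {i j : Fin 2} (hij : i ≠ j) (r : NodeRing k) :
    x k j ∣ r - ofBranch k i (toBranch k i r) := by
  rw [← Ideal.mem_span_singleton, ← Ideal.Quotient.mk_eq_mk_iff_sub_mem]
  have : (Ideal.Quotient.mkₐ k (Ideal.span {x k j})) = (Ideal.Quotient.mkₐ k (Ideal.span {x k j})).comp
      ((ofBranch k i).comp (toBranch k i)) := by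
    apply Ideal.Quotient.algHom_ext
    apply MvPolynomial.algHom_ext
    intro l
    change Ideal.Quotient.mk (Ideal.span {x k j}) (x k l) =
      Ideal.Quotient.mk _ (ofBranch k i (toBranch k i (x k l)))
    rw [toBranch_x]
    by_cases hl : l = i
    · rw [if_pos hl, ofBranch, Polynomial.aeval_X, hl]
    · have : l = j := by omega
      rw [if_neg hl, map_zero, map_zero, this]
      exact Ideal.Quotient.eq_zero_iff_mem.2 (Ideal.mem_span_singleton_self _)
  exact congrArg (fun g => g r) this

/-- Once `x i` is invertible the other coordinate becomes zero, so `L` is also a localization of the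
polynomial ring of the branch `i`, which is a principal ideal domain. -/
lemma isCurveRing (P : Ideal (NodeRing k)) [P.IsPrime] (L : Type u) [CommRing L]
    [Algebra (NodeRing k) L] [IsLocalization.AtPrime L P] {i : Fin 2} (hi : x k i ∉ P) :
    IsCurveRing L := by
  obtain ⟨j, hij⟩ : ∃ j, i ≠ j := ⟨i + 1, by fin_cases i <;> decide⟩
  have hj : x k j ∈ P := (x_isUnit_or k hij).resolve_left hi
  let φ : Polynomial k →+* NodeRing k := (ofBranch k i).toRingHom
  have hmem : ∀ r, r ∈ P ↔ φ (toBranch k i r) ∈ P := fun r => by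
    have h1 : r - φ (toBranch k i r) ∈ P := by
      obtain ⟨s, hs⟩ := dvd_sub k hij r
      change r - ofBranch k i (toBranch k i r) ∈ P
      rw [hs]; exact P.mul_mem_right _ hj
    constructor
    · intro hr; simpa using P.sub_mem hr h1
    · intro hr; simpa using P.add_mem h1 hr
  have hzero : algebraMap (NodeRing k) L (x k j) = 0 := by
    have : IsUnit (algebraMap (NodeRing k) L (x k i)) :=
      IsLocalization.map_units L (⟨x k i, hi⟩ : P.primeCompl)
    refine this.mul_left_cancel ?_
    rw [← map_mul, x_mul_x k hij, map_zero, mul_zero]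
  have heq : ∀ r, algebraMap (NodeRing k) L r = algebraMap _ L (φ (toBranch k i r)) := fun r => by
    obtain ⟨s, hs⟩ := dvd_sub k hij r
    have : r = φ (toBranch k i r) + x k j * s := by rw [← hs]; exact (add_sub_cancel _ r).symm
    nth_rewrite 1 [this]
    rw [map_add, map_mul, hzero, zero_mul, add_zero]
  let : Algebra (Polynomial k) L := ((algebraMap (NodeRing k) L).comp φ).toAlgebra
  let Q : Ideal (Polynomial k) := P.comap φ
  have : IsLocalization.AtPrime L Q := by
    refine ⟨?_, ?_, ?_⟩
    · rintro ⟨s, hs⟩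
      exact IsLocalization.map_units L (⟨φ s, hs⟩ : P.primeCompl)
    · intro z
      obtain ⟨⟨r, s⟩, hrs⟩ := IsLocalization.surj P.primeCompl z
      refine ⟨⟨toBranch k i r, ⟨toBranch k i s, fun h => s.2 ((hmem _).2 h)⟩⟩, ?_⟩
      change z * algebraMap _ L (φ _) = algebraMap _ L (φ _)
      rw [← heq, ← heq]; exact hrs
    · intro p q hpq
      obtain ⟨s, hs⟩ := (IsLocalization.eq_iff_exists P.primeCompl L).1
        (show algebraMap _ L (φ p) = algebraMap _ L (φ q) from hpq)
      refine ⟨⟨toBranch k i s, fun h => s.2 ((hmem _).2 h)⟩, ?_⟩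
      have := congrArg (toBranch k i) hs
      rw [map_mul, map_mul] at this
      have e : ∀ p, toBranch k i (φ p) = p := toBranch_ofBranch k i
      rw [e, e] at this
      exact this
  exact isCurveRing_of_isLocalization Q L

/-- The quotient by both coordinates is `k`, so they already generate a maximal ideal. -/
lemma eq_span (P : Ideal (NodeRing k)) [P.IsPrime] (h : ∀ i, x k i ∈ P) :
    P = Ideal.span {x k 0, x k 1} := by
  have hle : Ideal.span {x k 0, x k 1} ≤ P := by
    rw [Ideal.span_le]
    rintro _ (rfl | rfl)
    exacts [h 0, h 1]
  refine (Ideal.IsMaximal.eq_of_le ?_ (Ideal.IsPrime.ne_top ‹_›) hle).symm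
  let ψ : NodeRing k →ₐ[k] k := (Polynomial.aeval (0 : k)).comp (toBranch k 0)
  have hψ : Function.Surjective ψ := fun c => ⟨algebraMap _ _ c, by rw [AlgHom.commutes]; rfl⟩
  have hk : RingHom.ker ψ.toRingHom = Ideal.span {x k 0, x k 1} := by
    refine le_antisymm (fun r hr => ?_) ?_
    · obtain ⟨s, hs⟩ := dvd_sub k (zero_ne_one' (Fin 2)) r
      have h0 : Polynomial.aeval (0 : k) (toBranch k 0 r) = 0 := hr
      rw [Polynomial.coe_aeval_eq_eval, ← Polynomial.IsRoot, ← Polynomial.dvd_iff_isRoot,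
        map_zero, sub_zero] at h0
      obtain ⟨t, ht⟩ := h0
      rw [Ideal.mem_span_pair]
      refine ⟨ofBranch k 0 t, s, ?_⟩
      rw [sub_eq_iff_eq_add, ht, map_mul, ofBranch, Polynomial.aeval_X] at hs
      rw [hs, ofBranch]; ring
    · rw [Ideal.span_le]
      rintro _ (rfl | rfl)
      · change Polynomial.aeval (0 : k) (toBranch k 0 (x k 0)) = 0
        rw [toBranch_x, if_pos rfl, Polynomial.aeval_X]
      · change Polynomial.aeval (0 : k) (toBranch k 0 (x k 1)) = 0
        rw [toBranch_x, if_neg (by decide), map_zero]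
  rw [← hk]
  exact RingHom.ker_isMaximal_of_surjective ψ.toRingHom hψ

lemma isNodeRing (P : Ideal (NodeRing k)) [P.IsPrime] (L : Type u) [CommRing L]
    [Algebra (NodeRing k) L] [IsLocalization.AtPrime L P] (h : ∀ i, x k i ∈ P) :
    IsNodeRing (algebraMap (NodeRing k) L (x k 0)) (algebraMap (NodeRing k) L (x k 1)) := by
  have hl : IsLocalRing L := IsLocalization.AtPrime.isLocalRing L P
  have hflat : (algebraMap (NodeRing k) L).Flat := by
    rw [RingHom.flat_algebraMap_iff]
    exact IsLocalization.flat L P.primeCompl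
  have hP := eq_span k P h
  have h1 : maximalIdeal L = Ideal.span {algebraMap _ L (x k 0), algebraMap _ L (x k 1)} := by
    rw [← IsLocalization.AtPrime.map_eq_maximalIdeal P L, hP, Ideal.map_span, Set.image_pair]
  have h01 := x_mul_x k (zero_ne_one' (Fin 2))
  have h10 := x_mul_x k (one_ne_zero (α := Fin 2))
  refine ⟨hl, IsLocalization.isNoetherianRing P.primeCompl L inferInstance,
    by rw [← map_mul, h01, map_zero], fun r hr => ?_, fun r hr => ?_, fun r => ?_⟩
  · rw [← map_pow] at hr
    exact flat_dvd_of_mul_eq_zero _ hflat (dvd_of_sq_mul k (by decide))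
      (by rw [pow_two, mul_assoc, h01, mul_zero]) hr
  · rw [← map_pow] at hr
    exact flat_dvd_of_mul_eq_zero _ hflat (dvd_of_sq_mul k (by decide))
      (by rw [pow_two, mul_assoc, h10, mul_zero]) hr
  · change r ∈ maximalIdeal L ↔ _
    rw [h1, Ideal.mem_span_pair]
    simp only [eq_comm]

/-- The Euler field `d` of one coordinate maps `x y b` to `x y (b + d b)`, so it preserves the ideal
`(x y)` and descends. -/
lemma exists_derivation (i : Fin 2) : ∃ D : NodeRing k → NodeRing k, IsDerAlong (RingHom.id _) D ∧
    (∀ c : k, D (algebraMap k _ c) = 0) ∧ ∀ l, D (x k l) = if l = i then x k l else 0 := by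
  let d : Derivation k (MvPolynomial (Fin 2) k) (MvPolynomial (Fin 2) k) :=
    MvPolynomial.mkDerivation k fun l => if l = i then MvPolynomial.X l else 0
  have hd : ∀ l, d (MvPolynomial.X l) = if l = i then MvPolynomial.X l else 0 :=
    MvPolynomial.mkDerivation_X k _
  have hmk : ∀ a, Ideal.Quotient.mkₐ k (Ideal.span {(MvPolynomial.X 0 * MvPolynomial.X 1 :
      MvPolynomial (Fin 2) k)}) a = 0 → Ideal.Quotient.mkₐ k (Ideal.span {(MvPolynomial.X 0 *
      MvPolynomial.X 1 : MvPolynomial (Fin 2) k)}) (d a) = 0 := by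
    intro a ha
    have ha' := Ideal.Quotient.eq_zero_iff_mem.1 ha
    refine Ideal.Quotient.eq_zero_iff_mem.2 ?_
    obtain ⟨b, rfl⟩ := Ideal.mem_span_singleton.1 ha'
    rw [d.leibniz, d.leibniz, hd, hd, Ideal.mem_span_singleton]
    fin_cases i
    · exact ⟨d b + b, by simp; ring⟩
    · exact ⟨d b + b, by simp; ring⟩
  let D := d.liftOfSurjective (f := Ideal.Quotient.mkₐ k
    (Ideal.span {(MvPolynomial.X 0 * MvPolynomial.X 1 : MvPolynomial (Fin 2) k)}))
    Ideal.Quotient.mk_surjective hmk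
  refine ⟨D, IsDerAlong.of_derivation D, fun c => D.map_algebraMap c, fun l => ?_⟩
  have := Derivation.liftOfSurjective_apply (d := d) (f := Ideal.Quotient.mkₐ k
    (Ideal.span {(MvPolynomial.X 0 * MvPolynomial.X 1 : MvPolynomial (Fin 2) k)}))
    Ideal.Quotient.mk_surjective hmk (MvPolynomial.X l)
  refine this.trans ?_
  rw [hd]
  split_ifs <;> simp

end NodeRing

/-- Derivations into a flat algebra are combinations of derivations. -/
lemma exists_sum_of_isDerAlong {k A B : Type u} [Field k] [CommRing A] [CommRing B] [Algebra k A]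
    [Algebra.FiniteType k A] (f : A →+* B) (hf : f.Flat) {D : A → B} (hD : IsDerAlong f D)
    (hk : ∀ c : k, D (algebraMap k A c) = 0) :
    ∃ (n : ℕ) (b : Fin n → B) (d : Fin n → A → A), (∀ i, IsDerAlong (RingHom.id A) (d i)) ∧
      (∀ i (c : k), d i (algebraMap k A c) = 0) ∧ ∀ a, D a = ∑ i, b i * f (d i a) := by
  algebraize [f]
  let : Algebra k B := (f.comp (algebraMap k A)).toAlgebra
  have : IsScalarTower k A B := .of_algebraMap_eq' rfl
  have : IsNoetherianRing A := Algebra.FiniteType.isNoetherianRing k A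
  let δ : Derivation k A B := Derivation.mk'
    { toFun := D
      map_add' := hD.add
      map_smul' := fun c a => by
        rw [Algebra.smul_def, hD.leibniz, hk, mul_zero, add_zero, RingHom.id_apply,
          Algebra.smul_def]; rfl } fun a b => by
        change D (a * b) = _
        rw [hD.leibniz, Algebra.smul_def, Algebra.smul_def]; rfl
  let ℓ : B ⊗[A] Ω[A⁄k] →ₗ[B] B ⊗[A] A :=
    (TensorProduct.AlgebraTensorModule.rid A B B).symm.toLinearMap.comp
      (δ.liftKaehlerDifferential.liftBaseChange B)
  have : Module.FinitePresentation A (Ω[A⁄k]) := Module.finitePresentation_of_finite A _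
  -- `Ω[A⁄k]` is finitely presented and `B` is flat, so forming linear forms on it commutes with
  -- base change to `B`: each form on `B ⊗ Ω[A⁄k]` is a `B`-combination of forms on `Ω[A⁄k]`, that
  -- is, of derivations of `A`.
  have hbc := Module.FinitePresentation.isBaseChange_map A (Ω[A⁄k]) A B
  have key : ∀ ℓ : B ⊗[A] Ω[A⁄k] →ₗ[B] B ⊗[A] A, ∃ (n : ℕ) (b : Fin n → B)
      (φ : Fin n → Ω[A⁄k] →ₗ[A] A), ℓ = ∑ i, b i • (φ i).baseChange B := by
    intro ℓ
    induction ℓ using hbc.inductionOn with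
    | zero => exact ⟨0, Fin.elim0, Fin.elim0, by simp⟩
    | tmul φ => exact ⟨1, fun _ => 1, fun _ => φ, by simp⟩
    | smul b ℓ ih =>
      obtain ⟨n, c, φ, rfl⟩ := ih
      exact ⟨n, fun i => b * c i, φ, by simp only [Finset.smul_sum, mul_smul]⟩
    | add x y hx hy =>
      obtain ⟨n, c, φ, rfl⟩ := hx
      obtain ⟨m, d, ψ, rfl⟩ := hy
      refine ⟨n + m, Fin.append c d, Fin.append φ ψ, ?_⟩
      simp only [Fin.sum_univ_add, Fin.append_left, Fin.append_right]
  obtain ⟨n, b, φ, hφ⟩ := key ℓ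
  refine ⟨n, b, fun i a => φ i (KaehlerDifferential.D k A a), fun i => ⟨fun a c => by simp,
    fun a c => by simp⟩, fun i c => by simp, fun a => ?_⟩
  have h1 : ℓ (1 ⊗ₜ KaehlerDifferential.D k A a) = (TensorProduct.AlgebraTensorModule.rid A B B).symm
      (D a) := by
    change (TensorProduct.AlgebraTensorModule.rid A B B).symm
      ((δ.liftKaehlerDifferential.liftBaseChange B) _) = _
    rw [LinearMap.liftBaseChange_tmul, Derivation.liftKaehlerDifferential_comp_D, one_smul]; rfl
  rw [hφ, LinearEquiv.eq_symm_apply] at h1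
  rw [← h1]
  simp only [LinearMap.sum_apply, LinearMap.smul_apply, LinearMap.baseChange_tmul, map_sum, map_smul,
    smul_eq_mul, TensorProduct.AlgebraTensorModule.rid_tmul, Algebra.smul_def, mul_one]
  rfl

/-! ### Stalk maps of étale morphisms -/

section StalkMap

variable {X Y : Scheme.{u}}

lemma isEtaleLocal_stalkMap (f : X ⟶ Y) [Etale f] (x : X) : IsEtaleLocal (f.stalkMap x).hom := by
  have h1 : (f.stalkMap x).hom.FormallySmooth := by
    rw [← Scheme.Hom.mem_smoothLocus, f.smoothLocus_eq_top]; trivial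
  have h2 : (f.stalkMap x).hom.FormallyUnramified := FormallyUnramified.stalkMap f x
  refine ⟨Flat.stalkMap f x, ?_, f.toLRSHom.prop x, LocallyOfFiniteType.stalkMap f x⟩
  algebraize [(f.stalkMap x).hom]
  exact (Algebra.FormallyEtale.iff_formallyUnramified_and_formallySmooth).2 ⟨h2, h1⟩

/-- The global functions on a scheme over an affine scheme coming from the base. -/
noncomputable def specFun {R : Type u} [CommRing R] (f : X ⟶ Spec (.of R)) : R →+* Γ(X, ⊤) :=
  f.appTop.hom.comp (Scheme.ΓSpecIso (.of R)).inv.hom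

lemma specFun_comp {R : Type u} [CommRing R] (g : X ⟶ Y) (f : Y ⟶ Spec (.of R)) (r : R) :
    specFun (g ≫ f) r = g.appTop (specFun f r) := by
  simp only [specFun, Scheme.Hom.comp_appTop, CommRingCat.hom_comp, RingHom.comp_apply]

lemma specFun_comp_specMap {R S : Type u} [CommRing R] [CommRing S] (φ : R →+* S)
    (f : X ⟶ Spec (.of S)) (r : R) :
    specFun (f ≫ Spec.map (CommRingCat.ofHom φ)) r = specFun f (φ r) := by
  have h := ConcreteCategory.congr_hom (Scheme.ΓSpecIso_inv_naturality (CommRingCat.ofHom φ)) r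
  simp only [specFun, Scheme.Hom.comp_appTop, CommRingCat.hom_comp, RingHom.comp_apply]
  exact congrArg f.appTop h.symm

/-- The homomorphism from the ring to the local ring of a point of an affine scheme. -/
noncomputable def specGerm {R : Type u} [CommRing R] (x : Spec (.of R)) :
    R →+* (Spec (.of R)).presheaf.stalk x :=
  (((Spec (.of R)).presheaf.germ ⊤ x trivial).hom).comp (Scheme.ΓSpecIso (.of R)).inv.hom

/-- The prime ideal of a point of an affine scheme. -/
def specPrime {R : Type u} [CommRing R] (x : Spec (.of R)) : Ideal R := PrimeSpectrum.asIdeal x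

instance {R : Type u} [CommRing R] (x : Spec (.of R)) : (specPrime x).IsPrime := PrimeSpectrum.isPrime x

lemma specGerm_isLocalization {R : Type u} [CommRing R] (x : Spec (.of R)) :
    @IsLocalization.AtPrime _ _ ((Spec (.of R)).presheaf.stalk x) _ (specGerm x).toAlgebra
      (specPrime x) _ :=
  StructureSheaf.IsLocalization.to_stalk R x

lemma germ_specFun {R : Type u} [CommRing R] (f : X ⟶ Spec (.of R)) (x : X) (r : R) :
    X.presheaf.germ ⊤ x trivial (specFun f r) = f.stalkMap x (specGerm (f x) r) :=
  (Scheme.Hom.germ_stalkMap_apply f ⊤ x trivial ((Scheme.ΓSpecIso (.of R)).inv r)).symm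

lemma mem_basicOpen_specFun {R : Type u} [CommRing R] (f : X ⟶ Spec (.of R)) (x : X) (r : R) :
    x ∈ X.basicOpen (specFun f r) ↔ r ∉ specPrime (f x) := by
  have h : X.basicOpen (specFun f r) =
      f ⁻¹ᵁ ((Spec (.of R)).basicOpen ((Scheme.ΓSpecIso (.of R)).inv r)) :=
    (Scheme.preimage_basicOpen f _).symm
  rw [h, basicOpen_eq_of_affine]
  rfl

/-- The local rings of a scheme étale over a line are fields or discrete valuation rings. -/
lemma isCurveRing_of_etale_specPID {R : Type u} [CommRing R] [IsDomain R] [IsPrincipalIdealRing R]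
    (f : X ⟶ Spec (.of R)) [Etale f] (x : X) : IsCurveRing (X.presheaf.stalk x) := by
  let : Algebra R ((Spec (.of R)).presheaf.stalk (f x)) := (specGerm (f x)).toAlgebra
  have := specGerm_isLocalization (f x)
  exact (isEtaleLocal_stalkMap f x).isCurveRing
    (isCurveRing_of_isLocalization (specPrime (f x)) ((Spec (.of R)).presheaf.stalk (f x)))

instance locallyQuasiFinite_of_etale (f : X ⟶ Y) [Etale f] : LocallyQuasiFinite f := by
  have hle : ∀ {R S : Type u} [CommRing R] [CommRing S] {φ : R →+* S}, φ.Etale → φ.QuasiFinite := by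
    intro R S _ _ φ hφ
    algebraize [φ]
    exact (inferInstance : Algebra.QuasiFinite R S)
  refine ⟨fun {U} hU {V} hV e => hle (f.etale_appLE hU hV e)⟩

/-- Étale morphisms are locally quasi-finite, so their fibres are discrete. In a chart this isolates
the node. -/
lemma exists_opens_fiber_eq (f : X ⟶ Y) [Etale f] (x : X) :
    ∃ A : X.Opens, x ∈ A ∧ ∀ x' ∈ A, f x' = f x → x' = x := by
  obtain ⟨A, hA, h⟩ := isDiscrete_iff_forall_mem_exists_isOpen.1
    (f.isDiscrete_preimage_singleton (f x)) x rfl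
  refine ⟨⟨A, hA⟩, (h.ge (Set.mem_singleton x)).1, fun x' hx' e => h.le ⟨hx', e⟩⟩

end StalkMap

section Etale

variable {X : Scheme.{u}}

lemma exists_etale_fiberProduct (U V : X.Etale) (y : U.left) (z : V.left)
    (h : etHom U y = etHom V z) :
    ∃ (T : X.Etale) (a : T ⟶ U) (b : T ⟶ V) (t : T.left), a.left t = y ∧ b.left t = z := by
  obtain ⟨t, h1, h2⟩ := Scheme.Pullback.exists_preimage_pullback y z h
  refine ⟨Scheme.Etale.mk (pullback.fst (etHom U) (etHom V) ≫ etHom U),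
    MorphismProperty.Over.homMk (pullback.fst _ _) rfl trivial,
    MorphismProperty.Over.homMk (pullback.snd _ _) pullback.condition.symm trivial, t, h1, h2⟩

instance etale_left {T U : X.Etale} (h : T ⟶ U) : Etale h.left := by
  have : Etale (h.left ≫ etHom U) := by rw [et_w]; exact T.prop
  exact MorphismProperty.of_postcomp (W := @Etale) (W' := @Etale) h.left (etHom U) U.prop this

lemma germ_left {T U : X.Etale} (h : T ⟶ U) (t : T.left) (a : Γ(U.left, ⊤)) :
    T.left.presheaf.germ ⊤ t trivial (h.left.appTop a) =
      h.left.stalkMap t (U.left.presheaf.germ ⊤ (h.left t) trivial a) :=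
  (Scheme.Hom.germ_stalkMap_apply h.left ⊤ t trivial a).symm

end Etale

/-! ### Charts at nodes -/

section Chart

variable {k : Type u} [Field k] {X : Scheme.{u}} {p : X ⟶ Spec (.of k)}

namespace NodeChart

variable {U : X.Etale} {y : U.left} (c : NodeChart p U y)

lemma coord_eq (i : Fin 2) : c.coord i = specFun c.map (NodeRing.x k i) := rfl

lemma specFun_eq (a : k) : specFun (etHom U ≫ p) a = specFun c.map (algebraMap k (NodeRing k) a) := by
  rw [← c.comm, specFun_comp_specMap]

/-- Pull back of a chart. -/
noncomputable def comp {T : X.Etale} (h : T ⟶ U) (t : T.left) (ht : h.left t = y) : NodeChart p T t where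
  map := h.left ≫ c.map
  isEtale := by have := c.isEtale; infer_instance
  comm := by rw [Category.assoc, c.comm, ← Category.assoc, et_w]
  origin i := by
    rw [Scheme.Hom.comp_appTop, ConcreteCategory.comp_apply, ← Scheme.preimage_basicOpen_top]
    intro h'
    have h2 : h.left t ∈ U.left.basicOpen (c.coord i) := h'
    rw [ht] at h2
    exact c.origin i h2

lemma comp_coord {T : X.Etale} (h : T ⟶ U) (t : T.left) (ht : h.left t = y) (i : Fin 2) :
    (c.comp h t ht).coord i = h.left.appTop (c.coord i) := by
  change (h.left ≫ c.map).appTop _ = _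
  rw [Scheme.Hom.comp_appTop, ConcreteCategory.comp_apply]; rfl

/-- A chart at a point is a chart at every other point where the coordinates vanish. -/
noncomputable def move (y' : U.left) (h : ∀ i, y' ∉ U.left.basicOpen (c.coord i)) : NodeChart p U y' where
  map := c.map
  isEtale := c.isEtale
  comm := c.comm
  origin := h

lemma x_mem (i : Fin 2) : NodeRing.x k i ∈ (specPrime (c.map y)) := by
  by_contra h
  exact c.origin i ((mem_basicOpen_specFun c.map y _).2 h)

lemma isNodeRing : IsNodeRing (U.left.presheaf.germ ⊤ y trivial (c.coord 0))
    (U.left.presheaf.germ ⊤ y trivial (c.coord 1)) := by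
  have := c.isEtale
  let : Algebra (NodeRing k) ((Spec (.of (NodeRing k))).presheaf.stalk (c.map y)) :=
    (specGerm (c.map y)).toAlgebra
  have := specGerm_isLocalization (c.map y)
  have h := (isEtaleLocal_stalkMap c.map y).isNodeRing
    (NodeRing.isNodeRing k (specPrime (c.map y)) ((Spec (.of (NodeRing k))).presheaf.stalk (c.map y))
      c.x_mem)
  rw [coord_eq, coord_eq, germ_specFun, germ_specFun]
  exact h

lemma isCurveRing {y' : U.left} {i : Fin 2} (h : y' ∈ U.left.basicOpen (c.coord i)) :
    IsCurveRing (U.left.presheaf.stalk y') := by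
  have := c.isEtale
  let : Algebra (NodeRing k) ((Spec (.of (NodeRing k))).presheaf.stalk (c.map y')) :=
    (specGerm (c.map y')).toAlgebra
  have := specGerm_isLocalization (c.map y')
  exact (isEtaleLocal_stalkMap c.map y').isCurveRing
    (NodeRing.isCurveRing k (specPrime (c.map y')) ((Spec (.of (NodeRing k))).presheaf.stalk (c.map y'))
      ((mem_basicOpen_specFun c.map y' _).1 h))

/-- The local ring of the node is formally étale over the ring of the chart. -/
lemma formallyEtale : ((U.left.presheaf.germ ⊤ y trivial).hom.comp (specFun c.map)).FormallyEtale := by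
  have := c.isEtale
  let : Algebra (NodeRing k) ((Spec (.of (NodeRing k))).presheaf.stalk (c.map y)) :=
    (specGerm (c.map y)).toAlgebra
  have := specGerm_isLocalization (c.map y)
  have h1 : (specGerm (c.map y)).FormallyEtale :=
    Algebra.FormallyEtale.of_isLocalization (specPrime (c.map y)).primeCompl
  have h2 := (isEtaleLocal_stalkMap c.map y).formallyEtale
  have h3 : (U.left.presheaf.germ ⊤ y trivial).hom.comp (specFun c.map) =
      (c.map.stalkMap y).hom.comp (specGerm (c.map y)) :=
    RingHom.ext fun r => germ_specFun c.map y r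
  rw [h3]
  exact RingHom.FormallyEtale.comp h1 h2

end NodeChart

lemma IsNode.exists_chart {q : X} (hq : IsNode p q) (U : X.Etale) (y : U.left) (hy : etHom U y = q) :
    ∃ (T : X.Etale) (a : T ⟶ U) (t : T.left), a.left t = y ∧ Nonempty (NodeChart p T t) := by
  obtain ⟨V, z, hz, ⟨c⟩⟩ := hq
  obtain ⟨T, a, b, t, h1, h2⟩ := exists_etale_fiberProduct U V y z (hy.trans hz.symm)
  exact ⟨T, a, t, h1, ⟨c.comp b t h2⟩⟩

/-- Both kinds of local ring pass to étale extensions, so on a common neighbourhood the relation `u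
v = 0` with `u, v ≠ 0` would hold in a domain. -/
lemma IsNode.not_isCurveRing {q : X} (hq : IsNode p q) (U : X.Etale) (y : U.left)
    (hy : etHom U y = q) : ¬ IsCurveRing (U.left.presheaf.stalk y) := by
  intro h
  obtain ⟨T, a, t, rfl, ⟨c⟩⟩ := hq.exists_chart U y hy
  exact c.isNodeRing.not_isCurveRing ((isEtaleLocal_stalkMap a.left t).isCurveRing h)

lemma NodeChart.isNode {U : X.Etale} {y : U.left} (c : NodeChart p U y) : IsNode p (etHom U y) :=
  ⟨U, y, rfl, ⟨c⟩⟩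

/-- The origin is isolated among the points of a chart where both coordinates vanish. -/
lemma NodeChart.exists_opens {U : X.Etale} {y : U.left} (c : NodeChart p U y) :
    ∃ A : U.left.Opens, y ∈ A ∧ ∀ y' ∈ A, y' ≠ y → ∃ i, y' ∈ U.left.basicOpen (c.coord i) := by
  have := c.isEtale
  obtain ⟨A, hA, h⟩ := exists_opens_fiber_eq c.map y
  refine ⟨A, hA, fun y' hy' hne => ?_⟩
  by_contra! h'
  refine hne (h y' hy' ?_)
  -- A point where both coordinates vanish maps to the origin, so all such points lie in one fibre
  -- of the chart, which is discrete.
  have key : ∀ (z : U.left) (c : NodeChart p U z),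
      (specPrime (c.map z)) = Ideal.span {NodeRing.x k 0, NodeRing.x k 1} := fun z c =>
    NodeRing.eq_span k _ c.x_mem
  exact PrimeSpectrum.ext ((key y' (c.move y' h')).trans (key y c).symm)

/-- Near the origin of a chart every other point has an invertible coordinate, so its local ring is
that of a smooth curve. The image of this neighbourhood in `X` is open. -/
lemma IsNode.exists_opens {q : X} (hq : IsNode p q) :
    ∃ W : X.Opens, q ∈ W ∧ ∀ w ∈ W, IsNode p w → w = q := by
  obtain ⟨U, y, rfl, ⟨c⟩⟩ := hq
  obtain ⟨A, hA, h⟩ := c.exists_opens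
  refine ⟨⟨etHom U '' A, (etHom U).isOpenMap _ A.isOpen⟩, ⟨y, hA, rfl⟩, ?_⟩
  rintro _ ⟨y', hy', rfl⟩ hn
  by_cases e : y' = y
  · rw [e]
  · obtain ⟨i, hi⟩ := h y' hy' e
    exact absurd (c.isCurveRing hi) (hn.not_isCurveRing U y' rfl)

end Chart

/-! ### Smooth points; nodes are closed -/

section Smooth

variable {k : Type u} [Field k] {X : Scheme.{u}} {p : X ⟶ Spec (.of k)}

lemma IsCurveRing.of_etaleLocal_bijective {A B : Type*} [CommRing A] [CommRing B] (hA : IsCurveRing A)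
    (e : A ≃+* B) : IsCurveRing B where
  isLocalRing := by have := hA.isLocalRing; exact e.isLocalRing
  isNoetherianRing := by have := hA.isNoetherianRing; exact isNoetherianRing_of_ringEquiv A e
  isDomain := by have := hA.isDomain; exact e.symm.toMulEquiv.isDomain A
  principal := by
    obtain ⟨t, ht⟩ := hA.principal
    refine ⟨e t, fun r => ?_⟩
    obtain ⟨r, rfl⟩ := e.surjective r
    rw [isUnit_map_iff, ht, map_dvd_iff]

/-- A smooth curve is locally étale over an affine line over an open subset of `Spec k`. This subset
is the whole point, so the base ring is a field and the line has a principal ideal domain as its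
coordinate ring. -/
lemma exists_etale_line {Y : Scheme.{u}} (f : Y ⟶ Spec (.of k)) [SmoothOfRelativeDimension 1 f]
    (y : Y) : ∃ (V : Scheme.{u}) (j : V ⟶ Y) (v : V) (R : Type u) (_ : CommRing R) (_ : IsDomain R)
      (_ : IsPrincipalIdealRing R) (g : V ⟶ Spec (.of R)), IsOpenImmersion j ∧ j v = y ∧ Etale g := by
  obtain ⟨U, hU, V, hV, hyV, e, h⟩ :=
    SmoothOfRelativeDimension.exists_isStandardSmoothOfRelativeDimension (n := 1) (f := f) y
  obtain ⟨g, hg1, hg2⟩ := h.exists_etale_mvPolynomial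
  have hUt : U = ⊤ := by
    refine top_le_iff.1 fun z _ => ?_
    have : Subsingleton (Spec (CommRingCat.of k)) :=
      inferInstanceAs (Subsingleton (PrimeSpectrum k))
    exact Subsingleton.elim (f y) z ▸ e hyV
  let : Algebra Γ(Spec (CommRingCat.of k), U) Γ(Spec (CommRingCat.of k), U) := Algebra.id _
  have hfield : IsField Γ(Spec (CommRingCat.of k), U) := by
    subst hUt
    exact MulEquiv.isField (Field.toIsField k) (Scheme.ΓSpecIso (.of k)).commRingCatIsoToRingEquiv.toMulEquiv
  let : Field Γ(Spec (CommRingCat.of k), U) := hfield.toField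
  have : IsPrincipalIdealRing (MvPolynomial (Fin 1) Γ(Spec (CommRingCat.of k), U)) :=
    IsPrincipalIdealRing.of_surjective (MvPolynomial.uniqueAlgEquiv _ (Fin 1)).symm.toRingHom
      (MvPolynomial.uniqueAlgEquiv _ (Fin 1)).symm.surjective
  have : IsDomain (MvPolynomial (Fin 1) Γ(Spec (CommRingCat.of k), U)) := inferInstance
  have hE : Etale (Spec.map (CommRingCat.ofHom g)) :=
    (HasRingHomProperty.Spec_iff (P := @Etale)).2 hg2
  refine ⟨V.toScheme, V.ι, ⟨y, hyV⟩, _, _, this, ‹_›,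
    hV.isoSpec.hom ≫ Spec.map (CommRingCat.ofHom g), inferInstance, rfl, inferInstance⟩

lemma IsSmoothPoint.isCurveRing {x : X} (h : IsSmoothPoint p x) :
    IsCurveRing (X.presheaf.stalk x) := by
  obtain ⟨W, hx, hW⟩ := h
  obtain ⟨V, j, v, R, _, _, _, g, hj, hv, hg⟩ := exists_etale_line (W.ι ≫ p) ⟨x, hx⟩
  have h1 := isCurveRing_of_etale_specPID g v
  have h2 : (j ≫ W.ι) v = x := by rw [Scheme.Hom.comp_apply, hv]; rfl
  subst h2
  exact h1.of_etaleLocal_bijective (asIso ((j ≫ W.ι).stalkMap v)).commRingCatIsoToRingEquiv.symm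

lemma IsSmoothPoint.not_isNode {x : X} (h : IsSmoothPoint p x) : ¬ IsNode p x := fun hn =>
  hn.not_isCurveRing (etTop X) x rfl h.isCurveRing

end Smooth

section Curve

variable {k : Type u} [Field k] {X : Scheme.{u}} {p : X ⟶ Spec (.of k)}
  (hX : ∀ x : X, IsSmoothPoint p x ∨ IsNode p x)

include hX in
-- Every neighbourhood of a specialization `z` of `q` contains `q`. Smooth neighbourhoods contain no
-- node, and a node `z` has a neighbourhood without other nodes; so `z = q`.
lemma isClosed_of_isNode {q : X} (hq : IsNode p q) : IsClosed {q} := by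
  rw [← closure_eq_iff_isClosed]
  refine Set.Subset.antisymm (fun z hz => ?_) subset_closure
  have hqz : q ⤳ z := specializes_iff_mem_closure.2 hz
  by_contra hne
  have hne' : z ≠ q := hne
  rcases hX z with h | h
  · obtain ⟨W, hz, hW⟩ := h
    have hqW : q ∈ W := hqz.mem_open W.isOpen hz
    exact (show IsSmoothPoint p q from ⟨W, hqW, hW⟩).not_isNode hq
  · obtain ⟨W, hzW, hW⟩ := h.exists_opens
    exact hne' (hW q (hqz.mem_open W.isOpen hzW) hq).symm

lemma IsSmoothPoint.of_etale {U : X.Etale} {y : U.left} (h : IsSmoothPoint p (etHom U y)) :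
    IsCurveRing (U.left.presheaf.stalk y) :=
  (isEtaleLocal_stalkMap (etHom U) y).isCurveRing h.isCurveRing

/-- Here and at a node, finite type over `k` comes from the neighbourhood in the definition, so the
Noetherian property is recorded étale locally. -/
lemma IsSmoothPoint.exists_isLocallyNoetherian {x : X} (h : IsSmoothPoint p x) :
    ∃ (U : X.Etale) (y : U.left), etHom U y = x ∧ IsLocallyNoetherian U.left := by
  obtain ⟨W, hx, hW⟩ := h
  have hs : Smooth (W.ι ≫ p) := SmoothOfRelativeDimension.smooth 1 (W.ι ≫ p)
  have hn : IsLocallyNoetherian W.toScheme := LocallyOfFiniteType.isLocallyNoetherian (W.ι ≫ p)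
  exact ⟨Scheme.Etale.mk W.ι, ⟨x, hx⟩, rfl, hn⟩

lemma NodeChart.locallyOfFiniteType {U : X.Etale} {y : U.left} (c : NodeChart p U y) :
    LocallyOfFiniteType (etHom U ≫ p) := by
  have := c.isEtale
  have : LocallyOfFiniteType (Spec.map (CommRingCat.ofHom (algebraMap k (NodeRing k)))) := by
    rw [HasRingHomProperty.Spec_iff (P := @LocallyOfFiniteType)]
    exact (RingHom.finiteType_algebraMap).2 (inferInstance : Algebra.FiniteType k (NodeRing k))
  rw [← c.comm]
  infer_instance

lemma IsNode.exists_isLocallyNoetherian {x : X} (h : IsNode p x) :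
    ∃ (U : X.Etale) (y : U.left), etHom U y = x ∧ IsLocallyNoetherian U.left := by
  obtain ⟨U, y, rfl, ⟨c⟩⟩ := h
  have := c.locallyOfFiniteType
  exact ⟨U, y, rfl, LocallyOfFiniteType.isLocallyNoetherian (etHom U ≫ p)⟩

end Curve

/-! ### Spreading out non-zero-divisors -/

section Spread

/-- The annihilator of `a` over an affine neighbourhood is finitely generated and vanishes in the
stalk at `x`, so one function `G` invertible at `x` kills it. Where `G` is invertible, `a` stays a
non-zero-divisor. -/
lemma exists_opens_germ_mem_nonZeroDivisors {X : Scheme.{u}} [IsLocallyNoetherian X] {V : X.Opens}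
    (x : X) (hx : x ∈ V) (a : Γ(X, V)) (ha : X.presheaf.germ V x hx a ∈ (X.presheaf.stalk x)⁰) :
    ∃ W ≤ V, x ∈ W ∧ ∀ x' (h : x' ∈ V), x' ∈ W → X.presheaf.germ V x' h a ∈ (X.presheaf.stalk x')⁰ := by
  obtain ⟨_, ⟨A, hA, rfl⟩, hxA, hAV⟩ :=
    X.isBasis_affineOpens.exists_subset_of_mem_open hx V.isOpen
  have hAV' : A ≤ V := hAV
  classical
  let R := Γ(X, A)
  let b : R := rs hAV' a
  have hN : IsNoetherianRing R := IsLocallyNoetherian.component_noetherian ⟨A, hA⟩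
  let I : Ideal R := LinearMap.ker (LinearMap.mulLeft R b)
  obtain ⟨S, hS⟩ := (isNoetherianRing_iff_ideal_fg R).1 hN I
  have h0 : ∀ s ∈ S, X.presheaf.germ A x hxA s = 0 := fun s hs => by
    have hs' : b * s = 0 := by
      have : s ∈ I := hS ▸ Ideal.subset_span hs
      exact this
    refine (mem_nonZeroDivisors_iff_right.1 ha) _ ?_
    have h1 := germ_rs hAV' x hxA a
    rw [← h1, ← map_mul, mul_comm, hs', map_zero]
  have h1 : ∀ s ∈ S, ∃ g : R, g ∉ (hA.primeIdealOf ⟨x, hxA⟩).asIdeal ∧ g * s = 0 := fun s hs => by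
    have := hA.isLocalization_stalk ⟨x, hxA⟩
    let : Algebra R (X.presheaf.stalk x) := X.presheaf.algebra_section_stalk ⟨x, hxA⟩
    obtain ⟨g, hg⟩ := (IsLocalization.map_eq_zero_iff (hA.primeIdealOf ⟨x, hxA⟩).asIdeal.primeCompl
      (X.presheaf.stalk x) s).1 (h0 s hs)
    exact ⟨g, g.2, hg⟩
  choose! g hg1 hg2 using h1
  let G : R := ∏ s ∈ S, g s
  have hG : x ∈ X.basicOpen G := by
    rw [Scheme.mem_basicOpen _ _ _ hxA]
    simp only [G, map_prod]
    refine IsUnit.prod_iff.2 fun s hs => ?_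
    have := hA.isLocalization_stalk ⟨x, hxA⟩
    let : Algebra R (X.presheaf.stalk x) := X.presheaf.algebra_section_stalk ⟨x, hxA⟩
    exact IsLocalization.map_units (X.presheaf.stalk x)
      (⟨g s, hg1 s hs⟩ : (hA.primeIdealOf ⟨x, hxA⟩).asIdeal.primeCompl)
  have hGI : ∀ r ∈ I, G * r = 0 := fun r hr => by
    rw [← hS] at hr
    induction hr using Submodule.span_induction with
    | mem s hs =>
      change (∏ s ∈ S, g s) * s = 0
      rw [← Finset.mul_prod_erase S g hs, mul_comm (g s), mul_assoc, hg2 s hs, mul_zero]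
    | zero => rw [mul_zero]
    | add r s _ _ h1 h2 => rw [mul_add, h1, h2, add_zero]
    | smul c r _ h => rw [smul_eq_mul, mul_left_comm, h, mul_zero]
  refine ⟨X.basicOpen G, (X.basicOpen_le G).trans hAV', hG, fun x' hV hx' => ?_⟩
  have hx'A : x' ∈ A := X.basicOpen_le G hx'
  have := hA.isLocalization_stalk ⟨x', hx'A⟩
  let : Algebra R (X.presheaf.stalk x') := X.presheaf.algebra_section_stalk ⟨x', hx'A⟩
  have hu : IsUnit (algebraMap R (X.presheaf.stalk x') G) :=
    (Scheme.mem_basicOpen X G x' hx'A).1 hx'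
  rw [← germ_rs hAV' x' hx'A a, mem_nonZeroDivisors_iff_right]
  intro z hz
  obtain ⟨⟨r, s⟩, hrs⟩ := IsLocalization.surj (hA.primeIdealOf ⟨x', hx'A⟩).asIdeal.primeCompl z
  have h2 : algebraMap R (X.presheaf.stalk x') (b * r) = 0 := by
    rw [map_mul, ← hrs, mul_left_comm, ← mul_assoc, mul_comm (z * _)]
    have : algebraMap R (X.presheaf.stalk x') b * z = 0 := (mul_comm _ _).trans hz
    linear_combination (algebraMap R (X.presheaf.stalk x') s) * this
  obtain ⟨m, hm⟩ := (IsLocalization.map_eq_zero_iff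
    (hA.primeIdealOf ⟨x', hx'A⟩).asIdeal.primeCompl (X.presheaf.stalk x') _).1 h2
  have h3 := hGI (m * r) (by change b * (m * r) = 0; rw [← hm]; ring)
  have h4 : algebraMap R (X.presheaf.stalk x') r = 0 := by
    have hm' := IsLocalization.map_units (X.presheaf.stalk x') m
    refine (hu.mul hm').mul_left_cancel ?_
    rw [mul_zero, ← map_mul, ← map_mul, mul_assoc, h3, map_zero]
  refine (IsLocalization.map_units (X.presheaf.stalk x') s).mul_right_cancel ?_
  rw [hrs, h4, zero_mul]

/-- Non-zero-divisors ascend and descend along the stalk maps of an étale morphism, and such a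
morphism is open. -/
lemma exists_opens_germ_mem_nonZeroDivisors_of_etale {X : Scheme.{u}} (x : X)
    (hx : ∃ (U : X.Etale) (y : U.left), etHom U y = x ∧ IsLocallyNoetherian U.left) {V : X.Opens}
    (hxV : x ∈ V) (a : Γ(X, V)) (ha : X.presheaf.germ V x hxV a ∈ (X.presheaf.stalk x)⁰) :
    ∃ W ≤ V, x ∈ W ∧ ∀ x' (h : x' ∈ V), x' ∈ W → X.presheaf.germ V x' h a ∈ (X.presheaf.stalk x')⁰ := by
  obtain ⟨U, y, rfl, hU⟩ := hx
  have key : ∀ (y' : U.left) (h : etHom U y' ∈ V), U.left.presheaf.germ (etHom U ⁻¹ᵁ V) y' h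
      ((etHom U).app V a) = (etHom U).stalkMap y' (X.presheaf.germ V (etHom U y') h a) :=
    fun y' h => (Scheme.Hom.germ_stalkMap_apply (etHom U) V y' h a).symm
  obtain ⟨W, hW, hyW, h⟩ := exists_opens_germ_mem_nonZeroDivisors y (V := etHom U ⁻¹ᵁ V) hxV
    ((etHom U).app V a) (by
      rw [key]
      exact (isEtaleLocal_stalkMap (etHom U) y).flat.map_mem_nonZeroDivisors ha)
  refine ⟨⟨etHom U '' W, (etHom U).isOpenMap _ W.isOpen⟩, ?_, ⟨y, hyW, rfl⟩, ?_⟩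
  · rintro _ ⟨y', hy', rfl⟩
    exact hW hy'
  · rintro _ hV ⟨y', hy', rfl⟩
    have h1 := h y' hV hy'
    rw [key] at h1
    have h2 := isEtaleLocal_stalkMap (etHom U) y'
    exact mem_nonZeroDivisors_of_map_mem h2.flat h2.isLocalHom h1

end Spread

/-! ### Residue fields at nodes; branches and irreducible components -/

section Residue

variable {k : Type u} [Field k]

lemma NodeRing.exists_sub_mem (P : Ideal (NodeRing k)) [P.IsPrime] (h : ∀ i, x k i ∈ P)
    (r : NodeRing k) : ∃ a : k, r - algebraMap k _ a ∈ P := by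
  obtain ⟨r, rfl⟩ := Ideal.Quotient.mk_surjective r
  induction r using MvPolynomial.induction_on with
  | C a => exact ⟨a, by convert P.zero_mem; exact sub_self _⟩
  | add f g hf hg =>
    obtain ⟨a, ha⟩ := hf
    obtain ⟨b, hb⟩ := hg
    refine ⟨a + b, ?_⟩
    convert P.add_mem ha hb using 1
    rw [map_add, map_add]; ring
  | mul_X f i _ => exact ⟨0, by rw [map_zero, sub_zero, map_mul]; exact P.mul_mem_left _ (h i)⟩

lemma NodeRing.exists_sub_not_isUnit (P : Ideal (NodeRing k)) [P.IsPrime] (h : ∀ i, x k i ∈ P)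
    (L : Type u) [CommRing L] [IsLocalRing L] [Algebra (NodeRing k) L] [IsLocalization.AtPrime L P]
    (r : L) : ∃ a : k, ¬ IsUnit (r - algebraMap (NodeRing k) L (algebraMap k _ a)) := by
  obtain ⟨⟨n, s⟩, hs⟩ := IsLocalization.surj P.primeCompl r
  obtain ⟨a, ha⟩ := exists_sub_mem P h n
  obtain ⟨b, hb⟩ := exists_sub_mem P h s
  have hb0 : b ≠ 0 := by
    rintro rfl
    rw [map_zero, sub_zero] at hb
    exact s.2 hb
  refine ⟨a / b, fun hu => ?_⟩
  have h1 : n - algebraMap k _ (a / b) * s ∈ P := by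
    have : n - algebraMap k _ (a / b) * s = (n - algebraMap k _ a) -
        algebraMap k _ (a / b) * (s - algebraMap k _ b) := by
      rw [mul_sub, ← map_mul, div_mul_cancel₀ _ hb0]; ring
    rw [this]
    exact P.sub_mem ha (P.mul_mem_left _ hb)
  have h2 := hu.mul (IsLocalization.map_units L s)
  rw [sub_mul, hs, ← map_mul, ← map_sub, IsLocalization.AtPrime.isUnit_to_map_iff L P] at h2
  exact h2 h1

/-- The origin of the crossing lines has residue field `k`; the residue field of an étale extension
is algebraic over it, hence again `k`. -/
lemma NodeChart.exists_sub_not_isUnit [IsAlgClosed k] {X : Scheme.{u}} {p : X ⟶ Spec (.of k)} {U : X.Etale}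
    {y : U.left} (c : NodeChart p U y) (r : U.left.presheaf.stalk y) :
    ∃ a : k, ¬ IsUnit (r - U.left.presheaf.germ ⊤ y trivial (specFun (etHom U ≫ p) a)) := by
  have := c.isEtale
  let L := (Spec (.of (NodeRing k))).presheaf.stalk (c.map y)
  let : Algebra (NodeRing k) L := (specGerm (c.map y)).toAlgebra
  have := specGerm_isLocalization (c.map y)
  have hE := isEtaleLocal_stalkMap c.map y
  let φ : L →+* U.left.presheaf.stalk y := (c.map.stalkMap y).hom
  algebraize [φ]
  have : IsLocalHom (algebraMap L (U.left.presheaf.stalk y)) := hE.isLocalHom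
  have : Algebra.EssFiniteType L (U.left.presheaf.stalk y) := hE.essFiniteType
  have : Algebra.FormallyUnramified L (U.left.presheaf.stalk y) := hE.formallyUnramified
  let ψ : k →+* ResidueField L := (residue L).comp ((algebraMap (NodeRing k) L).comp (algebraMap k _))
  have hψ : Function.Surjective ψ := by
    intro z
    obtain ⟨l, rfl⟩ := residue_surjective z
    obtain ⟨a, ha⟩ := NodeRing.exists_sub_not_isUnit (specPrime (c.map y)) c.x_mem L l
    refine ⟨a, ?_⟩
    rw [← sub_eq_zero, ← neg_eq_zero, neg_sub]
    change residue L l - residue L _ = 0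
    rw [← map_sub, residue_eq_zero_iff]
    exact ha
  have : IsAlgClosed (ResidueField L) :=
    IsAlgClosed.of_ringEquiv k _ (RingEquiv.ofBijective ψ ⟨ψ.injective, hψ⟩)
  have : Algebra.IsSeparable (ResidueField L) (ResidueField (U.left.presheaf.stalk y)) := inferInstance
  obtain ⟨z, hz⟩ := (IsAlgClosed.algebraMap_bijective_of_isIntegral (k := ResidueField L)
    (K := ResidueField (U.left.presheaf.stalk y))).2 (residue _ r)
  obtain ⟨a, rfl⟩ := hψ z
  refine ⟨a, ?_⟩
  change _ ∈ maximalIdeal _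
  rw [← residue_eq_zero_iff, map_sub, sub_eq_zero, ← hz, c.specFun_eq, germ_specFun]
  rfl

end Residue

section Component

/-- Generalizations lift along the flat morphism `etHom U`, so a generic point above the image of
`y1` comes from a prime of the local ring at `y` contained in `P`; by minimality this prime is `P`.
-/
lemma closure_mem_irreducibleComponents {X : Scheme.{u}} (U : X.Etale) (y : U.left)
    (P : PrimeSpectrum (U.left.presheaf.stalk y)) (hP : P.asIdeal ∈ minimalPrimes _) :
    closure {etHom U (U.left.fromSpecStalk y P)} ∈ irreducibleComponents X := by
  set y1 := U.left.fromSpecStalk y P with hy1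
  refine ⟨isIrreducible_singleton.closure, fun Z hZ hle => ?_⟩
  obtain ⟨η, hη⟩ := QuasiSober.sober hZ.closure isClosed_closure
  have h1 : η ⤳ etHom U y1 := by
    rw [specializes_iff_mem_closure, hη.def]
    exact subset_closure (hle (subset_closure rfl))
  obtain ⟨y', hy', rfl⟩ := Flat.generalizingMap (etHom U) h1
  have h2 : y' ⤳ y := hy'.trans (by
    have : y1 ∈ Set.range (U.left.fromSpecStalk y) := ⟨P, rfl⟩
    rw [Scheme.range_fromSpecStalk] at this
    exact this)
  have h3 : y' ∈ Set.range (U.left.fromSpecStalk y) := by rw [Scheme.range_fromSpecStalk]; exact h2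
  obtain ⟨P', rfl⟩ := h3
  have h4 : P' ⤳ P := (U.left.fromSpecStalk y).isEmbedding.isInducing.specializes_iff.1 hy'
  have h5 : P'.asIdeal ≤ P.asIdeal := (PrimeSpectrum.le_iff_specializes P' P).2 h4
  have h6 : P' = P := PrimeSpectrum.ext (le_antisymm h5 (hP.2 ⟨P'.2, bot_le⟩ h5))
  rw [hy1, ← h6, hη.def]
  exact subset_closure

/-- The hypothesis says that `P` contracts to the maximal ideal, that is, to the closed point of the
spectrum of the local ring at `g y`. -/
lemma apply_fromSpecStalk_eq {T Q : Scheme.{u}} (g : T ⟶ Q) (y : T)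
    (P : PrimeSpectrum (T.presheaf.stalk y)) (h : ∀ b, ¬ IsUnit b → g.stalkMap y b ∈ P.asIdeal) :
    g (T.fromSpecStalk y P) = g y := by
  have h1 : (T.fromSpecStalk y ≫ g) P = (Spec.map (g.stalkMap y) ≫ Q.fromSpecStalk (g y)) P := by
    rw [Scheme.SpecMap_stalkMap_fromSpecStalk]
  refine h1.trans ?_
  have : Spec.map (g.stalkMap y) P = closedPoint (Q.presheaf.stalk (g y)) := by
    refine PrimeSpectrum.ext ?_
    have h1 : maximalIdeal (Q.presheaf.stalk (g y)) ≤
        (Spec.map (g.stalkMap y) P).asIdeal := fun b hb => h b hb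
    exact ((maximalIdeal.isMaximal _).eq_of_le (PrimeSpectrum.isPrime _).ne_top h1).symm
  change Q.fromSpecStalk (g y) (Spec.map (g.stalkMap y) P) = _
  rw [this]
  exact Scheme.fromSpecStalk_closedPoint

/-- If no irreducible component is contracted to `q`, then the functions which vanish at `q` do not
all vanish along a branch at a point over `q`. -/
lemma exists_stalkMap_notMem {C Q : Scheme.{u}} (f : C ⟶ Q) (U : C.Etale) (y : U.left)
    (hq : IsClosed {(etHom U ≫ f) y})
    (hf : ∀ Z ∈ irreducibleComponents C, ¬ Z ⊆ f ⁻¹' {(etHom U ≫ f) y})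
    (P : Ideal (U.left.presheaf.stalk y)) (hP : P ∈ minimalPrimes (U.left.presheaf.stalk y)) :
    ∃ b : Q.presheaf.stalk ((etHom U ≫ f) y), ¬ IsUnit b ∧ (etHom U ≫ f).stalkMap y b ∉ P := by
  by_contra! h
  have hprime : P.IsPrime := hP.1.1
  let P' : PrimeSpectrum (U.left.presheaf.stalk y) := ⟨P, hprime⟩
  -- If all functions vanishing at `q` vanish on the branch, its generic point lies over `q`; as `q`
  -- is closed, so does the whole component.
  refine hf _ (closure_mem_irreducibleComponents U y P' hP) ?_
  refine closure_minimal ?_ (hq.preimage f.continuous)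
  rw [Set.singleton_subset_iff]
  exact apply_fromSpecStalk_eq (etHom U ≫ f) y P' h

end Component

/-! ### Extension of derivations along étale morphisms of schemes -/

section EtaleDerivation

variable {X T T' : Scheme.{u}} {W : X.Opens}

lemma germ_appLE (g : T ⟶ X) {B : T.Opens} (h : B ≤ g ⁻¹ᵁ W) (t : T) (ht : t ∈ B) (a : Γ(X, W)) :
    T.presheaf.germ B t ht (g.appLE W B h a) = g.stalkMap t (X.presheaf.germ W (g t) (h ht) a) := by
  refine Eq.trans ?_ (Scheme.Hom.germ_stalkMap_apply g W t (h ht) a).symm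
  rw [Scheme.Hom.appLE, ConcreteCategory.comp_apply]
  exact TopCat.Presheaf.germ_res_apply T.presheaf (homOfLE h) t ht _

lemma stalkMap_comp_apply (h : T' ⟶ T) (g : T ⟶ X) (t : T') (r : X.presheaf.stalk ((h ≫ g) t)) :
    (h ≫ g).stalkMap t r = h.stalkMap t (g.stalkMap (h t) r) := by
  rw [Scheme.Hom.stalkMap_comp]; rfl

lemma formallyEtale_germ (hW : IsAffineOpen W) (x : X) (hx : x ∈ W) :
    (X.presheaf.germ W x hx).hom.FormallyEtale := by
  have := hW.isLocalization_stalk ⟨x, hx⟩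
  let : Algebra Γ(X, W) (X.presheaf.stalk x) := X.presheaf.algebra_section_stalk ⟨x, hx⟩
  exact Algebra.FormallyEtale.of_isLocalization (hW.primeIdealOf ⟨x, hx⟩).asIdeal.primeCompl

lemma formallyEtale_stalkMap_germ (hW : IsAffineOpen W) (g : T ⟶ X) [Etale g] (t : T) (ht : g t ∈ W) :
    ((g.stalkMap t).hom.comp (X.presheaf.germ W (g t) ht).hom).FormallyEtale :=
  RingHom.FormallyEtale.comp (formallyEtale_germ hW _ ht) (isEtaleLocal_stalkMap g t).formallyEtale

lemma _root_.RingHom.FormallyEtale.formallyUnramified' {A B : Type*} [CommRing A] [CommRing B]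
    {f : A →+* B} (h : f.FormallyEtale) : f.FormallyUnramified := by
  algebraize [f]
  have : Algebra.FormallyEtale A B := h
  exact (inferInstance : Algebra.FormallyUnramified A B)

lemma _root_.RingHom.Etale.formallyEtale' {A B : Type*} [CommRing A] [CommRing B]
    {f : A →+* B} (h : f.Etale) : f.FormallyEtale := by
  algebraize [f]
  exact (inferInstance : Algebra.FormallyEtale A B)

/-- The family `D` of derivations of the functions on the open subsets of a scheme over `W` extends the
derivation `d` of the functions on `W`. -/
structure IsEtaleExtension (d : Γ(X, W) → Γ(X, W)) (g : T ⟶ X)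
    (D : ∀ B : {B : T.Opens // B ≤ g ⁻¹ᵁ W}, Γ(T, B.1) → Γ(T, B.1)) : Prop where
  res : ∀ (B B' : {B : T.Opens // B ≤ g ⁻¹ᵁ W}) (h : B'.1 ≤ B.1) a, rs h (D B a) = D B' (rs h a)
  der : ∀ B, IsDerAlong (RingHom.id _) (D B)
  apply : ∀ B a, D B (g.appLE W B.1 B.2 a) = g.appLE W B.1 B.2 (d a)

/-- The derivation `E` of the local ring extends the derivation `d` of the functions on `W`. -/
structure IsGermExtension (d : Γ(X, W) → Γ(X, W)) (g : T ⟶ X) (t : T) (ht : g t ∈ W)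
    (E : T.presheaf.stalk t → T.presheaf.stalk t) : Prop where
  der : IsDerAlong (RingHom.id _) E
  apply : ∀ a, E (g.stalkMap t (X.presheaf.germ W (g t) ht a)) =
    g.stalkMap t (X.presheaf.germ W (g t) ht (d a))

lemma exists_isGermExtension (hW : IsAffineOpen W) {d : Γ(X, W) → Γ(X, W)}
    (hd : IsDerAlong (RingHom.id _) d) (g : T ⟶ X) [Etale g] (t : T) (ht : g t ∈ W) :
    ∃ E, IsGermExtension d g t ht E := by
  obtain ⟨E, h1, h2⟩ := IsDerAlong.exists_extension (formallyEtale_stalkMap_germ hW g t ht)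
    (RingHom.id _) (D := fun a => g.stalkMap t (X.presheaf.germ W (g t) ht (d a)))
    (hd.comp_left ((g.stalkMap t).hom.comp (X.presheaf.germ W (g t) ht).hom))
  exact ⟨E, h1, h2⟩

lemma IsGermExtension.comp (hW : IsAffineOpen W) {d : Γ(X, W) → Γ(X, W)} {g : T ⟶ X} [Etale g]
    (h : T' ⟶ T) {t : T'} {ht : g (h t) ∈ W} {E E'} (hE : IsGermExtension d g (h t) ht E)
    (hE' : IsGermExtension d (h ≫ g) t ht E') (r : T.presheaf.stalk (h t)) :
    E' (h.stalkMap t r) = h.stalkMap t (E r) := by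
  refine congrFun (IsDerAlong.ext_of_formallyUnramified
    (formallyEtale_stalkMap_germ hW g (h t) ht).formallyUnramified'
    (hE'.der.comp_right (h.stalkMap t).hom) (hE.der.comp_left (h.stalkMap t).hom) fun a => ?_) r
  have h1 := hE'.apply a
  have h2 := hE.apply a
  have key : ∀ b, (h ≫ g).stalkMap t (X.presheaf.germ W (g (h t)) ht b) =
      h.stalkMap t (g.stalkMap (h t) (X.presheaf.germ W (g (h t)) ht b)) := fun b =>
    stalkMap_comp_apply h g t _
  refine (congrArg E' (key a)).symm.trans (h1.trans ((key _).trans ?_))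
  exact congrArg (h.stalkMap t) h2.symm

lemma IsEtaleExtension.germ {d : Γ(X, W) → Γ(X, W)} (hW : IsAffineOpen W) {g : T ⟶ X} [Etale g] {D}
    (hD : IsEtaleExtension d g D) {t : T} {ht : g t ∈ W} {E} (hE : IsGermExtension d g t ht E)
    (B : {B : T.Opens // B ≤ g ⁻¹ᵁ W}) (htB : t ∈ B.1) (a : Γ(T, B.1)) :
    T.presheaf.germ B.1 t htB (D B a) = E (T.presheaf.germ B.1 t htB a) := by
  obtain ⟨_, ⟨A, hA, rfl⟩, htA, hAB⟩ :=
    T.isBasis_affineOpens.exists_subset_of_mem_open htB B.1.isOpen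
  have hAB' : A ≤ B.1 := hAB
  let A' : {B : T.Opens // B ≤ g ⁻¹ᵁ W} := ⟨A, hAB'.trans B.2⟩
  have key : ∀ b : Γ(T, A), T.presheaf.germ A t htA (D A' b) = E (T.presheaf.germ A t htA b) := by
    refine congrFun (IsDerAlong.ext_of_formallyUnramified
      (g.etale_appLE hW hA A'.2).formallyEtale'.formallyUnramified'
      ((hD.der A').comp_left (T.presheaf.germ A t htA).hom)
      (hE.der.comp_right (T.presheaf.germ A t htA).hom) fun a => ?_)
    have h1 := congrArg (T.presheaf.germ A t htA) (hD.apply A' a)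
    have h2 := hE.apply a
    refine h1.trans ((germ_appLE g A'.2 t htA _).trans (h2.symm.trans ?_))
    exact congrArg E (germ_appLE g A'.2 t htA a).symm
  rw [← germ_rs hAB' t htA, ← germ_rs hAB' t htA, hD.res B A' hAB']
  exact key _

/-- On affine opens the extension exists and is unique by formal étaleness. Uniqueness makes it
compatible with restriction, so it glues. -/
lemma exists_isEtaleExtension (hW : IsAffineOpen W) {d : Γ(X, W) → Γ(X, W)}
    (hd : IsDerAlong (RingHom.id _) d) (g : T ⟶ X) [Etale g] : ∃ D, IsEtaleExtension d g D := by
  let J := {A : T.Opens // IsAffineOpen A ∧ A ≤ g ⁻¹ᵁ W}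
  have h1 : ∀ A : J, ∃ D : Γ(T, A.1) → Γ(T, A.1), IsDerAlong (RingHom.id _) D ∧
      ∀ a, D (g.appLE W A.1 A.2.2 a) = g.appLE W A.1 A.2.2 (d a) := fun A =>
    IsDerAlong.exists_extension (g.etale_appLE hW A.2.1 A.2.2).formallyEtale' (RingHom.id _)
      (hd.comp_left (g.appLE W A.1 A.2.2).hom)
  choose D hD hDa using h1
  have hres : ∀ (A A' : J) (h : A'.1 ≤ A.1) a, rs h (D A a) = D A' (rs h a) := by
    intro A A' h
    refine congrFun (IsDerAlong.ext_of_formallyUnramified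
      (g.etale_appLE hW A.2.1 A.2.2).formallyEtale'.formallyUnramified'
      ((hD A).comp_left (rs h)) ((hD A').comp_right (rs h)) fun a => ?_)
    have key : ∀ b, rs h (g.appLE W A.1 A.2.2 b) = g.appLE W A'.1 A'.2.2 b := fun b => by
      simp only [rs, ← ConcreteCategory.comp_apply, Scheme.Hom.appLE_map]
    exact (congrArg (rs h) (hDa A a)).trans ((key _).trans ((hDa A' a).symm.trans
      (congrArg (D A') (key a).symm)))
  have hcov : ∀ B : T.Opens, B ≤ g ⁻¹ᵁ W → ∀ t ∈ B, ∃ A : J, t ∈ A.1 ∧ A.1 ≤ B := fun B hB t ht => by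
    obtain ⟨_, ⟨A, hA, rfl⟩, htA, hAB⟩ := T.isBasis_affineOpens.exists_subset_of_mem_open ht B.isOpen
    exact ⟨⟨A, hA, (show A ≤ B from hAB).trans hB⟩, htA, hAB⟩
  have hext : ∀ (B : T.Opens), B ≤ g ⁻¹ᵁ W → ∀ a b : Γ(T, B),
      (∀ (A : J) (h : A.1 ≤ B), rs h a = rs h b) → a = b := fun B hB a b H => by
    refine T.sheaf.eq_of_locally_eq' (fun A : {A : J // A.1 ≤ B} => A.1.1) B
      (fun A => homOfLE A.2) ?_ a b fun A => H A.1 A.2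
    intro t ht
    obtain ⟨A, h1, h2⟩ := hcov B hB t ht
    exact Opens.mem_iSup.2 ⟨⟨A, h2⟩, h1⟩
  have hglue : ∀ (B : {B : T.Opens // B ≤ g ⁻¹ᵁ W}) (a : Γ(T, B.1)), ∃ b : Γ(T, B.1),
      ∀ (A : J) (h : A.1 ≤ B.1), rs h b = D A (rs h a) := fun B a => by
    obtain ⟨b, hb, -⟩ := T.sheaf.existsUnique_gluing' (fun A : {A : J // A.1 ≤ B.1} => A.1.1) B.1
      (fun A => homOfLE A.2) (by
        intro t ht
        obtain ⟨A, h1, h2⟩ := hcov B.1 B.2 t ht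
        exact Opens.mem_iSup.2 ⟨⟨A, h2⟩, h1⟩) (fun A => D A.1 (rs A.2 a)) (by
        intro A A'
        refine hext (A.1.1 ⊓ A'.1.1) (inf_le_left.trans A.1.2.2) _ _ fun A'' h => ?_
        refine (rs_rs h inf_le_left _).trans (Eq.trans ?_ (rs_rs h inf_le_right _).symm)
        rw [hres A.1 A'' (h.trans inf_le_left), hres A'.1 A'' (h.trans inf_le_right), rs_rs, rs_rs])
    exact ⟨b, fun A h => hb ⟨A, h⟩⟩
  choose E hE using hglue
  refine ⟨E, ⟨?_, ?_, ?_⟩⟩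
  · intro B B' h a
    refine hext B'.1 B'.2 _ _ fun A hA => ?_
    rw [rs_rs, hE B a A (hA.trans h), hE B' _ A hA, rs_rs]
  · intro B
    refine ⟨fun a b => hext B.1 B.2 _ _ fun A hA => ?_, fun a b => hext B.1 B.2 _ _ fun A hA => ?_⟩
    · simp only [map_add, hE B _ A hA, (hD A).add]
    · simp only [map_add, map_mul, hE B _ A hA, (hD A).leibniz, RingHom.id_apply]
  · intro B a
    refine hext B.1 B.2 _ _ fun A hA => ?_
    have key : ∀ b, rs hA (g.appLE W B.1 B.2 b) = g.appLE W A.1 A.2.2 b := fun b => by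
      simp only [rs, ← ConcreteCategory.comp_apply, Scheme.Hom.appLE_map]
    rw [hE B _ A hA]
    exact (congrArg (D A) (key a)).trans ((hDa A a).trans (key _).symm)

end EtaleDerivation

/-! ### Germs of vector fields -/

section TangentGerm

variable {k : Type u} [Field k] {X : Scheme.{u}} {p : X ⟶ Spec (.of k)} {Z : Set X} {W : X.Opens}

/-- The constants in a local ring. -/
noncomputable def stalkConst (p : X ⟶ Spec (.of k)) (q : X) : k →+* X.presheaf.stalk q :=
  (X.presheaf.germ ⊤ q trivial).hom.comp (specFun p)

lemma stalkMap_stalkConst {T : Scheme.{u}} (g : T ⟶ X) (t : T) (c : k) :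
    g.stalkMap t (stalkConst p (g t) c) = stalkConst (g ≫ p) t c := by
  refine (Scheme.Hom.germ_stalkMap_apply g ⊤ t trivial _).trans ?_
  exact congrArg _ (specFun_comp g p c).symm

/-- `Spec k` is a point, so `T`, which contains the image of `q`, is everything and its functions
are constants. -/
lemma germ_appLE_top (q : X) (hq : q ∈ W) (T : (Spec (.of k)).Opens) (h : W ≤ p ⁻¹ᵁ T)
    (s : Γ(Spec (.of k), T)) :
    ∃ c : k, X.presheaf.germ W q hq (p.appLE T W h s) = stalkConst p q c := by
  have hT : T = ⊤ := by
    refine top_le_iff.1 fun z _ => ?_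
    have : Subsingleton (Spec (CommRingCat.of k)) :=
      inferInstanceAs (Subsingleton (PrimeSpectrum k))
    exact Subsingleton.elim (p q) z ▸ h hq
  subst hT
  refine ⟨(Scheme.ΓSpecIso (.of k)).hom s, ?_⟩
  rw [germ_appLE p h q hq]
  refine (Scheme.Hom.germ_stalkMap_apply p ⊤ q trivial s).trans ?_
  have : (Scheme.ΓSpecIso (.of k)).inv ((Scheme.ΓSpecIso (.of k)).hom s) = s :=
    ConcreteCategory.congr_hom (Scheme.ΓSpecIso (.of k)).hom_inv_id s
  change _ = X.presheaf.germ ⊤ q trivial (p.appTop ((Scheme.ΓSpecIso (.of k)).inv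
    ((Scheme.ΓSpecIso (.of k)).hom s)))
  rw [this]
  rfl

/-- `E` is the derivation of the local ring at `q` induced by the family `D`. -/
def IsGermOf (D : ∀ V : {V : X.Opens // V ≤ W}, Γ(X, V.1) → Γ(X, V.1)) (q : X)
    (E : X.presheaf.stalk q → X.presheaf.stalk q) : Prop :=
  ∀ (V : {V : X.Opens // V ≤ W}) (h : q ∈ V.1) a,
    E (X.presheaf.germ V.1 q h a) = X.presheaf.germ V.1 q h (D V a)

/-- A derivation of the local ring which kills the constants, and preserves the maximal ideal if
`q ∈ Z`. -/
structure IsTangentGerm (p : X ⟶ Spec (.of k)) (Z : Set X) (q : X)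
    (E : X.presheaf.stalk q → X.presheaf.stalk q) : Prop where
  der : IsDerAlong (RingHom.id _) E
  const : ∀ c, E (stalkConst p q c) = 0
  tangent : q ∈ Z → ∀ r, ¬ IsUnit r → ¬ IsUnit (E r)

lemma exists_germ_eq_of_mem {q : X} (hq : q ∈ W) (r : X.presheaf.stalk q) :
    ∃ (V : X.Opens) (_ : V ≤ W) (h : q ∈ V) (a : Γ(X, V)), X.presheaf.germ V q h a = r := by
  obtain ⟨V, h, a, rfl⟩ := X.presheaf.exists_germ_eq r
  exact ⟨V ⊓ W, inf_le_right, ⟨h, hq⟩, rs inf_le_left a, germ_rs (V := V ⊓ W) inf_le_left q ⟨h, hq⟩ a⟩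

lemma exists_isGermOf {D : ∀ V : {V : X.Opens // V ≤ W}, Γ(X, V.1) → Γ(X, V.1)}
    (hD : ∀ (V V' : {V : X.Opens // V ≤ W}) (h : V'.1 ≤ V.1) (a : Γ(X, V.1)),
      rs h (D V a) = D V' (rs h a)) (q : X) (hq : q ∈ W) : ∃ E, IsGermOf D q E := by
  choose V hV h a ha using fun r => exists_germ_eq_of_mem hq r
  refine ⟨fun r => X.presheaf.germ (V r) q (h r) (D ⟨V r, hV r⟩ (a r)), fun V' h' a' => ?_⟩
  set r := X.presheaf.germ V'.1 q h' a'
  obtain ⟨V'', h'', i, j, e⟩ := X.presheaf.germ_eq q (h r) h' (a r) a' (ha r)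
  have e1 := hD ⟨V r, hV r⟩ ⟨V'', i.le.trans (hV r)⟩ i.le (a r)
  have e2 := hD V' ⟨V'', j.le.trans V'.2⟩ j.le a'
  change X.presheaf.germ (V r) q (h r) (D ⟨V r, hV r⟩ (a r)) = _
  rw [← germ_rs i.le q h'', ← germ_rs j.le q h'', e1, e2]
  exact congrArg (fun s => X.presheaf.germ V'' q h'' (D ⟨V'', _⟩ s)) e

lemma IsGermOf.ext {D : ∀ V : {V : X.Opens // V ≤ W}, Γ(X, V.1) → Γ(X, V.1)} {q : X} (hq : q ∈ W)
    {E E'} (hE : IsGermOf D q E) (hE' : IsGermOf D q E') : E = E' := by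
  funext r
  obtain ⟨V, hV, h, a, rfl⟩ := exists_germ_eq_of_mem hq r
  exact (hE ⟨V, hV⟩ h a).trans (hE' ⟨V, hV⟩ h a).symm

lemma exists_common_germs {q : X} (hq : q ∈ W) (r s : X.presheaf.stalk q) :
    ∃ (V : X.Opens) (_ : V ≤ W) (h : q ∈ V) (a b : Γ(X, V)), X.presheaf.germ V q h a = r ∧
      X.presheaf.germ V q h b = s := by
  obtain ⟨V, hV, h, a, rfl⟩ := exists_germ_eq_of_mem hq r
  obtain ⟨V', hV', h', b, rfl⟩ := exists_germ_eq_of_mem h s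
  exact ⟨V', hV'.trans hV, h', rs hV' a, b, germ_rs hV' q h' a, rfl⟩

lemma IsTangentField.isTangentGerm {D} (hD : IsTangentField p Z W D) {q : X} (hq : q ∈ W) {E}
    (hE : IsGermOf D q E) : IsTangentGerm p Z q E := by
  refine ⟨⟨fun r s => ?_, fun r s => ?_⟩, fun c => ?_, fun hZ r hr => ?_⟩
  · obtain ⟨V, hV, h, a, b, rfl, rfl⟩ := exists_common_germs hq r s
    rw [← map_add, hE ⟨V, hV⟩ h, hE ⟨V, hV⟩ h, hE ⟨V, hV⟩ h, hD.add, map_add]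
  · obtain ⟨V, hV, h, a, b, rfl, rfl⟩ := exists_common_germs hq r s
    rw [← map_mul, hE ⟨V, hV⟩ h, hE ⟨V, hV⟩ h, hE ⟨V, hV⟩ h, hD.leibniz, map_add, map_mul, map_mul]
    rfl
  · have h1 := hE ⟨W, le_rfl⟩ hq (p.appLE ⊤ W le_top ((Scheme.ΓSpecIso (.of k)).inv c))
    rw [hD.base ⟨W, le_rfl⟩ ⊤ le_top, map_zero] at h1
    rw [← h1]
    refine congrArg E ?_
    rw [germ_appLE p le_top q hq]
    exact (Scheme.Hom.germ_stalkMap_apply p ⊤ q trivial _).symm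
  · obtain ⟨V, hV, h, a, rfl⟩ := exists_germ_eq_of_mem hq r
    rw [hE ⟨V, hV⟩ h]
    have := hD.tangent ⟨V, hV⟩ a q hZ h
    rw [Scheme.mem_basicOpen _ _ _ h, Scheme.mem_basicOpen _ _ _ h] at this
    exact this hr

/-- A family compatible with restriction, whose germs are tangent, is a tangent field. -/
lemma isTangentField_of_germ {D : ∀ V : {V : X.Opens // V ≤ W}, Γ(X, V.1) → Γ(X, V.1)}
    (h : ∀ q ∈ W, ∃ E, IsGermOf D q E ∧ IsTangentGerm p Z q E) : IsTangentField p Z W D := by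
  have hext : ∀ (V : {V : X.Opens // V ≤ W}) (a b : Γ(X, V.1)),
      (∀ q (hq : q ∈ V.1), X.presheaf.germ V.1 q hq a = X.presheaf.germ V.1 q hq b) → a = b :=
    fun V a b H => TopCat.Presheaf.section_ext X.sheaf V.1 a b H
  refine ⟨fun V V' hV a => ?_, fun V a b => ?_, fun V a b => ?_, fun V T hT s => ?_,
    fun V a z hz hzV => ?_⟩
  · refine hext V' _ _ fun q hq => ?_
    obtain ⟨E, hE, -⟩ := h q (V'.2 hq)
    rw [germ_rs hV, ← hE, ← hE, germ_rs hV]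
  · refine hext V _ _ fun q hq => ?_
    obtain ⟨E, hE, hE'⟩ := h q (V.2 hq)
    rw [map_add, ← hE, ← hE, ← hE, map_add, hE'.der.add]
  · refine hext V _ _ fun q hq => ?_
    obtain ⟨E, hE, hE'⟩ := h q (V.2 hq)
    rw [map_add, map_mul, map_mul, ← hE, ← hE, ← hE, map_mul, hE'.der.leibniz]; rfl
  · refine hext V _ _ fun q hq => ?_
    obtain ⟨E, hE, hE'⟩ := h q (V.2 hq)
    obtain ⟨c, hc⟩ := germ_appLE_top q hq T hT s
    rw [← hE, hc, hE'.const, map_zero]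
  · obtain ⟨E, hE, hE'⟩ := h z (V.2 hzV)
    rw [Scheme.mem_basicOpen _ _ _ hzV, Scheme.mem_basicOpen _ _ _ hzV, ← hE]
    exact hE'.tangent hz _

lemma mem_finset_inf {ι : Type*} (S : Finset ι) (B : ι → X.Opens) {q : X} (h : ∀ s, q ∈ B s) :
    q ∈ S.inf B := by
  classical
  induction S using Finset.induction_on with
  | empty => trivial
  | insert a S _ ih => rw [Finset.inf_insert]; exact ⟨h a, ih⟩

lemma exists_affine_finiteType [LocallyOfFiniteType p] {q : X} (hq : q ∈ W) :
    ∃ A ≤ W, q ∈ A ∧ IsAffineOpen A ∧ ((rs (le_top : A ≤ ⊤)).comp (specFun p)).FiniteType := by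
  obtain ⟨_, ⟨A, hA, rfl⟩, hqA, hAW⟩ := X.isBasis_affineOpens.exists_subset_of_mem_open hq W.isOpen
  refine ⟨A, hAW, hqA, hA, ?_⟩
  have h1 := LocallyOfFiniteType.finiteType_appLE (f := p) (isAffineOpen_top (Spec (.of k))) hA le_top
  have h2 : ((Scheme.ΓSpecIso (.of k)).inv.hom).FiniteType :=
    RingHom.FiniteType.of_surjective _ (Scheme.ΓSpecIso (.of k)).symm.commRingCatIsoToRingEquiv.surjective
  exact h1.comp h2

lemma IsGermOf.eq_on_affine {A : X.Opens} (hA : IsAffineOpen A) {D D'} (hAW : A ≤ W)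
    (hD : IsTangentField p Z W D) (hD' : IsTangentField p Z W D') {q : X} (hq : q ∈ A) {E E'}
    (hE : IsGermOf D q E) (hE' : IsGermOf D' q E')
    (h : ∀ a, X.presheaf.germ A q hq (D ⟨A, hAW⟩ a) = X.presheaf.germ A q hq (D' ⟨A, hAW⟩ a)) :
    E = E' := by
  refine IsDerAlong.ext_of_formallyUnramified (formallyEtale_germ hA q hq).formallyUnramified'
    (hD.isTangentGerm (hAW hq) hE).der (hD'.isTangentGerm (hAW hq) hE').der fun a => ?_
  exact (hE ⟨A, hAW⟩ hq a).trans ((h a).trans (hE' ⟨A, hAW⟩ hq a).symm)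

/-- Vector fields with the same germ agree near the point. -/
lemma exists_tangentRes_eq [LocallyOfFiniteType p] (D D' : tangentFields p Z W) {q : X} (hq : q ∈ W)
    {E} (hE : IsGermOf D.1 q E) (hE' : IsGermOf D'.1 q E) :
    ∃ (W' : X.Opens) (h : W' ≤ W), q ∈ W' ∧ tangentRes p Z h D = tangentRes p Z h D' := by
  obtain ⟨A, hAW, hqA, hA, hft⟩ := exists_affine_finiteType (p := p) hq
  let A' : {V : X.Opens // V ≤ W} := ⟨A, hAW⟩
  algebraize [(rs (le_top : A ≤ ⊤)).comp (specFun p)]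
  -- Derivations that kill the constants agree once they agree on generators. There are finitely
  -- many, so equality at `q` spreads to a neighbourhood.
  obtain ⟨S, hS⟩ := (Algebra.FiniteType.out (R := k) (A := Γ(X, A)))
  have h1 : ∀ s : Γ(X, A), ∃ B ≤ A, q ∈ B ∧ ∀ q' (h : q' ∈ A), q' ∈ B →
      X.presheaf.germ A q' h (D.1 A' s) = X.presheaf.germ A q' h (D'.1 A' s) := fun s => by
    have e : X.presheaf.germ A q hqA (D.1 A' s) = X.presheaf.germ A q hqA (D'.1 A' s) :=
      (hE A' hqA s).symm.trans (hE' A' hqA s)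
    obtain ⟨B, hqB, i, j, e⟩ := X.presheaf.germ_eq q hqA hqA _ _ e
    refine ⟨B, i.le, hqB, fun q' h hq' => ?_⟩
    rw [← germ_rs i.le q' hq', ← germ_rs i.le q' hq']
    exact congrArg _ e
  choose B hBA hqB hB using h1
  let W' : X.Opens := A ⊓ S.inf B
  have hW'A : W' ≤ A := inf_le_left
  refine ⟨W', hW'A.trans hAW, ⟨hqA, mem_finset_inf S B hqB⟩, ?_⟩
  · ext V a
    refine TopCat.Presheaf.section_ext X.sheaf V.1 _ _ fun q' hq' => ?_
    have hq'A : q' ∈ A := hW'A (V.2 hq')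
    obtain ⟨E1, hE1⟩ := exists_isGermOf D.2.res q' (hAW hq'A)
    obtain ⟨E2, hE2⟩ := exists_isGermOf D'.2.res q' (hAW hq'A)
    have h12 : E1 = E2 := hE1.eq_on_affine hA hAW D.2 D'.2 hq'A hE2 fun a => by
      have ha : a ∈ Algebra.adjoin k (S : Set Γ(X, A)) := hS ▸ trivial
      induction ha using Algebra.adjoin_induction with
      | mem s hs =>
        refine hB s q' hq'A ?_
        exact (Finset.inf_le hs : S.inf B ≤ B s) (V.2 hq').2
      | algebraMap c =>
        have hc : ∀ D ∈ tangentFields p Z W, D A' (algebraMap k Γ(X, A) c) = 0 := fun D hD =>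
          hD.base A' ⊤ le_top ((Scheme.ΓSpecIso (.of k)).inv c)
        rw [hc _ D.2, hc _ D'.2]
      | add a b _ _ ha hb => rw [D.2.add, D'.2.add, map_add, map_add, ha, hb]
      | mul a b _ _ ha hb => rw [D.2.leibniz, D'.2.leibniz, map_add, map_add, map_mul, map_mul,
          map_mul, map_mul, ha, hb]
    have e1 := hE1 ⟨V.1, V.2.trans (hW'A.trans hAW)⟩ hq' a
    have e2 := hE2 ⟨V.1, V.2.trans (hW'A.trans hAW)⟩ hq' a
    exact e1.symm.trans ((congrFun h12 _).trans e2)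

/-- Every tangent derivation of the local ring is the germ of a vector field. -/
lemma exists_tangentField [LocallyOfFiniteType p] {q : X}
    (hZ : ∃ W : X.Opens, q ∈ W ∧ ∀ z ∈ W, z ∈ Z → z = q) {E} (hE : IsTangentGerm p Z q E) :
    ∃ (W : X.Opens) (_ : q ∈ W) (D : tangentFields p Z W), IsGermOf D.1 q E := by
  obtain ⟨W0, hq0, hW0⟩ := hZ
  obtain ⟨A, hAW, hqA, hA, hft⟩ := exists_affine_finiteType (p := p) hq0
  algebraize [(rs (le_top : A ≤ ⊤)).comp (specFun p)]
  have hflat : (X.presheaf.germ A q hqA).hom.Flat := by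
    have := hA.isLocalization_stalk ⟨q, hqA⟩
    let : Algebra Γ(X, A) (X.presheaf.stalk q) := X.presheaf.algebra_section_stalk ⟨q, hqA⟩
    exact (RingHom.flat_algebraMap_iff).2
      (IsLocalization.flat _ (hA.primeIdealOf ⟨q, hqA⟩).asIdeal.primeCompl)
  have hconst : ∀ c : k, X.presheaf.germ A q hqA (algebraMap k Γ(X, A) c) = stalkConst p q c :=
    fun c => germ_rs (le_top : A ≤ ⊤) q hqA (specFun p c)
  -- On `Γ(X, A)` the derivation `E` is a combination of derivations `d i` of `Γ(X, A)` with
  -- coefficients in the local ring; these finitely many coefficients are defined near `q`.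
  obtain ⟨n, b, d, hd, hdk, hEd⟩ := exists_sum_of_isDerAlong (k := k) (X.presheaf.germ A q hqA).hom
    hflat (hE.der.comp_right (X.presheaf.germ A q hqA).hom) fun c =>
      (congrArg E (hconst c)).trans (hE.const c)
  have hb : ∀ i, ∃ (V : X.Opens) (_ : V ≤ A) (h : q ∈ V) (a : Γ(X, V)),
      X.presheaf.germ V q h a = b i := fun i => exists_germ_eq_of_mem hqA (b i)
  choose V hVA hqV β hβ using hb
  -- The identity is étale, so this extends each `d i` to all open subsets of `A`.
  choose D hD using fun i => exists_isEtaleExtension hA (hd i) (𝟙 X)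
  let W : X.Opens := A ⊓ Finset.univ.inf V
  have hWV : ∀ i, W ≤ V i := fun i => inf_le_right.trans (Finset.inf_le (Finset.mem_univ i))
  have hWA : W ≤ A := inf_le_left
  have hqW : q ∈ W := ⟨hqA, mem_finset_inf _ V hqV⟩
  have key : ∀ q' (hq' : q' ∈ A), ∃ E' : Fin n → X.presheaf.stalk q' → X.presheaf.stalk q',
      ∀ i, IsDerAlong (RingHom.id _) (E' i) ∧ (∀ a, E' i (X.presheaf.germ A q' hq' a) =
        X.presheaf.germ A q' hq' (d i a)) ∧ ∀ (B : {B : X.Opens // B ≤ A}) (h : q' ∈ B.1) a,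
          X.presheaf.germ B.1 q' h (D i B a) = E' i (X.presheaf.germ B.1 q' h a) := by
    intro q' hq'
    choose E' hE' using fun i => exists_isGermExtension hA (hd i) (𝟙 X) q' hq'
    refine ⟨E', fun i => ⟨(hE' i).der, fun a => ?_, fun B h a => (hD i).germ hA (hE' i) B h a⟩⟩
    have h1 := (hE' i).apply a
    rwa [Scheme.Hom.stalkMap_id] at h1
  let F : ∀ B : {B : X.Opens // B ≤ W}, Γ(X, B.1) → Γ(X, B.1) := fun B a =>
    ∑ i, rs (B.2.trans (hWV i)) (β i) * D i ⟨B.1, B.2.trans hWA⟩ a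
  have hF : ∀ q' (hq' : q' ∈ W) (E' : Fin n → X.presheaf.stalk q' → X.presheaf.stalk q'),
      (∀ i, ∀ (B : {B : X.Opens // B ≤ A}) (h : q' ∈ B.1) a, X.presheaf.germ B.1 q' h (D i B a) =
        E' i (X.presheaf.germ B.1 q' h a)) → IsGermOf F q' (fun r =>
          ∑ i, X.presheaf.germ (V i) q' (hWV i hq') (β i) * E' i r) := by
    intro q' hq' E' hE' B hB a
    simp only [F, map_sum, map_mul]
    refine Finset.sum_congr rfl fun i _ => ?_
    rw [germ_rs]
    exact congrArg (_ * ·) (hE' i ⟨B.1, B.2.trans hWA⟩ hB a).symm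
  have hFE : ∀ E' : Fin n → X.presheaf.stalk q → X.presheaf.stalk q,
      (∀ i, IsDerAlong (RingHom.id _) (E' i) ∧ (∀ a, E' i (X.presheaf.germ A q hqA a) =
        X.presheaf.germ A q hqA (d i a))) → (fun r =>
          ∑ i, X.presheaf.germ (V i) q (hWV i hqW) (β i) * E' i r) = E := by
    intro E' hE'
    refine IsDerAlong.ext_of_formallyUnramified (formallyEtale_germ hA q hqA).formallyUnramified'
      (IsDerAlong.sum _ fun i => (hE' i).1.smul _) hE.der fun a => ?_
    refine Eq.trans ?_ (hEd a).symm
    refine Finset.sum_congr rfl fun i _ => ?_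
    rw [hβ]
    exact congrArg (b i * ·) ((hE' i).2 a)
  refine ⟨W, hqW, ⟨F, isTangentField_of_germ fun q' hq' => ?_⟩, ?_⟩
  · obtain ⟨E', hE'⟩ := key q' (hWA hq')
    refine ⟨_, hF q' hq' E' fun i => (hE' i).2.2, IsDerAlong.sum _ fun i => (hE' i).1.smul _,
      fun c => ?_, fun hZ => ?_⟩
    · refine Finset.sum_eq_zero fun i _ => ?_
      have h1 : stalkConst p q' c = X.presheaf.germ A q' (hWA hq') (algebraMap k Γ(X, A) c) :=
        (germ_rs (le_top : A ≤ ⊤) q' (hWA hq') (specFun p c)).symm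
      rw [h1, (hE' i).2.1, hdk, map_zero, mul_zero]
    -- No other point of `Z` lies in the neighbourhood, so tangency is a condition on `E` alone.
    · obtain rfl : q' = q := hW0 q' (hAW (hWA hq')) hZ
      have e := hFE E' fun i => ⟨(hE' i).1, (hE' i).2.1⟩
      exact fun r hr => congrFun e r ▸ hE.tangent hZ r hr
  · obtain ⟨E', hE'⟩ := key q hqA
    have e := hFE E' fun i => ⟨(hE' i).1, (hE' i).2.1⟩
    have h := hF q hqW E' fun i => (hE' i).2.2
    exact fun B hB a => (congrFun e _).symm.trans (h B hB a)

end TangentGerm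

/-! ### Étale descent of functions -/

section EtaleGluing

variable {X : Scheme.{u}}

lemma fun_ext_of_etale {T : Scheme.{u}} (a b : Γ(T, ⊤))
    (H : ∀ t : T, ∃ (T' : Scheme.{u}) (h : T' ⟶ T) (_ : Etale h) (t' : T'), h t' = t ∧
      T'.presheaf.germ ⊤ t' trivial (h.appTop a) = T'.presheaf.germ ⊤ t' trivial (h.appTop b)) :
    a = b := by
  refine TopCat.Presheaf.section_ext T.sheaf ⊤ a b fun t _ => ?_
  obtain ⟨T', h, hh, t', rfl, e⟩ := H t
  have hl := isEtaleLocal_stalkMap h t'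
  refine injective_of_flat_of_isLocalHom hl.flat hl.isLocalHom ?_
  have key : ∀ c, h.stalkMap t' (T.presheaf.germ ⊤ (h t') trivial c) =
      T'.presheaf.germ ⊤ t' trivial (h.appTop c) := fun c => Scheme.Hom.germ_stalkMap_apply h ⊤ t' trivial c
  exact (key a).trans (e.trans (key b).symm)

/-- Functions are morphisms to the affine line over `ℤ`, so they descend along effective
epimorphisms. -/
lemma exists_descent {T U : Scheme.{u}} (h : T ⟶ U) [EffectiveEpi h] (c : Γ(T, ⊤))
    (H : ∀ {Z : Scheme.{u}} (g₁ g₂ : Z ⟶ T), g₁ ≫ h = g₂ ≫ h → g₁.appTop c = g₂.appTop c) :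
    ∃ b, h.appTop b = c := by
  let e := (AffineSpace.toSpecMvPolyIntEquiv (n := PUnit.{u + 1}) (X := T)).symm fun _ => c
  have he : AffineSpace.toSpecMvPolyIntEquiv _ e PUnit.unit = c :=
    congrFun (Equiv.apply_symm_apply _ _) _
  have h1 : ∀ {Z : Scheme.{u}} (g₁ g₂ : Z ⟶ T), g₁ ≫ h = g₂ ≫ h → g₁ ≫ e = g₂ ≫ e := by
    intro Z g₁ g₂ hg
    refine (AffineSpace.toSpecMvPolyIntEquiv _).injective (funext fun i => ?_)
    rw [AffineSpace.toSpecMvPolyIntEquiv_comp, AffineSpace.toSpecMvPolyIntEquiv_comp, he]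
    exact H g₁ g₂ hg
  refine ⟨AffineSpace.toSpecMvPolyIntEquiv _ (EffectiveEpi.desc h e h1) PUnit.unit, ?_⟩
  rw [← AffineSpace.toSpecMvPolyIntEquiv_comp, EffectiveEpi.fac, he]

/-- The fibre product of étale schemes. -/
lemma exists_fiberProduct {U A B : X.Etale} (h₁ : A ⟶ U) (h₂ : B ⟶ U) :
    ∃ (T : X.Etale) (a : T ⟶ A) (b : T ⟶ B), a ≫ h₁ = b ≫ h₂ ∧
      (∀ y z, h₁.left y = h₂.left z → ∃ t, a.left t = y ∧ b.left t = z) ∧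
      ∀ {Z : Scheme.{u}} (g₁ : Z ⟶ A.left) (g₂ : Z ⟶ B.left), g₁ ≫ h₁.left = g₂ ≫ h₂.left →
        ∃ g : Z ⟶ T.left, g ≫ a.left = g₁ ∧ g ≫ b.left = g₂ := by
  let T : X.Etale := Scheme.Etale.mk (pullback.fst h₁.left h₂.left ≫ etHom A)
  refine ⟨T, MorphismProperty.Over.homMk (pullback.fst _ _) rfl trivial,
    MorphismProperty.Over.homMk (pullback.snd h₁.left h₂.left) ?_ trivial, ?_, fun y z e => ?_,
    fun g₁ g₂ e => ⟨pullback.lift g₁ g₂ e, pullback.lift_fst _ _ _, pullback.lift_snd _ _ _⟩⟩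
  · change _ ≫ etHom B = pullback.fst h₁.left h₂.left ≫ etHom A
    rw [← et_w h₂, ← et_w h₁, ← Category.assoc, ← Category.assoc, pullback.condition]
  · exact MorphismProperty.Over.Hom.ext pullback.condition
  · obtain ⟨t, h1, h2⟩ := Scheme.Pullback.exists_preimage_pullback y z e
    exact ⟨t, h1, h2⟩

lemma exists_surjective_factor {T U : X.Etale} (h : T ⟶ U) (t : T.left) :
    ∃ (A : U.left.Opens) (h' : T ⟶ etOpen U A), h' ≫ etOpenι U A = h ∧ h.left t ∈ A ∧
      Surjective h'.left := by
  let A : U.left.Opens := ⟨Set.range h.left, h.left.isOpenMap.isOpen_range⟩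
  obtain ⟨h', hh'⟩ := etOpen_lift h A fun y => ⟨y, rfl⟩
  refine ⟨A, h', hh', ⟨t, rfl⟩, ⟨?_⟩⟩
  rintro ⟨_, y, rfl⟩
  refine ⟨y, Subtype.ext ?_⟩
  change (h'.left ≫ A.ι) y = h.left y
  exact congrArg (fun g => (g.left : T.left ⟶ U.left) y) hh'

lemma left_appTop_comp {T' T U : X.Etale} (g : T' ⟶ T) (h : T ⟶ U) (a : Γ(U.left, ⊤)) :
    (g ≫ h).left.appTop a = g.left.appTop (h.left.appTop a) := by
  change (g.left ≫ h.left).appTop a = _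
  rw [Scheme.Hom.comp_appTop]; rfl

/-- A function which is characterized by an étale local property exists if it exists étale locally. -/
lemma exists_fun_of_etale_local (U : X.Etale)
    (R : ∀ (T : X.Etale) (_ : T ⟶ U), Γ(T.left, ⊤) → Prop)
    (hres : ∀ T h c, R T h c → ∀ T' (g : T' ⟶ T), R T' (g ≫ h) (g.left.appTop c))
    (huniq : ∀ T h c c', R T h c → R T h c' → c = c')
    (hloc : ∀ y : U.left, ∃ T h t, h.left t = y ∧ ∃ c, R T h c)
    (hglue : ∀ T h c, (∀ t : T.left, ∃ T' g t', g.left t' = t ∧ R T' (g ≫ h) (g.left.appTop c)) →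
      R T h c) :
    ∃ c, R U (𝟙 U) c := by
  have h1 : ∀ y : U.left, ∃ (A : U.left.Opens), y ∈ A ∧ ∃ c, R (etOpen U A) (etOpenι U A) c := by
    intro y
    obtain ⟨T, h, t, rfl, c, hc⟩ := hloc y
    obtain ⟨A, h', hh', htA, hsurj⟩ := exists_surjective_factor h t
    -- Both pull backs of `c` to the fibre product satisfy `R`, so uniqueness supplies the descent
    -- datum.
    obtain ⟨P, a, b, hab, -, hlift⟩ := exists_fiberProduct h' h'
    obtain ⟨d, hd⟩ := exists_descent h'.left c fun g₁ g₂ hg => by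
      obtain ⟨g, rfl, rfl⟩ := hlift g₁ g₂ hg
      simp only [Scheme.Hom.comp_appTop, ConcreteCategory.comp_apply]
      refine congrArg g.appTop (huniq P (a ≫ h) _ _ (hres _ _ _ hc P a) ?_)
      have : a ≫ h = b ≫ h := by rw [← hh', ← Category.assoc, hab, Category.assoc]
      rw [this]
      exact hres _ _ _ hc P b
    refine ⟨A, htA, d, hglue _ _ _ fun y' => ?_⟩
    obtain ⟨t', ht'⟩ := hsurj.surj y'
    refine ⟨T, h', t', ht', ?_⟩
    rw [hh', hd]
    exact hc
  choose A hA c hc using h1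
  obtain ⟨d, hd⟩ := top_glue A (fun y _ => Opens.mem_iSup.2 ⟨y, hA y⟩) c fun i j => by
    let B : X.Etale := etOpen U (A i ⊓ A j)
    let q : ∀ l (_ : A i ⊓ A j ≤ A l), B ⟶ etOpen U (A l) := fun l hl =>
      MorphismProperty.Over.homMk (Scheme.homOfLE _ hl) (by
        change Scheme.homOfLE _ hl ≫ (A l).ι ≫ etHom U = (A i ⊓ A j).ι ≫ etHom U
        rw [← Category.assoc, Scheme.homOfLE_ι]) trivial
    have hq : ∀ l hl, q l hl ≫ etOpenι U (A l) = etOpenι U (A i ⊓ A j) := fun l hl =>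
      MorphismProperty.Over.Hom.ext (Scheme.homOfLE_ι _ hl)
    have e1 := hres _ _ _ (hc i) B (q i inf_le_left)
    have e2 := hres _ _ _ (hc j) B (q j inf_le_right)
    rw [hq] at e1 e2
    exact huniq _ _ _ _ e1 e2
  refine ⟨d, hglue _ _ _ fun y => ⟨_, etOpenι U (A y), ⟨y, hA y⟩, rfl, ?_⟩⟩
  rw [Category.comp_id]
  exact (hd y).symm ▸ hc y

end EtaleGluing

/-! ### Sections and germs of the logarithmic structure -/

namespace LogScheme

variable {X : LogScheme.{u}}

lemma res_comp {T' T U : X.toScheme.Etale} (g : T' ⟶ T) (h : T ⟶ U) (m : X.Sec U) :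
    X.res (g ≫ h) m = X.res g (X.res h m) := by
  simp only [LogScheme.res, op_comp, Functor.map_comp]
  rfl

lemma res_id {U : X.toScheme.Etale} (m : X.Sec U) : X.res (𝟙 U) m = m := by
  simp [LogScheme.res]

lemma eps_res {T U : X.toScheme.Etale} (h : T ⟶ U) (m : X.Sec U) :
    X.eps T (X.res h m) = h.left.appTop (X.eps U m) := X.log.ε_map h m

/-- Units of the structure sheaf have unique preimages. A preimage of the inverse of `X.eps U m` is
inverse to `m`, because the product and `1` both map to `1`. -/
lemma isUnit_of_isUnit_eps {U : X.toScheme.Etale} {m : X.Sec U} (h : IsUnit (X.eps U m)) : IsUnit m := by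
  obtain ⟨b, hb⟩ := h.exists_right_inv
  have hb' : IsUnit b := IsUnit.of_mul_eq_one (X.eps U m) (by rw [mul_comm, hb])
  obtain ⟨n, hn, -⟩ := X.log.sharp U b hb'
  refine IsUnit.of_mul_eq_one n ?_
  obtain ⟨o, ho, huniq⟩ := X.log.sharp U 1 isUnit_one
  rw [huniq (m * n) (by change X.eps U (m * n) = 1; rw [map_mul]; exact hn ▸ hb),
    huniq 1 (map_one (X.eps U))]

section Stalk

variable {Ω : Type u} [Field Ω] [IsAlgClosed Ω] {x : Spec (.of Ω) ⟶ X.toScheme}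

lemma exists_lift (U : X.toScheme.Etale) (y : U.left) (h : etHom U y = x default) :
    ∃ l : X.Lift x U, l.pt = y := by
  obtain ⟨l, hl⟩ := Scheme.pointSmallEtaleFiberObjToPreimage_surjective x (s₀ := x default) rfl U ⟨y, h⟩
  exact ⟨l, congrArg Subtype.val hl⟩

lemma Lift.etHom_pt {U : X.toScheme.Etale} (l : X.Lift x U) : etHom U l.pt = x default := by
  have h := Over.w l
  exact congrArg (fun g : Spec (.of Ω) ⟶ X.toScheme => g default) h

/-- The image of a lift. -/
noncomputable abbrev Lift.map {T U : X.toScheme.Etale} (h : T ⟶ U) (l : X.Lift x T) : X.Lift x U :=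
  (Scheme.pointSmallEtale x).fiber.map h l

lemma germ_res {T U : X.toScheme.Etale} (h : T ⟶ U) (l : X.Lift x T) (m : X.Sec U) :
    X.germ x T l (X.res h m) = X.germ x U (l.map h) m :=
  ConcreteCategory.congr_hom ((Scheme.pointSmallEtale x).toPresheafFiber_w h l
    (X.log.M.obj ⋙ forget₂ CommMonCat.{u} MonCat.{u})) m

lemma exists_res_eq {U : X.toScheme.Etale} {l : X.Lift x U} {m n : X.Sec U}
    (h : X.germ x U l m = X.germ x U l n) :
    ∃ (T : X.toScheme.Etale) (g : T ⟶ U) (l' : X.Lift x T), l'.map g = l ∧ X.res g m = X.res g n := by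
  obtain ⟨T, g, l', h1, h2⟩ := ((Scheme.pointSmallEtale x).toPresheafFiber_eq_iff'
    (P := X.log.M.obj ⋙ forget₂ CommMonCat.{u} MonCat.{u}) U l m n).1 h
  exact ⟨T, g, l', h1, h2⟩

lemma exists_germ_eq (s : X.Stalk x) :
    ∃ (T : X.toScheme.Etale) (l : X.Lift x T) (m : X.Sec T), X.germ x T l m = s :=
  (Scheme.pointSmallEtale x).toPresheafFiber_jointly_surjective
    (P := X.log.M.obj ⋙ forget₂ CommMonCat.{u} MonCat.{u}) s

lemma exists_germ_eq' {U : X.toScheme.Etale} (l : X.Lift x U) (s : X.Stalk x) :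
    ∃ (T : X.toScheme.Etale) (g : T ⟶ U) (l' : X.Lift x T) (m : X.Sec T),
      l'.map g = l ∧ X.germ x T l' m = s := by
  obtain ⟨T, l', m, rfl⟩ := exists_germ_eq s
  let a : (Scheme.pointSmallEtale x).fiber.Elements := ⟨U, l⟩
  let b : (Scheme.pointSmallEtale x).fiber.Elements := ⟨T, l'⟩
  let f := IsCofiltered.minToLeft a b
  let g := IsCofiltered.minToRight a b
  refine ⟨_, f.1, (IsCofiltered.min a b).2, X.res g.1 m, f.2, ?_⟩
  rw [germ_res]
  exact congrArg (fun l => X.germ x T l m) g.2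

/-- Sections with the same germ in the characteristic monoid differ by a unit, étale locally. -/
lemma exists_unit_of_charGerm_eq {U : X.toScheme.Etale} {l : X.Lift x U} {m n : X.Sec U}
    (h : (Associates.mk (X.germ x U l m) : X.CharStalk x) = Associates.mk (X.germ x U l n)) :
    ∃ (T : X.toScheme.Etale) (g : T ⟶ U) (l' : X.Lift x T) (w : X.Sec T), l'.map g = l ∧
      IsUnit w ∧ X.res g m = X.res g n * w := by
  obtain ⟨v, hv⟩ := (Associates.mk_eq_mk_iff_associated.1 h).symm
  obtain ⟨T, g, l1, w, rfl, hw⟩ := exists_germ_eq' l (v : X.Stalk x)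
  -- A representative of a unit germ need not be a unit; the inverse germ is represented too, and a
  -- further refinement makes the product one.
  obtain ⟨T2, g2, l2, w', rfl, hw'⟩ := exists_germ_eq' l1 ((v⁻¹ : (X.Stalk x)ˣ) : X.Stalk x)
  obtain ⟨T3, g3, l3, rfl, e3⟩ := exists_res_eq (l := l2) (m := X.res g2 w * w') (n := 1) (by
    rw [map_mul, germ_res, hw, hw', map_one]; exact v.mul_inv)
  obtain ⟨T4, g4, l4, rfl, e4⟩ := exists_res_eq (l := l3) (m := X.res (g3 ≫ g2 ≫ g) m)
      (n := X.res (g3 ≫ g2 ≫ g) n * X.res g3 (X.res g2 w)) (by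
    rw [map_mul, germ_res, germ_res, germ_res, germ_res, hw]
    simp only [Lift.map, Functor.map_comp] at hv ⊢
    exact hv.symm)
  refine ⟨T4, g4 ≫ g3 ≫ g2 ≫ g, l4, X.res g4 (X.res g3 (X.res g2 w)), ?_, ?_, ?_⟩
  · simp only [Lift.map, Functor.map_comp]; rfl
  · refine (IsUnit.of_mul_eq_one (X.res g3 w') ?_).map _
    rw [← map_mul, e3, map_one]
  · simp only [res_comp, map_mul] at e4 ⊢
    exact e4

end Stalk

end LogScheme

section BaseSections

variable {k : Type u} [Field k] [IsAlgClosed k] {N : LogStructure (Spec (.of k))}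
  {X : LogScheme.{u}} (p : X.Hom ⟨Spec (.of k), N⟩)

/-- The sections which come from the base. -/
noncomputable def pullB (U : X.toScheme.Etale) : BaseMonoid N →* X.Sec U :=
  p.pull U (etTop (Spec (.of k))) (etHom U ≫ p.base) (Category.comp_id _)

lemma res_pullB {T U : X.toScheme.Etale} (h : T ⟶ U) (s : BaseMonoid N) :
    X.res h (pullB p U s) = pullB p T s := by
  have h1 := p.pull_res U T (etTop _) (etTop _) h (𝟙 _) (etHom U ≫ p.base) (Category.comp_id _)
    (etHom T ≫ p.base) (Category.comp_id _) s (by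
      refine (congrArg (h.left ≫ ·) (Category.comp_id (etHom U ≫ p.base))).trans ?_
      exact (Category.assoc _ _ _).symm.trans (congrArg (· ≫ p.base) (et_w h)))
  have h2 : LogScheme.res ⟨Spec (.of k), N⟩ (𝟙 (etTop (Spec (.of k)))) s = s := LogScheme.res_id _
  rw [h2] at h1
  exact h1

lemma exists_eps_pullB (U : X.toScheme.Etale) (s : BaseMonoid N) :
    ∃ c : k, X.eps U (pullB p U s) = specFun (etHom U ≫ p.base) c := by
  refine ⟨(Scheme.ΓSpecIso (.of k)).hom (N.ε (etTop _) s), ?_⟩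
  refine (p.eps_pull U (etTop _) _ _ s).trans ?_
  refine congrArg ((etHom U ≫ p.base).appTop) ?_
  exact (ConcreteCategory.congr_hom (Scheme.ΓSpecIso (.of k)).hom_inv_id (N.ε (etTop _) s)).symm

variable {Ω : Type u} [Field Ω] [IsAlgClosed Ω] (x : Spec (.of Ω) ⟶ X.toScheme)

lemma germ_pullB (U : X.toScheme.Etale) (l : X.Lift x U) (s : BaseMonoid N) :
    X.germ x U l (pullB p U s) = baseToStalk p x s := by
  let h : U ⟶ etTop X.toScheme := MorphismProperty.Over.homMk (etHom U) (Category.comp_id _) trivial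
  rw [← res_pullB p h s, LogScheme.germ_res]
  have e1 : pullB p (etTop X.toScheme) s = p.pull (etTop X.toScheme) (etTop (Spec (.of k))) p.base
      ((Category.comp_id _).trans (Category.id_comp _).symm) s := by
    have : ∀ (g : X.toScheme ⟶ Spec (.of k)) (e : g = p.base) hg, p.pull (etTop X.toScheme)
        (etTop (Spec (.of k))) g hg s = p.pull (etTop X.toScheme) (etTop (Spec (.of k))) p.base
          ((Category.comp_id _).trans (Category.id_comp _).symm) s := by rintro _ rfl _; rfl
    exact this _ (Category.id_comp _) _
  have e2 : l.map h = Over.homMk x := by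
    refine Over.OverMorphism.ext ?_
    exact Over.w l
  rw [e1, e2]
  rfl

lemma baseToChar_mk (s : BaseMonoid N) :
    baseToChar p x (Associates.mk s) = Associates.mk (baseToStalk p x s) := rfl

/-- A point where the characteristic monoid is that of the base. -/
def IsGood (z : X.toScheme) : Prop :=
  ∃ (Ω : Type u) (_ : Field Ω) (_ : IsAlgClosed Ω) (x : Spec (.of Ω) ⟶ X.toScheme),
    x default = z ∧ Function.Bijective (baseToChar p x)

variable {p}

/-- Surjectivity of `baseToChar` decomposes the germ up to a unit, and this unit is realized étale
locally. -/
lemma IsGood.exists_decomp {T : X.toScheme.Etale} {y : T.left} (h : IsGood p (etHom T y))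
    (m : X.Sec T) :
    ∃ (T' : X.toScheme.Etale) (g : T' ⟶ T) (t' : T'.left) (s : BaseMonoid N) (w : X.Sec T'),
      g.left t' = y ∧ IsUnit w ∧ X.res g m = pullB p T' s * w := by
  obtain ⟨Ω, _, _, x, hx, -, hsurj⟩ := h
  obtain ⟨l, rfl⟩ := LogScheme.exists_lift T y hx.symm
  obtain ⟨s, hs⟩ := hsurj (Associates.mk (X.germ x T l m))
  obtain ⟨s, rfl⟩ := Associates.mk_surjective s
  rw [baseToChar_mk, ← germ_pullB p x T l] at hs
  obtain ⟨T', g, l', w, rfl, hw, e⟩ := LogScheme.exists_unit_of_charGerm_eq hs.symm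
  exact ⟨T', g, l'.pt, s, w, rfl, hw, by rw [e, res_pullB]⟩

/-- Injectivity of `baseToChar` makes `s` and `s'` associated, and cancellation in the integral
monoid passes the quotient on to `w` and `w'`. The ambiguity is a unit from the base; its function
is constant and invisible to derivations. -/
lemma IsGood.decomp_unique {T : X.toScheme.Etale} {y : T.left} (h : IsGood p (etHom T y))
    {s s' : BaseMonoid N} {w w' : X.Sec T} (hw : IsUnit w) (hw' : IsUnit w')
    (e : pullB p T s * w = pullB p T s' * w') :
    ∃ v : BaseMonoid N, IsUnit v ∧ w = pullB p T v * w' := by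
  obtain ⟨Ω, _, _, x, hx, hinj, -⟩ := h
  obtain ⟨l, rfl⟩ := LogScheme.exists_lift T y hx.symm
  have key : ∀ (s : BaseMonoid N) (w : X.Sec T), IsUnit w →
      Associates.mk (X.germ x T l (pullB p T s * w)) = baseToChar p x (Associates.mk s) :=
    fun s w hw => by
      rw [baseToChar_mk, Associates.mk_eq_mk_iff_associated, map_mul, germ_pullB]
      exact (associated_mul_isUnit_right_iff (hw.map (X.germ x T l))).2 (Associated.refl _) |>.symm
  have h1 := key s w hw
  rw [e, key s' w' hw'] at h1
  obtain ⟨v, hv⟩ := Associates.mk_eq_mk_iff_associated.1 (hinj h1).symm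
  refine ⟨v, v.isUnit, X.log.integral T (pullB p T s) _ _ ?_⟩
  refine e.trans ?_
  rw [← hv, map_mul, mul_assoc]

end BaseSections

/-! ### Density of the points with the characteristic monoid of the base -/

section Density

variable {k : Type u} [Field k] [IsAlgClosed k] {N : LogStructure (Spec (.of k))}
  {X : LogScheme.{u}} {p : X.Hom ⟨Spec (.of k), N⟩}

lemma exists_geometricPoint {Y : Scheme.{u}} (z : Y) :
    ∃ (Ω : Type u) (_ : Field Ω) (_ : IsAlgClosed Ω) (x : Spec (.of Ω) ⟶ Y), x default = z := by
  let K : Type u := Y.residueField z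
  let _ : Field K := inferInstanceAs (Field (Y.residueField z))
  let f : Spec (.of (AlgebraicClosure K)) ⟶ Spec (Y.residueField z) :=
    Spec.map (CommRingCat.ofHom (algebraMap K (AlgebraicClosure K)))
  refine ⟨AlgebraicClosure K, inferInstance, inferInstance, f ≫ Y.fromSpecResidueField z, ?_⟩
  rw [Scheme.Hom.comp_apply]
  exact Scheme.fromSpecResidueField_apply _ _

lemma IsLogCurve.isSmoothPoint_or_isNode (hX : IsLogCurve p) (z : X.toScheme) :
    IsSmoothPoint p.base z ∨ IsNode p.base z := by
  obtain ⟨Ω, _, _, x, rfl⟩ := exists_geometricPoint z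
  rcases hX.description Ω x with h | h | ⟨U, l, c, -⟩
  · exact Or.inl h.1
  · exact Or.inl h.1
  · exact Or.inr (LogScheme.Lift.etHom_pt l ▸ c.isNode)

/-- `IsMarking` concerns every geometric point over `z`. If it fails, some geometric point over `z`
is unmarked or nodal, which gives one of the other cases. -/
lemma IsLogCurve.isGood_or (hX : IsLogCurve p) (z : X.toScheme) :
    IsGood p z ∨ IsMarking p z ∨ IsNode p.base z := by
  by_contra! h
  refine h.2.1 fun Ω _ _ x hx => ?_
  rcases hX.description Ω x with h' | h' | ⟨U, l, c, -⟩
  · exact absurd ⟨Ω, _, _, x, hx, h'.2⟩ h.1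
  · exact h'
  · exact absurd (hx ▸ LogScheme.Lift.etHom_pt l ▸ c.isNode) h.2.2

lemma IsLogCurve.exists_opens_isGood (hX : IsLogCurve p) (z : X.toScheme) :
    ∃ W : X.toScheme.Opens, z ∈ W ∧ ∀ w ∈ W, w ≠ z → IsGood p w := by
  obtain ⟨W, hzW, hW⟩ := hX.locallyFinite z
  have h1 : ∃ V : X.toScheme.Opens, z ∈ V ∧ ∀ w ∈ V, IsNode p.base w → w = z := by
    rcases hX.isSmoothPoint_or_isNode z with ⟨V, hzV, hV⟩ | h
    · exact ⟨V, hzV, fun w hw hn => absurd hn (IsSmoothPoint.not_isNode ⟨V, hw, hV⟩)⟩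
    · exact h.exists_opens
  obtain ⟨V, hzV, hV⟩ := h1
  refine ⟨W ⊓ V, ⟨hzW, hzV⟩, fun w hw hne => ?_⟩
  rcases hX.isGood_or w with h | h | h
  · exact h
  · exact absurd (hW w hw.1 h) hne
  · exact absurd (hV w hw.2 h) hne

/-- A local parameter will do at a marking, and the sum of the two branch parameters at a node. It
follows that no nonzero function is supported at such points. -/
lemma IsLogCurve.exists_nonZeroDivisor (hX : IsLogCurve p) (T : X.toScheme.Etale) (y : T.left)
    (hy : ¬ IsGood p (etHom T y)) :
    ∃ (T' : X.toScheme.Etale) (h : T' ⟶ T) (t' : T'.left), h.left t' = y ∧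
      ∃ r : T'.left.presheaf.stalk t', r ∈ (T'.left.presheaf.stalk t')⁰ ∧ ¬ IsUnit r := by
  obtain ⟨Ω, _, _, x, hx⟩ := exists_geometricPoint (etHom T y)
  rcases hX.description Ω x with h | ⟨hs, U, l, γ, hγ, -⟩ | ⟨U, l, c, -⟩
  · exact absurd ⟨Ω, _, _, x, hx, h.2⟩ hy
  · obtain ⟨T', a, b, t', h1, h2⟩ := exists_etale_fiberProduct T U y l.pt
      (hx.symm.trans (LogScheme.Lift.etHom_pt l).symm)
    rw [← LogScheme.Lift.etHom_pt l] at hs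
    refine ⟨T', a, t', h1, ?_⟩
    obtain ⟨h0, hm⟩ := hγ
    have hl := isEtaleLocal_stalkMap b.left t'
    generalize l.pt = y' at h2 hs h0 hm
    subst h2
    have := hs.of_etale.isDomain
    refine ⟨b.left.stalkMap t' _, RingHom.Flat.map_mem_nonZeroDivisors hl.flat
      (mem_nonZeroDivisors_of_ne_zero h0), fun hu => ?_⟩
    have := hl.isLocalHom
    have h3 := isUnit_of_map_unit (b.left.stalkMap t').hom _ hu
    have h4 := hm.le (Ideal.mem_span_singleton_self _)
    exact h4 h3
  · obtain ⟨T', a, b, t', h1, h2⟩ := exists_etale_fiberProduct T U y l.pt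
      (hx.symm.trans (LogScheme.Lift.etHom_pt l).symm)
    have hn := (c.comp b t' h2).isNodeRing
    exact ⟨T', a, t', h1, _, hn.add_mem_nonZeroDivisors, (hn.nonunit _).2 ⟨1, 1, by ring⟩⟩

/-- Functions which agree at the points where the characteristic monoid is that of the base are equal. -/
lemma IsLogCurve.fun_ext (hX : IsLogCurve p) (U : X.toScheme.Etale) (a b : Γ(U.left, ⊤))
    (H : ∀ y : U.left, IsGood p (etHom U y) → U.left.presheaf.germ ⊤ y trivial a =
      U.left.presheaf.germ ⊤ y trivial b) : a = b := by
  refine fun_ext_of_etale a b fun y => ?_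
  by_cases hy : IsGood p (etHom U y)
  · refine ⟨U.left, 𝟙 _, inferInstance, y, rfl, ?_⟩
    have := H y hy
    rwa [← id_appTop U a, ← id_appTop U b] at this
  obtain ⟨T, h, t, rfl, r, hr, hru⟩ := hX.exists_nonZeroDivisor U y hy
  refine ⟨T.left, h.left, inferInstance, t, rfl, ?_⟩
  obtain ⟨W, hzW, hW⟩ := hX.exists_opens_isGood (etHom T t)
  obtain ⟨A, htA, hA⟩ := exists_opens_fiber_eq (etHom T) t
  obtain ⟨V0, hV0, htV0, r0, rfl⟩ := exists_germ_eq_of_mem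
    (W := A ⊓ etHom T ⁻¹ᵁ W) (q := t) ⟨htA, hzW⟩ r
  obtain ⟨_, ⟨V, hV, rfl⟩, htV, hVV⟩ :=
    T.left.isBasis_affineOpens.exists_subset_of_mem_open htV0 V0.isOpen
  have hVV' : V ≤ V0 := hVV
  let r1 : Γ(T.left, V) := rs hVV' r0
  let d : Γ(T.left, V) := rs le_top (h.left.appTop (a - b))
  -- All points of `V` other than `t` are good, and `t` is outside the locus where `r1` is
  -- invertible. So the difference `d` vanishes on this locus, a power of `r1` kills it, and `r1` is
  -- a non-zero-divisor at `t`.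
  have hd : T.left.presheaf.map (homOfLE (T.left.basicOpen_le r1)).op d = 0 := by
    refine TopCat.Presheaf.section_ext T.left.sheaf _ _ _ fun t' ht' => ?_
    have ht'V : t' ∈ V := T.left.basicOpen_le r1 ht'
    have hne : etHom T t' ≠ etHom T t := fun e => by
      have := hA t' (hV0 (hVV' ht'V)).1 e
      subst this
      refine hru ?_
      rw [← germ_rs hVV' t' htV]
      exact (T.left.mem_basicOpen r1 t' ht'V).1 ht'
    have hg := hW _ (hV0 (hVV' ht'V)).2 hne
    have e1 : etHom U (h.left t') = etHom T t' := congrArg (fun g : T.left ⟶ X.toScheme => g t') (et_w h)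
    have h1 := H (h.left t') (e1 ▸ hg)
    refine (germ_rs (T.left.basicOpen_le r1) t' ht' d).trans ?_
    refine (germ_rs le_top t' ht'V _).trans ?_
    refine Eq.trans ?_ (map_zero (T.left.presheaf.germ _ t' ht').hom).symm
    refine (Scheme.Hom.germ_stalkMap_apply h.left ⊤ t' trivial (a - b)).symm.trans ?_
    rw [map_sub]
    refine (congrArg (h.left.stalkMap t') (sub_eq_zero.2 h1)).trans (map_zero _)
  obtain ⟨n, hn⟩ := exists_pow_mul_eq_zero_of_res_basicOpen_eq_zero_of_isAffineOpen T.left hV d r1 hd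
  have h2 := congrArg (T.left.presheaf.germ V t htV) hn
  rw [map_mul, map_pow, map_zero, germ_rs hVV' t htV] at h2
  have h3 : T.left.presheaf.germ V t htV d = 0 :=
    (mem_nonZeroDivisors_iff.1 (pow_mem hr n)).1 _ h2
  have h4 : T.left.presheaf.germ ⊤ t trivial (h.left.appTop (a - b)) = 0 :=
    (germ_rs le_top t htV _).symm.trans h3
  rw [map_sub, map_sub] at h4
  exact sub_eq_zero.1 h4

end Density

/-! ### Logarithmic derivatives of sections -/

section EtaleDer

/-- A derivation of the structure sheaf of the étale site over `W` which kills the constants. -/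
structure IsEtaleDer {k : Type u} [Field k] {X : Scheme.{u}} (p : X ⟶ Spec (.of k)) (W : X.Opens)
    (D : ∀ U : EtIn W, Γ(U.1.left, ⊤) → Γ(U.1.left, ⊤)) : Prop where
  res : ∀ (U V : EtIn W) (h : U.1 ⟶ V.1) (a : Γ(V.1.left, ⊤)),
    h.left.appTop (D V a) = D U (h.left.appTop a)
  der : ∀ U, IsDerAlong (RingHom.id _) (D U)
  const : ∀ U c, D U (specFun (etHom U.1 ≫ p) c) = 0

/-- An étale scheme over an étale scheme over `W`. -/
abbrev EtIn.of {X : Scheme.{u}} {W : X.Opens} (U : EtIn W) {T : X.Etale} (h : T ⟶ U.1) : EtIn W :=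
  ⟨T, fun y => by
    have := U.2 (h.left y)
    rwa [← Scheme.Hom.comp_apply, et_w h] at this⟩

variable {k : Type u} [Field k] [IsAlgClosed k] {N : LogStructure (Spec (.of k))}
  {X : LogScheme.{u}} {p : X.Hom ⟨Spec (.of k), N⟩} {W : X.toScheme.Opens}
  {D : ∀ U : EtIn W, Γ(U.1.left, ⊤) → Γ(U.1.left, ⊤)}

variable (p) in
/-- The function `c` is the logarithmic derivative of the section `m`, where `m` is étale locally the
product of a section which comes from the base and a unit. -/
def IsDlog (D : ∀ U : EtIn W, Γ(U.1.left, ⊤) → Γ(U.1.left, ⊤)) (U : EtIn W) (m : X.Sec U.1)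
    (c : Γ(U.1.left, ⊤)) : Prop :=
  ∀ (T : X.toScheme.Etale) (h : T ⟶ U.1) (s : BaseMonoid N) (w : X.Sec T), IsUnit w →
    X.res h m = pullB p T s * w → D (U.of h) (X.eps T w) = X.eps T w * h.left.appTop c

lemma IsDlog.res {U : EtIn W} {m : X.Sec U.1} {c : Γ(U.1.left, ⊤)} (h : IsDlog p D U m c)
    {T : X.toScheme.Etale} (g : T ⟶ U.1) :
    IsDlog p D (U.of g) (X.res g m) (g.left.appTop c) := by
  intro T' g' s w hw e
  rw [← LogScheme.res_comp] at e
  have := h T' (g' ≫ g) s w hw e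
  rwa [left_appTop_comp] at this

lemma germ_appTop_left {T U : X.toScheme.Etale} (h : T ⟶ U) (t : T.left) {a b : Γ(U.left, ⊤)} 
    (e : h.left.appTop a = h.left.appTop b) :
    U.left.presheaf.germ ⊤ (h.left t) trivial a = U.left.presheaf.germ ⊤ (h.left t) trivial b := by
  have hl := isEtaleLocal_stalkMap h.left t
  refine injective_of_flat_of_isLocalHom hl.flat hl.isLocalHom ?_
  have key : ∀ c, h.left.stalkMap t (U.left.presheaf.germ ⊤ (h.left t) trivial c) =
      T.left.presheaf.germ ⊤ t trivial (h.left.appTop c) := fun c =>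
    Scheme.Hom.germ_stalkMap_apply h.left ⊤ t trivial c
  exact (key a).trans ((congrArg _ e).trans (key b).symm)

lemma etHom_left {T U : X.toScheme.Etale} (h : T ⟶ U) (t : T.left) :
    etHom U (h.left t) = etHom T t :=
  congrArg (fun g : T.left ⟶ X.toScheme => g t) (et_w h)

/-- Functions which agree after pull back to étale neighbourhoods of the points where the
characteristic monoid is that of the base are equal. -/
lemma IsLogCurve.fun_ext_etale (hX : IsLogCurve p) (U : X.toScheme.Etale) (a b : Γ(U.left, ⊤))
    (H : ∀ y : U.left, IsGood p (etHom U y) → ∃ (T : X.toScheme.Etale) (h : T ⟶ U) (t : T.left),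
      h.left t = y ∧ h.left.appTop a = h.left.appTop b) : a = b := by
  refine hX.fun_ext U a b fun y hy => ?_
  obtain ⟨T, h, t, rfl, e⟩ := H y hy
  exact germ_appTop_left h t e

lemma fun_ext_etale {U : X.toScheme.Etale} (a b : Γ(U.left, ⊤))
    (H : ∀ y : U.left, ∃ (T : X.toScheme.Etale) (h : T ⟶ U) (t : T.left),
      h.left t = y ∧ h.left.appTop a = h.left.appTop b) : a = b := by
  refine fun_ext_of_etale a b fun y => ?_
  obtain ⟨T, h, t, rfl, e⟩ := H y
  exact ⟨T.left, h.left, inferInstance, t, rfl, congrArg _ e⟩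

/-- At a good point `m` is a base section times a unit `w`, and `D (ε w) = ε w * c` determines `c`
because `ε w` is invertible. Good points suffice by density. -/
lemma IsDlog.unique (hX : IsLogCurve p) {U : EtIn W} {m : X.Sec U.1} {c c' : Γ(U.1.left, ⊤)}
    (h : IsDlog p D U m c) (h' : IsDlog p D U m c') : c = c' := by
  refine hX.fun_ext_etale U.1 c c' fun y hy => ?_
  obtain ⟨T, g, t, s, w, rfl, hw, e⟩ := hy.exists_decomp m
  refine ⟨T, g, t, rfl, (hw.map (X.eps T)).mul_left_cancel ?_⟩
  exact (h T g s w hw e).symm.trans (h' T g s w hw e)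

/-- To check that `c` is the logarithmic derivative of `m`, one decomposition is enough at each point. -/
lemma IsEtaleDer.isDlog_of (hX : IsLogCurve p) (hD : IsEtaleDer p.base W D) {U : EtIn W}
    {m : X.Sec U.1} {c : Γ(U.1.left, ⊤)}
    (H : ∀ y : U.1.left, IsGood p (etHom U.1 y) → ∃ (T : X.toScheme.Etale) (h : T ⟶ U.1)
      (t : T.left) (s : BaseMonoid N) (w : X.Sec T), h.left t = y ∧ IsUnit w ∧
        X.res h m = pullB p T s * w ∧ D (U.of h) (X.eps T w) = X.eps T w * h.left.appTop c) :
    IsDlog p D U m c := by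
  intro T' g s' w' hw' e'
  refine hX.fun_ext_etale T' _ _ fun y hy => ?_
  rw [← etHom_left g] at hy
  obtain ⟨T, h, t, s, w, ht, hw, e, ec⟩ := H (g.left y) hy
  obtain ⟨P, a, b, hab, hP, -⟩ := exists_fiberProduct g h
  obtain ⟨z, rfl, rfl⟩ := hP y t ht.symm
  refine ⟨P, a, z, rfl, ?_⟩
  have e1 : pullB p P s' * X.res a w' = pullB p P s * X.res b w := by
    rw [← res_pullB p a, ← res_pullB p b, ← map_mul, ← map_mul, ← e, ← e', ← LogScheme.res_comp,
      ← LogScheme.res_comp, hab]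
  rw [etHom_left, etHom_left] at hy
  -- On a common refinement the two unit factors differ by a unit from the base, a constant for `D`,
  -- so their logarithmic derivatives agree.
  obtain ⟨v, hv, e2⟩ := hy.decomp_unique (hw'.map _) (hw.map _) e1
  obtain ⟨r, hr⟩ := exists_eps_pullB p P v
  have h1 := hD.res ((U.of g).of a) (U.of g) a (X.eps T' w')
  have h2 := hD.res ((U.of h).of b) (U.of h) b (X.eps T w)
  rw [ec, ← LogScheme.eps_res, map_mul, ← LogScheme.eps_res, ← left_appTop_comp, ← hab] at h2
  rw [h1, map_mul, ← LogScheme.eps_res, ← left_appTop_comp, e2, map_mul, hr]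
  refine ((hD.der _).leibniz _ _).trans ?_
  rw [hD.const, mul_zero, add_zero]
  refine (congrArg (specFun (etHom P ≫ p.base) r * ·) h2.symm).trans ?_
  rw [mul_assoc]

variable (hX : IsLogCurve p) (hD : IsEtaleDer p.base W D)
include hX hD

lemma IsDlog.mul {U : EtIn W} {m m' : X.Sec U.1} {c c' : Γ(U.1.left, ⊤)}
    (h : IsDlog p D U m c) (h' : IsDlog p D U m' c') : IsDlog p D U (m * m') (c + c') := by
  refine hD.isDlog_of hX fun y hy => ?_
  obtain ⟨T, g, t, s, w, rfl, hw, e⟩ := hy.exists_decomp m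
  rw [etHom_left] at hy
  obtain ⟨T', g', t', s', w', rfl, hw', e'⟩ := hy.exists_decomp (X.res g m')
  have e1 : X.res (g' ≫ g) m = pullB p T' s * X.res g' w := by
    rw [LogScheme.res_comp, e, map_mul, res_pullB]
  have e2 : X.res (g' ≫ g) m' = pullB p T' s' * w' := by rw [LogScheme.res_comp, e']
  refine ⟨T', g' ≫ g, t', s * s', X.res g' w * w', rfl, (hw.map _).mul hw', ?_, ?_⟩
  · rw [map_mul, e1, e2, map_mul]
    exact mul_mul_mul_comm _ _ _ _
  · rw [map_mul]
    refine ((hD.der _).leibniz _ _).trans ?_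
    rw [h T' _ s _ (hw.map _) e1, h' T' _ s' w' hw' e2, map_add]
    simp only [RingHom.id_apply]
    ring

lemma IsDlog.pullB (U : EtIn W) (s : BaseMonoid N) : IsDlog p D U (pullB p U.1 s) 0 := by
  refine hD.isDlog_of hX fun y _ => ⟨U.1, 𝟙 _, y, s, 1, rfl, isUnit_one, ?_, ?_⟩
  · rw [LogScheme.res_id, mul_one]
  · rw [map_one, map_zero, mul_zero]
    exact (hD.der _).one

lemma IsDlog.of_isUnit {U : EtIn W} {w : X.Sec U.1} (hw : IsUnit w) {c : Γ(U.1.left, ⊤)}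
    (e : D U (X.eps U.1 w) = X.eps U.1 w * c) : IsDlog p D U w c := by
  refine hD.isDlog_of hX fun y _ => ⟨U.1, 𝟙 _, y, 1, w, rfl, hw, ?_, ?_⟩
  · rw [LogScheme.res_id, map_one, one_mul]
  · rw [id_appTop]; exact e

lemma exists_isDlog_of_isUnit {U : EtIn W} {w : X.Sec U.1} (hw : IsUnit w) :
    ∃ c, IsDlog p D U w c := by
  obtain ⟨b, hb⟩ := (hw.map (X.eps U.1)).exists_right_inv
  refine ⟨b * D U (X.eps U.1 w), IsDlog.of_isUnit hX hD hw ?_⟩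
  rw [← mul_assoc, hb, one_mul]

lemma IsDlog.pow {U : EtIn W} {m : X.Sec U.1} {c : Γ(U.1.left, ⊤)} (h : IsDlog p D U m c) (n : ℕ) :
    IsDlog p D U (m ^ n) (n * c) := by
  induction n with
  | zero =>
    have := IsDlog.of_isUnit (U := U) hX hD isUnit_one (c := 0) (by
      rw [map_one, mul_zero]; exact (hD.der _).one)
    rwa [pow_zero, Nat.cast_zero, zero_mul]
  | succ n ih =>
    have := ih.mul hX hD h
    rwa [pow_succ, Nat.cast_succ, add_mul, one_mul]

/-- At a good point `ε m` is a constant, possibly zero, times `ε w` for a unit `w`, and `D` kills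
the constant. Density gives the identity everywhere, also where `ε m` is a zero divisor. -/
lemma IsDlog.eps {U : EtIn W} {m : X.Sec U.1} {c : Γ(U.1.left, ⊤)} (h : IsDlog p D U m c) :
    D U (X.eps U.1 m) = X.eps U.1 m * c := by
  refine hX.fun_ext_etale U.1 _ _ fun y hy => ?_
  obtain ⟨T, g, t, s, w, rfl, hw, e⟩ := hy.exists_decomp m
  refine ⟨T, g, t, rfl, ?_⟩
  obtain ⟨r, hr⟩ := exists_eps_pullB p T s
  refine (hD.res (U.of g) U g _).trans ?_
  rw [map_mul, ← LogScheme.eps_res, e, map_mul, hr]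
  refine ((hD.der _).leibniz _ _).trans ?_
  rw [hD.const, mul_zero, add_zero, h T g s w hw e, RingHom.id_apply, mul_assoc]

omit hD in
lemma IsDlog.of_etale {U : EtIn W} {m : X.Sec U.1} {c : Γ(U.1.left, ⊤)}
    (hD : IsEtaleDer p.base W D)
    (H : ∀ y : U.1.left, ∃ (T : X.toScheme.Etale) (h : T ⟶ U.1) (t : T.left), h.left t = y ∧
      IsDlog p D (U.of h) (X.res h m) (h.left.appTop c)) : IsDlog p D U m c := by
  refine hD.isDlog_of hX fun y hy => ?_
  obtain ⟨T, h, t, rfl, hc⟩ := H y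
  rw [etHom_left] at hy
  obtain ⟨T', g, t', s, w, rfl, hw, e⟩ := hy.exists_decomp (X.res h m)
  refine ⟨T', g ≫ h, t', s, w, rfl, hw, ?_, ?_⟩
  · rw [LogScheme.res_comp, e]
  · rw [left_appTop_comp]
    exact hc T' g s w hw e

/-- Logarithmic derivatives are unique and can be recognized étale locally, so local ones glue. -/
lemma exists_isDlog (H : ∀ (U : EtIn W) (m : X.Sec U.1) (y : U.1.left),
      ∃ (T : X.toScheme.Etale) (h : T ⟶ U.1) (t : T.left), h.left t = y ∧
        ∃ c, IsDlog p D (U.of h) (X.res h m) c) (U : EtIn W) (m : X.Sec U.1) :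
    ∃ c, IsDlog p D U m c := by
  obtain ⟨c, hc⟩ := exists_fun_of_etale_local U.1
    (fun T h c => IsDlog p D (U.of h) (X.res h m) c) (fun T h c hc T' g => by
      rw [LogScheme.res_comp]; exact hc.res g) (fun T h c c' hc hc' => hc.unique hX hc')
    (H U m) (fun T h c hc => IsDlog.of_etale hX hD fun t => by
      obtain ⟨T', g, t', e, h'⟩ := hc t
      rw [LogScheme.res_comp] at h'
      exact ⟨T', g, t', e, h'⟩)
  exact ⟨c, by rwa [LogScheme.res_id] at hc⟩

omit hX hD in
/-- Étale schemes over `Spec k` are étale locally trivial. -/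
lemma exists_section (U : X.toScheme.Etale) (T : (Spec (.of k)).Etale) (g : U.left ⟶ T.left)
    (hg : g ≫ etHom T = etHom U ≫ p.base) (y : U.left) :
    ∃ (l : etTop (Spec (.of k)) ⟶ T) (U' : X.toScheme.Etale) (h : U' ⟶ U) (y' : U'.left),
      h.left y' = y ∧ h.left ≫ g = (etHom U' ≫ p.base) ≫ l.left := by
  have : Etale (etHom T) := T.prop
  have hs : Subsingleton (Spec (CommRingCat.of k)) := inferInstanceAs (Subsingleton (PrimeSpectrum k))
  -- `k` is separably closed, so the étale scheme `T` has a section through `g y`.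
  obtain ⟨l, hl, hl'⟩ := Scheme.exists_fac_of_etale_of_isSepClosed (etHom T) (𝟙 (Spec (.of k))) (g y)
    (Subsingleton.elim _ _)
  have : Etale l := by
    have h1 : Etale (l ≫ etHom T) := by rw [hl]; infer_instance
    exact MorphismProperty.of_postcomp (W := @Etale) (W' := @Etale) l (etHom T) ‹_› h1
  let l' : etTop (Spec (.of k)) ⟶ T := MorphismProperty.Over.homMk l hl trivial
  obtain ⟨y', h1, h2⟩ := Scheme.Pullback.exists_preimage_pullback (f := g) (g := l) y default hl'.symm
  let U' : X.toScheme.Etale := Scheme.Etale.mk (pullback.fst g l ≫ etHom U)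
  refine ⟨l', U', MorphismProperty.Over.homMk (pullback.fst g l) rfl trivial, y', h1, ?_⟩
  refine pullback.condition.trans (congrArg (· ≫ l) ?_)
  have h3 : pullback.snd g l = pullback.snd g l ≫ l ≫ etHom T := by
    rw [hl]; exact (Category.comp_id _).symm
  rw [h3, ← Category.assoc, ← pullback.condition, Category.assoc, hg]
  exact (Category.assoc _ _ _).symm

/-- A derivation of the structure sheaf which has logarithmic derivatives étale locally is a
logarithmic derivation. -/
lemma exists_logDerivation (H : ∀ (U : EtIn W) (m : X.Sec U.1) (y : U.1.left),
      ∃ (T : X.toScheme.Etale) (h : T ⟶ U.1) (t : T.left), h.left t = y ∧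
        ∃ c, IsDlog p D (U.of h) (X.res h m) c) :
    ∃ δ : logDerivations p W, ∀ U a, (δ.1 U).1 a = D U a := by
  choose L hL using exists_isDlog hX hD H
  refine ⟨⟨fun U => (D U, L U), ⟨hD.res, fun U => (hD.der U).add, fun U a b => (hD.der U).leibniz a b,
    fun U T g hg s => ?_, fun U V h m => ?_, fun U m n => ?_, fun U m => (hL U m).eps hX hD,
    fun U T g hg m => ?_⟩⟩, fun U a => rfl⟩
  · refine fun_ext_etale _ _ fun y => ?_
    -- After refinement `g` factors through a section of `T` over `Spec k`, so functions on `T`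
    -- become constants.
    obtain ⟨l, U', h, y', rfl, e⟩ := exists_section U.1 T g hg y
    refine ⟨U', h, y', rfl, ?_⟩
    refine (hD.res (U.of h) U h _).trans ?_
    have e1 : h.left.appTop (g.appTop s) = (etHom U' ≫ p.base).appTop (l.left.appTop s) := by
      have : ∀ (g' : U'.left ⟶ T.left), g' = (etHom U' ≫ p.base) ≫ l.left →
          g'.appTop s = (etHom U' ≫ p.base).appTop (l.left.appTop s) := by
        rintro _ rfl
        rw [Scheme.Hom.comp_appTop]; rfl
      refine Eq.trans ?_ (this _ e)
      rw [Scheme.Hom.comp_appTop]; rfl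
    rw [e1, map_zero]
    refine Eq.trans (congrArg (D _) ?_) (hD.const (U.of h) ((Scheme.ΓSpecIso (.of k)).hom (l.left.appTop s)))
    refine congrArg (etHom U' ≫ p.base).appTop ?_
    exact (ConcreteCategory.congr_hom (Scheme.ΓSpecIso (.of k)).hom_inv_id (l.left.appTop s)).symm
  · exact IsDlog.unique hX ((hL V m).res h) (hL U (X.res h m))
  · exact (hL U (m * n)).unique hX ((hL U m).mul hX hD (hL U n))
  · refine fun_ext_etale _ _ fun y => ?_
    obtain ⟨l, U', h, y', rfl, e⟩ := exists_section U.1 T g hg y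
    refine ⟨U', h, y', rfl, ?_⟩
    rw [map_zero]
    refine ((hL U _).res h).unique hX ?_
    have e1 := p.pull_res U.1 U' (etTop (Spec (.of k))) T h
    have h2 : (h.left ≫ g) ≫ etHom T = etHom U' ≫ p.base := by
      rw [Category.assoc, hg, ← Category.assoc, et_w]
    have e2 := p.pull_res U.1 U' T T h (𝟙 T) g hg (h.left ≫ g) h2 m
      (congrArg (h.left ≫ ·) (Category.comp_id g))
    have e3 := p.pull_res U' U' (etTop (Spec (.of k))) T (𝟙 U') l (etHom U' ≫ p.base)
      (Category.comp_id _) (h.left ≫ g) h2 m ((Category.id_comp _).trans e.symm)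
    rw [LogScheme.res_id] at e2 e3
    rw [e2, ← e3]
    exact IsDlog.pullB hX hD _ _

end EtaleDer

/-! ### Functions and derivations on open subsets of étale schemes -/

section Spread

lemma topIso_inv_rs {T : Scheme.{u}} (A : T.Opens) (a : Γ(T, ⊤)) :
    A.topIso.inv (rs le_top a) = A.ι.appTop a := by
  rw [Scheme.Opens.ι_appTop]
  change T.presheaf.map _ (T.presheaf.map _ a) = _
  rw [← ConcreteCategory.comp_apply, ← Functor.map_comp]
  rfl

end Spread

section OpenFun

lemma topIso_inv_eq_appLE {T : Scheme.{u}} (A : T.Opens) :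
    A.topIso.inv = A.ι.appLE A ⊤ A.ι_preimage_self.ge := by
  simp only [Scheme.Hom.appLE, Scheme.Opens.topIso_inv, Scheme.Opens.ι_app]
  exact (Functor.map_comp T.presheaf _ _).symm ▸ rfl

lemma topIso_inv_app {T' T : Scheme.{u}} (g : T' ⟶ T) (B : T'.Opens) (V : T.Opens)
    (g' : B.toScheme ⟶ V.toScheme) (h : g' ≫ V.ι = B.ι ≫ g) (hB : B ≤ g ⁻¹ᵁ V) (a : Γ(T, V)) :
    B.topIso.inv (g.appLE V B hB a) = g'.appTop (V.topIso.inv a) := by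
  refine ConcreteCategory.congr_hom (?_ : g.appLE V B hB ≫ B.topIso.inv = V.topIso.inv ≫ g'.appTop) a
  rw [topIso_inv_eq_appLE, topIso_inv_eq_appLE,
    Scheme.Hom.appLE_comp_appLE]
  have h1 : ∀ (f : B.toScheme ⟶ T) (hf : g' ≫ V.ι = f) (e : ⊤ ≤ f ⁻¹ᵁ V),
      f.appLE V ⊤ e = V.ι.appLE V ⊤ V.ι_preimage_self.ge ≫ g'.appTop := by
    rintro _ rfl e
    rw [← Scheme.Hom.appLE_comp_appLE g' V.ι V ⊤ ⊤ V.ι_preimage_self.ge le_top]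
    exact congrArg (_ ≫ ·) (Scheme.Hom.appLE_eq_app g')
  exact h1 _ h _

/-- Functions on an open subset of an étale scheme are the functions on the open subscheme. -/
noncomputable def openEquiv {X : Scheme.{u}} (T : X.Etale) (A : T.left.Opens) :
    Γ(T.left, A) ≃+* Γ((etOpen T A).left, ⊤) := A.topIso.symm.commRingCatIsoToRingEquiv

lemma openEquiv_rs {X : Scheme.{u}} (T : X.Etale) (A : T.left.Opens) (a : Γ(T.left, ⊤)) :
    openEquiv T A (rs le_top a) = (etOpenι T A).left.appTop a := topIso_inv_rs A a

lemma openEquiv_appLE {X : Scheme.{u}} {T T' : X.Etale} (h : T' ⟶ T) (B : T'.left.Opens) (A : T.left.Opens)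
    (h' : etOpen T' B ⟶ etOpen T A) (hh : h' ≫ etOpenι T A = etOpenι T' B ≫ h)
    (e : B ≤ h.left ⁻¹ᵁ A) (a : Γ(T.left, A)) :
    openEquiv T' B (h.left.appLE A B e a) = h'.left.appTop (openEquiv T A a) :=
  topIso_inv_app h.left B A h'.left (congrArg (fun g => g.left) hh) e a

attribute [irreducible] openEquiv

lemma exists_etOpen_map {X : Scheme.{u}} {T T' : X.Etale} (h : T' ⟶ T) (B : T'.left.Opens) (A : T.left.Opens)
    (e : B ≤ h.left ⁻¹ᵁ A) : ∃ h' : etOpen T' B ⟶ etOpen T A, h' ≫ etOpenι T A = etOpenι T' B ≫ h := by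
  refine etOpen_lift (etOpenι T' B ≫ h) A fun y => ?_
  have h1 : (etOpenι T' B ≫ h).left y = h.left (B.ι y) := Scheme.Hom.comp_apply B.ι h.left y
  exact h1 ▸ e y.2

end OpenFun

section GermDer

variable {k : Type u} [Field k] {X : Scheme.{u}} {p : X ⟶ Spec (.of k)} {W : X.Opens}
  {D : ∀ U : EtIn W, Γ(U.1.left, ⊤) → Γ(U.1.left, ⊤)}

/-- The derivation of the functions on an open subset of an étale scheme. -/
noncomputable def derOnOpen (D : ∀ U : EtIn W, Γ(U.1.left, ⊤) → Γ(U.1.left, ⊤)) (U : EtIn W)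
    (A : {A : U.1.left.Opens // A ≤ ⊤}) (a : Γ(U.1.left, A.1)) : Γ(U.1.left, A.1) :=
  (openEquiv U.1 A.1).symm (D (U.of (etOpenι U.1 A.1)) (openEquiv U.1 A.1 a))

lemma openEquiv_derOnOpen (U : EtIn W) (A : {A : U.1.left.Opens // A ≤ ⊤}) (a : Γ(U.1.left, A.1)) : 
    openEquiv U.1 A.1 (derOnOpen D U A a) = D (U.of (etOpenι U.1 A.1)) (openEquiv U.1 A.1 a) :=
  (openEquiv U.1 A.1).apply_symm_apply _

attribute [irreducible] derOnOpen

variable (hD : IsEtaleDer p W D)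
include hD

lemma IsEtaleDer.res_of (U : EtIn W) {T : X.Etale} (h : T ⟶ U.1)
    (a : Γ(U.1.left, ⊤)) : h.left.appTop (D U a) = D (U.of h) (h.left.appTop a) := hD.res (U.of h) U h a

lemma IsEtaleDer.add_of (U : EtIn W) {T : X.Etale} (h : T ⟶ U.1) (a b : Γ(T.left, ⊤)) :
    D (U.of h) (a + b) = D (U.of h) a + D (U.of h) b := (hD.der (U.of h)).add a b

lemma IsEtaleDer.leibniz_of (U : EtIn W) {T : X.Etale} (h : T ⟶ U.1) (a b : Γ(T.left, ⊤)) :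
    D (U.of h) (a * b) = a * D (U.of h) b + b * D (U.of h) a := (hD.der (U.of h)).leibniz a b

lemma IsEtaleDer.derOnOpen_appLE (U V : EtIn W) (h : U.1 ⟶ V.1) (B : {A : U.1.left.Opens // A ≤ ⊤})
    (A : {A : V.1.left.Opens // A ≤ ⊤}) (e : B.1 ≤ h.left ⁻¹ᵁ A.1) (a : Γ(V.1.left, A.1)) :
    h.left.appLE A.1 B.1 e (derOnOpen D V A a) = derOnOpen D U B (h.left.appLE A.1 B.1 e a) := by
  obtain ⟨h', hh'⟩ := exists_etOpen_map h B.1 A.1 e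
  have e1 := openEquiv_appLE h B.1 A.1 h' hh' e (derOnOpen D V A a)
  have e2 := openEquiv_appLE h B.1 A.1 h' hh' e a
  have e3 : h'.left.appTop (D (V.of (etOpenι V.1 A.1)) (openEquiv V.1 A.1 a)) =
      D (U.of (etOpenι U.1 B.1)) (h'.left.appTop (openEquiv V.1 A.1 a)) :=
    hD.res (U.of (etOpenι U.1 B.1)) (V.of (etOpenι V.1 A.1)) h' _
  have e4 := openEquiv_derOnOpen (D := D) V A a
  have e5 := openEquiv_derOnOpen (D := D) U B (h.left.appLE A.1 B.1 e a)
  refine (openEquiv U.1 B.1).injective ?_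
  exact e1.trans ((congrArg h'.left.appTop e4).trans (e3.trans
    ((congrArg (D (U.of (etOpenι U.1 B.1))) e2).symm.trans e5.symm)))

lemma IsEtaleDer.derOnOpen_rs (U : EtIn W) (A B : {A : U.1.left.Opens // A ≤ ⊤}) (e : B.1 ≤ A.1)
    (a : Γ(U.1.left, A.1)) : rs e (derOnOpen D U A a) = derOnOpen D U B (rs e a) := by
  have h1 := hD.derOnOpen_appLE U U (𝟙 U.1) B A e a
  have h2 : ∀ b, (𝟙 U.1 : U.1 ⟶ U.1).left.appLE A.1 B.1 e b = rs e b := fun b => by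
    have h3 : (𝟙 U.1.left : U.1.left ⟶ U.1.left).appLE A.1 B.1 e =
      U.1.left.presheaf.map (homOfLE e).op := by
      simp only [Scheme.Hom.appLE, Scheme.Hom.id_app]; exact Category.id_comp _
    exact ConcreteCategory.congr_hom h3 b
  rwa [h2, h2] at h1

lemma IsEtaleDer.derOnOpen_top (U : EtIn W) (A : {A : U.1.left.Opens // A ≤ ⊤}) (a : Γ(U.1.left, ⊤)) :
    derOnOpen D U A (rs A.2 a) = rs A.2 (D U a) := by
  refine (openEquiv U.1 A.1).injective ?_
  have e1 := openEquiv_derOnOpen (D := D) U A (rs A.2 a)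
  have e2 := openEquiv_rs U.1 A.1 a
  have e3 := openEquiv_rs U.1 A.1 (D U a)
  have e4 := hD.res_of U (etOpenι U.1 A.1) a
  exact e1.trans ((congrArg (D (U.of (etOpenι U.1 A.1))) e2).trans (e4.symm.trans e3.symm))

lemma IsEtaleDer.isDerAlong_derOnOpen (U : EtIn W) (A : {A : U.1.left.Opens // A ≤ ⊤}) :
    IsDerAlong (RingHom.id _) (derOnOpen D U A) := by
  refine ⟨fun a b => (openEquiv U.1 A.1).injective ?_, fun a b => (openEquiv U.1 A.1).injective ?_⟩
  · have e1 := hD.add_of U (etOpenι U.1 A.1) (openEquiv U.1 A.1 a) (openEquiv U.1 A.1 b)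
    have e2 := openEquiv_derOnOpen (D := D) U A (a + b)
    refine e2.trans ((congrArg _ (map_add (openEquiv U.1 A.1) a b)).trans (e1.trans
      (Eq.trans ?_ (map_add (openEquiv U.1 A.1) _ _).symm)))
    exact congrArg₂ (· + ·) (openEquiv_derOnOpen U A a).symm (openEquiv_derOnOpen U A b).symm
  · have e1 := hD.leibniz_of U (etOpenι U.1 A.1) (openEquiv U.1 A.1 a) (openEquiv U.1 A.1 b)
    have e2 := openEquiv_derOnOpen (D := D) U A (a * b)
    refine e2.trans ((congrArg _ (map_mul (openEquiv U.1 A.1) a b)).trans (e1.trans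
      (Eq.trans ?_ (map_add (openEquiv U.1 A.1) _ _).symm)))
    refine congrArg₂ (· + ·) (Eq.trans ?_ (map_mul (openEquiv U.1 A.1) _ _).symm)
      (Eq.trans ?_ (map_mul (openEquiv U.1 A.1) _ _).symm)
    · exact congrArg (_ * ·) (openEquiv_derOnOpen U A b).symm
    · exact congrArg (_ * ·) (openEquiv_derOnOpen U A a).symm

/-- The derivation of the local ring of an étale scheme. -/
lemma IsEtaleDer.exists_isGermOf (U : EtIn W) (y : U.1.left) :
    ∃ E, IsGermOf (derOnOpen D U) y E := 
  _root_.exists_isGermOf (fun V V' h a => hD.derOnOpen_rs U V V' h a) y trivial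

lemma IsEtaleDer.germ_eq {U : EtIn W} {y : U.1.left} {E} (hE : IsGermOf (derOnOpen D U) y E)
    (a : Γ(U.1.left, ⊤)) : U.1.left.presheaf.germ ⊤ y trivial (D U a) =
      E (U.1.left.presheaf.germ ⊤ y trivial a) := by
  have h1 := hE ⟨⊤, le_rfl⟩ trivial (rs le_rfl a)
  rw [hD.derOnOpen_top U ⟨⊤, le_rfl⟩] at h1
  rw [rs_self] at h1
  refine Eq.trans ?_ h1.symm
  rw [rs_self]

lemma IsEtaleDer.isDerAlong {U : EtIn W} {y : U.1.left} {E} (hE : IsGermOf (derOnOpen D U) y E) :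
    IsDerAlong (RingHom.id _) E := by
  refine ⟨fun r s => ?_, fun r s => ?_⟩
  · obtain ⟨V, hV, h, a, b, rfl, rfl⟩ := exists_common_germs (W := ⊤) trivial r s
    rw [← map_add, hE ⟨V, hV⟩ h, hE ⟨V, hV⟩ h, hE ⟨V, hV⟩ h, (hD.isDerAlong_derOnOpen _ _).add, map_add]
  · obtain ⟨V, hV, h, a, b, rfl, rfl⟩ := exists_common_germs (W := ⊤) trivial r s
    rw [← map_mul, hE ⟨V, hV⟩ h, hE ⟨V, hV⟩ h, hE ⟨V, hV⟩ h, (hD.isDerAlong_derOnOpen _ _).leibniz, map_add, map_mul, map_mul]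
    rfl

lemma IsEtaleDer.const_germ {U : EtIn W} {y : U.1.left} {E} (hE : IsGermOf (derOnOpen D U) y E) (c : k) :
    E (stalkConst (etHom U.1 ≫ p) y c) = 0 := by
  refine (hD.germ_eq hE _).symm.trans ?_
  rw [hD.const, map_zero]

lemma IsEtaleDer.stalkMap_comm {U V : EtIn W} (h : U.1 ⟶ V.1) {t : U.1.left} {E E'}
    (hE : IsGermOf (derOnOpen D U) t E) (hE' : IsGermOf (derOnOpen D V) (h.left t) E')
    (r : V.1.left.presheaf.stalk (h.left t)) : E (h.left.stalkMap t r) = h.left.stalkMap t (E' r) := by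
  obtain ⟨A, hA, htA, a, rfl⟩ := exists_germ_eq_of_mem (W := ⊤) trivial r
  rw [hE' ⟨A, hA⟩ htA]
  rw [← germ_appLE h.left (W := A) (B := h.left ⁻¹ᵁ A) le_rfl t htA, ← germ_appLE h.left (W := A)
    (B := h.left ⁻¹ᵁ A) le_rfl t htA, hE ⟨h.left ⁻¹ᵁ A, le_top⟩ htA,
    ← hD.derOnOpen_appLE U V h ⟨_, le_top⟩ ⟨A, hA⟩]

end GermDer

/-! ### Local existence of logarithmic derivatives -/

section LocalExistence

variable {k : Type u} [Field k] [IsAlgClosed k] {N : LogStructure (Spec (.of k))}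
  {X : LogScheme.{u}} {p : X.Hom ⟨Spec (.of k), N⟩} {W : X.toScheme.Opens}
  {D : ∀ U : EtIn W, Γ(U.1.left, ⊤) → Γ(U.1.left, ⊤)}
  (hX : IsLogCurve p) (hD : IsEtaleDer p.base W D)
include hX hD

lemma IsGood.exists_isDlog {U : EtIn W} {y : U.1.left} (hy : IsGood p (etHom U.1 y)) (m : X.Sec U.1) :
    ∃ (T : X.toScheme.Etale) (h : T ⟶ U.1) (t : T.left), h.left t = y ∧
      ∃ c, IsDlog p D (U.of h) (X.res h m) c := by
  obtain ⟨T, g, t, s, w, rfl, hw, e⟩ := hy.exists_decomp m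
  obtain ⟨c, hc⟩ := exists_isDlog_of_isUnit (U := U.of g) hX hD hw
  refine ⟨T, g, t, rfl, 0 + c, ?_⟩
  rw [e]
  exact (IsDlog.pullB hX hD (U.of g) s).mul hX hD hc

omit hX in
lemma res_eq_of_germ {T : EtIn W} {A : T.1.left.Opens} {α : X.Sec T.1} {a : Γ(T.1.left, A)}
    (h : rs le_top (D T (X.eps T.1 α)) = rs le_top (X.eps T.1 α) * a) :
    D (T.of (etOpenι T.1 A)) (X.eps _ (X.res (etOpenι T.1 A) α)) =
      X.eps _ (X.res (etOpenι T.1 A) α) * openEquiv T.1 A a := by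
  rw [LogScheme.eps_res]
  refine (hD.res (T.of (etOpenι T.1 A)) T (etOpenι T.1 A) _).symm.trans ?_
  have e2 := congrArg (openEquiv T.1 A) h
  rw [map_mul, openEquiv_rs, openEquiv_rs] at e2
  exact e2

/-- The logarithmic derivative of a section whose function is not a zero divisor. -/
lemma isDlog_of_mem_nonZeroDivisors {T : EtIn W} {γ : X.Sec T.1} {a : Γ(T.1.left, ⊤)}
    (hγ : ∀ t, T.1.left.presheaf.germ ⊤ t trivial (X.eps T.1 γ) ∈ (T.1.left.presheaf.stalk t)⁰)
    (e : D T (X.eps T.1 γ) = X.eps T.1 γ * a) : IsDlog p D T γ a := by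
  refine hD.isDlog_of hX fun y hy => ?_
  obtain ⟨T', g, t', s, w, rfl, hw, e3⟩ := hy.exists_decomp γ
  refine ⟨T', g, t', s, w, rfl, hw, e3, ?_⟩
  obtain ⟨c, hc⟩ := exists_eps_pullB p T' s
  have e4 := hD.res_of T g (X.eps _ γ)
  rw [e, map_mul, ← LogScheme.eps_res, e3, map_mul, hc] at e4
  have e5 := hD.leibniz_of T g (specFun (etHom T' ≫ p.base) c) (X.eps T' w)
  have e6 := hD.const (T.of g) c
  rw [e6, mul_zero, add_zero] at e5
  -- If the base factor had value zero, so would `ε γ`, which is a non-zero-divisor at every point.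
  have hc0 : c ≠ 0 := by
    rintro rfl
    have hl := isEtaleLocal_stalkMap g.left t'
    refine nonZeroDivisors.ne_zero (RingHom.Flat.map_mem_nonZeroDivisors hl.flat (hγ (g.left t'))) ?_
    refine (germ_left g t' _).symm.trans ?_
    have e6 : g.left.appTop (X.eps T.1 γ) = 0 := by
      rw [← LogScheme.eps_res, e3, map_mul, hc, map_zero, zero_mul]
    exact (congrArg _ e6).trans (map_zero _)
  have hcu : IsUnit (specFun (etHom T' ≫ p.base) c) := (isUnit_iff_ne_zero.2 hc0).map _
  refine hcu.mul_left_cancel ?_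
  exact e5.symm.trans (e4.symm.trans (mul_assoc _ _ _))

/-- A non-zero-divisor germ stays one nearby and the equation in the stalk holds on a neighbourhood,
where a function with germ `r` is the logarithmic derivative. -/
lemma exists_isDlog_of_mem_nonZeroDivisors {T : EtIn W} {t : T.1.left} {γ : X.Sec T.1}
    [IsLocallyNoetherian T.1.left] (hγ : T.1.left.presheaf.germ ⊤ t trivial (X.eps T.1 γ) ∈
      (T.1.left.presheaf.stalk t)⁰) {r : T.1.left.presheaf.stalk t}
    (hr : T.1.left.presheaf.germ ⊤ t trivial (D T (X.eps T.1 γ)) =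
      T.1.left.presheaf.germ ⊤ t trivial (X.eps T.1 γ) * r) :
    ∃ (T' : X.toScheme.Etale) (h : T' ⟶ T.1) (t' : T'.left), h.left t' = t ∧
      ∃ c, IsDlog p D (T.of h) (X.res h γ) c := by
  obtain ⟨A1, -, ht1, hA1⟩ := exists_opens_germ_mem_nonZeroDivisors t (V := ⊤) trivial _ hγ
  obtain ⟨A2, hA2, ht2, a, rfl⟩ := exists_germ_eq_of_mem ht1 r
  have e : T.1.left.presheaf.germ A2 t ht2 (rs le_top (D T (X.eps T.1 γ))) =
      T.1.left.presheaf.germ A2 t ht2 (rs le_top (X.eps T.1 γ) * a) := by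
    rw [map_mul, germ_rs, germ_rs, hr]
  obtain ⟨A, ht, i, j, e⟩ := T.1.left.presheaf.germ_eq t ht2 ht2 _ _ e
  have e1 : rs (le_top : A ≤ ⊤) (D T (X.eps T.1 γ)) = rs le_top (X.eps T.1 γ) * rs i.le a := by
    have := e
    change rs i.le _ = rs i.le _ at this
    rwa [rs_rs, map_mul, rs_rs] at this
  refine ⟨_, etOpenι T.1 A, ⟨t, ht⟩, rfl, openEquiv T.1 A (rs i.le a),
    isDlog_of_mem_nonZeroDivisors hX hD (fun t' => ?_) (res_eq_of_germ hD e1)⟩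
  have hl := isEtaleLocal_stalkMap (etOpenι T.1 A).left t'
  refine (LogScheme.eps_res (etOpenι T.1 A) γ).symm ▸ (germ_left (etOpenι T.1 A) t' _).symm ▸ ?_
  exact RingHom.Flat.map_mem_nonZeroDivisors hl.flat (hA1 t'.1 trivial (hA2 (i.le t'.2)))

omit hX hD in
lemma exists_appTop_isUnit {T : X.toScheme.Etale} {y : T.left} {a : Γ(T.left, ⊤)}
    (h : y ∈ T.left.basicOpen a) :
    ∃ (T' : X.toScheme.Etale) (g : T' ⟶ T) (t' : T'.left), g.left t' = y ∧
      IsUnit (g.left.appTop a) := by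
  refine ⟨_, etOpenι T (T.left.basicOpen a), ⟨y, h⟩, rfl, ?_⟩
  have h1 := (T.left.toRingedSpace.isUnit_res_basicOpen a).map (T.left.basicOpen a).topIso.inv.hom
  refine (congrArg IsUnit ?_).mp h1
  exact topIso_inv_rs _ a

/-- The logarithmic derivatives of the sections corresponding to the two branches of a node. -/
lemma isDlog_branch {T : EtIn W} {t : T.1.left} {α β w₀ : X.Sec T.1} {s₀ : BaseMonoid N}
    {a b e : Γ(T.1.left, ⊤)} (hw₀ : IsUnit w₀) (hαβ : α * β = pullB p T.1 s₀ * w₀)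
    (hα : D T (X.eps T.1 α) = X.eps T.1 α * a) (hβ : D T (X.eps T.1 β) = X.eps T.1 β * b)
    (he : D T (X.eps T.1 w₀) = X.eps T.1 w₀ * e) (hab : a + b = e)
    (hne : ∀ y : T.1.left, y ≠ t → y ∈ T.1.left.basicOpen (X.eps T.1 α) ∨
      y ∈ T.1.left.basicOpen (X.eps T.1 β))
    (h0 : T.1.left.presheaf.germ ⊤ t trivial (X.eps T.1 α) ≠ 0)
    (hu : ¬ IsUnit (T.1.left.presheaf.germ ⊤ t trivial (X.eps T.1 α))) :
    IsDlog p D T α a := by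
  refine hD.isDlog_of hX fun y hy => ?_
  by_cases hyt : y = t
  -- `t` is not a good point: otherwise the germ of `ε α` would be a constant times a unit, hence
  -- zero or a unit.
  · exfalso
    subst hyt
    obtain ⟨T', g, t', s, w, rfl, hw, e1⟩ := hy.exists_decomp α
    obtain ⟨c, hc⟩ := exists_eps_pullB p T' s
    have hl := isEtaleLocal_stalkMap g.left t'
    have e2 : g.left.stalkMap t' (T.1.left.presheaf.germ ⊤ (g.left t') trivial (X.eps T.1 α)) =
        T'.left.presheaf.germ ⊤ t' trivial (specFun (etHom T' ≫ p.base) c * X.eps T' w) := by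
      rw [← hc, ← map_mul, ← e1, LogScheme.eps_res]
      exact (germ_left g t' _).symm
    by_cases hc0 : c = 0
    · refine h0 (injective_of_flat_of_isLocalHom hl.flat hl.isLocalHom ?_)
      refine e2.trans ?_
      rw [hc0, map_zero, zero_mul, map_zero]
      exact (map_zero _).symm
    · have := hl.isLocalHom
      refine hu (isUnit_of_map_unit (g.left.stalkMap t').hom _ ?_)
      refine e2 ▸ IsUnit.map _ ?_
      exact ((isUnit_iff_ne_zero.2 hc0).map _).mul (hw.map _)
  rcases hne y hyt with h | h
  · obtain ⟨T', g, t', rfl, h'⟩ := exists_appTop_isUnit h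
    rw [← LogScheme.eps_res] at h'
    refine ⟨T', g, t', 1, X.res g α, rfl, LogScheme.isUnit_of_isUnit_eps h', by simp, ?_⟩
    rw [LogScheme.eps_res]
    refine (hD.res (T.of g) T g _).symm.trans ?_
    rw [hα, map_mul]
  -- Where `β` is invertible, `α = s₀ w₀ β⁻¹` has logarithmic derivative `e - b = a`.
  · obtain ⟨T', g, t', rfl, h'⟩ := exists_appTop_isUnit h
    rw [← LogScheme.eps_res] at h'
    obtain ⟨β', hβ'⟩ := (LogScheme.isUnit_of_isUnit_eps h').exists_right_inv
    have hβ'u : IsUnit β' := IsUnit.of_mul_eq_one (X.res g β) (by rw [mul_comm, hβ'])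
    refine ⟨T', g, t', s₀, X.res g w₀ * β', rfl, (hw₀.map _).mul hβ'u, ?_, ?_⟩
    · rw [← mul_assoc, ← res_pullB p g, ← map_mul, ← hαβ, map_mul, mul_assoc, hβ', mul_one]
    · have e1 : X.eps T' (X.res g w₀) = X.eps T' (X.res g w₀ * β') * X.eps T' (X.res g β) := by
        rw [← map_mul, mul_assoc, mul_comm β', hβ', mul_one]
      set z := X.eps T' (X.res g w₀ * β')
      have e2 : D (T.of g) (X.eps T' (X.res g w₀)) = X.eps T' (X.res g w₀) * g.left.appTop e := by
        rw [LogScheme.eps_res]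
        refine (hD.res (T.of g) T g _).symm.trans ?_
        rw [he, map_mul]
      have e3 : D (T.of g) (X.eps T' (X.res g β)) = X.eps T' (X.res g β) * g.left.appTop b := by
        rw [LogScheme.eps_res]
        refine (hD.res (T.of g) T g _).symm.trans ?_
        rw [hβ, map_mul]
      rw [e1] at e2
      have e4 := hD.leibniz_of T g z (X.eps T' (X.res g β))
      rw [e3, e2, ← hab, map_add] at e4
      refine (h'.mul_left_cancel ?_)
      linear_combination -e4

end LocalExistence

section LocalExistenceMarked

variable {k : Type u} [Field k] [IsAlgClosed k] {N : LogStructure (Spec (.of k))}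
  {X : LogScheme.{u}} {p : X.Hom ⟨Spec (.of k), N⟩} {W : X.toScheme.Opens}
  {D : ∀ U : EtIn W, Γ(U.1.left, ⊤) → Γ(U.1.left, ⊤)}
  (hX : IsLogCurve p) (hD : IsEtaleDer p.base W D)

/-- A common refinement of two étale neighbourhoods of a geometric point. -/
lemma LogScheme.exists_refinement {Ω : Type u} [Field Ω] [IsAlgClosed Ω]
    {x : Spec (.of Ω) ⟶ X.toScheme} {U V : X.toScheme.Etale} (l : X.Lift x U) (l' : X.Lift x V) :
    ∃ (T : X.toScheme.Etale) (f : T ⟶ U) (g : T ⟶ V) (m : X.Lift x T), m.map f = l ∧ m.map g = l' := by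
  let a : (Scheme.pointSmallEtale x).fiber.Elements := ⟨U, l⟩
  let b : (Scheme.pointSmallEtale x).fiber.Elements := ⟨V, l'⟩
  exact ⟨_, (IsCofiltered.minToLeft a b).1, (IsCofiltered.minToRight a b).1, (IsCofiltered.min a b).2,
    (IsCofiltered.minToLeft a b).2, (IsCofiltered.minToRight a b).2⟩

lemma charGerm_res {Ω : Type u} [Field Ω] [IsAlgClosed Ω] {x : Spec (.of Ω) ⟶ X.toScheme}
    {U V : X.toScheme.Etale} (g : U ⟶ V) (l : X.Lift x U) (m : X.Sec V) :
    charGerm x U l (X.res g m) = charGerm x V (l.map g) m :=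
  congrArg Associates.mk (LogScheme.germ_res g l m)

lemma charGerm_mul {Ω : Type u} [Field Ω] [IsAlgClosed Ω] {x : Spec (.of Ω) ⟶ X.toScheme}
    {U : X.toScheme.Etale} (l : X.Lift x U) (m n : X.Sec U) :
    charGerm x U l (m * n) = charGerm x U l m * charGerm x U l n := by
  rw [charGerm, map_mul]; rfl

lemma charGerm_pow {Ω : Type u} [Field Ω] [IsAlgClosed Ω] {x : Spec (.of Ω) ⟶ X.toScheme}
    {U : X.toScheme.Etale} (l : X.Lift x U) (m : X.Sec U) (n : ℕ) :
    charGerm x U l (m ^ n) = charGerm x U l m ^ n := by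
  rw [charGerm, map_pow]; exact Associates.mk_pow _ _

lemma charGerm_pullB {Ω : Type u} [Field Ω] [IsAlgClosed Ω] {x : Spec (.of Ω) ⟶ X.toScheme}
    {U : X.toScheme.Etale} (l : X.Lift x U) (s : BaseMonoid N) :
    charGerm x U l (pullB p U s) = baseToChar p x (Associates.mk s) := by
  rw [charGerm, germ_pullB, baseToChar_mk]

include hX hD

/-- The base and `γ` generate the characteristic monoid, so étale locally `m = s γ ^ i w` and only
`γ` needs attention. Its function generates the maximal ideal, which `D` preserves by `hT`; so `D (ε
γ)` is a multiple of `ε γ`. -/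
lemma IsMarkedAt.exists_isDlog {Ω : Type u} [Field Ω] [IsAlgClosed Ω] {x : Spec (.of Ω) ⟶ X.toScheme}
    (hx : IsMarkedAt p x)
    (hT : ∀ (U : EtIn W) (y : U.1.left), etHom U.1 y = x default → ∀ a : Γ(U.1.left, ⊤),
      ¬ IsUnit (U.1.left.presheaf.germ ⊤ y trivial a) →
        ¬ IsUnit (U.1.left.presheaf.germ ⊤ y trivial (D U a)))
    {U : EtIn W} {y : U.1.left} (hy : etHom U.1 y = x default) (m : X.Sec U.1) :
    ∃ (T : X.toScheme.Etale) (h : T ⟶ U.1) (t : T.left), h.left t = y ∧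
      ∃ c, IsDlog p D (U.of h) (X.res h m) c := by
  obtain ⟨hs, U0, l0, γ, hγ, -, hsurj⟩ := hx
  obtain ⟨l, rfl⟩ := LogScheme.exists_lift U.1 y hy
  obtain ⟨V, v, hv, hV⟩ := hs.exists_isLocallyNoetherian
  obtain ⟨lV, rfl⟩ := LogScheme.exists_lift V v hv
  obtain ⟨T1, f1, g1, l1, rfl, rfl⟩ := LogScheme.exists_refinement l l0
  obtain ⟨T2, f2, g2, l2, rfl, rfl⟩ := LogScheme.exists_refinement l1 lV
  obtain ⟨⟨s, i⟩, hsi⟩ := hsurj (charGerm x T2 l2 (X.res (f2 ≫ f1) m))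
  obtain ⟨s, rfl⟩ := Associates.mk_surjective s
  have hsi' : charGerm x T2 l2 (X.res (f2 ≫ f1) m) =
      charGerm x T2 l2 (pullB p T2 s * X.res (f2 ≫ g1) γ ^ i) := by
    rw [charGerm_mul, charGerm_pow, charGerm_pullB, charGerm_res (f2 ≫ g1)]
    simp only [LogScheme.Lift.map, Functor.map_comp]
    exact hsi.symm
  obtain ⟨T3, f3, l3, w, rfl, hw, e⟩ := LogScheme.exists_unit_of_charGerm_eq hsi'
  let T : EtIn W := U.of (f3 ≫ f2 ≫ f1)
  have hn : IsLocallyNoetherian T3.left :=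
    LocallyOfFiniteType.isLocallyNoetherian (f3 ≫ g2).left
  let b := f3 ≫ f2 ≫ g1
  have hb : (LogScheme.Lift.map g1 (LogScheme.Lift.map f2 (LogScheme.Lift.map f3 l3))).pt =
      b.left l3.pt := rfl
  have hl := isEtaleLocal_stalkMap b.left l3.pt
  have hs' : IsSmoothPoint p.base (etHom U0 (b.left l3.pt)) := by
    rw [etHom_left, LogScheme.Lift.etHom_pt]; exact hs
  have hcr := hs'.of_etale
  have := hcr.isDomain
  obtain ⟨hγ0, hγm⟩ : T3.left.presheaf.germ ⊤ l3.pt trivial (X.eps T3 (X.res b γ)) ∈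
      (T3.left.presheaf.stalk l3.pt)⁰ ∧ Ideal.span {T3.left.presheaf.germ ⊤ l3.pt trivial
        (X.eps T3 (X.res b γ))} = maximalIdeal (T3.left.presheaf.stalk l3.pt) := by
    rw [LogScheme.eps_res, germ_left]
    refine ⟨RingHom.Flat.map_mem_nonZeroDivisors hl.flat (mem_nonZeroDivisors_of_ne_zero hγ.1), ?_⟩
    rw [← hl.map_maximalIdeal]
    refine Eq.trans ?_ (congrArg (Ideal.map (b.left.stalkMap l3.pt).hom) hγ.2)
    refine Eq.trans ?_ (Ideal.map_span _ _).symm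
    exact congrArg Ideal.span Set.image_singleton.symm
  have hn1 : ¬ IsUnit (T3.left.presheaf.germ ⊤ l3.pt trivial (X.eps T3 (X.res b γ))) :=
    hγm.le (Ideal.mem_span_singleton_self _)
  have hn2 := hT T l3.pt (LogScheme.Lift.etHom_pt l3) _ hn1
  obtain ⟨r, hr⟩ := Ideal.mem_span_singleton.1
    (hγm.ge (show _ ∈ maximalIdeal (T3.left.presheaf.stalk l3.pt) from hn2))
  obtain ⟨T', h, t', ht', c, hc⟩ := exists_isDlog_of_mem_nonZeroDivisors (T := T) hX hD hγ0 hr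
  obtain ⟨c', hc'⟩ := exists_isDlog_of_isUnit (U := T) hX hD hw
  refine ⟨T', h ≫ f3 ≫ f2 ≫ f1, t', ?_, (0 + (i : ℕ) * c) + h.left.appTop c', ?_⟩
  rotate_left
  · have h1 := ((IsDlog.pullB hX hD (T.of h) s).mul hX hD (hc.pow hX hD i)).mul hX hD (hc'.res h)
    have h2 : X.res (h ≫ f3 ≫ f2 ≫ f1) m = pullB p T' s * X.res h (X.res b γ) ^ i * X.res h w := by
      have e1 : X.res f3 (pullB p T2 s * X.res (f2 ≫ g1) γ ^ i) = pullB p T3 s * X.res b γ ^ i :=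
        (map_mul _ _ _).trans (congrArg₂ (· * ·) (res_pullB p f3 s) ((map_pow _ _ _).trans
          (congrArg (· ^ i) (LogScheme.res_comp f3 (f2 ≫ g1) γ).symm)))
      have e2 : X.res h (pullB p T3 s * X.res b γ ^ i) = pullB p T' s * X.res h (X.res b γ) ^ i :=
        (map_mul _ _ _).trans (congrArg₂ (· * ·) (res_pullB p h s) (map_pow _ _ _))
      rw [LogScheme.res_comp, LogScheme.res_comp, e, e1, map_mul, e2]
    rw [h2]
    exact h1
  · change (f3 ≫ f2 ≫ f1).left (h.left t') = _
    rw [ht']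
    rfl

end LocalExistenceMarked

section LocalExistenceNodal

variable {k : Type u} [Field k] [IsAlgClosed k] {N : LogStructure (Spec (.of k))}
  {X : LogScheme.{u}} {p : X.Hom ⟨Spec (.of k), N⟩} {W : X.toScheme.Opens}
  {D : ∀ U : EtIn W, Γ(U.1.left, ⊤) → Γ(U.1.left, ⊤)}
  (hX : IsLogCurve p) (hD : IsEtaleDer p.base W D)

/-- The logarithmic structure of a nodal curve in a chart at a geometric node. -/
structure IsNodalChart {Ω : Type u} [Field Ω] [IsAlgClosed Ω] {x : Spec (.of Ω) ⟶ X.toScheme}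
    {U : X.toScheme.Etale} (l : X.Lift x U) (c : NodeChart p.base U l.pt) (α β : X.Sec U) : Prop where
  eps_left : X.eps U α = c.coord 0
  eps_right : X.eps U β = c.coord 1
  exists_decomp : ∀ z : X.CharStalk x, ∃ (s : BaseMonoid N) (i j : ℕ),
    z = baseToChar p x (Associates.mk s) * charGerm x U l α ^ i * charGerm x U l β ^ j
  exists_mul : ∃ s : BaseMonoid N,
    charGerm x U l α * charGerm x U l β = baseToChar p x (Associates.mk s)

/-- From the presentation of the characteristic monoid only generation and the relation between `α`
and `β` are kept. -/
lemma IsNodalAt.exists_isNodalChart {Ω : Type u} [Field Ω] [IsAlgClosed Ω]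
    {x : Spec (.of Ω) ⟶ X.toScheme} (hx : IsNodalAt p x) :
    ∃ (U : X.toScheme.Etale) (l : X.Lift x U) (c : NodeChart p.base U l.pt) (α β : X.Sec U),
      IsNodalChart l c α β := by
  obtain ⟨U, l, c, α, β, δ, hα, hβ, hφ, hker⟩ := hx
  obtain ⟨s, rfl⟩ := Associates.mk_surjective δ
  refine ⟨U, l, c, α, β, hα, hβ, fun z => ?_, s, ?_⟩
  · obtain ⟨⟨s, i, j⟩, rfl⟩ := hφ z
    obtain ⟨s, rfl⟩ := Associates.mk_surjective s
    exact ⟨s, i.toAdd, j.toAdd, (mul_assoc _ _ _).symm⟩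
  · have h1 := (Con.ker_rel _).1 (hker.ge (ConGen.Rel.of _ _ ⟨rfl, rfl⟩))
    simpa using h1

lemma eps_res_eq_coord {U T : X.toScheme.Etale} (h : T ⟶ U) {y : U.left} {t : T.left} (ht : h.left t = y)
    {c : NodeChart p.base U y} {i : Fin 2} {α : X.Sec U} (e : X.eps U α = c.coord i) :
    X.eps T (X.res h α) = (c.comp h t ht).coord i :=
  (LogScheme.eps_res h α).trans ((congrArg h.left.appTop e).trans (NodeChart.comp_coord c h t ht i).symm)

lemma IsNodalChart.comp {Ω : Type u} [Field Ω] [IsAlgClosed Ω] {x : Spec (.of Ω) ⟶ X.toScheme}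
    {U T : X.toScheme.Etale} {h : T ⟶ U} {l : X.Lift x T} {c : NodeChart p.base U (l.map h).pt}
    {α β : X.Sec U} (hc : IsNodalChart (l.map h) c α β) :
    IsNodalChart l (c.comp h l.pt rfl) (X.res h α) (X.res h β) := by
  refine ⟨?_, ?_, fun z => ?_, ?_⟩
  · exact eps_res_eq_coord h rfl hc.eps_left
  · exact eps_res_eq_coord h rfl hc.eps_right
  · rw [charGerm_res, charGerm_res]; exact hc.exists_decomp z
  · rw [charGerm_res, charGerm_res]; exact hc.exists_mul


lemma IsNodalChart.exists_res_eq {Ω : Type u} [Field Ω] [IsAlgClosed Ω] {x : Spec (.of Ω) ⟶ X.toScheme}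
    {U : X.toScheme.Etale} {l : X.Lift x U} {c : NodeChart p.base U l.pt} {α β : X.Sec U}
    (hc : IsNodalChart l c α β) (m : X.Sec U) :
    ∃ (T : X.toScheme.Etale) (h : T ⟶ U) (l' : X.Lift x T) (s : BaseMonoid N) (i j : ℕ) (w : X.Sec T),
      l'.map h = l ∧ IsUnit w ∧ X.res h m = pullB p T s * X.res h α ^ i * X.res h β ^ j * w := by
  obtain ⟨s, i, j, e⟩ := hc.exists_decomp (charGerm x U l m)
  have e' : charGerm x U l m = charGerm x U l (pullB p U s * α ^ i * β ^ j) := by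
    rw [charGerm_mul, charGerm_mul, charGerm_pow, charGerm_pow, charGerm_pullB]; exact e
  obtain ⟨T, h, l', w, rfl, hw, e⟩ := LogScheme.exists_unit_of_charGerm_eq e'
  refine ⟨T, h, l', s, i, j, w, rfl, hw, e.trans (congrArg (· * w) ?_)⟩
  rw [map_mul, map_mul, map_pow, map_pow, res_pullB]

lemma IsNodalChart.exists_mul_eq {Ω : Type u} [Field Ω] [IsAlgClosed Ω] {x : Spec (.of Ω) ⟶ X.toScheme}
    {U : X.toScheme.Etale} {l : X.Lift x U} {c : NodeChart p.base U l.pt} {α β : X.Sec U}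
    (hc : IsNodalChart l c α β) :
    ∃ (T : X.toScheme.Etale) (h : T ⟶ U) (l' : X.Lift x T) (s : BaseMonoid N) (w : X.Sec T),
      l'.map h = l ∧ IsUnit w ∧ X.res h α * X.res h β = pullB p T s * w := by
  obtain ⟨s, e⟩ := hc.exists_mul
  have e' : charGerm x U l (α * β) = charGerm x U l (pullB p U s) := by
    rw [charGerm_mul, charGerm_pullB]; exact e
  obtain ⟨T, h, l', w, rfl, hw, e⟩ := LogScheme.exists_unit_of_charGerm_eq e'
  refine ⟨T, h, l', s, w, rfl, hw, ?_⟩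
  rw [← map_mul, e, res_pullB]

include hD

/-- The logarithmic derivative of a unit vanishes at a node whose branches are preserved. -/
lemma IsEtaleDer.not_isUnit_dlog {U : EtIn W} {y : U.1.left} (c : NodeChart p.base U.1 y)
    {a b : U.1.left.presheaf.stalk y}
    (ha : U.1.left.presheaf.germ ⊤ y trivial (D U (c.coord 0)) =
      a * U.1.left.presheaf.germ ⊤ y trivial (c.coord 0))
    (hb : U.1.left.presheaf.germ ⊤ y trivial (D U (c.coord 1)) =
      b * U.1.left.presheaf.germ ⊤ y trivial (c.coord 1)) {w e : Γ(U.1.left, ⊤)} (hw : IsUnit w)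
    (he : D U w = w * e) : ¬ IsUnit (U.1.left.presheaf.germ ⊤ y trivial e) := by
  obtain ⟨E, hE⟩ := hD.exists_isGermOf U y
  have hder := hD.isDerAlong hE
  -- The residue field is `k`, so `w` is a constant plus some `f u + g v`. As `D` preserves `(u)`
  -- and `(v)`, it maps `w` into the maximal ideal.
  obtain ⟨r, hr⟩ := c.exists_sub_not_isUnit (U.1.left.presheaf.germ ⊤ y trivial w)
  have hn := c.isNodeRing
  have hloc := hn.isLocalRing
  rw [hD.germ_eq hE] at ha hb
  obtain ⟨f, g, hfg⟩ := (hn.nonunit _).1 hr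
  have h1 : E (U.1.left.presheaf.germ ⊤ y trivial w) = E f * U.1.left.presheaf.germ ⊤ y trivial (c.coord 0)
      + E g * U.1.left.presheaf.germ ⊤ y trivial (c.coord 1) +
      (f * a * U.1.left.presheaf.germ ⊤ y trivial (c.coord 0) +
        g * b * U.1.left.presheaf.germ ⊤ y trivial (c.coord 1)) := by
    have h2 := congrArg E hfg
    have h3 : E (U.1.left.presheaf.germ ⊤ y trivial (specFun (etHom U.1 ≫ p.base) r)) = 0 :=
      hD.const_germ hE r
    rw [hder.sub, h3, sub_zero, hder.add, hder.leibniz, hder.leibniz, ha, hb] at h2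
    rw [h2]
    simp only [RingHom.id_apply]
    ring
  have h2 := hD.germ_eq hE w
  rw [he, map_mul, h1] at h2
  intro hu
  refine (hn.nonunit (U.1.left.presheaf.germ ⊤ y trivial w * U.1.left.presheaf.germ ⊤ y trivial e)).2
    ⟨E f + f * a, E g + g * b, h2.trans (by ring)⟩ ((hw.map _).mul hu)

omit hD in
lemma mem_basicOpen_etOpenι {T : X.toScheme.Etale} {t : T.left} (c : NodeChart p.base T t) {α β : X.Sec T}
    (hα : X.eps T α = c.coord 0) (hβ : X.eps T β = c.coord 1) {A : T.left.Opens} (htA : t ∈ A)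
    (hA : ∀ y ∈ A, y ≠ t → ∃ i, y ∈ T.left.basicOpen (c.coord i)) (y : (etOpen T A).left)
    (hy : y ≠ (⟨t, htA⟩ : A)) :
    y ∈ (etOpen T A).left.basicOpen (X.eps _ (X.res (etOpenι T A) α)) ∨
      y ∈ (etOpen T A).left.basicOpen (X.eps _ (X.res (etOpenι T A) β)) := by
  obtain ⟨i, hi⟩ := hA y.1 y.2 (fun h => hy (Subtype.ext h))
  have hb : ∀ f, y.1 ∈ T.left.basicOpen f → y ∈ (etOpen T A).left.basicOpen
      ((etOpenι T A).left.appTop f) := fun f hf =>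
    (Scheme.preimage_basicOpen_top (etOpenι T A).left f).le hf
  rw [LogScheme.eps_res, LogScheme.eps_res, hα, hβ]
  fin_cases i
  · exact Or.inl (hb _ hi)
  · exact Or.inr (hb _ hi)

include hX

-- The traces `a + b` and `e`, the logarithmic derivative of the unit `w₀`, both vanish at the node.
-- So `a` and `b` can be changed by multiples of `v` and `u` until their sum is exactly `e`. The
-- equations then hold on a neighbourhood, where `isDlog_branch` applies to `α` and, by symmetry, to
-- `β`.
set_option maxHeartbeats 800000 in
lemma exists_isDlog_branch {T : EtIn W} {t : T.1.left} (c : NodeChart p.base T.1 t) {α β w₀ : X.Sec T.1}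
    {s₀ : BaseMonoid N} {a b : T.1.left.presheaf.stalk t} (hα : X.eps T.1 α = c.coord 0)
    (hβ : X.eps T.1 β = c.coord 1) (hw₀ : IsUnit w₀) (hαβ : α * β = pullB p T.1 s₀ * w₀)
    (ha : T.1.left.presheaf.germ ⊤ t trivial (D T (c.coord 0)) =
      a * T.1.left.presheaf.germ ⊤ t trivial (c.coord 0))
    (hb : T.1.left.presheaf.germ ⊤ t trivial (D T (c.coord 1)) =
      b * T.1.left.presheaf.germ ⊤ t trivial (c.coord 1)) (hab : ¬ IsUnit (a + b)) :
    ∃ (T' : X.toScheme.Etale) (h : T' ⟶ T.1) (t' : T'.left) (a' b' : Γ(T'.left, ⊤)), h.left t' = t ∧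
      IsDlog p D (T.of h) (X.res h α) a' ∧ IsDlog p D (T.of h) (X.res h β) b' := by
  obtain ⟨e, he⟩ := exists_isDlog_of_isUnit (U := T) hX hD hw₀
  have he' := he.eps hX hD
  have hn := c.isNodeRing
  have hloc := hn.isLocalRing
  have hen := hD.not_isUnit_dlog c ha hb (hw₀.map _) he'
  obtain ⟨a', b', h1, h2, h3⟩ := hn.exists_sum_eq
    (fun hu => (nonunits_add hab ((not_congr (IsUnit.neg_iff _)).2 hen)) (sub_eq_add_neg (a + b) _ ▸ hu)) ha hb
  obtain ⟨A0, htA0, hA0⟩ := c.exists_opens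
  obtain ⟨A1, hA1, htA1, a', b', rfl, rfl⟩ := exists_common_germs htA0 a' b'
  have key : ∀ (A : T.1.left.Opens) (ht : t ∈ A) (f g : Γ(T.1.left, A)),
      T.1.left.presheaf.germ A t ht f = T.1.left.presheaf.germ A t ht g →
      ∃ (A' : T.1.left.Opens) (h : A' ≤ A), t ∈ A' ∧ rs h f = rs h g := fun A ht f g e => by
    obtain ⟨A', ht', i, j, e⟩ := T.1.left.presheaf.germ_eq t ht ht f g e
    exact ⟨A', i.le, ht', e⟩
  obtain ⟨A2, hA2, htA2, e1⟩ := key A1 htA1 (rs le_top (D T (c.coord 0))) (a' * rs le_top (c.coord 0))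
    (by rw [map_mul, germ_rs, germ_rs]; exact h1)
  obtain ⟨A3, hA3, htA3, e2⟩ := key A2 htA2 (rs le_top (D T (c.coord 1))) (rs hA2 b' * rs le_top (c.coord 1))
    (by rw [map_mul, germ_rs, germ_rs, germ_rs]; exact h2)
  obtain ⟨A, hA, htA, e3⟩ := key A3 htA3 (rs (hA3.trans hA2) a' + rs (hA3.trans hA2) b') (rs le_top e)
    (by rw [map_add, germ_rs, germ_rs, germ_rs]; exact h3)
  let j := etOpenι T.1 A
  have r1 : rs (le_top : A ≤ ⊤) (D T (X.eps T.1 α)) = rs le_top (X.eps T.1 α) *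
      rs (hA.trans (hA3.trans hA2)) a' := by
    have := congrArg (rs (hA.trans hA3)) e1
    simp only [map_mul, rs_rs] at this
    rw [hα, this, mul_comm]
  have r2 : rs (le_top : A ≤ ⊤) (D T (X.eps T.1 β)) = rs le_top (X.eps T.1 β) *
      rs (hA.trans (hA3.trans hA2)) b' := by
    have := congrArg (rs hA) e2
    simp only [map_mul, rs_rs] at this
    rw [hβ, this, mul_comm]
  have r3 : rs (le_top : A ≤ ⊤) (D T (X.eps T.1 w₀)) = rs le_top (X.eps T.1 w₀) * rs le_top e := by
    rw [he', map_mul]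
  have r4 : openEquiv T.1 A (rs (hA.trans (hA3.trans hA2)) a') + openEquiv T.1 A (rs (hA.trans (hA3.trans hA2)) b') =
      openEquiv T.1 A (rs le_top e) := by
    simp only [map_add, rs_rs] at e3
    rw [← map_add, e3]
  let c' := c.comp j (⟨t, htA⟩ : A) rfl
  have hn' := c'.isNodeRing
  have c0 : X.eps _ (X.res j α) = c'.coord 0 := eps_res_eq_coord j rfl hα
  have c1 : X.eps _ (X.res j β) = c'.coord 1 := eps_res_eq_coord j rfl hβ
  have hne := mem_basicOpen_etOpenι c hα hβ htA fun y hy => hA0 y (hA1 (hA2 (hA3 (hA hy))))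
  have hres : X.res j α * X.res j β = pullB p _ s₀ * X.res j w₀ := by
    rw [← map_mul, hαβ, map_mul, res_pullB]
  refine ⟨_, j, (⟨t, htA⟩ : A), openEquiv T.1 A (rs (hA.trans (hA3.trans hA2)) a'),
    openEquiv T.1 A (rs (hA.trans (hA3.trans hA2)) b'), rfl, ?_, ?_⟩
  · refine isDlog_branch (T := T.of j) (t := (⟨t, htA⟩ : A)) hX hD (hw₀.map _) hres
      (res_eq_of_germ hD r1) (res_eq_of_germ hD r2) (res_eq_of_germ hD r3) r4 hne ?_ ?_
    · exact c0 ▸ hn'.left_ne_zero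
    · exact c0 ▸ hn'.not_isUnit_left
  · refine isDlog_branch (T := T.of j) (t := (⟨t, htA⟩ : A)) hX hD (hw₀.map _) ((mul_comm _ _).trans hres)
      (res_eq_of_germ hD r2) (res_eq_of_germ hD r1) (res_eq_of_germ hD r3) ((add_comm _ _).trans r4)
      (fun y hy => (hne y hy).symm) ?_ ?_
    · exact c1 ▸ hn'.right_ne_zero
    · exact c1 ▸ hn'.not_isUnit_right

end LocalExistenceNodal

/-! ### Passage between étale and Zariski local derivations -/

section StalkExtension

variable {T X : Scheme.{u}}

/-- The derivation `E'` of the local ring at `t` extends the derivation `E` of the local ring at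
`g t`. -/
structure IsStalkExtension (g : T ⟶ X) (t : T) (E : X.presheaf.stalk (g t) → X.presheaf.stalk (g t))
    (E' : T.presheaf.stalk t → T.presheaf.stalk t) : Prop where
  der : IsDerAlong (RingHom.id _) E'
  apply : ∀ r, E' (g.stalkMap t r) = g.stalkMap t (E r)

lemma IsStalkExtension.comm {T' : Scheme.{u}} {h : T' ⟶ T} {g : T ⟶ X} [Etale g] {t : T'}
    {E : X.presheaf.stalk (g (h t)) → X.presheaf.stalk (g (h t))} {E' E''}
    (h' : IsStalkExtension g (h t) E E') (h'' : IsStalkExtension (h ≫ g) t E E'')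
    (r : T.presheaf.stalk (h t)) : E'' (h.stalkMap t r) = h.stalkMap t (E' r) := by
  refine congrFun (IsDerAlong.ext_of_formallyUnramified (isEtaleLocal_stalkMap g (h t)).formallyUnramified
    (h''.der.comp_right (h.stalkMap t).hom) (h'.der.comp_left (h.stalkMap t).hom) fun a => ?_) r
  have h1 := h''.apply a
  have h2 := congrArg (h.stalkMap t) (h'.apply a)
  refine (congrArg E'' (stalkMap_comp_apply h g t a).symm).trans (h1.trans ?_)
  exact (stalkMap_comp_apply h g t (E a)).trans h2.symm

lemma IsStalkExtension.eq {g : T ⟶ X} [Etale g] {t : T} {E E' E''}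
    (h' : IsStalkExtension g t E E') (h'' : IsStalkExtension g t E E'') : E' = E'' :=
  IsDerAlong.ext_of_formallyUnramified (isEtaleLocal_stalkMap g t).formallyUnramified h'.der h''.der
    fun a => (h'.apply a).trans (h''.apply a).symm

/-- An extension of a derivation to an étale neighbourhood preserves the maximal ideal. -/
lemma IsStalkExtension.not_isUnit {g : T ⟶ X} [Etale g] {t : T} {E E'}
    (h : IsStalkExtension g t E E') (hE : ∀ r, ¬ IsUnit r → ¬ IsUnit (E r)) {s : T.presheaf.stalk t}
    (hs : ¬ IsUnit s) : ¬ IsUnit (E' s) := by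
  have hl := isEtaleLocal_stalkMap g t
  have := hl.isLocalHom
  have hs' : s ∈ Ideal.map (g.stalkMap t).hom (maximalIdeal _) := hl.map_maximalIdeal.ge hs
  suffices E' s ∈ maximalIdeal (T.presheaf.stalk t) from this
  refine Submodule.span_induction (p := fun s _ => E' s ∈ maximalIdeal _) ?_ ?_ ?_ ?_ hs'
  · rintro _ ⟨r, hr, rfl⟩
    rw [show E' ((g.stalkMap t).hom r) = g.stalkMap t (E r) from h.apply r]
    exact fun hu => hE r hr (isUnit_of_map_unit (g.stalkMap t).hom _ hu)
  · rw [h.der.zero]; exact zero_mem _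
  · intro x y _ _ hx hy
    rw [h.der.add]; exact add_mem hx hy
  · intro a x hx hx'
    rw [smul_eq_mul, h.der.leibniz]
    refine add_mem (Ideal.mul_mem_left _ _ hx') (Ideal.mul_mem_right _ _ ?_)
    exact (hl.map_maximalIdeal).le hx

end StalkExtension

section Underlying

variable {k : Type u} [Field k] {X : LogScheme.{u}} {p : X.toScheme ⟶ Spec (.of k)} {W : X.toScheme.Opens}
  {D : ∀ U : EtIn W, Γ(U.1.left, ⊤) → Γ(U.1.left, ⊤)}

lemma openEquiv_apply {X : Scheme.{u}} (T : X.Etale) (A : T.left.Opens) (a : Γ(T.left, A)) :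
    openEquiv T A a = A.topIso.inv a := by
  unfold openEquiv; rfl

/-- The derivations of the functions on the Zariski open subsets given by a derivation on the étale site. -/
noncomputable def underlyingDer (D : ∀ U : EtIn W, Γ(U.1.left, ⊤) → Γ(U.1.left, ⊤))
    (V : {V : X.toScheme.Opens // V ≤ W}) (b : Γ(X.toScheme, V.1)) : Γ(X.toScheme, V.1) :=
  V.1.topIso.hom (D (openEt V) (V.1.topIso.inv b))

lemma topIso_inv_underlyingDer (V : {V : X.toScheme.Opens // V ≤ W}) (b : Γ(X.toScheme, V.1)) :
    V.1.topIso.inv (underlyingDer D V b) = D (openEt V) (V.1.topIso.inv b) :=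
  ConcreteCategory.congr_hom V.1.topIso.hom_inv_id _

lemma topIso_inv_injective {X : Scheme.{u}} (V : X.Opens) : Function.Injective V.topIso.inv :=
  V.topIso.symm.commRingCatIsoToRingEquiv.injective

attribute [irreducible] underlyingDer

variable (hD : IsEtaleDer p W D)
include hD

lemma IsEtaleDer.underlyingDer_res (V V' : {V : X.toScheme.Opens // V ≤ W}) (h : V'.1 ≤ V.1)
    (a : Γ(X.toScheme, V.1)) : rs h (underlyingDer D V a) = underlyingDer D V' (rs h a) := by
  let g : (openEt V').1 ⟶ (openEt V).1 := MorphismProperty.Over.homMk (X.toScheme.homOfLE h)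
    (Scheme.homOfLE_ι _ _) trivial
  have h2 : ∀ b, (𝟙 X.toScheme : X.toScheme ⟶ _).appLE V.1 V'.1 h b = rs h b := fun b => by
    have h3 : (𝟙 X.toScheme : X.toScheme ⟶ X.toScheme).appLE V.1 V'.1 h =
      X.toScheme.presheaf.map (homOfLE h).op := by
      simp only [Scheme.Hom.appLE, Scheme.Hom.id_app]; exact Category.id_comp _
    exact ConcreteCategory.congr_hom h3 b
  have h1 : ∀ b, V'.1.topIso.inv (rs h b) = g.left.appTop (V.1.topIso.inv b) := fun b =>
    (congrArg _ (h2 b).symm).trans (topIso_inv_app (𝟙 X.toScheme) V'.1 V.1 g.left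
      ((Scheme.homOfLE_ι _ h).trans (Category.comp_id _).symm) h b)
  refine topIso_inv_injective V'.1 ?_
  refine (h1 _).trans ((congrArg _ (topIso_inv_underlyingDer V a)).trans ?_)
  refine (hD.res (openEt V') (openEt V) g _).trans ?_
  exact (congrArg _ (h1 a).symm).trans (topIso_inv_underlyingDer V' _).symm

lemma IsEtaleDer.exists_isGermOf_underlyingDer {q : X.toScheme} (hq : q ∈ W) :
    ∃ E, IsGermOf (underlyingDer D) q E :=
  _root_.exists_isGermOf (fun V V' h a => hD.underlyingDer_res V V' h a) q hq

lemma IsEtaleDer.appLE_underlyingDer (U : EtIn W) (V : {V : X.toScheme.Opens // V ≤ W})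
    (B : {A : U.1.left.Opens // A ≤ ⊤}) (e : B.1 ≤ etHom U.1 ⁻¹ᵁ V.1) (b : Γ(X.toScheme, V.1)) :
    (etHom U.1).appLE V.1 B.1 e (underlyingDer D V b) =
      derOnOpen D U B ((etHom U.1).appLE V.1 B.1 e b) := by
  obtain ⟨g, hg⟩ : ∃ g : etOpen U.1 B.1 ⟶ (openEt V).1, g.left ≫ V.1.ι = B.1.ι ≫ etHom U.1 := by
    obtain ⟨g, hg⟩ := exists_lift_opens (B.1.ι ≫ etHom U.1) V.1 fun y => e y.2
    exact ⟨MorphismProperty.Over.homMk g hg trivial, hg⟩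
  have h1 : ∀ b, openEquiv U.1 B.1 ((etHom U.1).appLE V.1 B.1 e b) = g.left.appTop (V.1.topIso.inv b) :=
    fun b => (openEquiv_apply _ _ _).trans (topIso_inv_app (etHom U.1) B.1 V.1 g.left hg e b)
  refine (openEquiv U.1 B.1).injective ?_
  refine (h1 _).trans ((congrArg _ (topIso_inv_underlyingDer V b)).trans ?_)
  refine (hD.res (U.of (etOpenι U.1 B.1)) (openEt V) g _).trans ?_
  exact (congrArg (D (U.of (etOpenι U.1 B.1))) (h1 b).symm).trans (openEquiv_derOnOpen U B _).symm

lemma IsEtaleDer.isStalkExtension (U : EtIn W) (y : U.1.left) {E E'}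
    (hE : IsGermOf (underlyingDer D) (etHom U.1 y) E) (hE' : IsGermOf (derOnOpen D U) y E') :
    IsStalkExtension (etHom U.1) y E E' := by
  refine ⟨hD.isDerAlong hE', fun r => ?_⟩
  obtain ⟨V, hV, hy, b, rfl⟩ := exists_germ_eq_of_mem (U.2 y) r
  let B : {A : U.1.left.Opens // A ≤ ⊤} := ⟨etHom U.1 ⁻¹ᵁ V, le_top⟩
  have h1 := fun b => germ_appLE (etHom U.1) (W := V) (B := B.1) le_rfl y hy b
  refine (congrArg E' (h1 b).symm).trans ((hE' B hy _).trans ?_)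
  refine (congrArg _ (hD.appLE_underlyingDer U ⟨V, hV⟩ B le_rfl b).symm).trans ((h1 _).trans ?_)
  exact congrArg _ (hE ⟨V, hV⟩ hy b).symm

/-- The stalk map to an étale neighbourhood is injective, so the identities can be checked there. -/
lemma IsEtaleDer.isDerAlong_germ {q : X.toScheme} (hq : q ∈ W) {E}
    (hE : IsGermOf (underlyingDer D) q E) :
    IsDerAlong (RingHom.id _) E ∧ ∀ c, E (stalkConst p q c) = 0 := by
  let U : EtIn W := openEt ⟨W, le_rfl⟩
  let y : U.1.left := (⟨q, hq⟩ : W)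
  have hl := isEtaleLocal_stalkMap (etHom U.1) y
  have hinj := injective_of_flat_of_isLocalHom hl.flat hl.isLocalHom
  obtain ⟨E', hE'⟩ := hD.exists_isGermOf U y
  have h := hD.isStalkExtension U y hE hE'
  refine ⟨⟨fun r s => hinj ?_, fun r s => hinj ?_⟩, fun c => hinj ?_⟩
  · refine (h.apply (r + s)).symm.trans ?_
    refine (congrArg E' (map_add (etHom U.1 |>.stalkMap y).hom r s)).trans ((h.der.add _ _).trans ?_)
    refine Eq.trans ?_ (map_add (etHom U.1 |>.stalkMap y).hom _ _).symm
    exact congrArg₂ (· + ·) (h.apply r) (h.apply s)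
  · refine (h.apply (r * s)).symm.trans ?_
    refine (congrArg E' (map_mul (etHom U.1 |>.stalkMap y).hom r s)).trans ((h.der.leibniz _ _).trans ?_)
    refine Eq.trans ?_ (map_add (etHom U.1 |>.stalkMap y).hom _ _).symm
    refine congrArg₂ (· + ·) ?_ ?_
    · exact (congrArg (_ * ·) (h.apply s)).trans (map_mul (etHom U.1 |>.stalkMap y).hom r (E s)).symm
    · exact (congrArg (_ * ·) (h.apply r)).trans (map_mul (etHom U.1 |>.stalkMap y).hom s (E r)).symm
  · refine (h.apply _).symm.trans ?_
    refine (congrArg E' (stalkMap_stalkConst (etHom U.1) y c)).trans ?_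
    exact (hD.const_germ hE' c).trans (map_zero (etHom U.1 |>.stalkMap y).hom).symm

end Underlying

section Extension

variable {k : Type u} [Field k] {X : LogScheme.{u}} {p : X.toScheme ⟶ Spec (.of k)} {W : X.toScheme.Opens}

/-- A derivation of the functions on an affine open subset extends to the étale site. -/
lemma exists_isEtaleDer (hW : IsAffineOpen W) {d : Γ(X.toScheme, W) → Γ(X.toScheme, W)}
    (hd : IsDerAlong (RingHom.id _) d) (hk : ∀ c, d (rs le_top (specFun p c)) = 0) :
    ∃ D : ∀ U : EtIn W, Γ(U.1.left, ⊤) → Γ(U.1.left, ⊤), IsEtaleDer p W D ∧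
      ∀ U a, D U (etPull U a) = etPull U (d a) := by
  have hle : ∀ U : EtIn W, (⊤ : U.1.left.Opens) ≤ etHom U.1 ⁻¹ᵁ W := fun U y _ => U.2 y
  have het : ∀ U : EtIn W, Etale (etHom U.1) := fun U => U.1.prop
  choose D hD using fun U : EtIn W => exists_isEtaleExtension hW hd (etHom U.1)
  have happ : ∀ U a, D U ⟨⊤, hle U⟩ (etPull U a) = etPull U (d a) := fun U a =>
    (hD U).apply ⟨⊤, hle U⟩ a
  refine ⟨fun U => D U ⟨⊤, hle U⟩, ⟨fun U V h a => ?_, fun U => (hD U).der ⟨⊤, hle U⟩, fun U c => ?_⟩, happ⟩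
  · refine TopCat.Presheaf.section_ext U.1.left.sheaf ⊤ _ _ fun y _ => ?_
    have hgU := exists_isGermExtension hW hd (h.left ≫ etHom V.1) y (V.2 (h.left y))
    have hgV := exists_isGermExtension hW hd (etHom V.1) (h.left y) (V.2 (h.left y))
    obtain ⟨E', hE'⟩ := hgV
    have key : ∀ (g : U.1.left ⟶ X.toScheme) [Etale g] (hg : h.left ≫ etHom V.1 = g) (hU : ⊤ ≤ g ⁻¹ᵁ W)
        (DU) (_ : IsEtaleExtension d g DU), U.1.left.presheaf.germ ⊤ y trivial
          (h.left.appTop (D V ⟨⊤, hle V⟩ a)) =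
          U.1.left.presheaf.germ ⊤ y trivial (DU ⟨⊤, hU⟩ (h.left.appTop a)) := by
      rintro _ _ rfl hU DU hDU
      obtain ⟨E, hE⟩ := hgU
      refine (germ_left h y _).trans ?_
      refine (congrArg _ ((hD V).germ hW hE' ⟨⊤, hle V⟩ trivial a)).trans ?_
      refine (hE'.comp hW h.left hE _).symm.trans ?_
      refine (congrArg E (germ_left h y a).symm).trans ?_
      exact (hDU.germ hW hE ⟨⊤, hU⟩ trivial _).symm
    exact key (etHom U.1) (et_w h) (hle U) (D U) (hD U)
  · have h1 : specFun (etHom U.1 ≫ p) c = etPull U (rs le_top (specFun p c)) := by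
      rw [specFun_comp]
      exact (ConcreteCategory.congr_hom (Scheme.Hom.appLE_eq_app (etHom U.1)) _).symm.trans
        (ConcreteCategory.congr_hom (Scheme.Hom.map_appLE (etHom U.1) (hle U) (homOfLE le_top).op) _).symm
    have h2 := happ U (rs le_top (specFun p c))
    rw [← h1, hk, map_zero] at h2
    exact h2

end Extension

/-! ### The trace of a derivation at a node -/

/-- The derivation `E` of a nodal local ring is logarithmic along the branches, and the sum of its
logarithmic values on the parameters vanishes at the node. -/
def IsTraceless {R : Type*} [CommRing R] (u v : R) (E : R → R) : Prop :=
  ∃ a b, E u = a * u ∧ E v = b * v ∧ ¬ IsUnit (a + b)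

lemma IsTraceless.map {R S : Type*} [CommRing R] [CommRing S] {u v : R} {E : R → R}
    (h : IsTraceless u v E) (f : R →+* S) (hf : IsLocalHom f) {E' : S → S}
    (hE : ∀ r, E' (f r) = f (E r)) : IsTraceless (f u) (f v) E' := by
  obtain ⟨a, b, h1, h2, h3⟩ := h
  refine ⟨f a, f b, by rw [hE, h1, map_mul], by rw [hE, h2, map_mul], fun hu => h3 ?_⟩
  rw [← map_add] at hu
  exact isUnit_of_map_unit f _ hu

/-- The coefficient of `f u` is unique up to its annihilator: `f a - a'` kills `f u`, so it is a
multiple of `f v` and vanishes at the node. The trace at the node thus depends neither on the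
coefficients nor on the étale extension. -/
lemma IsTraceless.of_map {R S : Type*} [CommRing R] [CommRing S] [IsLocalRing R] [IsLocalRing S]
    {u v : R} {E : R → R} {f : R →+* S} (hf : f.Flat) (hl : IsLocalHom f) {E' : S → S}
    (hE : ∀ r, E' (f r) = f (E r)) (huv : IsNodeRing (f u) (f v)) (h : IsTraceless (f u) (f v) E') :
    IsTraceless u v E := by
  obtain ⟨a', b', h1, h2, h3⟩ := h
  obtain ⟨a, ha⟩ : u ∣ E u := dvd_of_map_dvd_of_flat hf hl (by rw [← hE, h1]; exact dvd_mul_left _ _)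
  obtain ⟨b, hb⟩ : v ∣ E v := dvd_of_map_dvd_of_flat hf hl (by rw [← hE, h2]; exact dvd_mul_left _ _)
  rw [hE, ha, map_mul] at h1
  rw [hE, hb, map_mul] at h2
  refine ⟨a, b, by rw [ha, mul_comm], by rw [hb, mul_comm], fun hu => ?_⟩
  have e1 : ¬ IsUnit (f a - a') := fun h => huv.not_isUnit_right (isUnit_of_dvd_unit
    (huv.dvd_of_mul_left (by linear_combination h1)) h)
  have e2 : ¬ IsUnit (f b - b') := fun h => huv.not_isUnit_left (isUnit_of_dvd_unit
    (huv.dvd_of_mul_right (by linear_combination h2)) h)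
  refine nonunits_add (nonunits_add e1 e2) h3 ?_
  have : f a - a' + (f b - b') + (a' + b') = f (a + b) := by rw [map_add]; ring
  rw [this]
  exact hu.map f

section Nodal

variable {k : Type u} [Field k] [IsAlgClosed k] {N : LogStructure (Spec (.of k))}
  {X : LogScheme.{u}} {p : X.Hom ⟨Spec (.of k), N⟩} {W : X.toScheme.Opens}
  {D : ∀ U : EtIn W, Γ(U.1.left, ⊤) → Γ(U.1.left, ⊤)}
  (hX : IsLogCurve p) (hD : IsEtaleDer p.base W D)
include hD

lemma IsEtaleDer.isTraceless_comp {U T : EtIn W} (h : T.1 ⟶ U.1) (t : T.1.left)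
    (c : NodeChart p.base U.1 (h.left t)) {E E'} (hE : IsGermOf (derOnOpen D U) (h.left t) E)
    (hE' : IsGermOf (derOnOpen D T) t E')
    (htr : IsTraceless (U.1.left.presheaf.germ ⊤ (h.left t) trivial (c.coord 0))
      (U.1.left.presheaf.germ ⊤ (h.left t) trivial (c.coord 1)) E) :
    IsTraceless (T.1.left.presheaf.germ ⊤ t trivial ((c.comp h t rfl).coord 0))
      (T.1.left.presheaf.germ ⊤ t trivial ((c.comp h t rfl).coord 1)) E' := by
  have hl := isEtaleLocal_stalkMap h.left t
  have h1 := htr.map (h.left.stalkMap t).hom hl.isLocalHom (fun r => hD.stalkMap_comm h hE' hE r)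
  have h2 : ∀ i, T.1.left.presheaf.germ ⊤ t trivial ((c.comp h t rfl).coord i) =
      h.left.stalkMap t (U.1.left.presheaf.germ ⊤ (h.left t) trivial (c.coord i)) := fun i =>
    (congrArg _ (NodeChart.comp_coord c h t rfl i)).trans (germ_left h t _)
  rw [h2, h2]
  exact h1

include hX

/-- Étale locally `m = s α ^ i β ^ j w`, and tracelessness provides the logarithmic derivatives of
`α` and `β` through `exists_isDlog_branch`. -/
lemma IsNodalChart.exists_isDlog {Ω : Type u} [Field Ω] [IsAlgClosed Ω] {x : Spec (.of Ω) ⟶ X.toScheme}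
    {U : EtIn W} {l : X.Lift x U.1} {c : NodeChart p.base U.1 l.pt} {α β : X.Sec U.1}
    (hc : IsNodalChart l c α β) {E} (hE : IsGermOf (derOnOpen D U) l.pt E)
    (htr : IsTraceless (U.1.left.presheaf.germ ⊤ l.pt trivial (c.coord 0))
      (U.1.left.presheaf.germ ⊤ l.pt trivial (c.coord 1)) E) {V : EtIn W} {y : V.1.left}
    (hy : etHom V.1 y = x default) (m : X.Sec V.1) :
    ∃ (T : X.toScheme.Etale) (h : T ⟶ V.1) (t : T.left), h.left t = y ∧
      ∃ c, IsDlog p D (V.of h) (X.res h m) c := by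
  obtain ⟨l', rfl⟩ := LogScheme.exists_lift V.1 y hy
  obtain ⟨T1, f1, g1, l1, rfl, rfl⟩ := LogScheme.exists_refinement l l'
  obtain ⟨T2, f2, l2, s₀, w₀, rfl, hw₀, e₀⟩ := hc.comp.exists_mul_eq
  obtain ⟨T3, f3, l3, s, i, j, w, rfl, hw, e⟩ := hc.comp.comp.exists_res_eq (X.res (f2 ≫ g1) m)
  let T : EtIn W := V.of (f3 ≫ f2 ≫ g1)
  let h : T.1 ⟶ U.1 := f3 ≫ f2 ≫ f1
  obtain ⟨E', hE'⟩ := hD.exists_isGermOf T l3.pt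
  obtain ⟨a, b, ha, hb, hab⟩ := hD.isTraceless_comp (U := U) (T := T) h l3.pt c hE hE' htr
  rw [← hD.germ_eq hE'] at ha hb
  have hα : X.eps T.1 (X.res f3 (X.res f2 (X.res f1 α))) = (c.comp h l3.pt rfl).coord 0 := by
    rw [← LogScheme.res_comp, ← LogScheme.res_comp]
    exact eps_res_eq_coord h rfl hc.eps_left
  have hβ : X.eps T.1 (X.res f3 (X.res f2 (X.res f1 β))) = (c.comp h l3.pt rfl).coord 1 := by
    rw [← LogScheme.res_comp, ← LogScheme.res_comp]
    exact eps_res_eq_coord h rfl hc.eps_right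
  have hαβ : X.res f3 (X.res f2 (X.res f1 α)) * X.res f3 (X.res f2 (X.res f1 β)) =
      pullB p T.1 s₀ * X.res f3 w₀ := by
    rw [← map_mul, e₀, map_mul, res_pullB]
  obtain ⟨T', h', t', a', b', ht', hα', hβ'⟩ := exists_isDlog_branch hX hD (T := T) (t := l3.pt)
    (c.comp h l3.pt rfl) hα hβ (hw₀.map (X.res f3)) hαβ ha hb hab
  obtain ⟨c', hc'⟩ := exists_isDlog_of_isUnit (U := T) hX hD hw
  refine ⟨T', h' ≫ f3 ≫ f2 ≫ g1, t', ?_, 0 + (i : ℕ) * a' + (j : ℕ) * b' + h'.left.appTop c', ?_⟩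
  · change (f3 ≫ f2 ≫ g1).left (h'.left t') = _
    rw [ht']
    rfl
  · have h1 := (((IsDlog.pullB hX hD (T.of h') s).mul hX hD (hα'.pow hX hD i)).mul hX hD
      (hβ'.pow hX hD j)).mul hX hD (hc'.res h')
    have h2 : X.res (h' ≫ f3 ≫ f2 ≫ g1) m = pullB p T' s * X.res h' (X.res f3 (X.res f2 (X.res f1 α))) ^ i *
        X.res h' (X.res f3 (X.res f2 (X.res f1 β))) ^ j * X.res h' w := by
      rw [LogScheme.res_comp, LogScheme.res_comp, e]
      simp only [map_mul, map_pow]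
      exact congrArg (· * _ * _ * _) (res_pullB p h' s)
    rw [h2]
    exact h1

end Nodal

/-! ### Lifting derivations to logarithmic derivations -/

section Lift

variable {k : Type u} [Field k] [IsAlgClosed k] {N : LogStructure (Spec (.of k))}
  {X : LogScheme.{u}} {p : X.Hom ⟨Spec (.of k), N⟩} {Z : Set X.toScheme}

lemma IsLogCurve.exists_isolated (hX : IsLogCurve p) (hZ : ∀ z ∈ Z, IsMarking p z) (q : X.toScheme) :
    ∃ W : X.toScheme.Opens, q ∈ W ∧ ∀ z ∈ W, z ∈ Z → z = q := by
  obtain ⟨W, hq, hW⟩ := hX.locallyFinite q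
  exact ⟨W, hq, fun z hz h => hW z hz (hZ z h)⟩

lemma IsEtaleDer.isStalkExtension_of_eq {W : X.toScheme.Opens} {D : ∀ U : EtIn W, Γ(U.1.left, ⊤) → Γ(U.1.left, ⊤)}
    (hD : IsEtaleDer p.base W D) (U : EtIn W) (y : U.1.left) {g : U.1.left ⟶ X.toScheme}
    (hg : g = etHom U.1) {E E'} (hE : IsGermOf (underlyingDer D) (g y) E)
    (hE' : IsGermOf (derOnOpen D U) y E') : IsStalkExtension g y E E' := by
  subst hg
  exact hD.isStalkExtension U y hE hE'

/-- The extension to the étale site of a derivation of a local ring. -/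
lemma exists_isEtaleDer_germ (hX : IsLogCurve p) [LocallyOfFiniteType p.base]
    (hZ : ∀ z, z ∈ Z ↔ IsMarking p z) {q : X.toScheme} {E} (hE : IsTangentGerm p.base Z q E) :
    ∃ (W : X.toScheme.Opens) (_ : q ∈ W) (D : ∀ U : EtIn W, Γ(U.1.left, ⊤) → Γ(U.1.left, ⊤)),
      (∀ w ∈ W, w ≠ q → IsGood p w) ∧ IsEtaleDer p.base W D ∧ IsGermOf (underlyingDer D) q E := by
  obtain ⟨W0, hq0, D0, hD0⟩ := exists_tangentField (hX.exists_isolated (fun z hz => (hZ z).1 hz) q) hE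
  obtain ⟨W1, hq1, hW1⟩ := hX.exists_opens_isGood q
  obtain ⟨_, ⟨W, hW, rfl⟩, hqW, hWle⟩ :=
    X.toScheme.isBasis_affineOpens.exists_subset_of_mem_open (show q ∈ W0 ⊓ W1 from ⟨hq0, hq1⟩)
      (W0 ⊓ W1).isOpen
  have hWW : W ≤ W0 ⊓ W1 := hWle
  let D1 := tangentRes p.base Z (hWW.trans inf_le_left) D0
  have hD1 : IsGermOf D1.1 q E := fun V h a => hD0 ⟨V.1, V.2.trans (hWW.trans inf_le_left)⟩ h a
  obtain ⟨D, hD, hDd⟩ := exists_isEtaleDer (p := p.base) hW (d := D1.1 ⟨W, le_rfl⟩)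
    ⟨D1.2.add ⟨W, le_rfl⟩, D1.2.leibniz ⟨W, le_rfl⟩⟩ (fun c => D1.2.base ⟨W, le_rfl⟩ ⊤ le_top
      ((Scheme.ΓSpecIso (.of k)).inv c))
  refine ⟨W, hqW, D, fun w hw hwq => hW1 w (hWW hw).2 hwq, hD, ?_⟩
  obtain ⟨E1, hE1⟩ := hD.exists_isGermOf_underlyingDer hqW
  have : E1 = E := by
    refine IsDerAlong.ext_of_formallyUnramified (formallyEtale_germ hW q hqW).formallyUnramified'
      (hD.isDerAlong_germ hqW hE1).1 hE.der fun a => ?_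
    refine (hE1 ⟨W, le_rfl⟩ hqW a).trans (Eq.trans ?_ (hD1 ⟨W, le_rfl⟩ hqW a).symm)
    refine congrArg _ (topIso_inv_injective (X := X.toScheme) W ?_)
    refine (topIso_inv_underlyingDer (D := D) ⟨W, le_rfl⟩ a).trans ?_
    have h2 : ∀ b, (Scheme.Opens.topIso (X := X.toScheme) W).inv b = etPull (openEt ⟨W, le_rfl⟩) b := fun b =>
      ConcreteCategory.congr_hom (topIso_inv_eq_appLE (T := X.toScheme) W) b
    exact (congrArg _ (h2 a)).trans ((hDd (openEt ⟨W, le_rfl⟩) a).trans (h2 _).symm)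
  exact this ▸ hE1

/-- All other points of `W` are good, where logarithmic derivatives exist without condition; only
the points over `q` need a hypothesis. -/
lemma exists_logDerivation_germ_of (hX : IsLogCurve p) {W : X.toScheme.Opens} {q : X.toScheme} (hq : q ∈ W)
    {D : ∀ U : EtIn W, Γ(U.1.left, ⊤) → Γ(U.1.left, ⊤)} (hW : ∀ w ∈ W, w ≠ q → IsGood p w)
    (hD : IsEtaleDer p.base W D) {E} (hE : IsGermOf (underlyingDer D) q E)
    (h : ∀ (U : EtIn W) (m : X.Sec U.1) (y : U.1.left), etHom U.1 y = q →
      ∃ (T : X.toScheme.Etale) (h : T ⟶ U.1) (t : T.left), h.left t = y ∧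
        ∃ c, IsDlog p D (U.of h) (X.res h m) c) :
    ∃ (W : X.toScheme.Opens) (_ : q ∈ W) (δ : logDerivations p W),
      IsGermOf (underlyingDer fun U => (δ.1 U).1) q E := by
  obtain ⟨δ, hδ⟩ := exists_logDerivation hX hD fun U m y => by
    by_cases hy : etHom U.1 y = q
    · exact h U m y hy
    · exact (hW _ (U.2 y) hy).exists_isDlog hX hD m
  refine ⟨W, hq, δ, ?_⟩
  have : (fun U => (δ.1 U).1) = D := by funext U a; exact hδ U a
  rw [this]; exact hE

/-- A point that is not a node is good or a marking. At a marking, tangency of `E` passes to every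
étale neighbourhood, as `IsMarkedAt.exists_isDlog` requires. -/
lemma exists_logDerivation_germ_of_not_isNode (hX : IsLogCurve p) [LocallyOfFiniteType p.base]
    (hZ : ∀ z, z ∈ Z ↔ IsMarking p z) {q : X.toScheme} (hq : ¬ IsNode p.base q) {E}
    (hE : IsTangentGerm p.base Z q E) :
    ∃ (W : X.toScheme.Opens) (_ : q ∈ W) (δ : logDerivations p W),
      IsGermOf (underlyingDer fun U => (δ.1 U).1) q E := by
  obtain ⟨W, hqW, D, hW, hD, hund⟩ := exists_isEtaleDer_germ hX hZ hE
  refine exists_logDerivation_germ_of hX hqW hW hD hund fun U m y hy => ?_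
  rcases hX.isGood_or q with h | h | h
  · exact IsGood.exists_isDlog hX hD (hy ▸ h) m
  · obtain ⟨Ω, _, _, x, rfl⟩ := exists_geometricPoint q
    refine IsMarkedAt.exists_isDlog hX hD (h Ω x rfl) (fun V z hz a ha => ?_) hy m
    obtain ⟨E', hE'⟩ := hD.exists_isGermOf V z
    rw [hD.germ_eq hE']
    obtain ⟨E0, hE0⟩ := hD.exists_isGermOf_underlyingDer (V.2 z)
    have h0 : ∀ (q' : X.toScheme) (_ : q' = x default) (E0 : _) (_ : IsGermOf (underlyingDer D) q' E0),
        ∀ r, ¬ IsUnit r → ¬ IsUnit (E0 r) := by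
      rintro _ rfl E0 hE0
      exact hund.ext hqW hE0 ▸ hE.tangent ((hZ _).2 h)
    exact (hD.isStalkExtension V z hE0 hE').not_isUnit (h0 _ hz E0 hE0) ha
  · exact absurd h hq

/-- The converse of `IsNodalChart.isTraceless`: vanishing of the trace is the only obstruction to
lifting at a node. -/
lemma exists_logDerivation_germ_of_isNodalChart (hX : IsLogCurve p) [LocallyOfFiniteType p.base]
    (hZ : ∀ z, z ∈ Z ↔ IsMarking p z) {Ω : Type u} [Field Ω] [IsAlgClosed Ω]
    {x : Spec (.of Ω) ⟶ X.toScheme} {U : X.toScheme.Etale} {l : X.Lift x U} {c : NodeChart p.base U l.pt}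
    {α β : X.Sec U} (hc : IsNodalChart l c α β) {E} (hE : IsTangentGerm p.base Z (etHom U l.pt) E) {E'}
    (hE' : IsStalkExtension (etHom U) l.pt E E')
    (htr : IsTraceless (U.left.presheaf.germ ⊤ l.pt trivial (c.coord 0))
      (U.left.presheaf.germ ⊤ l.pt trivial (c.coord 1)) E') :
    ∃ (W : X.toScheme.Opens) (_ : etHom U l.pt ∈ W) (δ : logDerivations p W),
      IsGermOf (underlyingDer fun U => (δ.1 U).1) (etHom U l.pt) E := by
  obtain ⟨W, hqW, D, hW, hD, hund⟩ := exists_isEtaleDer_germ hX hZ hE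
  refine exists_logDerivation_germ_of hX hqW hW hD hund fun V m y hy => ?_
  obtain ⟨lW, -⟩ := LogScheme.exists_lift (x := x) (openEt ⟨W, le_rfl⟩).1
    (⟨x default, LogScheme.Lift.etHom_pt l ▸ hqW⟩ : W) rfl
  obtain ⟨T1, f, g, l1, rfl, -⟩ := LogScheme.exists_refinement l lW
  let T : EtIn W := (openEt ⟨W, le_rfl⟩).of g
  obtain ⟨E'', hE''⟩ := hD.exists_isGermOf T l1.pt
  have h1 : IsStalkExtension (f.left ≫ etHom U) l1.pt E E'' :=
    hD.isStalkExtension_of_eq T l1.pt (et_w f) hund hE''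
  have : Etale (etHom U) := U.prop
  have h2 := fun r => IsStalkExtension.comm (h := f.left) (g := etHom U) (t := l1.pt) hE' h1 r
  have hl := isEtaleLocal_stalkMap f.left l1.pt
  have h3 := htr.map (f.left.stalkMap l1.pt).hom hl.isLocalHom h2
  have h4 : ∀ i, T1.left.presheaf.germ ⊤ l1.pt trivial ((c.comp f l1.pt rfl).coord i) =
      f.left.stalkMap l1.pt (U.left.presheaf.germ ⊤ (f.left l1.pt) trivial (c.coord i)) := fun i =>
    (congrArg _ (NodeChart.comp_coord c f l1.pt rfl i)).trans (germ_left f l1.pt _)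
  refine IsNodalChart.exists_isDlog hX hD (U := T) hc.comp hE'' ?_ (hy.trans (LogScheme.Lift.etHom_pt _)) m
  exact (congrArg₂ (fun a b => IsTraceless a b E'') (h4 0) (h4 1)).mpr h3

end Lift

/-! ### The derivation underlying a logarithmic derivation -/

section Forward

variable {k : Type u} [Field k] [IsAlgClosed k] {N : LogStructure (Spec (.of k))}
  {X : LogScheme.{u}} {p : X.Hom ⟨Spec (.of k), N⟩} {Z : Set X.toScheme} {W : X.toScheme.Opens}
  {D : ∀ U : EtIn W, Γ(U.1.left, ⊤) → Γ(U.1.left, ⊤)}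

attribute [local instance] etModule restrModule

lemma IsLocalParameter.span_appTop {U T : X.toScheme.Etale} (h : T ⟶ U) (t : T.left) {a : Γ(U.left, ⊤)}
    (ha : IsLocalParameter (h.left t) a) :
    Ideal.span {T.left.presheaf.germ ⊤ t trivial (h.left.appTop a)} =
      maximalIdeal (T.left.presheaf.stalk t) := by
  have hl := isEtaleLocal_stalkMap h.left t
  rw [germ_left, ← hl.map_maximalIdeal]
  refine Eq.trans ?_ (congrArg (Ideal.map (h.left.stalkMap t).hom) ha.2)
  refine Eq.trans ?_ (Ideal.map_span _ _).symm
  exact congrArg Ideal.span Set.image_singleton.symm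

/-- A logarithmic derivation is tangent to the markings. -/
lemma IsEtaleDer.not_isUnit_of_isMarking (hD : IsEtaleDer p.base W D)
    (hdlog : ∀ (U : EtIn W) (m : X.Sec U.1), ∃ c, D U (X.eps U.1 m) = X.eps U.1 m * c)
    {q : X.toScheme} (hq : q ∈ W) (hm : IsMarking p q) {E} (hE : IsGermOf (underlyingDer D) q E)
    {r : X.toScheme.presheaf.stalk q} (hr : ¬ IsUnit r) : ¬ IsUnit (E r) := by
  obtain ⟨Ω, _, _, x, hx⟩ := exists_geometricPoint q
  obtain ⟨-, U0, l0, γ, hγ, -⟩ := hm Ω x hx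
  obtain ⟨lW, -⟩ := LogScheme.exists_lift (x := x) (openEt ⟨W, le_rfl⟩).1 (⟨x default, hx ▸ hq⟩ : W) rfl
  obtain ⟨T1, f, g, l, rfl, -⟩ := LogScheme.exists_refinement l0 lW
  let T : EtIn W := (openEt ⟨W, le_rfl⟩).of g
  obtain ⟨y, hy⟩ : ∃ y : T.1.left, y = l.pt := ⟨_, rfl⟩
  obtain rfl : etHom T.1 y = q := hy ▸ (LogScheme.Lift.etHom_pt l).trans hx
  obtain ⟨E', hE'⟩ := hD.exists_isGermOf T y
  have h := hD.isStalkExtension T y hE hE'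
  have h0 : Ideal.span {T.1.left.presheaf.germ ⊤ y trivial (X.eps T.1 (X.res f γ))} =
      maximalIdeal (T.1.left.presheaf.stalk y) := by
    subst hy
    rw [LogScheme.eps_res]
    exact IsLocalParameter.span_appTop f l.pt hγ
  -- The parameter has a logarithmic derivative, so `E'` maps the generator of the maximal ideal to
  -- a multiple of itself and preserves this ideal.
  obtain ⟨c, hc⟩ := hdlog T (X.res f γ)
  have h1 : E' (T.1.left.presheaf.germ ⊤ y trivial (X.eps T.1 (X.res f γ))) =
      T.1.left.presheaf.germ ⊤ y trivial (X.eps T.1 (X.res f γ)) *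
        T.1.left.presheaf.germ ⊤ y trivial c := by
    rw [← hD.germ_eq hE', ← map_mul]
    exact congrArg _ hc
  have h2 : ∀ s, ¬ IsUnit s → ¬ IsUnit (E' s) := by
    intro s hs
    obtain ⟨s, rfl⟩ := Ideal.mem_span_singleton.1 (h0.ge (show s ∈ maximalIdeal _ from hs))
    refine h0.le (Ideal.mem_span_singleton.2 ?_)
    rw [h.der.leibniz, h1]
    exact dvd_add (dvd_mul_right _ _) ((dvd_mul_right _ _).mul_left _)
  have hl := isEtaleLocal_stalkMap (etHom T.1) y
  have := hl.isLocalHom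
  intro hu
  refine h2 ((etHom T.1).stalkMap y r) (fun h' => hr (isUnit_of_map_unit ((etHom T.1).stalkMap y).hom _ h')) ?_
  exact (h.apply r).symm ▸ hu.map ((etHom T.1).stalkMap y).hom

lemma IsEtaleDer.isTangentField (hD : IsEtaleDer p.base W D)
    (hdlog : ∀ (U : EtIn W) (m : X.Sec U.1), ∃ c, D U (X.eps U.1 m) = X.eps U.1 m * c)
    (hZ : ∀ z ∈ Z, IsMarking p z) : IsTangentField p.base Z W (underlyingDer D) := by
  refine isTangentField_of_germ fun q hq => ?_
  obtain ⟨E, hE⟩ := hD.exists_isGermOf_underlyingDer hq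
  obtain ⟨h1, h2⟩ := hD.isDerAlong_germ hq hE
  exact ⟨E, hE, h1, h2, fun hqZ r hr => hD.not_isUnit_of_isMarking hdlog hq (hZ q hqZ) hE hr⟩

/-- A logarithmic derivation is traceless at the nodes. -/
lemma IsNodalChart.isTraceless {Ω : Type u} [Field Ω] [IsAlgClosed Ω]
    {x : Spec (.of Ω) ⟶ X.toScheme} {U : X.toScheme.Etale} {l : X.Lift x U} {c : NodeChart p.base U l.pt}
    {α β : X.Sec U} (hc : IsNodalChart l c α β) (hX : IsLogCurve p) (hD : IsEtaleDer p.base W D)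
    (hdlog : ∀ (U : EtIn W) (m : X.Sec U.1), ∃ c, IsDlog p D U m c) (hW : etHom U l.pt ∈ W) {E E'}
    (hE : IsGermOf (underlyingDer D) (etHom U l.pt) E)
    (hE' : IsStalkExtension (etHom U) l.pt E E') :
    IsTraceless (U.left.presheaf.germ ⊤ l.pt trivial (c.coord 0))
      (U.left.presheaf.germ ⊤ l.pt trivial (c.coord 1)) E' := by
  obtain ⟨lW, -⟩ := LogScheme.exists_lift (x := x) (openEt ⟨W, le_rfl⟩).1
    (⟨x default, LogScheme.Lift.etHom_pt l ▸ hW⟩ : W) rfl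
  obtain ⟨T1, f1, g, l1, rfl, -⟩ := LogScheme.exists_refinement l lW
  obtain ⟨T2, f2, l2, s₀, w₀, rfl, hw₀, e₀⟩ := hc.comp.exists_mul_eq
  let T : EtIn W := (openEt ⟨W, le_rfl⟩).of (f2 ≫ g)
  let h : T.1 ⟶ U := f2 ≫ f1
  obtain ⟨E'', hE''⟩ := hD.exists_isGermOf T l2.pt
  have h1 : IsStalkExtension (h.left ≫ etHom U) l2.pt E E'' :=
    hD.isStalkExtension_of_eq T l2.pt (et_w h) hE hE''
  have : Etale (etHom U) := U.prop
  have h2 := fun r => IsStalkExtension.comm (h := h.left) (g := etHom U) (t := l2.pt) hE' h1 r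
  have hl := isEtaleLocal_stalkMap h.left l2.pt
  let c' := c.comp h l2.pt rfl
  have hα : X.eps T.1 (X.res f2 (X.res f1 α)) = c'.coord 0 := by
    rw [← LogScheme.res_comp]
    exact eps_res_eq_coord h rfl hc.eps_left
  have hβ : X.eps T.1 (X.res f2 (X.res f1 β)) = c'.coord 1 := by
    rw [← LogScheme.res_comp]
    exact eps_res_eq_coord h rfl hc.eps_right
  obtain ⟨a, ha⟩ := hdlog T (X.res f2 (X.res f1 α))
  obtain ⟨b, hb⟩ := hdlog T (X.res f2 (X.res f1 β))
  obtain ⟨e, he⟩ := hdlog T w₀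
  have e1 : T.1.left.presheaf.germ ⊤ l2.pt trivial (D T (c'.coord 0)) =
      T.1.left.presheaf.germ ⊤ l2.pt trivial a * T.1.left.presheaf.germ ⊤ l2.pt trivial (c'.coord 0) := by
    rw [← hα, ha.eps hX hD, map_mul, mul_comm]
  have e2 : T.1.left.presheaf.germ ⊤ l2.pt trivial (D T (c'.coord 1)) =
      T.1.left.presheaf.germ ⊤ l2.pt trivial b * T.1.left.presheaf.germ ⊤ l2.pt trivial (c'.coord 1) := by
    rw [← hβ, hb.eps hX hD, map_mul, mul_comm]
  have e3 := hD.not_isUnit_dlog (U := T) c' e1 e2 (hw₀.map (X.eps T.1)) (he.eps hX hD)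
  -- `α β` is a base section times the unit `w₀`, and base sections have logarithmic derivative
  -- zero. By `e3` the function `e` vanishes at the node.
  have e4 : a + b = 0 + e := by
    refine IsDlog.unique hX (ha.mul hX hD hb) ?_
    rw [e₀]
    exact (IsDlog.pullB hX hD T s₀).mul hX hD he
  rw [zero_add] at e4
  have h4 : ∀ i, T.1.left.presheaf.germ ⊤ l2.pt trivial (c'.coord i) =
      h.left.stalkMap l2.pt (U.left.presheaf.germ ⊤ (h.left l2.pt) trivial (c.coord i)) := fun i =>
    (congrArg _ (NodeChart.comp_coord c h l2.pt rfl i)).trans (germ_left h l2.pt _)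
  have h5 : IsTraceless (T.1.left.presheaf.germ ⊤ l2.pt trivial (c'.coord 0))
      (T.1.left.presheaf.germ ⊤ l2.pt trivial (c'.coord 1)) E'' := by
    refine ⟨_, _, (hD.germ_eq hE'' _).symm.trans e1, (hD.germ_eq hE'' _).symm.trans e2, ?_⟩
    rw [← map_add, e4]
    exact e3
  have hn := c'.isNodeRing
  exact IsTraceless.of_map hl.flat hl.isLocalHom h2 ((congrArg₂ IsNodeRing (h4 0) (h4 1)).mp hn)
    ((congrArg₂ (fun a b => IsTraceless a b E'') (h4 0) (h4 1)).mp h5)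

lemma IsLogDerivation.isEtaleDer {δ : LogFamily X W} (h : IsLogDerivation p W δ) :
    IsEtaleDer p.base W fun U => (δ U).1 where
  res := h.res
  der U := ⟨h.add U, h.leibniz U⟩
  const U c := h.base U (etTop _) (etHom U.1 ≫ p.base) (Category.comp_id _)
    ((Scheme.ΓSpecIso (.of k)).inv c)

lemma IsLogDerivation.isDlog {δ : LogFamily X W} (hδ : IsLogDerivation p W δ) (U : EtIn W) (m : X.Sec U.1) :
    IsDlog p (fun U => (δ U).1) U m ((δ U).2 m) := by
  intro T h s w hw e
  have h1 := hδ.dlog_mul (U.of h) (pullB p T s) w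
  have h2 : (δ (U.of h)).2 (pullB p T s) = 0 := hδ.dlog_base (U.of h) _ _ _ s
  rw [h2, zero_add, ← e, ← hδ.dlog_res (U.of h) U h m] at h1
  exact (hδ.dlog_eps (U.of h) w).trans (congrArg _ h1.symm)

/-- At each point of an étale scheme both derivations extend the same derivation of the Zariski
local ring below, and such an extension is unique. -/
lemma IsEtaleDer.eq_of_underlyingDer_eq {D D' : ∀ U : EtIn W, Γ(U.1.left, ⊤) → Γ(U.1.left, ⊤)}
    (hD : IsEtaleDer p.base W D) (hD' : IsEtaleDer p.base W D')
    (h : underlyingDer D = underlyingDer D') : D = D' := by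
  funext U a
  refine TopCat.Presheaf.section_ext U.1.left.sheaf ⊤ _ _ fun y _ => ?_
  obtain ⟨E, hE⟩ := hD.exists_isGermOf_underlyingDer (U.2 y)
  obtain ⟨E1, hE1⟩ := hD.exists_isGermOf U y
  obtain ⟨E2, hE2⟩ := hD'.exists_isGermOf U y
  have : Etale (etHom U.1) := U.1.prop
  have e := (hD.isStalkExtension U y hE hE1).eq (hD'.isStalkExtension U y (h ▸ hE) hE2)
  exact (hD.germ_eq hE1 a).trans ((congrFun e _).trans (hD'.germ_eq hE2 a).symm)

/-- A logarithmic derivation is determined by the underlying derivation. -/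
lemma IsLogDerivation.eq_of_underlyingDer_eq (hX : IsLogCurve p) {δ δ' : LogFamily X W}
    (hδ : IsLogDerivation p W δ) (hδ' : IsLogDerivation p W δ')
    (h : underlyingDer (fun U => (δ U).1) = underlyingDer fun U => (δ' U).1) : δ = δ' := by
  have h1 := hδ.isEtaleDer.eq_of_underlyingDer_eq hδ'.isEtaleDer h
  refine funext fun U => Prod.ext (congrFun h1 U) (funext fun m => ?_)
  have h2 := hδ'.isDlog U m
  rw [← h1] at h2
  exact IsDlog.unique hX (hδ.isDlog U m) h2

lemma underlyingDer_def (D : ∀ U : EtIn W, Γ(U.1.left, ⊤) → Γ(U.1.left, ⊤))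
    (V : {V : X.toScheme.Opens // V ≤ W}) (b : Γ(X.toScheme, V.1)) :
    underlyingDer D V b = V.1.topIso.hom (D (openEt V) (V.1.topIso.inv b)) := by
  unfold underlyingDer; rfl

lemma topIso_hom_etPull (V : {V : X.toScheme.Opens // V ≤ W}) (a : Γ(X.toScheme, W)) :
    V.1.topIso.hom (etPull (openEt V) a) = rs V.2 a := by
  refine topIso_inv_injective V.1 ?_
  refine (ConcreteCategory.congr_hom V.1.topIso.hom_inv_id _).trans ?_
  refine Eq.trans ?_ (ConcreteCategory.congr_hom (topIso_inv_eq_appLE (T := X.toScheme) V.1) _).symm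
  exact (ConcreteCategory.congr_hom (Scheme.Hom.map_appLE (Scheme.Opens.ι (X := X.toScheme) V.1)
    (Scheme.Opens.ι_preimage_self (X := X.toScheme) V.1).ge (homOfLE V.2).op) a).symm

/-- The vector field underlying a logarithmic derivation. -/
noncomputable def underlyingField (hZ : ∀ z ∈ Z, IsMarking p z) (W : X.toScheme.Opens) :
    logDerivations p W →ₗ[Γ(X.toScheme, W)] tangentFields p.base Z W where
  toFun δ := ⟨underlyingDer fun U => (δ.1 U).1, δ.2.isEtaleDer.isTangentField
    (fun U m => ⟨_, δ.2.dlog_eps U m⟩) hZ⟩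
  map_add' δ δ' := by
    refine Subtype.ext (funext fun V => funext fun b => ?_)
    have h : ∀ (D D' : ∀ U : EtIn W, Γ(U.1.left, ⊤) → Γ(U.1.left, ⊤)),
        underlyingDer (fun U => D U + D' U) V b = underlyingDer D V b + underlyingDer D' V b := fun D D' => by
      rw [underlyingDer_def, underlyingDer_def, underlyingDer_def]
      exact map_add V.1.topIso.hom.hom _ _
    exact h _ _
  map_smul' a δ := by
    refine Subtype.ext (funext fun V => funext fun b => ?_)
    have h : ∀ (D : ∀ U : EtIn W, Γ(U.1.left, ⊤) → Γ(U.1.left, ⊤)),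
        underlyingDer (fun U => a • D U) V b = rs V.2 a * underlyingDer D V b := fun D => by
      rw [underlyingDer_def, underlyingDer_def, ← topIso_hom_etPull]
      exact map_mul V.1.topIso.hom.hom (etPull (openEt V) a) _
    exact h _

lemma underlyingField_apply (hZ : ∀ z ∈ Z, IsMarking p z) (δ : logDerivations p W) :
    (underlyingField hZ W δ).1 = underlyingDer fun U => (δ.1 U).1 := rfl

lemma underlyingField_injective (hX : IsLogCurve p) (hZ : ∀ z ∈ Z, IsMarking p z) :
    Function.Injective (underlyingField hZ W) := fun δ δ' h =>
  Subtype.ext (δ.2.eq_of_underlyingDer_eq hX δ'.2 (congrArg Subtype.val h))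

lemma underlyingField_logRes (hZ : ∀ z ∈ Z, IsMarking p z) {W' : X.toScheme.Opens} (h : W' ≤ W)
    (δ : logDerivations p W) : underlyingField hZ W' (logRes p h δ) =
      tangentRes p.base Z h (underlyingField hZ W δ) := by
  refine Subtype.ext (funext fun V => funext fun b => ?_)
  exact (underlyingDer_def _ V b).trans
    (underlyingDer_def (fun U => (δ.1 U).1) ⟨V.1, V.2.trans h⟩ b).symm

attribute [irreducible] underlyingField

/-- The homomorphism from the logarithmic tangent sheaf to the sheaf of vector fields tangent to the
markings. -/
noncomputable def underlyingHom (hZ : ∀ z ∈ Z, IsMarking p z) : logTangentSheaf p ⟶ tangentSheaf p.base Z :=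
  ⟨PresheafOfModules.homMk
    { app W := AddCommGrpCat.ofHom ((underlyingField hZ W.unop).toAddMonoidHom.comp
        (unshrink p W.unop).toAddMonoidHom)
      naturality := fun W W' f => by
        refine ConcreteCategory.hom_ext _ _ fun δ => ?_
        have h1 := underlyingField_logRes hZ f.unop.le (unshrink p W.unop δ)
        have h2 := (unshrink p W'.unop).apply_symm_apply (logRes p f.unop.le (unshrink p W.unop δ))
        exact (congrArg (underlyingField hZ W'.unop) h2).trans h1 }
    fun W r δ => (congrArg (underlyingField hZ W.unop) ((unshrink p W.unop).map_smul r δ)).trans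
      ((underlyingField hZ W.unop).map_smul r _)⟩

lemma isUnderlyingDerivation_underlyingHom (hZ : ∀ z ∈ Z, IsMarking p z) :
    IsUnderlyingDerivation p (underlyingHom hZ) := fun W δ V b => by
  refine (underlyingDer_def (fun U => ((unshrink p W δ).1 U).1) V b).symm.trans ?_
  exact congrFun (congrFun (underlyingField_apply hZ (unshrink p W δ)).symm V) b

lemma underlyingHom_app_injective (hX : IsLogCurve p) (hZ : ∀ z ∈ Z, IsMarking p z) (W : X.toScheme.Opens) :
    Function.Injective (Scheme.Modules.Hom.app (underlyingHom hZ) W) := fun _ _ h =>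
  (unshrink p W).injective (underlyingField_injective hX hZ h)

end Forward

/-! ### The module of derivations at a node -/

section NodeDerivations

variable {k B B' : Type u} [Field k] [CommRing B] [CommRing B']

/-- A derivation over the constants. -/
structure IsConstDer (κ : k →+* B) (D : B → B) : Prop where
  der : IsDerAlong (RingHom.id B) D
  const : ∀ c, D (κ c) = 0

/-- The derivation `E` of `B'` extends the derivation `D` of `B`. -/
structure IsDerExtension (f : B →+* B') (D : B → B) (E : B' → B') : Prop where
  der : IsDerAlong (RingHom.id B') E
  apply : ∀ b, E (f b) = f (D b)

/-- The local ring `B` of a node, with an étale local extension `B'` with parameters `u`, `v` along the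
branches. -/
structure IsNodeExtension (κ : k →+* B) (f : B →+* B') (u v : B') : Prop where
  isLocalRing : IsLocalRing B
  isEtaleLocal : IsEtaleLocal f
  isNodeRing : IsNodeRing u v
  residue : ∀ r : B', ∃ c : k, ¬ IsUnit (r - f (κ c))
  ext : ∀ D E : B' → B', IsConstDer (f.comp κ) D → IsConstDer (f.comp κ) E → D u = E u → D v = E v → D = E
  sum_left : ∃ (E : B' → B') (n : ℕ) (b : Fin n → B') (d : Fin n → B → B),
    IsDerAlong (RingHom.id B') E ∧ (∀ i, IsConstDer κ (d i)) ∧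
    (∀ x, E (f x) = ∑ i, b i * f (d i x)) ∧ E u = u ∧ E v = 0
  sum_right : ∃ (E : B' → B') (n : ℕ) (b : Fin n → B') (d : Fin n → B → B),
    IsDerAlong (RingHom.id B') E ∧ (∀ i, IsConstDer κ (d i)) ∧
    (∀ x, E (f x) = ∑ i, b i * f (d i x)) ∧ E u = 0 ∧ E v = v

lemma IsConstDer.smul {κ : k →+* B} {D : B → B} (h : IsConstDer κ D) (b : B) :
    IsConstDer κ (fun x => b * D x) :=
  ⟨h.der.smul b, fun c => by rw [h.const, mul_zero]⟩

lemma IsConstDer.add {κ : k →+* B} {D E : B → B} (h : IsConstDer κ D) (h' : IsConstDer κ E) :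
    IsConstDer κ (fun x => D x + E x) :=
  ⟨h.der.add' h'.der, fun c => by rw [h.const, h'.const, add_zero]⟩

lemma IsConstDer.sum {κ : k →+* B} {n : ℕ} {D : Fin n → B → B} (h : ∀ i, IsConstDer κ (D i)) :
    IsConstDer κ (fun x => ∑ i, D i x) :=
  ⟨IsDerAlong.sum _ fun i => (h i).der, fun c => by simp only [(h _).const, Finset.sum_const_zero]⟩

/-- Apply `E` to `u v = 0` and multiply by `v`: what remains is `v ^ 2 * E u = 0`, so `u ∣ E u`.
Every derivation at a node is logarithmic along both branches. -/
lemma IsNodeRing.dvd_der {u v : B'} (hn : IsNodeRing u v) {E : B' → B'}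
    (hE : IsDerAlong (RingHom.id B') E) : u ∣ E u ∧ v ∣ E v := by
  have h1 : u * E v + v * E u = 0 := by
    have := hE.leibniz u v
    rw [hn.mul, hE.zero] at this
    exact this.symm
  have h2 := hn.mul
  exact ⟨hn.ann_right _ (by linear_combination v * h1 - E v * h2),
    hn.ann_left _ (by linear_combination u * h1 - E u * h2)⟩

namespace IsNodeExtension

variable {κ : k →+* B} {f : B →+* B'} {u v : B'} (h : IsNodeExtension κ f u v)
include h

lemma symm : IsNodeExtension κ f v u where
  isLocalRing := h.isLocalRing
  isEtaleLocal := h.isEtaleLocal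
  isNodeRing := h.isNodeRing.symm
  residue := h.residue
  ext D E hD hE h1 h2 := h.ext D E hD hE h2 h1
  sum_left := by
    obtain ⟨E, n, b, d, h1, h2, h3, h4, h5⟩ := h.sum_right
    exact ⟨E, n, b, d, h1, h2, h3, h5, h4⟩
  sum_right := by
    obtain ⟨E, n, b, d, h1, h2, h3, h4, h5⟩ := h.sum_left
    exact ⟨E, n, b, d, h1, h2, h3, h5, h4⟩

lemma exists_ext {D : B → B} (hD : IsConstDer κ D) : ∃ E, IsDerExtension f D E := by
  obtain ⟨E, h1, h2⟩ := IsDerAlong.exists_extension h.isEtaleLocal.formallyEtale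
    (RingHom.id _) (D := fun a => f (D a)) (hD.der.comp_left f)
  exact ⟨E, h1, h2⟩

/-- There are derivations with prescribed logarithmic values at the node. -/
lemma exists_of_sum {E : B' → B'} {n : ℕ} {b : Fin n → B'} {d : Fin n → B → B}
    (hE : IsDerAlong (RingHom.id B') E) (hd : ∀ i, IsConstDer κ (d i))
    (hsum : ∀ x, E (f x) = ∑ i, b i * f (d i x)) {p q : B'} (hu : E u = p * u) (hv : E v = q * v) :
    ∃ (D : B → B) (D' : B' → B') (p' q' : B'), IsConstDer κ D ∧ IsDerExtension f D D' ∧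
      D' u = p' * u ∧ D' v = q' * v ∧ ¬ IsUnit (p' - p) ∧ ¬ IsUnit (q' - q) := by
  have hn := h.isNodeRing
  have hloc := hn.isLocalRing
  -- `E` restricts to a combination of derivations of `B` with coefficients in `B'`. Replacing each
  -- coefficient by the constant with the same residue gives a derivation of `B` itself and moves
  -- the logarithmic values only within the maximal ideal.
  choose c hc using fun i => h.residue (b i)
  choose e he using fun i => h.exists_ext (hd i)
  choose p1 hp1 using fun i => (hn.dvd_der (he i).der).1
  choose q1 hq1 using fun i => (hn.dvd_der (he i).der).2
  let D' : B' → B' := fun x => E x + ∑ i, (f (κ (c i)) - b i) * e i x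
  have hD' : IsDerAlong (RingHom.id B') D' :=
    hE.add' (IsDerAlong.sum _ fun i => (he i).der.smul _)
  have hmem : ∀ i, f (κ (c i)) - b i ∈ maximalIdeal B' := fun i => by
    rw [← neg_mem_iff, neg_sub]; exact hc i
  refine ⟨fun x => ∑ i, κ (c i) * d i x, D', p + ∑ i, (f (κ (c i)) - b i) * p1 i,
    q + ∑ i, (f (κ (c i)) - b i) * q1 i, IsConstDer.sum fun i => (hd i).smul _, ⟨hD', fun x => ?_⟩, ?_, ?_, ?_, ?_⟩
  · simp only [D', hsum, (he _).apply, map_sum, map_mul, ← Finset.sum_add_distrib]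
    exact Finset.sum_congr rfl fun i _ => by ring
  · simp only [D', hu, hp1, add_mul, Finset.sum_mul]
    exact congrArg _ (Finset.sum_congr rfl fun i _ => by ring)
  · simp only [D', hv, hq1, add_mul, Finset.sum_mul]
    exact congrArg _ (Finset.sum_congr rfl fun i _ => by ring)
  · rw [add_sub_cancel_left]
    exact (maximalIdeal B').sum_mem fun i _ => Ideal.mul_mem_right _ _ (hmem i)
  · rw [add_sub_cancel_left]
    exact (maximalIdeal B').sum_mem fun i _ => Ideal.mul_mem_right _ _ (hmem i)

lemma not_isUnit_map {b : B} (hb : ¬ IsUnit b) : ¬ IsUnit (f b) := fun hu => by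
  have := h.isEtaleLocal.isLocalHom
  exact hb (isUnit_of_map_unit f b hu)

lemma map_injective : Function.Injective f := by
  have := h.isLocalRing
  have := h.isNodeRing.isLocalRing
  exact injective_of_flat_of_isLocalHom h.isEtaleLocal.flat h.isEtaleLocal.isLocalHom

omit h in
lemma _root_.IsDerExtension.isConstDer {D : B → B} (hD : IsConstDer κ D) {D' : B' → B'}
    (h : IsDerExtension f D D') : IsConstDer (f.comp κ) D' :=
  ⟨h.der, fun c => by rw [RingHom.comp_apply, h.apply, hD.const, map_zero]⟩

/-- If `u` divided all values on `B`, then `D'` modulo `u` would be a derivation of `B'` that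
vanishes on `B`, hence zero because `B'` is unramified over `B`. -/
lemma exists_not_dvd {D : B → B} {D' : B' → B'} (hD' : IsDerExtension f D D') {w : B'}
    (hw : ¬ u ∣ D' w) : ∃ x, ¬ u ∣ f (D x) := by
  by_contra! hall
  refine hw ?_
  have h1 := IsDerAlong.ext_of_formallyUnramified h.isEtaleLocal.formallyUnramified
    (hD'.der.comp_left (Ideal.Quotient.mk (Ideal.span {u})))
    (IsDerAlong.of_zero _) (fun x => by
      rw [hD'.apply]
      exact Ideal.Quotient.eq_zero_iff_mem.2 (Ideal.mem_span_singleton.2 (hall x)))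
  exact Ideal.mem_span_singleton.1 (Ideal.Quotient.eq_zero_iff_mem.1 (congrFun h1 w))

/-- The traceless derivations are the multiples of a derivation. -/
lemma exists_traceless : ∃ (σ : B → B) (σ' : B' → B') (g : B'), IsConstDer κ σ ∧ IsDerExtension f σ σ' ∧
    IsUnit g ∧ σ' u = g * u ∧ σ' v = - g * v ∧ (∃ x, f (σ x) ∈ B'⁰) ∧
    ∀ (D : B → B) (D' : B' → B'), IsConstDer κ D → IsDerExtension f D D' → IsTraceless u v D' →
      ∃ r, ∀ x, D x = r * σ x := by
  have hn := h.isNodeRing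
  have hloc := hn.isLocalRing
  obtain ⟨E1, n1, b1, d1, hE1, hd1, hs1, hu1, hv1⟩ := h.sum_left
  obtain ⟨E2, n2, b2, d2, hE2, hd2, hs2, hu2, hv2⟩ := h.sum_right
  obtain ⟨D1, D1', p1, q1, hD1, hD1', hp1, hq1, hp1', hq1'⟩ := h.exists_of_sum hE1 hd1 hs1
    (p := 1) (q := 0) (by rw [hu1, one_mul]) (by rw [hv1, zero_mul])
  obtain ⟨D2, D2', p2, q2, hD2, hD2', hp2, hq2, hp2', hq2'⟩ := h.exists_of_sum hE2 hd2 hs2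
    (p := 0) (q := 1) (by rw [hu2, zero_mul]) (by rw [hv2, one_mul])
  -- The logarithmic values of `D1` and `D2` are congruent to `(1, 0)` and `(0, 1)`, so the
  -- difference resembles `u ∂u - v ∂v`.
  let σ : B → B := fun x => D1 x + (-1) * D2 x
  let σ' : B' → B' := fun x => D1' x + (-1) * D2' x
  have hσ : IsConstDer κ σ := hD1.add (hD2.smul (-1))
  have hσ' : IsDerExtension f σ σ' := ⟨hD1'.der.add' (hD2'.der.smul (-1)), fun x => by
    simp only [σ, σ', hD1'.apply, hD2'.apply, map_add, map_mul, map_neg, map_one]⟩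
  have e1 : σ' u = (p1 - p2) * u := by simp only [σ', hp1, hp2]; ring
  have e2 : σ' v = (q1 - q2) * v := by simp only [σ', hq1, hq2]; ring
  have hw : ¬ IsUnit ((p1 - p2) + (q1 - q2) - 0) := by
    have h1 : (p1 - p2) + (q1 - q2) - 0 = (p1 - 1) + (q1 - 0) - (p2 - 0) - (q2 - 1) := by ring
    rw [h1]
    exact (maximalIdeal B').sub_mem ((maximalIdeal B').sub_mem ((maximalIdeal B').add_mem hp1' hq1') hp2') hq2'
  -- The coefficients can be chosen with sum exactly zero, and not only zero at the node.
  obtain ⟨g, g2, e3, e4, hg2⟩ := hn.exists_sum_eq hw e1 e2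
  obtain rfl : g2 = -g := (neg_eq_of_add_eq_zero_right hg2).symm
  have hg : IsUnit g := by
    by_contra hg
    have h1 : (g - (p1 - p2)) * u = 0 := by rw [sub_mul, ← e3, ← e1, sub_self]
    obtain ⟨r, hr⟩ := hn.dvd_of_mul_left (r := g - (p1 - p2)) (by rw [mul_comm, h1])
    have h2 : (1 : B') = g - v * r - (p1 - 1) + (p2 - 0) := by rw [← hr]; ring
    have h3 : (1 : B') ∈ maximalIdeal B' := h2 ▸ (maximalIdeal B').add_mem ((maximalIdeal B').sub_mem
      ((maximalIdeal B').sub_mem hg (Ideal.mul_mem_right _ _ hn.not_isUnit_right)) hp1') hp2'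
    exact h3 isUnit_one
  have hx : ∃ x, f (σ x) ∈ B'⁰ := by
    obtain ⟨x, -, hx⟩ := hn.exists_mem_nonZeroDivisors (f.toAddMonoidHom.comp (AddMonoidHom.mk' σ hσ.der.add)) ⊤
      (by
        obtain ⟨x, hx⟩ := h.exists_not_dvd hσ' (w := v) (by
          rw [e4, neg_mul, dvd_neg, (hg.dvd_mul_left)]
          exact hn.not_dvd)
        exact ⟨x, trivial, hx⟩)
      (by
        obtain ⟨x, hx⟩ := h.symm.exists_not_dvd hσ' (w := u) (by
          rw [e3, (hg.dvd_mul_left)]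
          exact hn.symm.not_dvd)
        exact ⟨x, trivial, hx⟩)
    exact ⟨x, hx⟩
  refine ⟨σ, σ', g, hσ, hσ', hg, e3, e4, hx, fun D D' hD hD' ⟨a, b, ha, hb, hab⟩ => ?_⟩
  obtain ⟨a, b', ha, hb, hab⟩ := hn.exists_sum_eq (w := 0) (by rwa [sub_zero]) ha hb
  obtain rfl : b' = -a := (neg_eq_of_add_eq_zero_right hab).symm
  obtain ⟨g', hg'⟩ := hg.exists_right_inv
  -- A derivation over the constants is determined by its values on `u` and `v`. The factor `a * g'`
  -- lies in `B'` at first; it descends to `B` as the quotient of `D x` by `σ x`, where `f (σ x)` is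
  -- a non-zero-divisor.
  have key : D' = fun x => (a * g') * σ' x := by
    refine h.ext _ _ (hD'.isConstDer hD) ((hσ'.isConstDer hσ).smul _) ?_ ?_
    · simp only [ha, e3]; linear_combination (-a * u) * hg'
    · simp only [hb, e4]; linear_combination (a * v) * hg'
  obtain ⟨x, hx⟩ := hx
  have h1 : f (D x) = (a * g') * f (σ x) := by rw [← hD'.apply, ← hσ'.apply, key]
  have hB := h.isLocalRing
  obtain ⟨r, hr⟩ := dvd_of_map_dvd_of_flat h.isEtaleLocal.flat h.isEtaleLocal.isLocalHom
    (a := σ x) (b := D x) (by rw [h1]; exact dvd_mul_left _ _)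
  have h2 : a * g' = f r := by
    rw [hr, map_mul, mul_comm] at h1
    exact (mul_cancel_right_mem_nonZeroDivisors hx).1 h1.symm
  refine ⟨r, fun y => h.map_injective ?_⟩
  rw [map_mul, ← h2, ← hD'.apply, ← hσ'.apply, key]

/-- The module of derivations at a node. -/
lemma exists_generators : ∃ (σ τ : B → B) (g p q : B'), IsConstDer κ σ ∧ IsConstDer κ τ ∧
    IsUnit g ∧ IsUnit (p + q) ∧
    (∀ r, (∀ x, r * σ x = 0) → r = 0) ∧
    (∃ σ', IsDerExtension f σ σ' ∧ IsTraceless u v σ') ∧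
    (∀ (D : B → B) (D' : B' → B'), IsConstDer κ D → IsDerExtension f D D' → IsTraceless u v D' →
      ∃ r, ∀ x, D x = r * σ x) ∧
    (∀ D : B → B, IsConstDer κ D → ∃ r s, ∀ x, D x = r * σ x + s * τ x) ∧
    (∀ b, ¬ IsUnit b → ∃ c, ∀ x, b * τ x = c * σ x) ∧
    ∀ b c, (∀ x, b * τ x = c * σ x) → v ∣ f b * p - f c * g ∧ u ∣ f b * q + f c * g := by
  have hn := h.isNodeRing
  have hloc := hn.isLocalRing
  obtain ⟨σ, σ', g, hσ, hσ', hg, e1, e2, ⟨x, hx⟩, hT⟩ := h.exists_traceless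
  obtain ⟨E1, n1, b1, d1, hE1, hd1, hs1, hu1, hv1⟩ := h.sum_left
  obtain ⟨τ, τ', p, q, hτ, hτ', hp, hq, hp', hq'⟩ := h.exists_of_sum hE1 hd1 hs1
    (p := 1) (q := 0) (by rw [hu1, one_mul]) (by rw [hv1, zero_mul])
  have hpq : IsUnit (p + q) := by
    by_contra hc
    have h1 : (1 : B') = (p + q) - (p - 1) - (q - 0) := by ring
    have h3 : (1 : B') ∈ maximalIdeal B' := h1 ▸ (maximalIdeal B').sub_mem ((maximalIdeal B').sub_mem hc hp') hq'
    exact h3 isUnit_one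
  refine ⟨σ, τ, g, p, q, hσ, hτ, hg, hpq, fun r hr => ?_, ⟨σ', hσ', g, -g, e1, e2, by simp⟩, hT, fun D hD => ?_,
    fun b hb => ?_, fun b c hbc => ?_⟩
  · refine h.map_injective ?_
    rw [map_zero]
    refine (mem_nonZeroDivisors_iff_right.1 hx) _ ?_
    rw [← map_mul, hr, map_zero]
  · obtain ⟨D', hD'⟩ := h.exists_ext hD
    obtain ⟨a, ha⟩ := (hn.dvd_der hD'.der).1
    obtain ⟨b, hb⟩ := (hn.dvd_der hD'.der).2
    obtain ⟨w, hw⟩ := hpq.exists_right_inv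
    -- Subtracting the constant multiple of `τ` with the same trace at the node leaves a traceless
    -- derivation, which is a multiple of `σ`.
    obtain ⟨s, hs⟩ := h.residue ((a + b) * w)
    obtain ⟨r, hr⟩ := hT (fun x => D x + (-κ s) * τ x) (fun x => D' x + (-f (κ s)) * τ' x)
      (hD.add (hτ.smul _)) ⟨hD'.der.add' (hτ'.der.smul _), fun x => by
        simp only [hD'.apply, hτ'.apply, map_add, map_mul, map_neg]⟩
      ⟨a - f (κ s) * p, b - f (κ s) * q, by simp only [ha, hp]; ring, by simp only [hb, hq]; ring, by
        have : a - f (κ s) * p + (b - f (κ s) * q) = ((a + b) * w - f (κ s)) * (p + q) := by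
          linear_combination (-(a + b)) * hw
        rw [this]
        exact fun hu => hs (isUnit_of_mul_isUnit_left hu)⟩
    exact ⟨r, κ s, fun x => by rw [← hr]; ring⟩
  · refine hT (fun x => b * τ x) (fun x => f b * τ' x) (hτ.smul b) ⟨hτ'.der.smul _, fun x => by
      rw [hτ'.apply, map_mul]⟩ ⟨f b * p, f b * q, by simp only [hp, mul_assoc], by simp only [hq, mul_assoc], ?_⟩
    rw [← mul_add]
    exact fun hu => h.not_isUnit_map hb (isUnit_of_mul_isUnit_left hu)
  -- The relation extends to `B'` and can be evaluated on `u` and `v`: `c / b` becomes `p / g` along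
  -- `v = 0` and `-q / g` along `u = 0`.
  · have hext : ∀ y, f b * τ' y = f c * σ' y := congrFun (IsDerAlong.ext_of_formallyUnramified
      h.isEtaleLocal.formallyUnramified (hτ'.der.smul (f b)) (hσ'.der.smul (f c)) fun y => by
        rw [hτ'.apply, hσ'.apply, ← map_mul, hbc, map_mul])
    have h1 := hext u
    have h2 := hext v
    rw [hp, e1] at h1
    rw [hq, e2] at h2
    exact ⟨hn.dvd_of_mul_left (by linear_combination h1), hn.dvd_of_mul_right (by linear_combination h2)⟩

end IsNodeExtension

end NodeDerivations

/-! ### Local criteria for sheaves of modules -/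

section LocalCriteria

variable {X : Scheme.{u}} {F G H : X.Modules}

lemma app_mrs (φ : F ⟶ G) {V U : X.Opens} (h : V ≤ U) (s : Γ(F, U)) :
    φ.app V (mrs F h s) = mrs G h (φ.app U s) :=
  ConcreteCategory.congr_hom (φ.mapPresheaf.naturality (homOfLE h).op) s

lemma comp_app_apply (φ : F ⟶ G) (ψ : G ⟶ H) (U : X.Opens) (s : Γ(F, U)) :
    (φ ≫ ψ).app U s = ψ.app U (φ.app U s) := rfl

lemma mrs_ext (F : X.Modules) {U : X.Opens} (s t : Γ(F, U))
    (h : ∀ x ∈ U, ∃ (V : X.Opens) (h : V ≤ U), x ∈ V ∧ mrs F h s = mrs F h t) : s = t := by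
  choose V hV hx hst using fun x : U => h x.1 x.2
  exact TopCat.Sheaf.eq_of_locally_eq' (C := AddCommGrpCat) ⟨F.presheaf, F.isSheaf⟩ V U
    (fun x => homOfLE (hV x)) (fun x hxU => Opens.mem_iSup.2 ⟨⟨x, hxU⟩, hx _⟩) s t fun x => hst x

/-- Each section of the target is locally in the image. -/
def IsLocSurjective (φ : F ⟶ G) : Prop :=
  ∀ (U : X.Opens) (s : Γ(G, U)), ∀ x ∈ U, ∃ (V : X.Opens) (h : V ≤ U) (t : Γ(F, V)),
    x ∈ V ∧ φ.app V t = mrs G h s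

lemma IsLocSurjective.epi {φ : F ⟶ G} (hφ : IsLocSurjective φ) : Epi φ := by
  refine Preadditive.epi_of_cancel_zero _ fun ψ hψ => ?_
  refine Scheme.Modules.hom_ext _ _ fun U => ConcreteCategory.hom_ext _ _ fun s => ?_
  refine mrs_ext _ _ _ fun x hx => ?_
  obtain ⟨V, h, t, hxV, ht⟩ := hφ U s x hx
  refine ⟨V, h, hxV, ?_⟩
  rw [← app_mrs, ← app_mrs, ← ht, ← comp_app_apply, hψ]
  rfl

lemma mono_of_app_injective {φ : F ⟶ G} (hφ : ∀ (U : X.Opens) (s : Γ(F, U)), φ.app U s = 0 → s = 0) :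
    Mono φ := by
  refine Preadditive.mono_of_cancel_zero _ fun ψ hψ => ?_
  refine Scheme.Modules.hom_ext _ _ fun U => ConcreteCategory.hom_ext _ _ fun s => hφ U _ ?_
  rw [← comp_app_apply, hψ]
  rfl

lemma app_injective (φ : F ⟶ G) [Mono φ] (U : X.Opens) : Function.Injective (φ.app U) := by
  have : Mono ((Scheme.Modules.toPresheaf X).map φ) := inferInstance
  have : Mono (((Scheme.Modules.toPresheaf X).map φ).app (op U)) := inferInstance
  exact (AddCommGrpCat.mono_iff_injective _).1 this

lemma exact_of_local {f : F ⟶ G} {g : G ⟶ H} (w : f ≫ g = 0)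
    (hfg : ∀ (U : X.Opens) (s : Γ(G, U)), g.app U s = 0 → ∀ x ∈ U, ∃ (V : X.Opens) (h : V ≤ U)
      (t : Γ(F, V)), x ∈ V ∧ f.app V t = mrs G h s) : (ShortComplex.mk f g w).Exact := by
  rw [ShortComplex.exact_iff_epi_kernel_lift]
  refine IsLocSurjective.epi fun U s x hx => ?_
  obtain ⟨V, h, t, hxV, ht⟩ := hfg U ((kernel.ι g).app U s) (by
    rw [← comp_app_apply, kernel.condition]; rfl) x hx
  refine ⟨V, h, t, hxV, app_injective (kernel.ι g) V ?_⟩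
  rw [← comp_app_apply, app_mrs, ← ht]
  exact congrArg (fun φ => Scheme.Modules.Hom.app φ V t) (kernel.lift_ι g f w)

/-- The sections which are locally in the image. -/
def imageSections (φ : F ⟶ G) (U : X.Opens) : Submodule Γ(X, U) Γ(G, U) where
  carrier := {s | ∀ x ∈ U, ∃ (V : X.Opens) (h : V ≤ U) (t : Γ(F, V)), x ∈ V ∧ φ.app V t = mrs G h s}
  zero_mem' x hx := ⟨U, le_rfl, 0, hx, by rw [map_zero, map_zero]⟩
  add_mem' {s s'} hs hs' x hx := by
    obtain ⟨V, h, t, hxV, ht⟩ := hs x hx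
    obtain ⟨V', h', t', hxV', ht'⟩ := hs' x hx
    refine ⟨V ⊓ V', inf_le_left.trans h, mrs F inf_le_left t + mrs F inf_le_right t', ⟨hxV, hxV'⟩, ?_⟩
    rw [map_add, app_mrs, app_mrs, ht, ht', mrs_mrs, mrs_mrs, map_add]
  smul_mem' c s hs x hx := by
    obtain ⟨V, h, t, hxV, ht⟩ := hs x hx
    exact ⟨V, h, rs h c • t, hxV, by rw [Scheme.Modules.Hom.app_smul, ht, mrs_smul]⟩

/-- The image presheaf of submodules. -/
def imageSubmodule (φ : F ⟶ G) : PresheafOfModules.Submodule G.val where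
  obj U := imageSections φ U.unop
  map {U U'} f s hs x hx := by
    obtain ⟨V, h, t, hxV, ht⟩ := hs x (f.unop.le hx)
    refine ⟨V ⊓ U'.unop, inf_le_right, mrs F inf_le_left t, ⟨hxV, hx⟩, ?_⟩
    rw [app_mrs, ht]
    exact (mrs_mrs G inf_le_left h s).trans
      (mrs_mrs G (inf_le_right : V ⊓ U'.unop ≤ U'.unop) f.unop.le s).symm

/-- The image sheaf. -/
noncomputable def imageSheaf (φ : F ⟶ G) : X.Modules where
  val := (imageSubmodule φ).toPresheafOfModules
  isSheaf := by
    change TopCat.Presheaf.IsSheaf (X := X) (imageSubmodule φ).toPresheafOfModules.presheaf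
    rw [TopCat.Presheaf.isSheaf_iff_isSheaf_comp (forget AddCommGrpCat.{u})]
    apply TopCat.Presheaf.isSheaf_of_isSheafUniqueGluing_types
    intro ι U sf hsf
    let s : ∀ i, imageSections φ (U i) := sf
    obtain ⟨t, ht, ht'⟩ := G.isSheaf.isSheafUniqueGluing U
      (fun i => (s i).1) (fun i j => congrArg Subtype.val (hsf i j))
    have hmem : t ∈ imageSections φ (iSup U) := by
      intro x hx
      obtain ⟨i, hi⟩ := Opens.mem_iSup.mp hx
      obtain ⟨V, hV, r, hxV, hr⟩ := (s i).2 x hi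
      refine ⟨V, hV.trans (le_iSup U i), r, hxV, ?_⟩
      have h1 : mrs G (le_iSup U i) t = (s i).1 := ht i
      rw [← mrs_mrs G hV (le_iSup U i), h1, hr]
    refine ⟨(⟨t, hmem⟩ : imageSections φ (iSup U)), fun i => Subtype.ext (ht i), ?_⟩
    intro E hE
    exact Subtype.ext (ht' (E : imageSections φ (iSup U)).1 fun i => congrArg Subtype.val (hE i))

/-- An epimorphism factors through its image sheaf, whose inclusion is then both a monomorphism and
an epimorphism, hence an isomorphism. -/
lemma isLocSurjective_of_epi (φ : F ⟶ G) [Epi φ] : IsLocSurjective φ := by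
  let i : imageSheaf φ ⟶ G := ⟨(imageSubmodule φ).ι⟩
  let j : F ⟶ imageSheaf φ := ⟨PresheafOfModules.homMk
    { app U := AddCommGrpCat.ofHom (AddMonoidHom.mk' (fun s => (⟨φ.app U.unop s, fun x hx =>
        ⟨U.unop, le_rfl, s, hx,
          ConcreteCategory.congr_hom (G.presheaf.map_id _).symm (φ.app U.unop s)⟩⟩ :
            imageSections φ U.unop)) fun s t => Subtype.ext (map_add _ _ _))
      naturality U V f := ConcreteCategory.hom_ext _ _ fun s =>
        Subtype.ext (app_mrs φ f.unop.le s) }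
    fun U r s => Subtype.ext (Scheme.Modules.Hom.app_smul φ _ _)⟩
  have hij : j ≫ i = φ := rfl
  have hm : Mono i := mono_of_app_injective fun U s hs => Subtype.ext hs
  have he : Epi i := by
    have : Epi (j ≫ i) := by rw [hij]; infer_instance
    exact epi_of_epi j i
  have hiso : IsIso i := isIso_of_mono_of_epi i
  intro U s
  let r : imageSections φ U := (inv i).app U s
  have hr : i.app U ((inv i).app U s) = s := by
    rw [← comp_app_apply, IsIso.inv_hom_id]; rfl
  have := r.2
  rwa [show r.1 = s from hr] at this

/-- The torsion subsheaf is the kernel of the projection, and taking sections over `U` is left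
exact. -/
lemma isTorsionSection_of_modTorsionπ_eq_zero {U : X.Opens} (s : Γ(F, U))
    (hs : (modTorsionπ F).app U s = 0) : IsTorsionSection F U s := by
  have hm : Mono (torsionι F) := mono_of_app_injective fun U s hs => Subtype.ext hs
  have hex : (ShortComplex.mk (torsionι F) (modTorsionπ F) (cokernel.condition _)).Exact :=
    ShortComplex.exact_cokernel _
  let Φ := Scheme.Modules.toPresheaf X ⋙ (evaluation _ AddCommGrpCat.{u}).obj (op U)
  have : PreservesFiniteLimits ((evaluation (Opens X)ᵒᵖ AddCommGrpCat.{u}).obj (op U)) :=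
    ⟨fun J _ _ => inferInstance⟩
  have : PreservesFiniteLimits Φ := comp_preservesFiniteLimits _ _
  have : Φ.PreservesZeroMorphisms := ⟨fun _ _ => rfl⟩
  have h2 := hex.map_of_mono_of_preservesKernel Φ hm inferInstance
  rw [ShortComplex.ab_exact_iff] at h2
  obtain ⟨t, ht⟩ := h2 s hs
  have h3 := (t : torsionSections F U).2
  rwa [show (t : torsionSections F U).1 = s from ht] at h3

lemma modTorsionπ_eq_zero {U : X.Opens} (s : Γ(F, U)) (hs : IsTorsionSection F U s) :
    (modTorsionπ F).app U s = 0 := by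
  have h := congrArg (fun φ => Scheme.Modules.Hom.app φ U (⟨s, hs⟩ : torsionSections F U))
    (cokernel.condition (torsionι F))
  exact h

end LocalCriteria

/-! ### Stalks of sheaves of modules and of their pull backs -/

section StalkModules

variable {X Y : Scheme.{u}}

noncomputable instance stalkModule (M : X.Modules) (x : X) :
    Module (X.presheaf.stalk x) (M.presheaf.stalk x) :=
  let M' : PresheafOfModules.{u} (X.presheaf ⋙ forget₂ CommRingCat.{u} RingCat.{u}) := M.val
  inferInstanceAs (Module ↑(TopCat.Presheaf.stalk X.presheaf x) ↑(TopCat.Presheaf.stalk M'.presheaf x))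

/-- The germ of a section of a module. -/
noncomputable def mgerm (M : X.Modules) {U : X.Opens} {x : X} (hx : x ∈ U) :
    Γ(M, U) →+ M.presheaf.stalk x := (M.presheaf.germ U x hx).hom

variable {M N : X.Modules} {x : X}

lemma mgerm_smul {U : X.Opens} (hx : x ∈ U) (a : Γ(X, U)) (s : Γ(M, U)) :
    mgerm M hx (a • s) = X.presheaf.germ U x hx a • mgerm M hx s :=
  PresheafOfModules.germ_smul (R := X.presheaf) M.val x U hx a s

lemma mgerm_mrs {U V : X.Opens} (h : V ≤ U) (hx : x ∈ V) (s : Γ(M, U)) :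
    mgerm M hx (mrs M h s) = mgerm M (h hx) s :=
  TopCat.Presheaf.germ_res_apply M.presheaf (homOfLE h) x hx s

lemma exists_mgerm_eq (z : M.presheaf.stalk x) :
    ∃ (U : X.Opens) (hx : x ∈ U) (s : Γ(M, U)), mgerm M hx s = z := by
  obtain ⟨U, hx, s, hs⟩ := TopCat.Presheaf.exists_germ_eq M.presheaf z
  exact ⟨U, hx, s, hs⟩

lemma exists_mrs_eq_of_mgerm_eq {U V : X.Opens} {hU : x ∈ U} {hV : x ∈ V} {s : Γ(M, U)} {t : Γ(M, V)}
    (h : mgerm M hU s = mgerm M hV t) : ∃ (W : X.Opens) (hWU : W ≤ U) (hWV : W ≤ V),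
      x ∈ W ∧ mrs M hWU s = mrs M hWV t := by
  obtain ⟨W, hx, i, j, hij⟩ := TopCat.Presheaf.germ_eq M.presheaf x hU hV s t h
  exact ⟨W, i.le, j.le, hx, hij⟩

/-- The universal property of the stalk. It is stated for semilinear maps because of pull backs,
where `φ` is a stalk map. -/
lemma exists_stalk_desc {R' A : Type*} [CommRing R'] [AddCommGroup A] [Module R' A]
    (φ : X.presheaf.stalk x →+* R') (ψ : ∀ U : X.Opens, x ∈ U → Γ(M, U) →+ A)
    (hres : ∀ (V U : X.Opens) (h : V ≤ U) (hx : x ∈ V) (s : Γ(M, U)), ψ V hx (mrs M h s) = ψ U (h hx) s)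
    (hsmul : ∀ (U : X.Opens) (hx : x ∈ U) (a : Γ(X, U)) (s : Γ(M, U)),
      ψ U hx (a • s) = φ (X.presheaf.germ U x hx a) • ψ U hx s) :
    ∃ l : M.presheaf.stalk x →ₛₗ[φ] A, ∀ (U : X.Opens) (hx : x ∈ U) (s : Γ(M, U)),
      l (mgerm M hx s) = ψ U hx s := by
  obtain ⟨L, key⟩ : ∃ L : M.presheaf.stalk x → A, ∀ (U : X.Opens) (hx : x ∈ U) (s : Γ(M, U)),
      L (mgerm M hx s) = ψ U hx s := by
    choose U hU s hs using fun z : M.presheaf.stalk x => exists_mgerm_eq z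
    refine ⟨fun z => ψ (U z) (hU z) (s z), fun V hx t => ?_⟩
    obtain ⟨W, h1, h2, hxW, h3⟩ := exists_mrs_eq_of_mgerm_eq (hs (mgerm M hx t))
    refine (hres _ _ h1 hxW _).symm.trans ?_
    rw [h3, hres]
  refine ⟨⟨⟨L, fun z w => ?_⟩, fun a z => ?_⟩, key⟩
  · obtain ⟨V, hx, t, rfl⟩ := exists_mgerm_eq z
    obtain ⟨V', hx', t', rfl⟩ := exists_mgerm_eq w
    have hi : x ∈ V ⊓ V' := ⟨hx, hx'⟩
    have h1 : mgerm M hx t + mgerm M hx' t' = mgerm M hi (mrs M inf_le_left t + mrs M inf_le_right t') := by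
      rw [map_add, mgerm_mrs, mgerm_mrs]
    rw [h1, key, key, key, map_add, hres, hres]
  · obtain ⟨V, hx, t, rfl⟩ := exists_mgerm_eq z
    obtain ⟨V', hx', b, rfl⟩ := TopCat.Presheaf.exists_germ_eq X.presheaf a
    have hi : x ∈ V ⊓ V' := ⟨hx, hx'⟩
    have h0 := germ_rs (inf_le_right : V ⊓ V' ≤ V') x hi b
    have h1 : X.presheaf.germ V' x hx' b • mgerm M hx t =
        mgerm M hi ((rs inf_le_right b : Γ(X, V ⊓ V')) • mrs M inf_le_left t) := by
      rw [mgerm_smul, mgerm_mrs, h0]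
    refine (congrArg L h1).trans ?_
    rw [key, hsmul, hres, h0]
    exact congrArg _ (key V hx t).symm

/-- The map on stalks. -/
noncomputable def stalkHom (φ : M ⟶ N) (x : X) :
    M.presheaf.stalk x →ₗ[X.presheaf.stalk x] N.presheaf.stalk x :=
  (exists_stalk_desc (M := M) (RingHom.id (X.presheaf.stalk x))
    (fun U hx => (mgerm N hx).comp (φ.app U).hom)
    (fun _ _ h hx s => (congrArg _ (app_mrs φ h s)).trans (mgerm_mrs h hx _))
    (fun _ hx a s => (congrArg _ (φ.app_smul a s)).trans (mgerm_smul hx a _))).choose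

lemma stalkHom_mgerm (φ : M ⟶ N) {U : X.Opens} (hx : x ∈ U) (s : Γ(M, U)) :
    stalkHom φ x (mgerm M hx s) = mgerm N hx (φ.app U s) :=
  (exists_stalk_desc (M := M) (RingHom.id (X.presheaf.stalk x))
    (fun U hx => (mgerm N hx).comp (φ.app U).hom)
    (fun _ _ h hx s => (congrArg _ (app_mrs φ h s)).trans (mgerm_mrs h hx _))
    (fun _ hx a s => (congrArg _ (φ.app_smul a s)).trans (mgerm_smul hx a _))).choose_spec U hx s

section Skyscraper

variable (x) (A : Type u) [AddCommGroup A] [Module (X.presheaf.stalk x) A]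

/-- The skyscraper presheaf. -/
def skyPresheaf : TopCat.Presheaf AddCommGrpCat.{u} X where
  obj U := AddCommGrpCat.of (PLift (x ∈ U.unop) → A)
  map {U V} f := AddCommGrpCat.ofHom
    { toFun s h := s ⟨f.unop.le h.down⟩
      map_zero' := rfl
      map_add' _ _ := rfl }

noncomputable instance (U : (Opens X)ᵒᵖ) : Module (X.ringCatSheaf.obj.obj U) ((skyPresheaf x A).obj U) :=
  letI : ∀ _ : PLift (x ∈ U.unop), Module Γ(X, U.unop) A := fun h =>
    Module.compHom A (X.presheaf.germ U.unop x h.down).hom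
  inferInstanceAs (Module Γ(X, U.unop) (PLift (x ∈ U.unop) → A))

/-- The skyscraper sheaf of a module over the local ring at a point. -/
noncomputable def sky : X.Modules where
  val := PresheafOfModules.ofPresheaf (skyPresheaf x A) (by
    intro U V f r m
    exact funext fun h => congrArg (· • m ⟨f.unop.le h.down⟩)
      (germ_rs f.unop.le x h.down r).symm)
  isSheaf := by
    change TopCat.Presheaf.IsSheaf (X := X) (skyPresheaf x A)
    rw [TopCat.Presheaf.isSheaf_iff_isSheaf_comp (forget AddCommGrpCat.{u})]
    apply TopCat.Presheaf.isSheaf_of_isSheafUniqueGluing_types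
    intro ι U sf hsf
    let s : ∀ i, PLift (x ∈ U i) → A := sf
    have hs : ∀ i j (hi : x ∈ U i) (hj : x ∈ U j), s i ⟨hi⟩ = s j ⟨hj⟩ := fun i j hi hj =>
      congrFun (hsf i j) ⟨⟨hi, hj⟩⟩
    have hex : ∀ h : x ∈ iSup U, ∃ i, x ∈ U i := fun h => Opens.mem_iSup.1 h
    let t : PLift (x ∈ iSup U) → A := fun h => s _ ⟨(hex h.down).choose_spec⟩
    refine ⟨t, fun i => funext fun h => hs _ i _ h.down, fun t' ht' => funext fun h => ?_⟩
    exact congrFun (ht' (hex h.down).choose) ⟨(hex h.down).choose_spec⟩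

variable {x A}

/-- The value of a section of a skyscraper sheaf. -/
def skyValue {U : X.Opens} (h : x ∈ U) (s : Γ(sky x A, U)) : A := (show PLift (x ∈ U) → A from s) ⟨h⟩

/-- The map to a skyscraper sheaf determined by a map on the stalk. -/
noncomputable def toSky (l : M.presheaf.stalk x →ₗ[X.presheaf.stalk x] A) : M ⟶ sky x A :=
  ⟨PresheafOfModules.homMk
    { app _ := AddCommGrpCat.ofHom
        { toFun s h := l (mgerm M h.down s)
          map_zero' := funext fun h => (congrArg l (map_zero (mgerm M h.down))).trans l.map_zero
          map_add' s t := funext fun h => (congrArg l (map_add (mgerm M h.down) s t)).trans (l.map_add _ _) }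
      naturality _ _ f := ConcreteCategory.hom_ext _ _ fun s => funext fun h =>
        congrArg l (mgerm_mrs f.unop.le h.down s) }
    fun _ r s => funext fun h => (congrArg l (mgerm_smul h.down r s)).trans (l.map_smul _ _)⟩

lemma exists_ofSky (φ : M ⟶ sky x A) : ∃ l : M.presheaf.stalk x →ₗ[X.presheaf.stalk x] A,
    ∀ (U : X.Opens) (hx : x ∈ U) (s : Γ(M, U)),
      l (mgerm M hx s) = skyValue hx (φ.app U s) :=
  exists_stalk_desc (RingHom.id _)
    (fun U hx =>
      { toFun s := skyValue hx (φ.app U s)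
        map_zero' := congrFun (map_zero (φ.app U).hom) ⟨hx⟩
        map_add' s t := congrFun (map_add (φ.app U).hom s t) ⟨hx⟩ })
    (fun _ _ h hx s => congrFun (app_mrs φ h s) ⟨hx⟩)
    (fun _ hx a s => congrFun (φ.app_smul a s) ⟨hx⟩)

end Skyscraper

section PullbackStalk

variable {f : X ⟶ Y}

lemma mem_preimage {x : X} {W : Y.Opens} (h : f x ∈ W) : x ∈ f ⁻¹ᵁ W := h

variable (f) (K : Y.Modules)

/-- The pull back of a section. -/
noncomputable def pullSection {W : Y.Opens} : Γ(K, W) →+ Γ((Scheme.Modules.pullback f).obj K, f ⁻¹ᵁ W) :=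
  (((Scheme.Modules.pullbackPushforwardAdjunction f).unit.app K).app W).hom

lemma pullSection_smul {W : Y.Opens} (a : Γ(Y, W)) (s : Γ(K, W)) :
    pullSection f K (a • s) = f.app W a • pullSection f K s :=
  ((Scheme.Modules.pullbackPushforwardAdjunction f).unit.app K).app_smul a s

lemma pullSection_mrs {V W : Y.Opens} (h : V ≤ W) (s : Γ(K, W)) :
    pullSection f K (mrs K h s) = mrs _ (f.preimage_mono h) (pullSection f K s) :=
  app_mrs ((Scheme.Modules.pullbackPushforwardAdjunction f).unit.app K) h s

lemma exists_pullStalk (x : X) : ∃ l : K.presheaf.stalk (f x) →ₛₗ[(f.stalkMap x).hom]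
    ((Scheme.Modules.pullback f).obj K).presheaf.stalk x,
    ∀ (W : Y.Opens) (hx : f x ∈ W) (s : Γ(K, W)),
      l (mgerm K hx s) = mgerm _ (mem_preimage hx) (pullSection f K s) :=
  exists_stalk_desc (f.stalkMap x).hom
    (fun _ hx => (mgerm ((Scheme.Modules.pullback f).obj K) (mem_preimage hx)).comp (pullSection f K))
    (fun _ _ h hx s => (congrArg _ (pullSection_mrs f K h s)).trans
      (mgerm_mrs (f.preimage_mono h) (mem_preimage hx) _))
    (fun U hx a s => ((congrArg _ (pullSection_smul f K a s)).trans
      (mgerm_smul (mem_preimage hx) _ _)).trans (congrArg (· • mgerm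
        ((Scheme.Modules.pullback f).obj K) (mem_preimage hx) (pullSection f K s))
          (Scheme.Hom.germ_stalkMap_apply f U x hx a).symm))

/-- The comparison of the stalk with the stalk of the pull back. -/
noncomputable def pullStalk (x : X) : K.presheaf.stalk (f x) →ₛₗ[(f.stalkMap x).hom]
    ((Scheme.Modules.pullback f).obj K).presheaf.stalk x := (exists_pullStalk f K x).choose

variable {K}

lemma pullStalk_mgerm {x : X} {W : Y.Opens} (hx : f x ∈ W) (s : Γ(K, W)) :
    pullStalk f K x (mgerm K hx s) = mgerm _ (mem_preimage hx) (pullSection f K s) :=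
  (exists_pullStalk f K x).choose_spec W hx s

lemma stalkHom_pullStalk {L : Y.Modules} (a : K ⟶ L) {x : X} (z : K.presheaf.stalk (f x)) :
    stalkHom ((Scheme.Modules.pullback f).map a) x (pullStalk f K x z) =
      pullStalk f L x (stalkHom a (f x) z) := by
  obtain ⟨W, hx, s, rfl⟩ := exists_mgerm_eq z
  rw [stalkHom_mgerm, pullStalk_mgerm, pullStalk_mgerm, stalkHom_mgerm]
  exact congrArg (fun φ => mgerm _ (mem_preimage hx) (Scheme.Modules.Hom.app φ W s))
    ((Scheme.Modules.pullbackPushforwardAdjunction f).unit.naturality a).symm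

/-- A semilinear map on the stalk at `f x` is a map from `K` to the push forward of a skyscraper
sheaf, hence by adjunction a map from the pull back to the skyscraper. With `span_range_pullStalk`
this is the universal property of the base change of the stalk of `K`. -/
lemma exists_pullStalk_lift (x : X) {A : Type u} [AddCommGroup A] [Module (X.presheaf.stalk x) A]
    (μ : K.presheaf.stalk (f x) →ₛₗ[(f.stalkMap x).hom] A) :
    ∃ l : ((Scheme.Modules.pullback f).obj K).presheaf.stalk x →ₗ[X.presheaf.stalk x] A,
      ∀ z, l (pullStalk f K x z) = μ z := by
  let ψ : K ⟶ (Scheme.Modules.pushforward f).obj (sky x A) :=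
    ⟨PresheafOfModules.homMk
      { app U := AddCommGrpCat.ofHom
          { toFun s h := μ (mgerm K (U := U.unop) h.down s)
            map_zero' := funext fun h => (congrArg μ (map_zero (mgerm K (U := U.unop) h.down))).trans μ.map_zero
            map_add' s t := funext fun h =>
              (congrArg μ (map_add (mgerm K (U := U.unop) h.down) s t)).trans (μ.map_add _ _) }
        naturality U V g := ConcreteCategory.hom_ext _ _ fun s => funext fun h =>
          congrArg μ (mgerm_mrs g.unop.le h.down s) }
      fun U r s => funext fun h => ((congrArg μ (mgerm_smul (U := U.unop) h.down r s)).trans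
        (μ.map_smulₛₗ _ _)).trans (congrArg (· • μ (mgerm K (U := U.unop) h.down s))
          (Scheme.Hom.germ_stalkMap_apply f U.unop x h.down r))⟩
  let ψ' := ((Scheme.Modules.pullbackPushforwardAdjunction f).homEquiv _ _).symm ψ
  have hψ : (Scheme.Modules.pullbackPushforwardAdjunction f).unit.app K ≫
      (Scheme.Modules.pushforward f).map ψ' = ψ := by
    refine ((Scheme.Modules.pullbackPushforwardAdjunction f).homEquiv_unit _ _ _).symm.trans ?_
    exact Equiv.apply_symm_apply _ _
  obtain ⟨l, hl⟩ := exists_ofSky ψ'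
  refine ⟨l, fun z => ?_⟩
  obtain ⟨W, hx, s, rfl⟩ := exists_mgerm_eq z
  rw [pullStalk_mgerm, hl]
  exact congrArg (fun φ => skyValue (mem_preimage hx) (Scheme.Modules.Hom.app φ W s)) hψ

/-- The map to the skyscraper sheaf of the quotient by the span corresponds to zero under the
adjunction, so the quotient is zero. -/
lemma span_range_pullStalk (x : X) :
    Submodule.span (X.presheaf.stalk x) (Set.range (pullStalk f K x)) = ⊤ := by
  let P := Submodule.span (X.presheaf.stalk x) (Set.range (pullStalk f K x))
  have h : toSky P.mkQ = 0 := by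
    apply ((Scheme.Modules.pullbackPushforwardAdjunction f).homEquiv _ _).injective
    rw [Adjunction.homEquiv_unit, Adjunction.homEquiv_unit]
    refine Scheme.Modules.hom_ext _ _ fun W => ConcreteCategory.hom_ext _ _ fun s => funext fun h => ?_
    refine Eq.trans (b := P.mkQ (mgerm _ (mem_preimage h.down) (pullSection f K s))) rfl ?_
    refine Eq.trans ?_ (Eq.refl (0 : _ ⧸ P))
    rw [Submodule.mkQ_apply, Submodule.Quotient.mk_eq_zero]
    exact Submodule.subset_span ⟨_, pullStalk_mgerm f h.down s⟩
  rw [eq_top_iff]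
  rintro z -
  obtain ⟨U, hx, s, rfl⟩ := exists_mgerm_eq z
  rw [← Submodule.Quotient.mk_eq_zero]
  exact congrArg (fun φ => skyValue hx (Scheme.Modules.Hom.app φ U s)) h

end PullbackStalk

end StalkModules

/-! ### The structure sheaf of a point -/

section PointSheaf

variable {X : Scheme.{u}} {x : X}

/-- A constant, as a function on an open subset of the spectrum of the residue field. -/
noncomputable def pointConst (U : X.Opens) :
    X.residueField x →+* Γ(Spec (X.residueField x), X.fromSpecResidueField x ⁻¹ᵁ U) :=
  (rs (X := Spec (X.residueField x)) (V := X.fromSpecResidueField x ⁻¹ᵁ U) (W := ⊤) le_top).comp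
    (Scheme.ΓSpecIso (X.residueField x)).inv.hom

lemma pointConst_residue {U : X.Opens} (hx : x ∈ U) (a : Γ(X, U)) :
    (X.fromSpecResidueField x).app U a = pointConst U (X.residue x (X.presheaf.germ U x hx a)) := by
  have h1 : (X.fromSpecResidueField x).app U =
      (X.presheaf.germ U x hx ≫ X.residue x) ≫ (Scheme.ΓSpecIso (X.residueField x)).inv ≫
        (Spec (X.residueField x)).presheaf.map (homOfLE le_top).op := by
    dsimp only [Scheme.fromSpecResidueField]
    rw [Scheme.Hom.comp_app, Scheme.fromSpecStalk_app hx, Category.assoc, Category.assoc, Category.assoc,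
      Scheme.Hom.naturality]
    exact congrArg (X.presheaf.germ U x hx ≫ ·)
      (Scheme.ΓSpecIso_inv_naturality_assoc (X.residue x) _).symm
  exact ConcreteCategory.congr_hom h1 a

lemma pointConst_rs {U V : X.Opens} (h : V ≤ U) (c : X.residueField x) :
    rs ((X.fromSpecResidueField x).preimage_mono h) (pointConst U c) = pointConst V c :=
  rs_rs _ _ _

lemma pointConst_injective {U : X.Opens} (hx : x ∈ U) : Function.Injective (pointConst (x := x) U) := by
  have : Nontrivial Γ(Spec (X.residueField x), X.fromSpecResidueField x ⁻¹ᵁ U) := by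
    let z : Spec (X.residueField x) := closedPoint _
    have hz : z ∈ X.fromSpecResidueField x ⁻¹ᵁ U := by
      change X.fromSpecResidueField x z ∈ U
      rwa [Scheme.fromSpecResidueField_apply]
    exact ((Spec (X.residueField x)).presheaf.germ _ z hz).hom.domain_nontrivial
  exact RingHom.injective _

lemma pointConst_surjective {U : X.Opens} (hx : x ∈ U) : Function.Surjective (pointConst (x := x) U) := by
  intro t
  have h : ⊤ ≤ X.fromSpecResidueField x ⁻¹ᵁ U := fun z _ => by
    change X.fromSpecResidueField x z ∈ U
    rwa [Scheme.fromSpecResidueField_apply]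
  refine ⟨(Scheme.ΓSpecIso (X.residueField x)).hom (rs h t), ?_⟩
  refine (congrArg (rs (X := Spec (X.residueField x)) (V := X.fromSpecResidueField x ⁻¹ᵁ U) (W := ⊤) le_top)
    (ConcreteCategory.congr_hom (Scheme.ΓSpecIso (X.residueField x)).hom_inv_id (rs h t))).trans ?_
  refine (rs_rs (X := Spec (X.residueField x)) le_top h t).trans ?_
  exact ConcreteCategory.congr_hom ((Spec (X.residueField x)).presheaf.map_id _) t

lemma subsingleton_pointSheaf {U : X.Opens} (hx : x ∉ U) : Subsingleton Γ(pointSheaf x, U) := by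
  have h : X.fromSpecResidueField x ⁻¹ᵁ U = ⊥ := by
    ext z
    refine ⟨fun hz => hx ?_, fun hz => hz.elim⟩
    have hz' : X.fromSpecResidueField x z ∈ U := hz
    rwa [Scheme.fromSpecResidueField_apply] at hz'
  have : Subsingleton Γ(Spec (X.residueField x), X.fromSpecResidueField x ⁻¹ᵁ U) := by
    rw [h]
    infer_instance
  exact this

variable {M : X.Modules}

open Classical in
/-- The map on sections to the structure sheaf of a point determined by a map on the stalk. -/
noncomputable def pointHom (l : M.presheaf.stalk x →ₛₗ[(X.residue x).hom] X.residueField x) (U : X.Opens) :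
    Γ(M, U) →+ Γ(Spec (X.residueField x), X.fromSpecResidueField x ⁻¹ᵁ U) :=
  if h : x ∈ U then (pointConst U).toAddMonoidHom.comp (l.toAddMonoidHom.comp (mgerm M h)) else 0

lemma pointHom_apply (l : M.presheaf.stalk x →ₛₗ[(X.residue x).hom] X.residueField x) {U : X.Opens}
    (h : x ∈ U) (s : Γ(M, U)) : pointHom l U s = pointConst U (l (mgerm M h s)) := by
  rw [pointHom, dif_pos h]
  rfl

/-- The map to the structure sheaf of a point determined by a map on the stalk. -/
noncomputable def toPoint (l : M.presheaf.stalk x →ₛₗ[(X.residue x).hom] X.residueField x) :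
    M ⟶ pointSheaf x :=
  ⟨PresheafOfModules.homMk
    { app U := AddCommGrpCat.ofHom (pointHom l U.unop)
      naturality U V f := by
        refine ConcreteCategory.hom_ext _ _ fun s => ?_
        by_cases h : x ∈ V.unop
        · have h' : x ∈ U.unop := f.unop.le h
          refine (pointHom_apply l h (mrs M f.unop.le s)).trans ?_
          refine (congrArg (fun z => pointConst V.unop (l z)) (mgerm_mrs f.unop.le h s)).trans ?_
          refine (pointConst_rs f.unop.le _).symm.trans ?_
          exact congrArg (rs ((X.fromSpecResidueField x).preimage_mono f.unop.le))
            (pointHom_apply l h' s).symm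
        · exact (subsingleton_pointSheaf h).elim _ _ }
    fun U r s => by
      by_cases h : x ∈ U.unop
      · have h1 := pointHom_apply l h ((show Γ(X, U.unop) from r) • (show Γ(M, U.unop) from s))
        rw [mgerm_smul, l.map_smulₛₗ, smul_eq_mul, map_mul, ← pointHom_apply l h] at h1
        exact h1.trans (congrArg (· * _) (pointConst_residue h r).symm)
      · exact (subsingleton_pointSheaf h).elim _ _⟩

lemma toPoint_app (l : M.presheaf.stalk x →ₛₗ[(X.residue x).hom] X.residueField x) {U : X.Opens}
    (h : x ∈ U) (s : Γ(M, U)) :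
    (toPoint l).app U s = (pointConst U (l (mgerm M h s)) :
      Γ(Spec (X.residueField x), X.fromSpecResidueField x ⁻¹ᵁ U)) :=
  pointHom_apply l h s

lemma toPoint_app_eq_zero_iff (l : M.presheaf.stalk x →ₛₗ[(X.residue x).hom] X.residueField x)
    {U : X.Opens} (h : x ∈ U) (s : Γ(M, U)) : (toPoint l).app U s = 0 ↔ l (mgerm M h s) = 0 := by
  rw [toPoint_app l h]
  exact (map_eq_zero_iff _ (pointConst_injective h))

lemma exists_toPoint_app_eq (l : M.presheaf.stalk x →ₛₗ[(X.residue x).hom] X.residueField x)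
    {U : X.Opens} (h : x ∈ U) (t : Γ(pointSheaf x, U)) : ∃ c, ∀ (V : X.Opens) (hV : V ≤ U) (hx : x ∈ V)
      (s : Γ(M, V)), l (mgerm M hx s) = c → (toPoint l).app V s = mrs _ hV t := by
  obtain ⟨c, hc⟩ := pointConst_surjective h t
  refine ⟨c, fun V hV hx s hs => (toPoint_app l hx s).trans ?_⟩
  rw [hs, ← pointConst_rs hV, hc]
  rfl

end PointSheaf

/-! ### From stalks to the exact sequence -/

section Assembly

variable {X : Scheme.{u}}

lemma mgerm_ext {M : X.Modules} {U : X.Opens} (s : Γ(M, U)) (h : ∀ x (hx : x ∈ U), mgerm M hx s = 0) :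
    s = 0 := by
  refine mrs_ext _ _ _ fun x hx => ?_
  obtain ⟨W, h1, h2, hxW, hW⟩ := exists_mrs_eq_of_mgerm_eq ((h x hx).trans (map_zero (mgerm M hx)).symm)
  exact ⟨W, h1, hxW, hW⟩

/-- Taking sections over an open subset commutes with products, whereas taking stalks need not; the
product is therefore handled on sections. -/
lemma pi_section_ext {ι : Type u} (P : ι → X.Modules) {V : X.Opens} (t t' : Γ(∏ᶜ P, V))
    (h : ∀ i, (Pi.π P i).app V t = (Pi.π P i).app V t') : t = t' := by
  let Φ := Scheme.Modules.toPresheaf X ⋙ (evaluation _ AddCommGrpCat.{u}).obj (op V)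
  have : PreservesLimitsOfShape (Discrete ι) ((evaluation (Opens X)ᵒᵖ AddCommGrpCat.{u}).obj (op V)) :=
    inferInstance
  have : PreservesLimitsOfShape (Discrete ι) Φ := comp_preservesLimitsOfShape _ _
  exact Concrete.isLimit_ext _ (isLimitOfPreserves Φ (limit.isLimit (Discrete.functor P))) t t'
    fun ⟨i⟩ => h i

variable {F G : X.Modules}

/-- An element of the stalk of `G` lies in the image of `F` up to torsion. -/
def IsTorsionImage (ι : F ⟶ G) (x : X) (η : G.presheaf.stalk x) : Prop :=
  ∃ (ξ : F.presheaf.stalk x) (a : X.presheaf.stalk x), a ∈ (X.presheaf.stalk x)⁰ ∧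
    a • (η - stalkHom ι x ξ) = 0

lemma isTorsionSection_iff {M : X.Modules} {U : X.Opens} (s : Γ(M, U)) : IsTorsionSection M U s ↔
    ∀ x (hx : x ∈ U), ∃ a ∈ (X.presheaf.stalk x)⁰, a • mgerm M hx s = 0 := by
  refine ⟨fun h x hx => ?_, fun h x hx => ?_⟩
  · obtain ⟨V, hV, hxV, a, ha, has⟩ := h x hx
    refine ⟨_, ha, ?_⟩
    rw [← mgerm_mrs hV hxV, ← mgerm_smul, has, map_zero]
  · obtain ⟨a, ha, has⟩ := h x hx
    obtain ⟨V, hxV, b, rfl⟩ := TopCat.Presheaf.exists_germ_eq X.presheaf a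
    have hi : x ∈ V ⊓ U := ⟨hxV, hx⟩
    have h0 := germ_rs (inf_le_left : V ⊓ U ≤ V) x hi b
    have h1 : mgerm M hi ((rs inf_le_left b : Γ(X, V ⊓ U)) • mrs M inf_le_right s) = mgerm M hi 0 := by
      rw [mgerm_smul, mgerm_mrs, h0, map_zero]
      exact has
    obtain ⟨W, h2, h3, hxW, h4⟩ := exists_mrs_eq_of_mgerm_eq h1
    refine ⟨W, h2.trans inf_le_right, hxW, rs (h2.trans inf_le_left) b, ?_, ?_⟩
    · exact (germ_rs (h2.trans inf_le_left) x hxW b).symm ▸ ha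
    · rw [mrs_smul, map_zero, mrs_mrs] at h4
      have h5 : rs h2 (rs inf_le_left b : Γ(X, V ⊓ U)) = rs (h2.trans inf_le_left) b := rs_rs _ _ _
      rwa [h5] at h4

/-- The map `g` takes a section to its values under the `l e`. On stalks, modulo torsion, `F` is
contained in `G` and is the kernel of `l e` where `P` holds, everything elsewhere. By `hP` at most
one factor of the product matters near each point; `hnzd` is needed because torsion is tested at all
points, so an annihilator found at one point must remain a non-zero-divisor nearby. -/
theorem shortExact_of_stalks (ι : F ⟶ G) (P : X → Prop)
    (hP : ∀ x, ∃ U : X.Opens, x ∈ U ∧ ∀ e ∈ U, P e → e = x)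
    (hnzd : ∀ (x : X) (V : X.Opens) (hx : x ∈ V) (a : Γ(X, V)), X.presheaf.germ V x hx a ∈ (X.presheaf.stalk x)⁰ →
      ∃ W ≤ V, x ∈ W ∧ ∀ x' (h : x' ∈ V), x' ∈ W → X.presheaf.germ V x' h a ∈ (X.presheaf.stalk x')⁰)
    (hinj : ∀ x (ξ : F.presheaf.stalk x), ∀ a ∈ (X.presheaf.stalk x)⁰, a • stalkHom ι x ξ = 0 → ξ = 0)
    (hsurj : ∀ x, ¬ P x → ∀ η, IsTorsionImage ι x η)
    (hl : ∀ e, P e → ∃ l : G.presheaf.stalk e →ₛₗ[(X.residue e).hom] X.residueField e,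
      Function.Surjective l ∧ ∀ η, l η = 0 ↔ IsTorsionImage ι e η) :
    ∃ (g : modTorsion G ⟶ ∏ᶜ fun e : {e : X // P e} => pointSheaf e.1)
      (w : (ι ≫ modTorsionπ G) ≫ g = 0), (ShortComplex.mk _ g w).ShortExact := by
  choose l hls hlk using fun e : {e : X // P e} => hl e.1 e.2
  let g₀ : G ⟶ ∏ᶜ fun e : {e : X // P e} => pointSheaf e.1 := Pi.lift fun e => toPoint (l e)
  have hg₀ : ∀ e (U : X.Opens) (s : Γ(G, U)), (Pi.π (fun e : {e : X // P e} => pointSheaf e.1) e).app U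
      (g₀.app U s) = (toPoint (l e)).app U s := fun e U s =>
    congrArg (fun φ => Scheme.Modules.Hom.app φ U s) (Pi.lift_π (fun e => toPoint (l e)) e)
  have hzero : ∀ (U : X.Opens) (s : Γ(G, U)), g₀.app U s = 0 ↔
      ∀ (e : {e : X // P e}) (he : e.1 ∈ U), l e (mgerm G he s) = 0 := fun U s => by
    refine ⟨fun h e he => ?_, fun h => pi_section_ext _ _ _ fun e => ?_⟩
    · rw [← toPoint_app_eq_zero_iff, ← hg₀, h, map_zero]
    · rw [hg₀, map_zero]
      by_cases he : e.1 ∈ U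
      · exact (toPoint_app_eq_zero_iff _ he _).2 (h e he)
      · exact (subsingleton_pointSheaf he).elim _ _
  -- A torsion element is a torsion image with `ξ = 0`, so the `l e` kill it and `g₀` factors
  -- through the quotient.
  have hcoker : torsionι G ≫ g₀ = 0 := by
    refine Scheme.Modules.hom_ext _ _ fun U => ConcreteCategory.hom_ext _ _ fun s => ?_
    refine (hzero U (s : torsionSections G U).1).2 fun e he => (hlk e _).2 ?_
    obtain ⟨a, ha, has⟩ := (isTorsionSection_iff _).1 (s : torsionSections G U).2 e.1 he
    exact ⟨0, a, ha, by rwa [map_zero, sub_zero]⟩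
  let g := cokernel.desc (torsionι G) g₀ hcoker
  have hg : modTorsionπ G ≫ g = g₀ := cokernel.π_desc _ _ _
  have hg' : ∀ (U : X.Opens) (s : Γ(G, U)), g.app U ((modTorsionπ G).app U s) = g₀.app U s := fun U s =>
    congrArg (fun φ => Scheme.Modules.Hom.app φ U s) hg
  have w : (ι ≫ modTorsionπ G) ≫ g = 0 := by
    rw [Category.assoc, hg]
    refine Scheme.Modules.hom_ext _ _ fun U => ConcreteCategory.hom_ext _ _ fun s => ?_
    refine (hzero U (ι.app U s)).2 fun e he => (hlk e _).2 ⟨mgerm F he s, 1, one_mem _, ?_⟩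
    rw [stalkHom_mgerm, sub_self, smul_zero]
  refine ⟨g, w, ?_⟩
  have hm : Mono (ι ≫ modTorsionπ G) := mono_of_app_injective fun U s hs => by
    have h1 := (isTorsionSection_iff _).1 (isTorsionSection_of_modTorsionπ_eq_zero _ hs)
    refine mgerm_ext _ fun x hx => ?_
    obtain ⟨a, ha, has⟩ := h1 x hx
    exact hinj x _ a ha (by rwa [stalkHom_mgerm])
  have he : Epi g := IsLocSurjective.epi fun U t x hx => by
    obtain ⟨U₀, hxU₀, hU₀⟩ := hP x
    -- On `U₀` the product has at most one nonzero factor, the one at `x`.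
    by_cases hPx : P x
    · obtain ⟨c, hc⟩ := exists_toPoint_app_eq (l ⟨x, hPx⟩) hx 
        ((Pi.π (fun e : {e : X // P e} => pointSheaf e.1) ⟨x, hPx⟩).app U t)
      obtain ⟨η, hη⟩ := hls ⟨x, hPx⟩ c
      obtain ⟨V, hxV, s, hs⟩ := exists_mgerm_eq η
      have hVV : x ∈ V ⊓ (U₀ ⊓ U) := ⟨hxV, hxU₀, hx⟩
      refine ⟨V ⊓ (U₀ ⊓ U), inf_le_right.trans inf_le_right,
        (modTorsionπ G).app _ (mrs G inf_le_left s), hVV, pi_section_ext _ _ _ fun e => ?_⟩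
      rw [hg', hg₀]
      by_cases he : e.1 ∈ V ⊓ (U₀ ⊓ U)
      · obtain rfl : e = ⟨x, hPx⟩ := Subtype.ext (hU₀ e.1 he.2.1 e.2)
        refine (hc _ (inf_le_right.trans inf_le_right) hVV _ ?_).trans (app_mrs _ _ _).symm
        rw [mgerm_mrs, hs, hη]
      · exact (subsingleton_pointSheaf he).elim _ _
    · refine ⟨U₀ ⊓ U, inf_le_right, 0, ⟨hxU₀, hx⟩, pi_section_ext _ _ _ fun e => ?_⟩
      have he : e.1 ∉ U₀ ⊓ U := fun he => hPx (hU₀ e.1 he.1 e.2 ▸ e.2)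
      exact (subsingleton_pointSheaf he).elim _ _
  refine { exact := exact_of_local w fun U s' hs' x hx => ?_, mono_f := hm, epi_g := he }
  obtain ⟨V, hV, s, hxV, hs⟩ := isLocSurjective_of_epi (modTorsionπ G) U s' x hx
  have hK : IsTorsionImage ι x (mgerm G hxV s) := by
    by_cases hPx : P x
    · refine (hlk ⟨x, hPx⟩ _).1 ((hzero V s).1 ?_ ⟨x, hPx⟩ hxV)
      rw [← hg', hs, app_mrs, hs', map_zero]
    · exact hsurj x hPx _
  -- At `x` the section `s` is the image of `ξ` up to torsion. Representatives satisfy the same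
  -- relation near `x`, where `b` is still a non-zero-divisor, so the difference is a torsion
  -- section.
  obtain ⟨ξ, a, ha, hξ⟩ := hK
  obtain ⟨V₁, hxV₁, r, rfl⟩ := exists_mgerm_eq ξ
  obtain ⟨V₂, hxV₂, b, rfl⟩ := TopCat.Presheaf.exists_germ_eq X.presheaf a
  obtain ⟨V₃, hV₃, hxV₃, hb⟩ := hnzd x V₂ hxV₂ b ha
  have hi : x ∈ V₃ ⊓ (V ⊓ V₁) := ⟨hxV₃, hxV, hxV₁⟩
  let d : Γ(G, V₃ ⊓ (V ⊓ V₁)) := mrs G (inf_le_right.trans inf_le_left) s -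
    ι.app _ (mrs F (inf_le_right.trans inf_le_right) r)
  let b' : Γ(X, V₃ ⊓ (V ⊓ V₁)) := rs (inf_le_left.trans hV₃) b
  have hb' : ∀ y (hy : y ∈ V₃ ⊓ (V ⊓ V₁)), X.presheaf.germ _ y hy b' ∈ (X.presheaf.stalk y)⁰ := fun y hy =>
    (germ_rs (inf_le_left.trans hV₃) y hy b).symm ▸ hb y (hV₃ hy.1) hy.1
  have h1 : mgerm G hi (b' • d) = mgerm G hi 0 := by
    rw [mgerm_smul, map_sub, mgerm_mrs, app_mrs, mgerm_mrs, map_zero, ← stalkHom_mgerm]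
    exact (congrArg (· • _) (germ_rs (inf_le_left.trans hV₃) x hi b)).trans hξ
  obtain ⟨W, h2, h3, hxW, h4⟩ := exists_mrs_eq_of_mgerm_eq h1
  have htor : IsTorsionSection G W (mrs G h2 d) := (isTorsionSection_iff _).2 fun y hy =>
    ⟨_, hb' y (h2 hy), by
      rw [mgerm_mrs, ← mgerm_smul, ← mgerm_mrs h2 hy, h4, map_zero, map_zero]⟩
  refine ⟨W, h2.trans (inf_le_right.trans (inf_le_left.trans hV)),
    mrs F (h2.trans (inf_le_right.trans inf_le_right)) r, hxW, ?_⟩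
  have h5 := modTorsionπ_eq_zero _ htor
  have h6 : mrs G h2 d = mrs G (h2.trans (inf_le_right.trans inf_le_left)) s -
      ι.app _ (mrs F (h2.trans (inf_le_right.trans inf_le_right)) r) := by
    rw [map_sub, mrs_mrs, ← app_mrs, mrs_mrs]
  rw [h6, map_sub, sub_eq_zero, app_mrs, hs, mrs_mrs] at h5
  exact h5.symm

end Assembly

/-! ### Algebra of the pulled back stalks -/

section StalkAlgebra

variable {R R' T Θ T' Θ' : Type u} [CommRing R] [CommRing R'] [AddCommGroup T] [AddCommGroup Θ]
  [AddCommGroup T'] [AddCommGroup Θ'] [Module R T] [Module R Θ] [Module R' T'] [Module R' Θ']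
  {φ : R →+* R'}

/-- If `M` is torsion free over a discrete valuation ring, or a field, so is any base change. -/
lemma eq_zero_of_smul_eq_zero_of_isCurveRing (hR : IsCurveRing R) (hΘ : ∀ (r : R) (θ : Θ), r • θ = 0 → r = 0 ∨ θ = 0)
    (j : Θ →ₛₗ[φ] Θ') (hj : Submodule.span R' (Set.range j) = ⊤)
    (hlift : ∀ (A : Type u) [AddCommGroup A] [Module R' A] (μ : Θ →ₛₗ[φ] A),
      ∃ l : Θ' →ₗ[R'] A, ∀ z, l (j z) = μ z)
    {a : R'} (ha : a ∈ R'⁰) {η : Θ'} (h : a • η = 0) : η = 0 := by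
  have := hR.isLocalRing
  have := hR.isNoetherianRing
  have := hR.isDomain
  have hpir : IsPrincipalIdealRing R := by
    have h1 := (tfae_of_isNoetherianRing_of_isLocalRing_of_isDomain R).out 4 0
    obtain ⟨t, ht⟩ := hR.principal
    refine h1.1 ⟨t, ?_⟩
    ext r
    rw [Submodule.mem_span_singleton, mem_maximalIdeal, mem_nonunits_iff, ht r]
    exact ⟨fun ⟨s, hs⟩ => ⟨s, by rw [hs, smul_eq_mul, mul_comm]⟩, fun ⟨s, hs⟩ => ⟨s, by
      rw [← hs, smul_eq_mul, mul_comm]⟩⟩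
  have : Module.IsTorsionFree R Θ := by
    refine ⟨fun r hr θ θ' hθ => ?_⟩
    have h1 : r • (θ - θ') = 0 := by rw [smul_sub, sub_eq_zero]; exact hθ
    rcases hΘ _ _ h1 with h2 | h2
    · exact absurd h2 hr.ne_zero
    · exact sub_eq_zero.1 h2
  -- Torsion free modules over a principal ideal domain are flat, and a non-zero-divisor of `R'`
  -- acts injectively on the base change of a flat module.
  have : Module.Flat R Θ := inferInstance
  let : Algebra R R' := φ.toAlgebra
  let μ : Θ →ₛₗ[φ] (R' ⊗[R] Θ) :=
    { toFun θ := 1 ⊗ₜ θ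
      map_add' _ _ := TensorProduct.tmul_add _ _ _
      map_smul' r θ := by
        rw [TensorProduct.tmul_smul]
        exact (algebraMap_smul R' r ((1 : R') ⊗ₜ[R] θ)).symm }
  obtain ⟨l, hl⟩ := hlift _ μ
  let : Module R Θ' := Module.compHom Θ' φ
  have : IsScalarTower R R' Θ' := ⟨fun r s t => mul_smul (φ r) s t⟩
  let j' : Θ →ₗ[R] Θ' := { toFun := j, map_add' := j.map_add, map_smul' := j.map_smulₛₗ }
  -- `Θ'` is a retract of `R' ⊗ Θ`, so it inherits the injectivity.
  have hm : ∀ z, j'.liftBaseChange R' (l z) = z := fun z => by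
    have hz : z ∈ Submodule.span R' (Set.range j) := hj ▸ Submodule.mem_top
    induction hz using Submodule.span_induction with
    | mem x hx =>
      obtain ⟨t, rfl⟩ := hx
      rw [hl]
      exact (LinearMap.liftBaseChange_tmul R' j' 1 t).trans (one_smul _ _)
    | zero => rw [map_zero, map_zero]
    | add x y _ _ hx hy => rw [map_add, map_add, hx, hy]
    | smul a x _ hx => rw [map_smul, map_smul, hx]
  have h1 : l η = 0 := by
    refine Module.Flat.isSMulRegular_of_nonZeroDivisors (M := R' ⊗[R] Θ) ha ?_
    change a • l η = a • 0
    rw [← map_smul, h, map_zero, smul_zero]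
  rw [← hm η, h1, map_zero]

variable (i : T →ₗ[R] Θ) (ι : T' →ₗ[R'] Θ') (j₁ : T →ₛₗ[φ] T') (j : Θ →ₛₗ[φ] Θ')

/-- The pull back of the vector fields at a node. -/
structure IsNodalPullback (σ : T) (τ : Θ) : Prop where
  comm : ∀ t, ι (j₁ t) = j (i t)
  span₁ : Submodule.span R' (Set.range j₁) = ⊤
  span : Submodule.span R' (Set.range j) = ⊤
  lift : ∀ μ : Θ →ₛₗ[φ] R', ∃ l : Θ' →ₗ[R'] R', ∀ z, l (j z) = μ z
  gen₁ : ∀ t : T, ∃ r : R, t = r • σ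
  gen : ∀ θ : Θ, ∃ r s : R, θ = r • i σ + s • τ
  free : ∀ r : R, r • i σ = 0 → r = 0
  smul : ∀ b : R, ¬ IsUnit b → ∃ c : R, b • τ = c • i σ

namespace IsNodalPullback

variable {i ι j₁ j} {σ : T} {τ : Θ} (h : IsNodalPullback i ι j₁ j σ τ)
include h

/-- Multiplication by `b` carries `Θ` into the free module on `i σ`; the coordinate there is a
functional with value `b` on `i σ` and `c` on `τ`, and it extends to the pull back. If `φ b` is a
non-zero-divisor, the kernel is torsion: the functional realizes `τ` as `(c / b) σ`, with the
denominator cleared. -/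
lemma exists_functional {b c : R} (hbc : b • τ = c • i σ) :
    ∃ l : Θ' →ₗ[R'] R', l (ι (j₁ σ)) = φ b ∧ l (j τ) = φ c := by
  have h1 : ∀ θ, ∃ d : R, b • θ = d • i σ := fun θ => by
    obtain ⟨r, s, rfl⟩ := h.gen θ
    exact ⟨b * r + s * c, by rw [smul_add, smul_smul, smul_comm, hbc, smul_smul, add_smul]⟩
  choose d hd using h1
  have huniq : ∀ r s : R, r • i σ = s • i σ → r = s := fun r s hrs =>
    sub_eq_zero.1 (h.free _ (by rw [sub_smul, hrs, sub_self]))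
  let μ : Θ →ₛₗ[φ] R' :=
    { toFun θ := φ (d θ)
      map_add' θ θ' := by
        rw [← map_add]
        exact congrArg φ (huniq _ _ (by rw [← hd, add_smul, ← hd, ← hd, smul_add]))
      map_smul' r θ := by
        rw [smul_eq_mul, ← map_mul]
        exact congrArg φ (huniq _ _ (by rw [← hd, mul_smul, ← hd, smul_comm])) }
  obtain ⟨l, hl⟩ := h.lift μ
  refine ⟨l, ?_, ?_⟩
  · rw [h.comm, hl]
    exact congrArg φ (huniq _ _ (hd _).symm)
  · rw [hl]
    exact congrArg φ (huniq _ _ ((hd _).symm.trans hbc))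

lemma exists_eq_smul (ξ : T') : ∃ r : R', ξ = r • j₁ σ := by
  have hξ : ξ ∈ Submodule.span R' (Set.range j₁) := h.span₁ ▸ Submodule.mem_top
  induction hξ using Submodule.span_induction with
  | mem x hx =>
    obtain ⟨t, rfl⟩ := hx
    obtain ⟨r, rfl⟩ := h.gen₁ t
    exact ⟨φ r, j₁.map_smulₛₗ _ _⟩
  | zero => exact ⟨0, (zero_smul _ _).symm⟩
  | add x y _ _ hx hy =>
    obtain ⟨r, rfl⟩ := hx
    obtain ⟨s, rfl⟩ := hy
    exact ⟨r + s, (add_smul _ _ _).symm⟩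
  | smul a x _ hx =>
    obtain ⟨r, rfl⟩ := hx
    exact ⟨a * r, (mul_smul _ _ _).symm⟩

lemma exists_eq_add (η : Θ') : ∃ r s : R', η = r • ι (j₁ σ) + s • j τ := by
  have hη : η ∈ Submodule.span R' (Set.range j) := h.span ▸ Submodule.mem_top
  induction hη using Submodule.span_induction with
  | mem x hx =>
    obtain ⟨t, rfl⟩ := hx
    obtain ⟨r, s, rfl⟩ := h.gen t
    exact ⟨φ r, φ s, by rw [map_add, j.map_smulₛₗ, j.map_smulₛₗ, h.comm]⟩
  | zero => exact ⟨0, 0, by rw [zero_smul, zero_smul, add_zero]⟩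
  | add x y _ _ hx hy =>
    obtain ⟨r, s, rfl⟩ := hx
    obtain ⟨r', s', rfl⟩ := hy
    exact ⟨r + r', s + s', by rw [add_smul, add_smul]; abel⟩
  | smul a x _ hx =>
    obtain ⟨r, s, rfl⟩ := hx
    exact ⟨a * r, a * s, by rw [smul_add, mul_smul, mul_smul]⟩

lemma smul_eq {b c : R} (hbc : b • τ = c • i σ) : φ b • j τ = φ c • ι (j₁ σ) := by
  rw [h.comm, ← j.map_smulₛₗ, hbc, j.map_smulₛₗ]

/-- For `ξ = r • j₁ σ` the functional maps `a • ι ξ` to `a * r * φ b`, and `a` and `φ b` are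
non-zero-divisors. -/
lemma eq_zero {b : R} (hb : ¬ IsUnit b) (hb' : φ b ∈ R'⁰) {a : R'} (ha : a ∈ R'⁰) {ξ : T'}
    (hξ : a • ι ξ = 0) : ξ = 0 := by
  obtain ⟨c, hbc⟩ := h.smul b hb
  obtain ⟨l, hl, -⟩ := h.exists_functional hbc
  obtain ⟨r, rfl⟩ := h.exists_eq_smul ξ
  have h1 := congrArg l hξ
  rw [map_smul, map_smul, map_smul, hl, map_zero, smul_eq_mul, smul_eq_mul, mul_comm] at h1
  have h2 := (mul_right_mem_nonZeroDivisors_eq_zero_iff hb').1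
    ((mul_right_mem_nonZeroDivisors_eq_zero_iff ha).1 h1)
  rw [h2, zero_smul]

/-- Modulo torsion `s τ = (s c / b) σ`, and by hypothesis the coefficient lies in `R'`. -/
lemma exists_of_dvd {b c : R} (hb' : φ b ∈ R'⁰) (hbc : b • τ = c • i σ) {r s : R'}
    (hs : φ b ∣ s * φ c) : ∃ (ξ : T') (a : R'), a ∈ R'⁰ ∧ a • (r • ι (j₁ σ) + s • j τ - ι ξ) = 0 := by
  obtain ⟨d, hd⟩ := hs
  refine ⟨(r + d) • j₁ σ, φ b, hb', ?_⟩
  have h1 := h.smul_eq hbc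
  have h2 : r • ι (j₁ σ) + s • j τ - ι ((r + d) • j₁ σ) = s • j τ - d • ι (j₁ σ) := by
    rw [map_smul, add_smul]; abel
  rw [h2, smul_sub, smul_comm, h1, smul_smul, smul_smul, hd, sub_self]

/-- The map takes `r σ + s τ` to the residue of `s`. It is well defined: if `r σ + s τ` is torsion
with `s` a unit, then `φ b ∣ φ c`. The kernel is the torsion image because `m (c / b)` lies in `R'`
for every nonunit `m`. -/
lemma exists_residue {κ : Type u} [Field κ] {ρ : R' →+* κ} (hρs : Function.Surjective ρ)
    (hρ : ∀ r, ρ r = 0 ↔ ¬ IsUnit r) {b c : R} (hb' : φ b ∈ R'⁰) (hbc : b • τ = c • i σ)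
    (hndvd : ¬ φ b ∣ φ c) (hdvd : ∀ m, ¬ IsUnit m → φ b ∣ m * φ c) :
    ∃ l : Θ' →ₛₗ[ρ] κ, Function.Surjective l ∧ ∀ η, l η = 0 ↔
      ∃ (ξ : T') (a : R'), a ∈ R'⁰ ∧ a • (η - ι ξ) = 0 := by
  obtain ⟨Λ, hΛ1, hΛ2⟩ := h.exists_functional hbc
  have key : ∀ a ∈ R'⁰, ∀ r s : R', a • (r • ι (j₁ σ) + s • j τ) = 0 → ρ s = 0 := fun a ha r s hrs => by
    rw [hρ]
    intro hs
    have h1 := congrArg Λ hrs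
    rw [map_smul, map_add, map_smul, map_smul, hΛ1, hΛ2, map_zero, smul_eq_mul, smul_eq_mul, smul_eq_mul,
      mul_comm] at h1
    have h2 := (mul_right_mem_nonZeroDivisors_eq_zero_iff ha).1 h1
    refine hndvd ((hs.dvd_mul_left).1 ⟨-r, ?_⟩)
    linear_combination h2
  choose r s hrs using h.exists_eq_add
  have hs : ∀ η r' s', η = r' • ι (j₁ σ) + s' • j τ → ρ (s η) = ρ s' := fun η r' s' hη => by
    rw [← sub_eq_zero, ← map_sub]
    refine key 1 (one_mem _) (r η - r') _ ?_
    rw [one_smul, sub_smul, sub_smul, sub_add_sub_comm, ← hrs, hη, sub_self]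
  let l : Θ' →ₛₗ[ρ] κ :=
    { toFun η := ρ (s η)
      map_add' η η' := by
        rw [hs (η + η') (r η + r η') (s η + s η'), map_add]
        rw [add_smul, add_smul, add_add_add_comm, ← hrs, ← hrs]
      map_smul' a η := by
        rw [hs (a • η) (a * r η) (a * s η), map_mul, smul_eq_mul]
        rw [mul_smul, mul_smul, ← smul_add, ← hrs] }
  refine ⟨l, fun z => ?_, fun η => ⟨fun hη => ?_, fun ⟨ξ, a, ha, hη⟩ => ?_⟩⟩
  · obtain ⟨z, rfl⟩ := hρs z
    exact ⟨z • j τ, hs _ 0 z (by rw [zero_smul, zero_add])⟩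
  · rw [hrs η]
    exact h.exists_of_dvd hb' hbc (hdvd _ ((hρ _).1 hη))
  · obtain ⟨r', rfl⟩ := h.exists_eq_smul ξ
    refine key a ha (r η - r') (s η) ?_
    rw [← hη]
    congr 1
    rw [map_smul, sub_smul]
    nth_rewrite 3 [hrs η]
    abel

end IsNodalPullback

/-- The divisibility at a node of `C` lying over a node of `Q`. -/
lemma IsNodeRing.not_dvd_and_dvd {s t u v : R} (hn : IsNodeRing s t) (hu : s ∣ u ∨ t ∣ u) (hv : s ∣ v ∨ t ∣ v)
    {b c g p q : R} (hb : b ∈ R⁰) (hbuv : ∃ x y, b = x * u + y * v) (hg : IsUnit g) (hpq : IsUnit (p + q))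
    (h1 : v ∣ b * p - c * g) (h2 : u ∣ b * q + c * g) :
    ¬ b ∣ c ∧ ∀ m, ¬ IsUnit m → b ∣ m * c := by
  have main : ∀ {s t : R}, IsNodeRing s t → s ∣ u → t ∣ v → ¬ b ∣ c ∧ ∀ m, ¬ IsUnit m → b ∣ m * c := by
    intro s t hn hu hv
    have h1 := hv.trans h1
    have h2 := hu.trans h2
    have hbs := hn.not_dvd_left_of_mem hb
    have hbt := hn.not_dvd_right_of_mem hb
    refine ⟨fun ⟨d, hd⟩ => ?_, fun m hm => ?_⟩
    -- If `c = b d`, then `d` is `p / g` on the branch `t = 0` and `-q / g` on `s = 0`. These values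
    -- would agree at the node, against the invertibility of `p + q`.
    · have h3 : t ∣ b * (p - d * g) := by rw [hd] at h1; convert h1 using 1; ring
      have h4 : s ∣ b * (q + d * g) := by rw [hd] at h2; convert h2 using 1; ring
      obtain ⟨y, hy⟩ := (hn.symm.left_prime h3).resolve_left hbt
      obtain ⟨x, hx⟩ := (hn.left_prime h4).resolve_left hbs
      exact (hn.nonunit _).2 ⟨x, y, by linear_combination hx + hy⟩ hpq
    · obtain ⟨x, y, rfl⟩ := (hn.nonunit m).1 hm
      obtain ⟨w, hw⟩ := hg.exists_right_inv
      obtain ⟨d, hd⟩ := h1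
      obtain ⟨e, he⟩ := h2
      have hmul := hn.mul
      -- For `m = x s + y t` the quotient `m c / b` is `x s p / g` on `t = 0` and `-y t q / g` on `s
      -- = 0`; the witness is the sum of both.
      refine ⟨x * s * p * w - y * t * q * w, ?_⟩
      linear_combination (-(x * s + y * t) * c) * hw - (x * s * w) * hd + (y * t * w) * he +
        (y * w * e - x * w * d) * hmul
  -- If `u` and `v` vanished on the same branch, so would `b ∈ (u, v)`.
  have hcon : ∀ {s t : R}, IsNodeRing s t → s ∣ u → s ∣ v → False := fun hn h3 h4 => by
    obtain ⟨x, y, hxy⟩ := hbuv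
    exact hn.not_dvd_left_of_mem hb (hxy ▸ dvd_add (h3.mul_left _) (h4.mul_left _))
  rcases hu with hu | hu <;> rcases hv with hv | hv
  · exact (hcon hn hu hv).elim
  · exact main hn hu hv
  · exact main hn.symm hu hv
  · exact (hcon hn.symm hu hv).elim

/-- For `b ≠ 0` the equation makes `c / b` integral over the valuation ring `R`, which is normal;
for `b = 0` it forces `c = 0`. -/
lemma IsCurveRing.dvd_of_sq (hR : IsCurveRing R) {b c r s : R} (h : c ^ 2 = r * (b * c) + s * b ^ 2) : b ∣ c := by
  have := hR.isLocalRing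
  have := hR.isNoetherianRing
  have := hR.isDomain
  have hval : ValuationRing R := by
    have h1 := (tfae_of_isNoetherianRing_of_isLocalRing_of_isDomain R).out 4 1
    obtain ⟨t, ht⟩ := hR.principal
    refine h1.1 ⟨t, ?_⟩
    ext r
    rw [Submodule.mem_span_singleton, mem_maximalIdeal, mem_nonunits_iff, ht r]
    exact ⟨fun ⟨s, hs⟩ => ⟨s, by rw [hs, smul_eq_mul, mul_comm]⟩, fun ⟨s, hs⟩ => ⟨s, by
      rw [← hs, smul_eq_mul, mul_comm]⟩⟩
  rcases ValuationRing.dvd_total b c with hbc | ⟨t, rfl⟩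
  · exact hbc
  · by_cases hc : c = 0
    · rw [hc]; exact dvd_zero _
    · have h1 : c ^ 2 * (1 - t * (r + s * t)) = 0 := by linear_combination h
      have h2 := (mul_eq_zero.1 h1).resolve_left (pow_ne_zero 2 hc)
      exact ⟨r + s * t, by linear_combination c * h2⟩

end StalkAlgebra

/-! ### The stalks of the two tangent sheaves of a curve -/

section NodeExtension

variable {k : Type u} [Field k] {X : Scheme.{u}} {p : X ⟶ Spec (.of k)} {U : X.Etale} {y : U.left}

lemma NodeRing.derivation_ext {B : Type*} [CommRing B] {h : NodeRing k →+* B} {D E : NodeRing k → B}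
    (hD : IsDerAlong h D) (hE : IsDerAlong h E)
    (hc : ∀ c : k, D (algebraMap k (NodeRing k) c) = E (algebraMap k (NodeRing k) c))
    (hx : ∀ i, D (NodeRing.x k i) = E (NodeRing.x k i)) : D = E := by
  funext r
  obtain ⟨r, rfl⟩ := Ideal.Quotient.mk_surjective r
  induction r using MvPolynomial.induction_on with
  | C c => exact hc c
  | add a b ha hb => rw [map_add, hD.add, hE.add, ha, hb]
  | mul_X a i ha => rw [map_mul, hD.leibniz, hE.leibniz, ha, hx]

/-- The homomorphism from the coordinate ring of the node to the local ring of a chart. -/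
noncomputable abbrev NodeChart.toStalk (c : NodeChart p U y) : NodeRing k →+* U.left.presheaf.stalk y :=
  (U.left.presheaf.germ ⊤ y trivial).hom.comp (specFun c.map)

lemma NodeChart.stalkMap_stalkConst (c : NodeChart p U y) (a : k) :
    (etHom U).stalkMap y (stalkConst p (etHom U y) a) = c.toStalk (algebraMap k (NodeRing k) a) :=
  (_root_.stalkMap_stalkConst (etHom U) y a).trans
    (congrArg (U.left.presheaf.germ ⊤ y trivial) (c.specFun_eq a))

/-- The Euler field of one coordinate extends to the local ring of the chart. Restricted to an
affine open subset of `X` it is a derivation into a flat algebra, hence a combination of derivations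
of that ring, and these extend to the local ring of `X`. This links the coordinates, which exist
only étale locally, to derivations on `X`. -/
lemma NodeChart.exists_sum [LocallyOfFiniteType p] (c : NodeChart p U y) (i : Fin 2) :
    ∃ (E : U.left.presheaf.stalk y → U.left.presheaf.stalk y) (n : ℕ) (b : Fin n → U.left.presheaf.stalk y)
      (d : Fin n → X.presheaf.stalk (etHom U y) → X.presheaf.stalk (etHom U y)),
    IsDerAlong (RingHom.id _) E ∧ (∀ i, IsConstDer (stalkConst p (etHom U y)) (d i)) ∧
    (∀ x, E ((etHom U).stalkMap y x) = ∑ i, b i * (etHom U).stalkMap y (d i x)) ∧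
    ∀ l, E (U.left.presheaf.germ ⊤ y trivial (c.coord l)) =
      if l = i then U.left.presheaf.germ ⊤ y trivial (c.coord l) else 0 := by
  obtain ⟨D, hD, hDc, hDx⟩ := NodeRing.exists_derivation k i
  obtain ⟨E, hE, hEh⟩ := IsDerAlong.exists_extension c.formallyEtale (RingHom.id _)
    (D := fun a => c.toStalk (D a)) (hD.comp_left c.toStalk)
  obtain ⟨A, -, hqA, hA, hft⟩ := exists_affine_finiteType (p := p) (W := ⊤) (q := etHom U y) trivial
  algebraize [(rs (le_top : A ≤ ⊤)).comp (specFun p)]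
  let g : Γ(X, A) →+* X.presheaf.stalk (etHom U y) := (X.presheaf.germ A (etHom U y) hqA).hom
  have hg : ∀ a : k, g (algebraMap k Γ(X, A) a) = stalkConst p (etHom U y) a := fun a =>
    germ_rs (le_top : A ≤ ⊤) _ hqA (specFun p a)
  let f : X.presheaf.stalk (etHom U y) →+* U.left.presheaf.stalk y := ((etHom U).stalkMap y).hom
  have hf : IsEtaleLocal f := isEtaleLocal_stalkMap (etHom U) y
  have hgflat : g.Flat := by
    have := hA.isLocalization_stalk ⟨etHom U y, hqA⟩
    let : Algebra Γ(X, A) (X.presheaf.stalk (etHom U y)) := X.presheaf.algebra_section_stalk ⟨etHom U y, hqA⟩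
    exact (RingHom.flat_algebraMap_iff).2
      (IsLocalization.flat _ (hA.primeIdealOf ⟨etHom U y, hqA⟩).asIdeal.primeCompl)
  obtain ⟨n, b, d, hd, hdc, hsum⟩ := exists_sum_of_isDerAlong (k := k) (f.comp g) (hgflat.comp hf.flat)
    (hE.comp_right (f.comp g)) (fun a => by
      have h1 : (f.comp g) (algebraMap k Γ(X, A) a) = c.toStalk (algebraMap k (NodeRing k) a) :=
        (congrArg f (hg a)).trans (c.stalkMap_stalkConst a)
      have h2 := hEh (algebraMap k (NodeRing k) a)
      rw [hDc, map_zero] at h2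
      exact (congrArg E h1).trans h2)
  choose δ hδ hδg using fun i => IsDerAlong.exists_extension (formallyEtale_germ hA _ hqA) (RingHom.id _)
    (D := fun a => g (d i a)) ((hd i).comp_left g)
  refine ⟨E, n, b, δ, hE, fun i => ⟨hδ i, fun a => ?_⟩, fun x => ?_, fun l => ?_⟩
  · rw [← hg]
    exact (hδg i _).trans (by rw [hdc, map_zero])
  · refine congrFun (IsDerAlong.ext_of_formallyUnramified (formallyEtale_germ hA _ hqA).formallyUnramified'
      (hE.comp_right f) (IsDerAlong.sum _ fun i => ((hδ i).comp_left f).smul (b i)) fun a => ?_) x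
    refine (hsum a).trans (Finset.sum_congr rfl fun i _ => ?_)
    exact congrArg (fun z => b i * f z) (hδg i a).symm
  · have h1 := hEh (NodeRing.x k l)
    rw [hDx] at h1
    refine h1.trans ?_
    split_ifs with h
    · rfl
    · exact map_zero _

lemma NodeChart.isNodeExtension [IsAlgClosed k] [LocallyOfFiniteType p] (c : NodeChart p U y) :
    IsNodeExtension (stalkConst p (etHom U y)) ((etHom U).stalkMap y).hom
      (U.left.presheaf.germ ⊤ y trivial (c.coord 0)) (U.left.presheaf.germ ⊤ y trivial (c.coord 1)) where
  isLocalRing := inferInstance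
  isEtaleLocal := isEtaleLocal_stalkMap (etHom U) y
  isNodeRing := c.isNodeRing
  residue r := by
    obtain ⟨a, ha⟩ := c.exists_sub_not_isUnit r
    exact ⟨a, fun h => ha (by rwa [← show _ = U.left.presheaf.germ ⊤ y trivial (specFun (etHom U ≫ p) a) from
      _root_.stalkMap_stalkConst (p := p) (etHom U) y a])⟩
  ext D E hD hE h0 h1 := by
    refine IsDerAlong.ext_of_formallyUnramified c.formallyEtale.formallyUnramified' hD.der hE.der fun a => ?_
    refine congrFun (NodeRing.derivation_ext (hD.der.comp_right c.toStalk) (hE.der.comp_right c.toStalk)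
      (fun a => ?_) fun i => ?_) a
    · rw [← c.stalkMap_stalkConst]
      exact (hD.const a).trans (hE.const a).symm
    · fin_cases i
      · exact h0
      · exact h1
  sum_left := by
    obtain ⟨E, n, b, d, h1, h2, h3, h4⟩ := c.exists_sum 0
    exact ⟨E, n, b, d, h1, h2, h3, h4 0, h4 1⟩
  sum_right := by
    obtain ⟨E, n, b, d, h1, h2, h3, h4⟩ := c.exists_sum 1
    exact ⟨E, n, b, d, h1, h2, h3, h4 0, h4 1⟩

end NodeExtension

section StalkMapAt

variable {T X Y : Scheme.{u}}

/-- The map on stalks, with an explicit target point. -/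
noncomputable def stalkMapAt (g : T ⟶ X) (t : T) {q : X} (h : g t = q) :
    X.presheaf.stalk q →+* T.presheaf.stalk t := by
  subst h
  exact (g.stalkMap t).hom

lemma stalkMapAt_comp (g : T ⟶ X) (h : X ⟶ Y) (t : T) {x : X} {q : Y} (h1 : g t = x) (h2 : h x = q)
    (h3 : (g ≫ h) t = q) (r : Y.presheaf.stalk q) :
    stalkMapAt (g ≫ h) t h3 r = stalkMapAt g t h1 (stalkMapAt h x h2 r) := by
  subst h1
  subst h2
  exact stalkMap_comp_apply g h t r

lemma stalkMapAt_germ (g : T ⟶ X) (t : T) {q : X} (h : g t = q) (a : Γ(X, ⊤)) :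
    stalkMapAt g t h (X.presheaf.germ ⊤ q trivial a) = T.presheaf.germ ⊤ t trivial (g.appTop a) := by
  subst h
  exact Scheme.Hom.germ_stalkMap_apply g ⊤ t trivial a

end StalkMapAt

section TangentStalk

variable {k : Type u} [Field k] {X : Scheme.{u}} {p : X ⟶ Spec (.of k)} {Z : Set X} {q : X}

lemma IsGermOf.add {W : X.Opens} {D D' : ∀ V : {V : X.Opens // V ≤ W}, Γ(X, V.1) → Γ(X, V.1)} {E E'}
    (h : IsGermOf D q E) (h' : IsGermOf D' q E') :
    IsGermOf (fun V a => D V a + D' V a) q (fun r => E r + E' r) := fun V hq a => by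
  rw [map_add, ← h V hq, ← h' V hq]

lemma exists_tangentStalk (p : X ⟶ Spec (.of k)) (Z : Set X) (q : X) :
    ∃ θ : (tangentSheaf p Z).presheaf.stalk q →ₗ[X.presheaf.stalk q]
      (X.presheaf.stalk q → X.presheaf.stalk q),
    ∀ (W : X.Opens) (hq : q ∈ W) (D : tangentFields p Z W),
      IsGermOf D.1 q (θ (mgerm (tangentSheaf p Z) hq D)) := by
  choose ψ hψ using fun (W : X.Opens) (hq : q ∈ W) (D : tangentFields p Z W) => exists_isGermOf D.2.res q hq
  obtain ⟨l, hl⟩ := exists_stalk_desc (M := tangentSheaf p Z) (RingHom.id (X.presheaf.stalk q))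
    (fun W hq => AddMonoidHom.mk' (fun D => ψ W hq D) fun D D' =>
      (hψ W hq (D + D' : tangentFields p Z W)).ext hq ((hψ W hq D).add (hψ W hq D')))
    (fun V U h hx D => (hψ V hx (tangentRes p Z h D)).ext hx fun V' hq a =>
      hψ U (h hx) D ⟨V'.1, V'.2.trans h⟩ hq a)
    (fun U hx a D => (hψ U hx (a • D : tangentFields p Z U)).ext hx fun V hq b => by
      refine (congrArg (X.presheaf.germ U q hx a * ·) (hψ U hx D V hq b)).trans ?_
      refine (congrArg (· * _) (germ_rs V.2 q hq a).symm).trans ?_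
      exact (map_mul (X.presheaf.germ V.1 q hq).hom _ _).symm)
  exact ⟨l, fun W hq D => (congrArg (IsGermOf D.1 q) (hl W hq D)).mpr (hψ W hq D)⟩

end TangentStalk

/-- Since `u v = 0`, the product `(b p - c g) (b q + c g)` vanishes: a quadratic equation for `c /
b` whose leading coefficient is a unit. Its coefficients lie in `B'`, but the membership of `c ^ 2`
in the ideal `(b c, b ^ 2)` descends to `B`. -/
lemma exists_sq_eq_of_dvd {B B' : Type*} [CommRing B] [CommRing B'] {f : B →+* B'}
    (hf : f.Flat) (hl : IsLocalHom f) [IsLocalRing B] [IsLocalRing B'] {u v g p q : B'} (huv : u * v = 0)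
    (hg : IsUnit g) {b c : B} (h1 : v ∣ f b * p - f c * g) (h2 : u ∣ f b * q + f c * g) :
    ∃ r s, c ^ 2 = r * (b * c) + s * b ^ 2 := by
  obtain ⟨x, hx⟩ := h1
  obtain ⟨y, hy⟩ := h2
  obtain ⟨g', hg'⟩ := hg.exists_right_inv
  have h0 : (f b * p - f c * g) * (f b * q + f c * g) = 0 := by
    rw [hx, hy]; linear_combination x * y * huv
  have h : f (c ^ 2) ∈ (Ideal.span {b * c, b ^ 2}).map f := by
    rw [Ideal.map_span, Set.image_pair, Ideal.mem_span_pair]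
    refine ⟨g' * (p - q), g' ^ 2 * p * q, ?_⟩
    simp only [map_mul, map_pow]
    linear_combination (g' ^ 2) * h0 - (f b * f c * (p - q) * g' - f c ^ 2 * (g * g' + 1)) * hg'
  obtain ⟨r, s, h⟩ := Ideal.mem_span_pair.1 (mem_of_map_mem_of_flat hf hl h)
  exact ⟨r, s, h.symm⟩

section TangentStalk

variable {k : Type u} [Field k] {X : Scheme.{u}} {p : X ⟶ Spec (.of k)} {Z : Set X} {q : X}

/-- A linear map from the stalk of the tangent sheaf which takes a vector field to its germ. -/
def IsTangentStalkMap (p : X ⟶ Spec (.of k)) (Z : Set X) (q : X)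
    (θ : (tangentSheaf p Z).presheaf.stalk q →ₗ[X.presheaf.stalk q]
      (X.presheaf.stalk q → X.presheaf.stalk q)) : Prop :=
  ∀ (W : X.Opens) (hq : q ∈ W) (D : tangentFields p Z W),
    IsGermOf D.1 q (θ (mgerm (tangentSheaf p Z) hq D))

variable {θ : (tangentSheaf p Z).presheaf.stalk q →ₗ[X.presheaf.stalk q]
      (X.presheaf.stalk q → X.presheaf.stalk q)} (hθ : IsTangentStalkMap p Z q θ)
include hθ

lemma IsTangentStalkMap.isTangentGerm (z) : IsTangentGerm p Z q (θ z) := by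
  obtain ⟨W, hW, D, rfl⟩ := exists_mgerm_eq z
  exact IsTangentField.isTangentGerm (D : tangentFields p Z W).2 hW (hθ W hW D)

variable [LocallyOfFiniteType p]

/-- A vector field whose induced derivation of the local ring is zero vanishes near `q`, because
finitely many generators decide this. -/
lemma IsTangentStalkMap.injective : Function.Injective θ := by
  refine (injective_iff_map_eq_zero θ).2 fun z hz => ?_
  obtain ⟨W, hW, D, rfl⟩ := exists_mgerm_eq z
  have h1 := hθ W hW D
  have h2 := hθ W hW (0 : tangentFields p Z W)
  have e0 : mgerm (tangentSheaf p Z) hW (0 : tangentFields p Z W) = 0 :=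
    map_zero (mgerm (tangentSheaf p Z) hW)
  rw [hz] at h1
  rw [e0, map_zero] at h2
  obtain ⟨W', h, hq, e⟩ := exists_tangentRes_eq D 0 hW h1 h2
  refine (mgerm_mrs h hq D).symm.trans ?_
  refine (congrArg (mgerm (tangentSheaf p Z) hq) e).trans ?_
  exact (mgerm_mrs (M := tangentSheaf p Z) h hq (0 : tangentFields p Z W)).trans e0

lemma IsTangentStalkMap.exists_eq (hZ : ∃ W : X.Opens, q ∈ W ∧ ∀ z ∈ W, z ∈ Z → z = q) {E}
    (hE : IsTangentGerm p Z q E) : ∃ z, θ z = E := by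
  obtain ⟨W, hW, D, hD⟩ := exists_tangentField hZ hE
  exact ⟨_, (hθ W hW D).ext hW hD⟩

lemma IsTangentStalkMap.smul_eq_zero (hX : IsDomain (X.presheaf.stalk q)) (r : X.presheaf.stalk q)
    (z : (tangentSheaf p Z).presheaf.stalk q) (h : r • z = 0) : r = 0 ∨ z = 0 := by
  by_contra! hne
  refine hne.2 (hθ.injective ?_)
  rw [map_zero]
  funext x
  have h1 : r * θ z x = 0 := by
    have h2 := congrArg θ h
    rw [map_smul, map_zero] at h2
    exact congrFun h2 x
  exact (mul_eq_zero.1 h1).resolve_left hne.1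

end TangentStalk

lemma stalkHom_injective {X : Scheme.{u}} {M N : X.Modules} (φ : M ⟶ N)
    (h : ∀ W, Function.Injective (φ.app W)) (x : X) : Function.Injective (stalkHom φ x) := by
  refine (injective_iff_map_eq_zero _).2 fun z hz => ?_
  obtain ⟨W, hW, s, rfl⟩ := exists_mgerm_eq z
  rw [stalkHom_mgerm, ← map_zero (mgerm N hW)] at hz
  obtain ⟨W', h1, h2, hx, e⟩ := exists_mrs_eq_of_mgerm_eq hz
  rw [← app_mrs, map_zero] at e
  rw [← mgerm_mrs h1 hx, h W' (e.trans (map_zero (Scheme.Modules.Hom.app φ W').hom).symm), map_zero]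

section LogStalk

variable {k : Type u} [Field k] [IsAlgClosed k] {N : LogStructure (Spec (.of k))}
  {X : LogScheme.{u}} {p : X.Hom ⟨Spec (.of k), N⟩} {Z : Set X.toScheme}

lemma exists_isNodalChart_of_isNode (hX : IsLogCurve p) {q : X.toScheme} (hq : IsNode p.base q) :
    ∃ (Ω : Type u) (_ : Field Ω) (_ : IsAlgClosed Ω) (x : Spec (.of Ω) ⟶ X.toScheme)
      (U : X.toScheme.Etale) (l : X.Lift x U) (c : NodeChart p.base U l.pt) (α β : X.Sec U),
      x default = q ∧ IsNodalChart l c α β := by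
  obtain ⟨Ω, _, _, x, rfl⟩ := exists_geometricPoint q
  rcases hX.description Ω x with h | h | h
  · exact absurd hq h.1.not_isNode
  · exact absurd hq h.1.not_isNode
  · obtain ⟨U, l, c, α, β, h⟩ := h.exists_isNodalChart
    exact ⟨Ω, _, _, x, U, l, c, α, β, rfl, h⟩

lemma IsMarking.not_isNode {q : X.toScheme} (hq : IsMarking p q) : ¬ IsNode p.base q := by
  obtain ⟨Ω, _, _, x, rfl⟩ := exists_geometricPoint q
  exact (hq Ω x rfl).1.not_isNode

lemma stalkHom_mgerm_underlyingHom (hZ : ∀ z ∈ Z, IsMarking p z) {W : X.toScheme.Opens} {q : X.toScheme}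
    (hW : q ∈ W) (s : Shrink.{u} (logDerivations p W)) :
    stalkHom (underlyingHom hZ) q (mgerm (logTangentSheaf p) hW s) =
      mgerm (tangentSheaf p.base Z) hW (underlyingField hZ W (unshrink p W s)) :=
  stalkHom_mgerm (underlyingHom hZ) hW _

lemma stalkHom_mgerm_unshrink (hZ : ∀ z ∈ Z, IsMarking p z) {W : X.toScheme.Opens} {q : X.toScheme}
    (hW : q ∈ W) (δ : logDerivations p W) :
    stalkHom (underlyingHom hZ) q (mgerm (logTangentSheaf p) hW ((unshrink p W).symm δ)) =
      mgerm (tangentSheaf p.base Z) hW (underlyingField hZ W δ) := by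
  refine (stalkHom_mgerm (underlyingHom hZ) hW _).trans ?_
  refine congrArg (mgerm (tangentSheaf p.base Z) hW) ?_
  exact congrArg (underlyingField hZ W) ((unshrink p W).apply_symm_apply δ)

lemma isGermOf_underlyingField_iff (hZ : ∀ z ∈ Z, IsMarking p z) {q : X.toScheme} {W : X.toScheme.Opens}
    (δ : logDerivations p W) {E} : IsGermOf (underlyingField hZ W δ).1 q E ↔
      IsGermOf (underlyingDer fun U => (δ.1 U).1) q E :=
  Iff.of_eq (congrArg (fun D => IsGermOf D q E) (underlyingField_apply hZ δ))

variable {q : X.toScheme} {θ : (tangentSheaf p.base Z).presheaf.stalk q →ₗ[X.toScheme.presheaf.stalk q]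
      (X.toScheme.presheaf.stalk q → X.toScheme.presheaf.stalk q)}
  (hθ : IsTangentStalkMap p.base Z q θ)
include hθ

lemma IsTangentStalkMap.exists_logDerivation (hZ : ∀ z ∈ Z, IsMarking p z)
    (z : (logTangentSheaf p).presheaf.stalk q) :
    ∃ (W : X.toScheme.Opens) (_ : q ∈ W) (δ : logDerivations p W),
      IsGermOf (underlyingDer fun U => (δ.1 U).1) q (θ (stalkHom (underlyingHom hZ) q z)) :=
  (exists_mgerm_eq z).imp fun W ⟨hW, s, h⟩ => ⟨hW, unshrink p W s,
    (isGermOf_underlyingField_iff hZ (unshrink p W s)).1 (Eq.mp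
      (congrArg (fun z => IsGermOf _ q (θ z)) ((stalkHom_mgerm_underlyingHom hZ hW s).symm.trans
        (congrArg (stalkHom (underlyingHom hZ) q) h))) (hθ W hW (underlyingField hZ W (unshrink p W s))))⟩

lemma IsTangentStalkMap.exists_of_logDerivation (hZ : ∀ z ∈ Z, IsMarking p z) {W : X.toScheme.Opens} (hW : q ∈ W)
    (δ : logDerivations p W) {E} (hE : IsGermOf (underlyingDer fun U => (δ.1 U).1) q E) :
    ∃ z, θ (stalkHom (underlyingHom hZ) q z) = E := by
  refine ⟨mgerm (logTangentSheaf p) hW ((unshrink p W).symm δ), ?_⟩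
  rw [stalkHom_mgerm_unshrink]
  exact (hθ W hW (underlyingField hZ W δ)).ext hW ((isGermOf_underlyingField_iff hZ δ).2 hE)

variable [LocallyOfFiniteType p.base]

lemma IsTangentStalkMap.surjective_of_not_isNode (hX : IsLogCurve p) (hZ : ∀ z, z ∈ Z ↔ IsMarking p z)
    (hq : ¬ IsNode p.base q) :
    Function.Surjective (stalkHom (underlyingHom (p := p) fun z => (hZ z).1) q) := by
  intro η
  obtain ⟨W, hW, δ, h⟩ := exists_logDerivation_germ_of_not_isNode hX hZ hq (hθ.isTangentGerm η)
  obtain ⟨z, hz⟩ := hθ.exists_of_logDerivation (fun z => (hZ z).1) hW δ h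
  exact ⟨z, hθ.injective hz⟩

end LogStalk

section NodeStalk

variable {k : Type u} [Field k] [IsAlgClosed k] {N : LogStructure (Spec (.of k))}
  {X : LogScheme.{u}} {p : X.Hom ⟨Spec (.of k), N⟩} [LocallyOfFiniteType p.base] {Z : Set X.toScheme}

/-- Generators of the stalks of the two tangent sheaves at a node, with the properties of the relation
between them. -/
lemma exists_stalk_generators (hX : IsLogCurve p) (hZ : ∀ z, z ∈ Z ↔ IsMarking p z) {q : X.toScheme}
    (hq : IsNode p.base q) :
    ∃ (i : (logTangentSheaf p).presheaf.stalk q →ₗ[X.toScheme.presheaf.stalk q]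
        (tangentSheaf p.base Z).presheaf.stalk q)
      (σ : (logTangentSheaf p).presheaf.stalk q) (τ : (tangentSheaf p.base Z).presheaf.stalk q),
      i = stalkHom (underlyingHom (p := p) fun z => (hZ z).1) q ∧
      (∀ t, ∃ r : X.toScheme.presheaf.stalk q, t = r • σ) ∧
      (∀ t, ∃ r s : X.toScheme.presheaf.stalk q, t = r • i σ + s • τ) ∧
      (∀ r : X.toScheme.presheaf.stalk q, r • i σ = 0 → r = 0) ∧
      (∀ b : X.toScheme.presheaf.stalk q, ¬ IsUnit b → ∃ c : X.toScheme.presheaf.stalk q, b • τ = c • i σ) ∧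
      (∀ b c : X.toScheme.presheaf.stalk q, b • τ = c • i σ → ∃ r s, c ^ 2 = r * (b * c) + s * b ^ 2) ∧
      ∃ (U : X.toScheme.Etale) (y : U.left) (hy : etHom U y = q) (c₀ : NodeChart p.base U y) (α β : X.Sec U)
        (g p' q' : U.left.presheaf.stalk y), X.eps U α = c₀.coord 0 ∧ X.eps U β = c₀.coord 1 ∧
        IsUnit g ∧ IsUnit (p' + q') ∧ ∀ b c : X.toScheme.presheaf.stalk q, b • τ = c • i σ →
          U.left.presheaf.germ ⊤ y trivial (c₀.coord 1) ∣
            stalkMapAt (etHom U) y hy b * p' - stalkMapAt (etHom U) y hy c * g ∧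
          U.left.presheaf.germ ⊤ y trivial (c₀.coord 0) ∣
            stalkMapAt (etHom U) y hy b * q' + stalkMapAt (etHom U) y hy c * g := by
  obtain ⟨Ω, _, _, x, U, l, c₀, α, β, hx, hc⟩ := exists_isNodalChart_of_isNode hX hq
  obtain rfl : etHom U l.pt = q := (LogScheme.Lift.etHom_pt l).trans hx
  obtain ⟨θ, hθ⟩ : ∃ θ, IsTangentStalkMap p.base Z (etHom U l.pt) θ := exists_tangentStalk _ _ _
  have hZq : etHom U l.pt ∉ Z := fun h => ((hZ _).1 h).not_isNode hq
  have htan : ∀ {E}, IsConstDer (stalkConst p.base (etHom U l.pt)) E → ∃ z, θ z = E := fun hE =>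
    hθ.exists_eq (hX.exists_isolated (fun z => (hZ z).1) _) ⟨hE.der, hE.const, fun h => absurd h hZq⟩
  have hne := c₀.isNodeExtension
  obtain ⟨σ, τ, g, p', q', hσ, hτ, hg, hpq, hfree, ⟨σ', hσ', hσt⟩, hgen₁, hgen, hsmul, hrel⟩ :=
    hne.exists_generators
  set i := stalkHom (underlyingHom (p := p) fun z => (hZ z).1) (etHom U l.pt) with hi
  have hinj : Function.Injective i :=
    stalkHom_injective _ (underlyingHom_app_injective hX fun z => (hZ z).1) _
  -- `σ` is traceless, so it lifts to the logarithmic tangent sheaf.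
  obtain ⟨σ₀, hσ₀⟩ : ∃ z, θ (i z) = σ := by
    obtain ⟨W, hW, δ, h⟩ := exists_logDerivation_germ_of_isNodalChart hX hZ hc
      ⟨hσ.der, hσ.const, fun h => absurd h hZq⟩ ⟨hσ'.der, hσ'.apply⟩ hσt
    exact hθ.exists_of_logDerivation _ hW δ h
  obtain ⟨τ₀, hτ₀⟩ := htan hτ
  have hrel' : ∀ b c : X.toScheme.presheaf.stalk (etHom U l.pt), b • τ₀ = c • i σ₀ → ∀ x, b * τ x = c * σ x :=
    fun b c h x => by
      have h1 := congrFun (congrArg θ h) x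
      rw [map_smul, map_smul, hτ₀, hσ₀] at h1
      exact h1
  refine ⟨i, σ₀, τ₀, rfl, fun t => ?_, fun t => ?_, fun r hr => ?_, fun b hb => ?_, fun b c h => ?_,
    U, l.pt, rfl, c₀, α, β, g, p', q', hc.eps_left, hc.eps_right, hg, hpq, fun b c h => hrel b c (hrel' b c h)⟩
  -- Germs of logarithmic derivations are traceless, hence multiples of `σ`.
  · obtain ⟨W, hW, δ, h⟩ := hθ.exists_logDerivation (fun z => (hZ z).1) t
    have ht := hθ.isTangentGerm (i t)
    obtain ⟨E', hE'⟩ := hne.exists_ext ⟨ht.der, ht.const⟩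
    obtain ⟨r, hr⟩ := hgen₁ _ E' ⟨ht.der, ht.const⟩ hE' (hc.isTraceless hX δ.2.isEtaleDer
      (fun U m => ⟨_, δ.2.isDlog U m⟩) hW h ⟨hE'.der, hE'.apply⟩)
    refine ⟨r, hinj (hθ.injective ?_)⟩
    rw [map_smul, map_smul, hσ₀]
    exact funext hr
  · have ht := hθ.isTangentGerm t
    obtain ⟨r, s, h⟩ := hgen _ ⟨ht.der, ht.const⟩
    refine ⟨r, s, hθ.injective ?_⟩
    rw [map_add, map_smul, map_smul, hσ₀, hτ₀]
    exact funext h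
  · refine hfree r fun x => ?_
    have h1 := congrFun (congrArg θ hr) x
    rw [map_smul, hσ₀, map_zero] at h1
    exact h1
  · obtain ⟨c, h⟩ := hsmul b hb
    refine ⟨c, hθ.injective ?_⟩
    rw [map_smul, map_smul, hσ₀, hτ₀]
    exact funext h
  · obtain ⟨h1, h2⟩ := hrel b c (hrel' b c h)
    exact exists_sq_eq_of_dvd hne.isEtaleLocal.flat hne.isEtaleLocal.isLocalHom hne.isNodeRing.mul hg h1 h2

end NodeStalk

/-! ### Points of C over nodes of Q -/

/-- A prime inside `(u)` contains `u` or `v` because `u v = 0`, and `v ∉ (u)`. Through this the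
hypothesis on components of C applies to each branch. -/
lemma IsNodeRing.span_mem_minimalPrimes {R : Type*} [CommRing R] {u v : R} (h : IsNodeRing u v) :
    Ideal.span {u} ∈ minimalPrimes R := by
  have hp : (Ideal.span {u}).IsPrime := by
    refine ⟨fun e => h.not_isUnit_left (Ideal.span_singleton_eq_top.1 e), fun {a b} hab => ?_⟩
    simp only [Ideal.mem_span_singleton] at hab ⊢
    exact h.left_prime hab
  refine ⟨⟨hp, bot_le⟩, fun P hP hle => ?_⟩
  have := hP.1
  rcases this.mem_or_mem (show u * v ∈ P from h.mul ▸ P.zero_mem) with hu | hv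
  · rwa [Ideal.span_singleton_le_iff_mem]
  · exact absurd (Ideal.mem_span_singleton.1 (hle hv)) h.not_dvd

section StalkMapAt

variable {T X : Scheme.{u}}

lemma isLocalHom_stalkMapAt (g : T ⟶ X) (t : T) {q : X} (h : g t = q) :
    IsLocalHom (stalkMapAt g t h) := by
  subst h
  exact g.toLRSHom.prop t

lemma stalkMapAt_congr {g g' : T ⟶ X} (e : g = g') (t : T) {q : X} (h : g t = q) (h' : g' t = q) :
    stalkMapAt g t h = stalkMapAt g' t h' := by
  subst e
  rfl

lemma exists_etale_over {C Q : Scheme.{u}} (f : C ⟶ Q) (U : Q.Etale) (y : U.left) (e : C)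
    (h : etHom U y = f e) : ∃ (V : C.Etale) (v : V.left) (g : V.left ⟶ U.left),
      g ≫ etHom U = etHom V ≫ f ∧ etHom V v = e ∧ g v = y := by
  obtain ⟨v, h1, h2⟩ := Scheme.Pullback.exists_preimage_pullback e y h.symm
  exact ⟨Scheme.Etale.mk (pullback.fst f (etHom U)), v, pullback.snd f (etHom U),
    pullback.condition.symm, h1, h2⟩

lemma exists_stalkMap_stalkMap_notMem {C Q : Scheme.{u}} (f : C ⟶ Q) (U : C.Etale) (y : U.left)
    (hq : IsClosed {f (etHom U y)})
    (hf : ∀ Z ∈ irreducibleComponents C, ¬ Z ⊆ f ⁻¹' {f (etHom U y)})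
    (P : Ideal (U.left.presheaf.stalk y)) (hP : P ∈ minimalPrimes (U.left.presheaf.stalk y)) :
    ∃ b : Q.presheaf.stalk (f (etHom U y)), ¬ IsUnit b ∧
      (etHom U).stalkMap y (f.stalkMap (etHom U y) b) ∉ P := by
  obtain ⟨b, hb, hbP⟩ := exists_stalkMap_notMem f U y hq hf P hP
  exact ⟨b, hb, fun h => hbP ((stalkMap_comp_apply (etHom U) f y b).symm ▸ h)⟩

end StalkMapAt

section Node

variable {k : Type u} [Field k] [IsAlgClosed k] {N : LogStructure (Spec (.of k))}
  {X : LogScheme.{u}} {p : X.Hom ⟨Spec (.of k), N⟩}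

/-- At a node a section of the logarithmic structure which is not invertible vanishes on a branch. -/
lemma IsNodalChart.dvd_or_dvd {Ω : Type u} [Field Ω] [IsAlgClosed Ω] {x : Spec (.of Ω) ⟶ X.toScheme}
    {U : X.toScheme.Etale} {l : X.Lift x U} {c : NodeChart p.base U l.pt} {α β : X.Sec U}
    (hc : IsNodalChart l c α β) (m : X.Sec U)
    (hm : ¬ IsUnit (U.left.presheaf.germ ⊤ l.pt trivial (X.eps U m))) :
    U.left.presheaf.germ ⊤ l.pt trivial (c.coord 0) ∣ U.left.presheaf.germ ⊤ l.pt trivial (X.eps U m) ∨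
    U.left.presheaf.germ ⊤ l.pt trivial (c.coord 1) ∣ U.left.presheaf.germ ⊤ l.pt trivial (X.eps U m) := by
  -- Étale locally the function of `m` is a constant times powers of the two coordinates times a
  -- unit. If it is not invertible at the node, an exponent is positive or the constant is zero; the
  -- divisibility descends.
  obtain ⟨T, h, l', s, i, j, w, rfl, hw, e⟩ := hc.exists_res_eq m
  have hf := isEtaleLocal_stalkMap h.left l'.pt
  have e1 := congrArg (fun m => T.left.presheaf.germ ⊤ l'.pt trivial (X.eps T m)) e
  simp only [map_mul, map_pow, LogScheme.eps_res] at e1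
  rw [germ_left, germ_left, germ_left, hc.eps_left, hc.eps_right] at e1
  obtain ⟨a, ha⟩ := exists_eps_pullB (p := p) T s
  rw [ha] at e1
  suffices h' : ∀ (f : U.left.presheaf.stalk (l'.map h).pt →+* T.left.presheaf.stalk l'.pt) (u v r),
      f.Flat → IsLocalHom f → ¬ IsUnit r →
      f r = T.left.presheaf.germ ⊤ l'.pt trivial (specFun (etHom T ≫ p.base) a) * f u ^ i * f v ^ j *
        T.left.presheaf.germ ⊤ l'.pt trivial (X.eps T w) → u ∣ r ∨ v ∣ r from
    h' (h.left.stalkMap l'.pt).hom _ _ _ hf.flat hf.isLocalHom hm e1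
  intro f u v r hf hl hr e
  rcases i with _ | i
  · rcases j with _ | j
    · by_cases h0 : a = 0
      · refine Or.inl (dvd_of_map_dvd_of_flat hf hl ?_)
        rw [e, h0]; simp
      · refine absurd (hl.map_nonunit r ?_) hr
        rw [e, pow_zero, pow_zero, mul_one, mul_one]
        exact (((isUnit_iff_ne_zero.2 h0).map _).map (T.left.presheaf.germ ⊤ l'.pt trivial).hom).mul
          ((hw.map (X.eps T)).map (T.left.presheaf.germ ⊤ l'.pt trivial).hom)
    · refine Or.inr (dvd_of_map_dvd_of_flat hf hl ?_)
      rw [e, pow_succ]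
      exact ((dvd_mul_left _ _).mul_left _).mul_right _
  · refine Or.inl (dvd_of_map_dvd_of_flat hf hl ?_)
    rw [e, pow_succ]
    exact (((dvd_mul_left _ _).mul_left _).mul_right _).mul_right _

variable {C Q : LogScheme.{u}} {πC : C.Hom ⟨Spec (.of k), N⟩} {πQ : Q.Hom ⟨Spec (.of k), N⟩}
  (hC : IsLogCurve πC) (hQ : IsLogCurve πQ) (f : C.Hom Q)
  (hnode : ∀ Z ∈ irreducibleComponents C.toScheme, ∀ q, IsNode πQ.base q → ¬ Z ⊆ f.base ⁻¹' {q})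
include hC hQ hnode

/-- The comparison of the two tangent sheaves at a node over a node. -/
lemma exists_not_dvd_and_dvd {e : C.toScheme} (he : IsNode πC.base e) {U : Q.toScheme.Etale}
    {y : U.left} (hy : etHom U y = f.base e) (c₀ : NodeChart πQ.base U y) {α β : Q.Sec U}
    (hα : Q.eps U α = c₀.coord 0) (hβ : Q.eps U β = c₀.coord 1) {g p' q' : U.left.presheaf.stalk y}
    (hg : IsUnit g) (hpq : IsUnit (p' + q')) :
    ∃ b : Q.toScheme.presheaf.stalk (f.base e), ¬ IsUnit b ∧
      (f.base.stalkMap e).hom b ∈ (C.toScheme.presheaf.stalk e)⁰ ∧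
      ∀ c : Q.toScheme.presheaf.stalk (f.base e),
        U.left.presheaf.germ ⊤ y trivial (c₀.coord 1) ∣
          stalkMapAt (etHom U) y hy b * p' - stalkMapAt (etHom U) y hy c * g →
        U.left.presheaf.germ ⊤ y trivial (c₀.coord 0) ∣
            stalkMapAt (etHom U) y hy b * q' + stalkMapAt (etHom U) y hy c * g →
        ¬ (f.base.stalkMap e).hom b ∣ (f.base.stalkMap e).hom c ∧
        ∀ m, ¬ IsUnit m → (f.base.stalkMap e).hom b ∣ m * (f.base.stalkMap e).hom c := by
  obtain ⟨V, v, g₁, hg₁, hv, hgv⟩ := exists_etale_over f.base U y e hy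
  obtain ⟨Ω, _, _, x, V', l', c', α', β', hx, hc'⟩ := exists_isNodalChart_of_isNode hC he
  obtain ⟨lv, rfl⟩ := LogScheme.exists_lift V v (hv.trans hx.symm)
  obtain ⟨T, h₁, h₂, l, rfl, rfl⟩ := LogScheme.exists_refinement l' lv
  have hc := hc'.comp
  set c := c'.comp h₁ l.pt rfl
  obtain rfl : etHom T l.pt = e := (LogScheme.Lift.etHom_pt l).trans hx
  have hq : IsNode πQ.base (f.base (etHom T l.pt)) := ⟨U, y, hy, ⟨c₀⟩⟩
  let g₀ : T.left ⟶ U.left := h₂.left ≫ g₁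
  have hg₀ : g₀ ≫ etHom U = etHom T ≫ f.base := by
    rw [Category.assoc, hg₁, ← Category.assoc, et_w]
  have hgt : g₀ l.pt = y := hgv
  have hn := c.isNodeRing
  have hn₀ := c₀.isNodeRing
  have hψ := isEtaleLocal_stalkMap (etHom T) l.pt
  set ψ := ((etHom T).stalkMap l.pt).hom
  set φ := (f.base.stalkMap (etHom T l.pt)).hom
  set χ := stalkMapAt g₀ l.pt hgt
  have hχ : IsLocalHom χ := isLocalHom_stalkMapAt _ _ _
  have hcomm : ∀ r, χ (stalkMapAt (etHom U) y hy r) = ψ (φ r) := fun r => by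
    have h1 : (g₀ ≫ etHom U) l.pt = f.base (etHom T l.pt) := by rw [hg₀]; rfl
    rw [← stalkMapAt_comp g₀ (etHom U) l.pt hgt hy h1, stalkMapAt_congr hg₀ l.pt h1 rfl]
    exact stalkMapAt_comp (etHom T) f.base l.pt rfl rfl rfl r
  have hcl := isClosed_of_isNode hQ.isSmoothPoint_or_isNode hq
  -- On each branch some function vanishing at the node of `Q` survives, since no component is
  -- contracted there; by avoidance one `b` survives on both branches.
  have hb : ∀ w : T.left.presheaf.stalk l.pt, Ideal.span {w} ∈ minimalPrimes _ →
      ∃ b ∈ (maximalIdeal (Q.toScheme.presheaf.stalk (f.base (etHom T l.pt)))).toAddSubgroup,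
        ¬ w ∣ (ψ.comp φ).toAddMonoidHom b := fun w hw => by
    obtain ⟨b, hb, hbw⟩ := exists_stalkMap_stalkMap_notMem f.base T l.pt hcl
      (fun Z hZ => hnode Z hZ _ hq) _ hw
    exact ⟨b, hb, fun h => hbw (Ideal.mem_span_singleton.2 h)⟩
  obtain ⟨b, hb, hbn⟩ := hn.exists_mem_nonZeroDivisors (ψ.comp φ).toAddMonoidHom _
    (hb _ hn.span_mem_minimalPrimes) (hb _ hn.symm.span_mem_minimalPrimes)
  have hbu : ¬ IsUnit b := hb
  have hbn : ψ (φ b) ∈ _ := hbn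
  -- Here the logarithmic structure of `f` enters: the coordinate is the function of a section of
  -- `M_Q`, so its pull back is the function of a section of `M_C`, and that vanishes on a whole
  -- branch once it vanishes at the node.
  have hcoord : ∀ (i : Fin 2) (γ : Q.Sec U), Q.eps U γ = c₀.coord i →
      ¬ IsUnit (U.left.presheaf.germ ⊤ y trivial (c₀.coord i)) →
      T.left.presheaf.germ ⊤ l.pt trivial (c.coord 0) ∣ χ (U.left.presheaf.germ ⊤ y trivial (c₀.coord i)) ∨
      T.left.presheaf.germ ⊤ l.pt trivial (c.coord 1) ∣ χ (U.left.presheaf.germ ⊤ y trivial (c₀.coord i)) := by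
    intro i γ hγ hu
    have e1 : χ (U.left.presheaf.germ ⊤ y trivial (c₀.coord i)) =
        T.left.presheaf.germ ⊤ l.pt trivial (C.eps T (f.pull T U g₀ hg₀ γ)) := by
      rw [f.eps_pull, hγ]
      exact stalkMapAt_germ g₀ l.pt hgt _
    rw [e1]
    refine hc.dvd_or_dvd _ fun h => hu (hχ.map_nonunit _ ?_)
    rw [e1]; exact h
  refine ⟨b, hbu, mem_nonZeroDivisors_of_map_mem hψ.flat hψ.isLocalHom hbn, fun a h1 h2 => ?_⟩
  have h1' := map_dvd χ h1
  have h2' := map_dvd χ h2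
  simp only [map_sub, map_add, map_mul, hcomm] at h1' h2'
  have hbuv : ∃ r s, ψ (φ b) = r * χ (U.left.presheaf.germ ⊤ y trivial (c₀.coord 0)) +
      s * χ (U.left.presheaf.germ ⊤ y trivial (c₀.coord 1)) := by
    have := isLocalHom_stalkMapAt (etHom U) y hy
    obtain ⟨r, s, h⟩ := (hn₀.nonunit (stalkMapAt (etHom U) y hy b)).1 fun h =>
      hbu (isUnit_of_map_unit (stalkMapAt (etHom U) y hy) b h)
    exact ⟨χ r, χ s, by rw [← hcomm, h, map_add, map_mul, map_mul]⟩
  obtain ⟨h3, h4⟩ := hn.not_dvd_and_dvd (hcoord 0 α hα hn₀.not_isUnit_left)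
    (hcoord 1 β hβ hn₀.not_isUnit_right) hbn hbuv (hg.map χ) (map_add χ p' q' ▸ hpq.map χ) h1' h2'
  refine ⟨fun h => h3 (map_dvd ψ h), fun m hm => dvd_of_map_dvd_of_flat hψ.flat hψ.isLocalHom ?_⟩
  rw [map_mul]
  exact h4 _ fun h => hm (hψ.isLocalHom.map_nonunit m h)

/-- At a smooth point over a node some function vanishing at the node does not pull back to zero. -/
lemma exists_stalkMap_ne_zero {x : C.toScheme} (hx : IsSmoothPoint πC.base x)
    (hq : IsNode πQ.base (f.base x)) : ∃ b : Q.toScheme.presheaf.stalk (f.base x), ¬ IsUnit b ∧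
      (f.base.stalkMap x).hom b ∈ (C.toScheme.presheaf.stalk x)⁰ := by
  have := hx.isCurveRing.isDomain
  have hd : IsDomain ((etTop C.toScheme).left.presheaf.stalk x) := this
  obtain ⟨b, hb, h⟩ := exists_stalkMap_stalkMap_notMem f.base (etTop C.toScheme) x
    (isClosed_of_isNode hQ.isSmoothPoint_or_isNode hq) (fun Z hZ => hnode Z hZ _ hq) ⊥
    (by rw [IsDomain.minimalPrimes_eq_singleton_bot]; rfl)
  refine ⟨b, hb, mem_nonZeroDivisors_of_ne_zero fun h0 => h ?_⟩
  have h1 : f.base.stalkMap (etHom (etTop C.toScheme) x) b = 0 := h0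
  rw [h1, map_zero]
  exact zero_mem _

end Node

/-- The inverse on the stalk at `f x` induces a left inverse by `exists_pullStalk_lift`, and the
image contains generators by `span_range_pullStalk`. -/
lemma bijective_stalkHom_pullback {X Y : Scheme.{u}} (f : X ⟶ Y) {K L : Y.Modules} (a : K ⟶ L) (x : X)
    (h : Function.Bijective (stalkHom a (f x))) :
    Function.Bijective (stalkHom ((Scheme.Modules.pullback f).map a) x) := by
  let e := LinearEquiv.ofBijective (stalkHom a (f x)) h
  obtain ⟨l, hl⟩ := exists_pullStalk_lift (K := L) f x
    ((pullStalk f K x).comp e.symm.toLinearMap)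
  have h1 : ∀ z, l (stalkHom ((Scheme.Modules.pullback f).map a) x z) = z := by
    intro z
    have hz : z ∈ Submodule.span (X.presheaf.stalk x) (Set.range (pullStalk f K x)) := by
      rw [span_range_pullStalk]; trivial
    induction hz using Submodule.span_induction with
    | mem z hz =>
      obtain ⟨w, rfl⟩ := hz
      rw [stalkHom_pullStalk, hl]
      exact congrArg (pullStalk f K x) (e.symm_apply_apply w)
    | zero => rw [map_zero, map_zero]
    | add z z' _ _ hz hz' => rw [map_add, map_add, hz, hz']
    | smul r z _ hz => rw [map_smul, map_smul, hz]
  refine ⟨Function.LeftInverse.injective h1, fun z => ?_⟩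
  have hz : z ∈ Submodule.span (X.presheaf.stalk x) (Set.range (pullStalk f L x)) := by
    rw [span_range_pullStalk]; trivial
  induction hz using Submodule.span_induction with
  | mem z hz =>
    obtain ⟨w, rfl⟩ := hz
    obtain ⟨w, rfl⟩ := h.2 w
    exact ⟨_, stalkHom_pullStalk f a w⟩
  | zero => exact ⟨0, map_zero _⟩
  | add z z' _ _ hz hz' =>
    obtain ⟨y, rfl⟩ := hz
    obtain ⟨y', rfl⟩ := hz'
    exact ⟨y + y', map_add _ _ _⟩
  | smul r z _ hz =>
    obtain ⟨y, rfl⟩ := hz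
    exact ⟨r • y, map_smul _ _ _⟩

/-! ### The three kinds of points of C and the theorem -/

section Main

variable {k : Type u} [Field k] [IsAlgClosed k] {N : LogStructure (Spec (.of k))}
  {C Q : LogScheme.{u}} {πC : C.Hom ⟨Spec (.of k), N⟩} {πQ : Q.Hom ⟨Spec (.of k), N⟩}
  (hC : IsLogCurve πC) (hQ : IsLogCurve πQ) [LocallyOfFiniteType πQ.base] {Z : Set Q.toScheme}
  (hZ : ∀ z, z ∈ Z ↔ IsMarking πQ z) (f : C.Hom Q)
  (hnode : ∀ Z ∈ irreducibleComponents C.toScheme, ∀ q, IsNode πQ.base q → ¬ Z ⊆ f.base ⁻¹' {q})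

/-- The pull back of the comparison of the two tangent sheaves. -/
noncomputable abbrev pullUnderlying : (Scheme.Modules.pullback f.base).obj (logTangentSheaf πQ) ⟶
    (Scheme.Modules.pullback f.base).obj (tangentSheaf πQ.base Z) :=
  (Scheme.Modules.pullback f.base).map (underlyingHom (p := πQ) fun z => (hZ z).1)

-- Off the nodes of `Q` the two tangent sheaves have the same stalk, torsion free over a discrete
-- valuation ring or a field, so pulling back creates no torsion.
include hQ in
lemma stalk_of_not_isNode {x : C.toScheme} (hx : ¬ IsNode πQ.base (f.base x)) :
    (∀ ξ, ∀ a ∈ (C.toScheme.presheaf.stalk x)⁰, a • stalkHom (pullUnderlying hZ f) x ξ = 0 → ξ = 0) ∧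
      ∀ η, IsTorsionImage (pullUnderlying hZ f) x η := by
  have hs := (hQ.isSmoothPoint_or_isNode (f.base x)).resolve_right hx
  obtain ⟨θ, hθ⟩ : ∃ θ, IsTangentStalkMap πQ.base Z (f.base x) θ := exists_tangentStalk _ _ _
  have hb := bijective_stalkHom_pullback f.base (underlyingHom (p := πQ) fun z => (hZ z).1) x
    ⟨stalkHom_injective _ (underlyingHom_app_injective hQ fun z => (hZ z).1) _,
      hθ.surjective_of_not_isNode hQ hZ hx⟩
  refine ⟨fun ξ a ha h => hb.1 ?_, fun η => ?_⟩
  · rw [map_zero]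
    exact eq_zero_of_smul_eq_zero_of_isCurveRing hs.isCurveRing (hθ.smul_eq_zero hs.isCurveRing.isDomain)
      (pullStalk f.base (tangentSheaf πQ.base Z) x) (span_range_pullStalk f.base x)
      (fun _ => exists_pullStalk_lift f.base x) ha h
  · obtain ⟨ξ, rfl⟩ := hb.2 η
    exact ⟨ξ, 1, one_mem _, by rw [sub_self, smul_zero]⟩

-- At a smooth point over a node, `c / b` is integral over a normal ring; so modulo torsion `τ` is a
-- multiple of `σ` and the cokernel vanishes.
include hC hQ hnode in
lemma stalk_of_isSmoothPoint {x : C.toScheme} (hx : IsSmoothPoint πC.base x)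
    (hq : IsNode πQ.base (f.base x)) :
    (∀ ξ, ∀ a ∈ (C.toScheme.presheaf.stalk x)⁰, a • stalkHom (pullUnderlying hZ f) x ξ = 0 → ξ = 0) ∧
      ∀ η, IsTorsionImage (pullUnderlying hZ f) x η := by
  obtain ⟨i, σ, τ, rfl, hgen₁, hgen, hfree, hsmul, hsq, -⟩ := exists_stalk_generators hQ hZ hq
  have h : IsNodalPullback (φ := (f.base.stalkMap x).hom) _ (stalkHom (pullUnderlying hZ f) x)
      (pullStalk f.base _ x) (pullStalk f.base _ x) σ τ :=
    ⟨stalkHom_pullStalk f.base _, span_range_pullStalk f.base x, span_range_pullStalk f.base x,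
      exists_pullStalk_lift f.base x,
      hgen₁, hgen, hfree, hsmul⟩
  obtain ⟨b, hb, hb'⟩ := exists_stalkMap_ne_zero hC hQ f hnode hx hq
  refine ⟨fun ξ a ha hξ => h.eq_zero hb hb' ha hξ, fun η => ?_⟩
  obtain ⟨c, hbc⟩ := hsmul b hb
  obtain ⟨r, s, e⟩ := hsq b c hbc
  obtain ⟨r', s', rfl⟩ := h.exists_eq_add η
  refine h.exists_of_dvd hb' hbc (Dvd.dvd.mul_left (hx.isCurveRing.dvd_of_sq
    (r := (f.base.stalkMap x).hom r) (s := (f.base.stalkMap x).hom s) ?_) _)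
  rw [← map_pow, e]
  simp only [map_add, map_mul, map_pow]

-- At a node over a node, `c / b` is not in the local ring but its products with the maximal ideal
-- are, so the cokernel is the residue field.
include hC hQ hnode in
lemma stalk_of_isNode {e : C.toScheme} (he : IsNode πC.base e) (hq : IsNode πQ.base (f.base e)) :
    (∀ ξ, ∀ a ∈ (C.toScheme.presheaf.stalk e)⁰, a • stalkHom (pullUnderlying hZ f) e ξ = 0 → ξ = 0) ∧
      ∃ l : ((Scheme.Modules.pullback f.base).obj (tangentSheaf πQ.base Z)).presheaf.stalk e
          →ₛₗ[(C.toScheme.residue e).hom] C.toScheme.residueField e,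
        Function.Surjective l ∧ ∀ η, l η = 0 ↔ IsTorsionImage (pullUnderlying hZ f) e η := by
  obtain ⟨i, σ, τ, rfl, hgen₁, hgen, hfree, hsmul, -, U, y, hy, c₀, α, β, g, p, q, hα, hβ, hg, hpq, hrel⟩ :=
    exists_stalk_generators hQ hZ hq
  have h : IsNodalPullback (φ := (f.base.stalkMap e).hom) _ (stalkHom (pullUnderlying hZ f) e)
      (pullStalk f.base _ e) (pullStalk f.base _ e) σ τ :=
    ⟨stalkHom_pullStalk f.base _, span_range_pullStalk f.base e, span_range_pullStalk f.base e,
      exists_pullStalk_lift f.base e,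
      hgen₁, hgen, hfree, hsmul⟩
  obtain ⟨b, hb, hb', hdvd⟩ := exists_not_dvd_and_dvd hC hQ f hnode he hy c₀ hα hβ hg hpq
  obtain ⟨c, hbc⟩ := hsmul b hb
  obtain ⟨h1, h2⟩ := hrel b c hbc
  obtain ⟨h3, h4⟩ := hdvd c h1 h2
  exact ⟨fun ξ a ha hξ => h.eq_zero hb hb' ha hξ,
    h.exists_residue (κ := C.toScheme.residueField e) (C.toScheme.residue_surjective e)
      (fun r => IsLocalRing.residue_eq_zero_iff r) hb' hbc h3 h4⟩

end Main

theorem mainTheorem12 {k : Type u} [Field k] [IsAlgClosed k] (N : LogStructure (Spec (.of k)))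
    (C Q : LogScheme.{u}) (πC : C.Hom ⟨Spec (.of k), N⟩) (πQ : Q.Hom ⟨Spec (.of k), N⟩)
    (p₀ p₁ : Q.toScheme) (hC : IsLogCurve πC) (hQ : IsTwoMarkedSemistableRational πQ p₀ p₁)
    (f : C.Hom Q) (hf : LogScheme.IsOver f πQ πC)
    (hnode : ∀ Z ∈ irreducibleComponents C.toScheme, ∀ q, IsNode πQ.base q →
      ¬ Z ⊆ f.base ⁻¹' {q}) :
    ∃ a : logTangentSheaf πQ ⟶ tangentSheaf πQ.base {p₀, p₁}, IsUnderlyingDerivation πQ a ∧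
      ∃ (g : torsionFreePullback πQ f {p₀, p₁} ⟶
          ∏ᶜ fun e : {e : C.toScheme // IsNode πC.base e ∧ IsNode πQ.base (f.base e)} =>
            pointSheaf e.1)
        (w : toTorsionFreePullback πQ f {p₀, p₁} a ≫ g = 0),
        (ShortComplex.mk _ g w).ShortExact := by
  have hZ : ∀ z, z ∈ ({p₀, p₁} : Set Q.toScheme) ↔ IsMarking πQ z := fun z => (hQ.marking_iff z).symm
  have := hQ.proper
  refine ⟨underlyingHom fun z => (hZ z).1, isUnderlyingDerivation_underlyingHom _,
    shortExact_of_stalks (pullUnderlying hZ f) (fun e => IsNode πC.base e ∧ IsNode πQ.base (f.base e))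
      (fun x => ?_) (fun x V hx a ha => ?_) (fun x => ?_) (fun x hx => ?_) fun e he =>
      (stalk_of_isNode hC hQ.isLogCurve hZ f hnode he.1 he.2).2⟩
  · by_cases hx : IsNode πC.base x
    · obtain ⟨W, hxW, h⟩ := hx.exists_opens
      exact ⟨W, hxW, fun e he h' => h e he h'.1⟩
    · obtain ⟨W, hxW, h⟩ := (hC.isSmoothPoint_or_isNode x).resolve_right hx
      exact ⟨W, hxW, fun e he h' => absurd h'.1 (IsSmoothPoint.not_isNode ⟨W, he, h⟩)⟩
  · exact exists_opens_germ_mem_nonZeroDivisors_of_etale x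
      ((hC.isSmoothPoint_or_isNode x).elim IsSmoothPoint.exists_isLocallyNoetherian
        IsNode.exists_isLocallyNoetherian) hx a ha
  · by_cases hq : IsNode πQ.base (f.base x)
    · rcases hC.isSmoothPoint_or_isNode x with h | h
      · exact (stalk_of_isSmoothPoint hC hQ.isLogCurve hZ f hnode h hq).1
      · exact (stalk_of_isNode hC hQ.isLogCurve hZ f hnode h hq).1
    · exact (stalk_of_not_isNode hQ.isLogCurve hZ f hq).1
  · by_cases hq : IsNode πQ.base (f.base x)
    · exact (stalk_of_isSmoothPoint hC hQ.isLogCurve hZ f hnode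
        ((hC.isSmoothPoint_or_isNode x).resolve_right fun h => hx ⟨h, hq⟩) hq).2
    · exact (stalk_of_not_isNode hQ.isLogCurve hZ f hq).2
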